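/- **Theorem.** There are a (deterministic) real RAM algorithm and an absolute constant $c$ with the following property. The input consists of a dimension $d \ge 1$, a real number $\varepsilon > 0$, an integer $k \ge 1$ and a non-empty finite list $\mathcal C$ of points of $\mathbb R^d$, given by their coordinates; $|\mathcal C|$ denotes the length of the list. The algorithm returns $k$ (not necessarily distinct) points $F \subset \mathbb R^d$ with $$\max_{p\in\mathcal C}\min_{f\in F}\|p-f\|_2 \;\le\; (1+\varepsilon)\cdot \mathrm{OPT},\qquad \mathrm{OPT} := \inf_{G}\ \max_{p\in\mathcal C}\min_{g\in G}\|p-g\|_2 ,$$ where $G$ ranges over all choices of $k$ points of $\mathbb R^d$. With $\bar\varepsilon := \min\{\varepsilon, 1/2\}$, the algorithm halts after at most $$c\cdot\Bigl(|\mathcal C|\cdot k\cdot (1/\bar\varepsilon)^{c d} \;+\; 2^{\,c\,\left((1/\bar\varepsilon)^{c d}\cdot k^{1-1/d}\cdot\log k \;+\; d\log d\right)}\Bigr)$$ steps. In other words, its running time is $O\bigl(|\mathcal C|\, k\,(1/\varepsilon)^{O(d)} + 2^{O((1/\varepsilon)^{O(d)} k^{1-1/d}\log k + d\log d)}\bigr)$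 for $\varepsilon\le 1/2$, and the bound for $\varepsilon=1/2$ holds for all larger $\varepsilon$; the constants hidden in $O(\cdot)$ depend on nothing. Here a real RAM stores real numbers exactly and performs, at unit cost, the operations $+,-,\times,/$ and comparison on real numbers, $+,-$ and comparison on natural numbers, and reads and writes of memory by indirect addressing; it has no rounding and no root operation. Logarithms are natural. -/

import Mathlib

/-!
The cost model is a real RAM: finitely many registers are named by a program, memory is accessed
by indirect addressing, real numbers are stored exactly, and every instruction and every test
costs one unit of time.  There is no rounding operation, no root, and no conversion
between real numbers and natural numbers.
-/

namespace RealRAM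

/-- A configuration of the memory of the machine: registers and an unbounded random access memory
for natural numbers (used for counters and addresses), and the same for real numbers. -/
structure State where
  ireg : ℕ → ℕ
  rreg : ℕ → ℝ
  imem : ℕ → ℕ
  rmem : ℕ → ℝ

/-- The elementary instructions.  The arguments `a b c` are names of registers. -/
inductive Instr where
  | iconst (a m : ℕ)
  | iadd (a b c : ℕ)
  | isub (a b c : ℕ)
  | iload (a b : ℕ)
  | istore (a b : ℕ)
  | rconst (a : ℕ) (z : ℤ)
  | radd (a b c : ℕ)
  | rsub (a b c : ℕ)
  | rmul (a b c : ℕ)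
  | rdiv (a b c : ℕ)
  | rload (a b : ℕ)
  | rstore (a b : ℕ)

/-- The effect of an instruction.  Subtraction of natural numbers is truncated at zero, division
of a real number by zero returns zero.  `iload a b` and `rload a b` read, into register `a`, the
memory cell whose address is in index register `b`; `istore a b` and `rstore a b` write the content
of register `b` into the memory cell whose address is in index register `a`. -/
noncomputable def Instr.apply : Instr → State → State
  | .iconst a m, s => { s with ireg := Function.update s.ireg a m }
  | .iadd a b c, s => { s with ireg := Function.update s.ireg a (s.ireg b + s.ireg c) }
  | .isub a b c, s => { s with ireg := Function.update s.ireg a (s.ireg b - s.ireg c) }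
  | .iload a b, s => { s with ireg := Function.update s.ireg a (s.imem (s.ireg b)) }
  | .istore a b, s => { s with imem := Function.update s.imem (s.ireg a) (s.ireg b) }
  | .rconst a z, s => { s with rreg := Function.update s.rreg a (z : ℝ) }
  | .radd a b c, s => { s with rreg := Function.update s.rreg a (s.rreg b + s.rreg c) }
  | .rsub a b c, s => { s with rreg := Function.update s.rreg a (s.rreg b - s.rreg c) }
  | .rmul a b c, s => { s with rreg := Function.update s.rreg a (s.rreg b * s.rreg c) }
  | .rdiv a b c, s => { s with rreg := Function.update s.rreg a (s.rreg b / s.rreg c) }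
  | .rload a b, s => { s with rreg := Function.update s.rreg a (s.rmem (s.ireg b)) }
  | .rstore a b, s => { s with rmem := Function.update s.rmem (s.ireg a) (s.rreg b) }

/-- The tests: strict comparison of two index registers, or of two real registers. -/
inductive Test where
  | ilt (a b : ℕ)
  | rlt (a b : ℕ)

/-- The truth value of a test. -/
def Test.Holds : Test → State → Prop
  | .ilt a b, s => s.ireg a < s.ireg b
  | .rlt a b, s => s.rreg a < s.rreg b

/-- Programs: finite control-flow structures over the instructions and tests. -/
inductive Program where
  | instr (i : Instr)
  | seq (P Q : Program)
  | ite (b : Test) (P Q : Program)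
  | loop (b : Test) (P : Program)

/-- `Runs P s s' t`: started in `s`, the program `P` halts in `s'` after exactly `t` steps, where
every executed instruction and every evaluated test is one step.  `Program.loop b P` repeats
`P` as long as the test `b` holds. -/
inductive Runs : Program → State → State → ℕ → Prop where
  | instr (i : Instr) (s : State) : Runs (.instr i) s (i.apply s) 1
  | seq {P Q : Program} {s s' s'' : State} {t t' : ℕ}
      (h : Runs P s s' t) (h' : Runs Q s' s'' t') : Runs (.seq P Q) s s'' (t + t')
  | ite_true {b : Test} {P Q : Program} {s s' : State} {t : ℕ}
      (hb : b.Holds s) (h : Runs P s s' t) : Runs (.ite b P Q) s s' (t + 1)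
  | ite_false {b : Test} {P Q : Program} {s s' : State} {t : ℕ}
      (hb : ¬ b.Holds s) (h : Runs Q s s' t) : Runs (.ite b P Q) s s' (t + 1)
  | loop_true {b : Test} {P : Program} {s s' s'' : State} {t t' : ℕ}
      (hb : b.Holds s) (h : Runs P s s' t) (h' : Runs (.loop b P) s' s'' t') :
      Runs (.loop b P) s s'' (t + t' + 1)
  | loop_false {b : Test} {P : Program} {s : State}
      (hb : ¬ b.Holds s) : Runs (.loop b P) s s 1

end RealRAM

namespace KCenter

/-- The `k`-center cost of the centers `F 0, …, F (k-1)` for the clients `p 0, …, p (n-1)`: the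
largest distance of a client to its nearest center. -/
noncomputable def cost {d n k : ℕ} (p : Fin n → EuclideanSpace ℝ (Fin d))
    (F : Fin k → EuclideanSpace ℝ (Fin d)) : ℝ :=
  ⨆ i, ⨅ j, dist (p i) (F j)

/-- The optimum of continuous Euclidean `k`-center: the centers are arbitrary points. -/
noncomputable def opt {d n : ℕ} (k : ℕ) (p : Fin n → EuclideanSpace ℝ (Fin d)) : ℝ :=
  ⨅ F : Fin k → EuclideanSpace ℝ (Fin d), cost p F

/-- The memory of the machine at the start: the index registers `0, 1, 2` hold the number `n` of
clients, the dimension `d` and the number `k` of centers, the real register `0` holds the error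
parameter `ε`, and the real memory holds the coordinates of the clients, one client after the
other, from address `0` on.  Everything else is zero. -/
noncomputable def input {d n : ℕ} (k : ℕ) (ε : ℝ) (p : Fin n → EuclideanSpace ℝ (Fin d)) :
    RealRAM.State where
  ireg a := if a = 0 then n else if a = 1 then d else if a = 2 then k else 0
  rreg a := if a = 0 then ε else 0
  imem _ := 0
  rmem a := if h : a < n * d then p (Fin.divNat ⟨a, h⟩) (Fin.modNat ⟨a, h⟩) else 0

/-- The centers that the machine returns: their coordinates are in the real memory, one center
after the other, from the address in the index register `0` on. -/
noncomputable def output (d k : ℕ) (s : RealRAM.State) : Fin k → EuclideanSpace ℝ (Fin d) :=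
  fun j => WithLp.toLp 2 fun l => s.rmem (s.ireg 0 + (j * d + l))

end KCenter

/-! The algorithm starts with Gonzalez' farthest-point traversal. The farthest client and the `k`
centers are `k + 1` points at mutual distance at least the radius `r`, so two of them share an
optimal center and `r / 2 ≤ OPT ≤ r`. Let `e = min ε (1 / 2)`. The traversal continues until its
radius is at most `e * r / 8`; the visited points form a net `S`, and disjoint balls around them
give `|S| ≤ k * (17 / e) ^ d`. Centers may be restricted to grids around the net points, at the
price of moving each center by at most `e * r / 64`. Only `r ^ 2` is known, as there are no roots;
the mesh is computed from a coordinate difference `u` with `u ≤ r` and `r ^ 2 ≤ d * u ^ 2`. It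
remains to find, for the radii `r / 2 * (1 + e / 16) ^ j`, at most `k` grid points that cover `S`.

This is done by a dynamic program that scans the candidates in a fixed order and either takes or
skips each. A partial selection matters only through its cardinality and the part of `S` it covers,
and it is discarded once some point of `S` can no longer be covered. Hence coverage can vary only on
the frontier, the net points near both a scanned and an unscanned candidate, and a frontier of size
`w` leaves at most `(k + 1) * 2 ^ w` selections (`length_dpRun_le`).

The order of the candidates keeps `w` small. In every coordinate, cuts are placed greedily: among
`T` positions with disjoint neighbourhoods, the best one is close to at most a `1 / T` fraction of
the points there (`cuts_count`). Candidates are scanned cell by cell, and inside a cell by the first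
coordinate. A frontier point is either close to a cut, which happens for at most `d * |S| / T`
points, or lies in the current cell near the sweeping hyperplane (`Net.frontier_le`). As `S` is
separated, the latter are at most `O(d ^ 2 / e) * O(T * d ^ 2 / e) ^ (d - 1)` many
(`Net.length_slice_le`). For `T` about `k ^ (1 / d) / d ^ 2`, both counts are `(1 / e) ^ O(d) * k ^
(1 - 1 / d)` (`Net.frontier_le_pow`).

The scans over the clients take time `n * k * (1 / e) ^ O(d)`. Everything else depends on the net
only and takes time polynomial in a size of the form `a * b`, where `a = (1 / e) ^ O(d)` and `b = 2
^ O(w + log k + d log d)`; the inequality `a * b ≤ a ^ 2 + b ^ 2` separates the two summands of the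
claim.

For the machine model, the algorithm is written as functions on numbers, pairs and lists. `Comp R f`
says that `f` is computed by a program in time linear in `τ` whenever `R a τ`; this is closed under
composition, pairing, branching and loops. Values live in a heap that only grows, so results
computed earlier are never destroyed. `PComp` is the coarser notion of polynomial time, which
suffices for everything after the scans over the clients. -/

namespace RealRAM

/-! ### Heap representation of values and compilation of composite functions -/

/-- The part of the memory that the compiled functional programs use: cells below `hi` and `hr` are
allocated and never change again. -/
structure Heap where
  im : ℕ → ℕ
  rm : ℕ → ℝ
  hi : ℕ
  hr : ℕ

/-- The heap of a machine state; index registers `0` and `1` hold the allocation pointers. -/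
def heap (s : State) : Heap := ⟨s.imem, s.rmem, s.ireg 0, s.ireg 1⟩

/-- `H'` extends `H` by newly allocated cells. -/
structure Heap.Le (H H' : Heap) : Prop where
  hi : H.hi ≤ H'.hi
  hr : H.hr ≤ H'.hr
  im : ∀ p, p < H.hi → H'.im p = H.im p
  rm : ∀ p, p < H.hr → H'.rm p = H.rm p

theorem Heap.Le.refl (H : Heap) : H.Le H := ⟨le_rfl, le_rfl, fun _ _ => rfl, fun _ _ => rfl⟩

theorem Heap.Le.trans {H H' H'' : Heap} (h : H.Le H') (h' : H'.Le H'') : H.Le H'' where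
  hi := h.hi.trans h'.hi
  hr := h.hr.trans h'.hr
  im p hp := (h'.im p (hp.trans_le h.hi)).trans (h.im p hp)
  rm p hp := (h'.rm p (hp.trans_le h.hr)).trans (h.rm p hp)

/-- Types whose values are represented in the heap by a natural number (a value or a pointer). -/
class HeapRep (α : Type) where
  rep : Heap → α → ℕ → Prop
  mono : ∀ {H H' : Heap} {a : α} {p : ℕ}, H.Le H' → rep H a p → rep H' a p

open HeapRep

instance : HeapRep ℕ where
  rep _ a p := p = a
  mono _ h := h

instance : HeapRep Bool where
  rep _ a p := p = a.toNat
  mono _ h := h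

/-- Real numbers are boxed, so that a value of any type is handled through a single index register.
-/
instance : HeapRep ℝ where
  rep H a p := p < H.hr ∧ H.rm p = a
  mono h := fun ⟨h1, h2⟩ => ⟨h1.trans_le h.hr, (h.rm _ h1).trans h2⟩

/-- Address `0` is excluded because it stands for the empty list. A list cell then has the same
representation as the pair of its head and tail, so that consing onto a pair and splitting a list
cost nothing beyond the pair itself. -/
instance {α β : Type} [HeapRep α] [HeapRep β] : HeapRep (α × β) where
  rep H a p := p ≠ 0 ∧ p + 1 < H.hi ∧ rep H a.1 (H.im p) ∧ rep H a.2 (H.im (p + 1))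
  mono {H H' a p} h := by
    rintro ⟨h0, h1, h2, h3⟩
    refine ⟨h0, h1.trans_le h.hi, ?_, ?_⟩
    · rw [h.im _ (by omega)]; exact mono h h2
    · rw [h.im _ h1]; exact mono h h3

/-- Linked lists. -/
def listRep {α : Type} [HeapRep α] (H : Heap) : List α → ℕ → Prop
  | [], p => p = 0
  | a :: l, p => p ≠ 0 ∧ p + 1 < H.hi ∧ rep H a (H.im p) ∧ listRep H l (H.im (p + 1))

instance {α : Type} [HeapRep α] : HeapRep (List α) where
  rep := listRep
  mono {H H' a} := by
    intro p h
    induction a generalizing p with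
    | nil => exact id
    | cons a l ih =>
      rintro ⟨h0, h1, h2, h3⟩
      refine ⟨h0, h1.trans_le h.hi, ?_, ?_⟩
      · rw [h.im _ (by omega)]; exact mono h h2
      · rw [h.im _ h1]; exact ih h3

theorem rep_prod {α β : Type} [HeapRep α] [HeapRep β] {H : Heap} {a : α × β} {p : ℕ} :
    rep H a p ↔ p ≠ 0 ∧ p + 1 < H.hi ∧ rep H a.1 (H.im p) ∧ rep H a.2 (H.im (p + 1)) := Iff.rfl

theorem rep_nil {α : Type} [HeapRep α] {H : Heap} {p : ℕ} : rep H ([] : List α) p ↔ p = 0 := Iff.rfl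

theorem rep_cons {α : Type} [HeapRep α] {H : Heap} {a : α} {l : List α} {p : ℕ} :
    rep H (a :: l) p ↔ rep H (a, l) p := Iff.rfl

theorem rep_nat {H : Heap} {a p : ℕ} : rep H a p ↔ p = a := Iff.rfl

theorem rep_bool {H : Heap} {a : Bool} {p : ℕ} : rep H a p ↔ p = a.toNat := Iff.rfl

theorem rep_real {H : Heap} {a : ℝ} {p : ℕ} : rep H a p ↔ p < H.hr ∧ H.rm p = a := Iff.rfl

/-- A straight-line program. -/
def block : List Instr → Program
  -- There is no empty program. Real register `0` is scratch space, so that overwriting it is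
  -- harmless.
  | [] => .instr (.rconst 0 0)
  | i :: is => .seq (.instr i) (block is)

/-- The effect of a straight-line program. -/
noncomputable def exec : List Instr → State → State
  | [], s => (Instr.rconst 0 0).apply s
  | i :: is, s => exec is (i.apply s)

theorem runs_block (is : List Instr) (s : State) : Runs (block is) s (exec is s) (is.length + 1) := by
  induction is generalizing s with
  | nil => exact .instr _ _
  | cons i is ih =>
    have := Runs.seq (.instr i s) (ih (i.apply s))
    rwa [Nat.add_comm] at this

/-- The heap only grows and the registers from `2` to `b - 1` keep their content. -/
structure Ext (b : ℕ) (s s' : State) : Prop where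
  le : (heap s).Le (heap s')
  reg : ∀ r, 2 ≤ r → r < b → s'.ireg r = s.ireg r

theorem Ext.refl (b : ℕ) (s : State) : Ext b s s := ⟨.refl _, fun _ _ _ => rfl⟩

theorem Ext.trans {b : ℕ} {s s' s'' : State} (h : Ext b s s') (h' : Ext b s' s'') : Ext b s s'' :=
  ⟨h.le.trans h'.le, fun r h1 h2 => (h'.reg r h1 h2).trans (h.reg r h1 h2)⟩

theorem Ext.mono {b b' : ℕ} {s s' : State} (h : Ext b' s s') (hb : b ≤ b') : Ext b s s' :=
  ⟨h.le, fun r h1 h2 => h.reg r h1 (h2.trans_le hb)⟩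

theorem Ext.pos {b : ℕ} {s s' : State} (h : Ext b s s') (h0 : 0 < s.ireg 0) : 0 < s'.ireg 0 :=
  h0.trans_le h.le.hi

theorem Ext.rep {α : Type} [HeapRep α] {b r : ℕ} {s s' : State} (h : Ext b s s') {a : α}
    (ha : rep (heap s) a (s.ireg r)) (h2 : 2 ≤ r) (hr : r < b) :
    HeapRep.rep (heap s') a (s'.ireg r) := by
  rw [h.reg r h2 hr]; exact HeapRep.mono h.le ha

variable {α β γ δ : Type} [HeapRep α] [HeapRep β] [HeapRep γ] [HeapRep δ]

/-- The program `P` computes `f` on the argument in index register `b`, leaves the result there, and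
needs time `C * (τ + 1)` whenever `R a τ`. -/
def Impl (P : Program) (b C : ℕ) (R : α → ℕ → Prop) (f : α → β) : Prop :=
  ∀ (s : State) (a : α) (τ : ℕ), R a τ → 0 < s.ireg 0 → rep (heap s) a (s.ireg b) →
    ∃ s' t, Runs P s s' t ∧ t ≤ C * (τ + 1) ∧ Ext b s s' ∧ rep (heap s') (f a) (s'.ireg b)

/-- `f` can be computed by a real RAM in time `O(τ)` whenever `R a τ`. -/
def Comp (R : α → ℕ → Prop) (f : α → β) : Prop :=
  ∃ C, ∀ b, 2 ≤ b → ∃ P, Impl P b C R f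

/-- The requirement of functions that are computable in constant time. -/
abbrev O1 : α → ℕ → Prop := fun _ _ => True

theorem Comp.scale {R R' : α → ℕ → Prop} {f : α → β} (h : Comp R f) (c : ℕ)
    (hR : ∀ a τ, R' a τ → R a (c * (τ + 1))) : Comp R' f := by
  obtain ⟨C, h⟩ := h
  refine ⟨C * (c + 1), fun b hb => ?_⟩
  obtain ⟨P, h⟩ := h b hb
  refine ⟨P, fun s a τ ha h0 hr => ?_⟩
  obtain ⟨s', t, h1, h2, h3⟩ := h s a _ (hR a τ ha) h0 hr
  refine ⟨s', t, h1, h2.trans ?_, h3⟩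
  rw [mul_assoc]
  gcongr
  nlinarith

theorem Comp.mono {R R' : α → ℕ → Prop} {f : α → β} (h : Comp R f)
    (hR : ∀ a τ, R' a τ → R a τ) : Comp R' f := by
  obtain ⟨C, h⟩ := h
  refine ⟨C, fun b hb => ?_⟩
  obtain ⟨P, h⟩ := h b hb
  exact ⟨P, fun s a τ ha h0 hr => h s a _ (hR a τ ha) h0 hr⟩

theorem Comp.congr {R : α → ℕ → Prop} {f g : α → β} (h : Comp R f) (hfg : ∀ a, f a = g a) :
    Comp R g := by
  rwa [← funext hfg]

/-- The base register is written `c + 2` because it has to differ from the allocation registers `0`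
and `1`. -/
theorem Comp.ofBlock {f : α → β} (is : ℕ → List Instr) (C : ℕ) (hC : ∀ b, (is b).length ≤ C)
    (h : ∀ c s a, 0 < s.ireg 0 → rep (heap s) a (s.ireg (c + 2)) →
      Ext (c + 2) s (exec (is (c + 2)) s) ∧
        rep (heap (exec (is (c + 2)) s)) (f a) ((exec (is (c + 2)) s).ireg (c + 2))) :
    Comp O1 f := by
  refine ⟨C + 1, fun b hb => ⟨block (is b), fun s a τ _ h0 hr => ?_⟩⟩
  obtain ⟨c, rfl⟩ := Nat.exists_eq_add_of_le' hb
  obtain ⟨h1, h2⟩ := h c s a h0 hr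
  refine ⟨_, _, runs_block _ _, ?_, h1, h2⟩
  have := hC (c + 2)
  nlinarith

theorem Comp.id : Comp O1 (fun a : α => a) := by
  refine Comp.ofBlock (fun _ => []) 0 (by simp) fun c s a h0 h => ?_
  exact ⟨⟨.refl _, fun _ _ _ => rfl⟩, h⟩

theorem Comp.comp {R : α → ℕ → Prop} {R' : β → ℕ → Prop} {f : α → β} {g : β → γ}
    (hg : Comp R' g) (hf : Comp R f) :
    Comp (fun a τ => R a τ ∧ R' (f a) τ) (fun a => g (f a)) := by
  obtain ⟨C, hf⟩ := hf
  obtain ⟨C', hg⟩ := hg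
  refine ⟨C + C', fun b hb => ?_⟩
  obtain ⟨P, hf⟩ := hf b hb
  obtain ⟨Q, hg⟩ := hg b hb
  refine ⟨.seq P Q, fun s a τ ha h0 hr => ?_⟩
  obtain ⟨s', t, h1, h2, h3, h4⟩ := hf s a τ ha.1 h0 hr
  obtain ⟨s'', t', h1', h2', h3', h4'⟩ := hg s' (f a) τ ha.2 (h3.pos h0) h4
  exact ⟨s'', t + t', .seq h1 h1', by rw [add_mul]; omega, h3.trans h3', h4'⟩

theorem Comp.fst : Comp O1 (fun a : α × β => a.1) := by
  refine Comp.ofBlock (fun b => [.iload b b]) 1 (by simp) fun c s a h0 h => ?_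
  obtain ⟨h1, h2, h3, h4⟩ := h
  have hh : heap (exec [.iload (c + 2) (c + 2)] s) = heap s := by simp [exec, Instr.apply, heap]
  refine ⟨⟨hh ▸ .refl _, fun r hr hrb => ?_⟩, ?_⟩
  · simp [exec, Instr.apply, hrb.ne]
  · rw [hh]; simpa [exec, Instr.apply, heap] using h3

theorem Comp.snd : Comp O1 (fun a : α × β => a.2) := by
  refine Comp.ofBlock (fun b => [.iconst (b + 1) 1, .iadd b b (b + 1), .iload b b]) 3 (by simp)
    fun c s a h0 h => ?_
  obtain ⟨h1, h2, h3, h4⟩ := h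
  have hh : heap (exec [.iconst (c + 2 + 1) 1, .iadd (c + 2) (c + 2) (c + 2 + 1),
      .iload (c + 2) (c + 2)] s) = heap s := by
    simp [exec, Instr.apply, heap]
  refine ⟨⟨hh ▸ .refl _, fun r hr hrb => ?_⟩, ?_⟩
  · simp [exec, Instr.apply, hrb.ne, (hrb.trans (Nat.lt_succ_self _)).ne]
  · rw [hh]; simpa [exec, Instr.apply, heap] using h4

/-- Allocation of two cells with the contents of registers `b` and `b + 1`. -/
def consBlock (b : ℕ) : List Instr :=
  [.istore 0 b, .iconst (b + 2) 1, .iadd (b + 2) 0 (b + 2), .istore (b + 2) (b + 1),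
    .iconst (b + 2) 0, .iadd b 0 (b + 2), .iconst (b + 2) 2, .iadd 0 0 (b + 2)]

theorem consBlock_spec {c : ℕ} {s : State} (h0 : 0 < s.ireg 0) {x : α} {y : β}
    (hx : rep (heap s) x (s.ireg (c + 2))) (hy : rep (heap s) y (s.ireg (c + 3))) :
    Ext (c + 2) s (exec (consBlock (c + 2)) s) ∧
      rep (heap (exec (consBlock (c + 2)) s)) (x, y) ((exec (consBlock (c + 2)) s).ireg (c + 2)) := by
  have hle : (heap s).Le (heap (exec (consBlock (c + 2)) s)) := by
    constructor <;> intros <;> simp [consBlock, exec, Instr.apply, heap, Function.update_apply] at *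
    rw [if_neg (by omega), if_neg (by omega)]
  refine ⟨⟨hle, fun r hr hrb => ?_⟩, ?_⟩
  · simp [consBlock, exec, Instr.apply, Function.update_apply]
    grind
  · have hx' := mono hle hx
    have hy' := mono hle hy
    have e1 : (exec (consBlock (c + 2)) s).ireg (c + 2) = s.ireg 0 := by
      simp [consBlock, exec, Instr.apply]
    rw [e1, rep_prod]
    refine ⟨h0.ne', ?_, ?_, ?_⟩
    · simp [consBlock, exec, Instr.apply, heap]
    · convert hx' using 1
      simp [consBlock, exec, Instr.apply, heap]
    · convert hy' using 1
      simp [consBlock, exec, Instr.apply, heap]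

/-- Copies register `b` to register `b'`. -/
def copyBlock (b' b : ℕ) : List Instr := [.iconst b' 0, .iadd b' b b']

theorem copyBlock_spec {b b' : ℕ} (hb : b ≠ b') (hb' : 2 ≤ b') (s : State) :
    Ext b' s (exec (copyBlock b' b) s) ∧ heap (exec (copyBlock b' b) s) = heap s ∧
      (exec (copyBlock b' b) s).ireg b' = s.ireg b := by
  have hh : heap (exec (copyBlock b' b) s) = heap s := by
    simp [copyBlock, exec, Instr.apply, heap, Function.update_apply]
    omega
  refine ⟨⟨hh ▸ .refl _, fun r hr hrb => ?_⟩, hh, ?_⟩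
  · simp [copyBlock, exec, Instr.apply, Function.update_apply, hrb.ne]
  · simp [copyBlock, exec, Instr.apply, hb]

/-- Registers are used like a stack. The argument stays in register `b` while `f` works on a copy
from `b + 1` on; that result survives the computation of `g`, which only uses registers from `b + 2`
on. The two results are then moved down and put into a new cell. -/
theorem Comp.pair {R : α → ℕ → Prop} {R' : α → ℕ → Prop} {f : α → β} {g : α → γ}
    (hf : Comp R f) (hg : Comp R' g) :
    Comp (fun a τ => R a τ ∧ R' a τ) (fun a => (f a, g a)) := by
  obtain ⟨C, hf⟩ := hf
  obtain ⟨C', hg⟩ := hg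
  refine ⟨C + C' + 25, fun b hb => ?_⟩
  obtain ⟨P, hf⟩ := hf (b + 1) (by omega)
  obtain ⟨Q, hg⟩ := hg (b + 2) (by omega)
  refine ⟨.seq (block (copyBlock (b + 1) b)) (.seq P (.seq (block (copyBlock (b + 2) b)) (.seq Q
    (.seq (block (copyBlock b (b + 1))) (.seq (block (copyBlock (b + 1) (b + 2)))
      (block (consBlock b))))))), fun s a τ ha h0 hr => ?_⟩
  obtain ⟨x1, e1, r1⟩ := copyBlock_spec (b := b) (b' := b + 1) (by omega) (by omega) s
  have q1 := runs_block (copyBlock (b + 1) b) s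
  set s1 := exec (copyBlock (b + 1) b) s
  obtain ⟨s2, t2, q2, l2, x2, r2⟩ := hf s1 a τ ha.1 (x1.pos h0) (by rw [e1, r1]; exact hr)
  obtain ⟨x3, e3, r3⟩ := copyBlock_spec (b := b) (b' := b + 2) (by omega) (by omega) s2
  have q3 := runs_block (copyBlock (b + 2) b) s2
  set s3 := exec (copyBlock (b + 2) b) s2
  have x12 := x1.trans x2
  obtain ⟨s4, t4, q4, l4, x4, r4⟩ := hg s3 a τ ha.2 (x3.pos (x12.pos h0))
    (by rw [e3, r3]; exact x12.rep hr hb (by omega))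
  have r4' : rep (heap s4) (f a) (s4.ireg (b + 1)) := by
    refine x4.rep (x3.rep r2 (by omega) (by omega)) (by omega) (by omega)
  have x24 : Ext b s s4 :=
    (x12.mono (by omega)).trans ((x3.mono (by omega)).trans (x4.mono (by omega)))
  obtain ⟨x5, e5, r5⟩ := copyBlock_spec (b := b + 1) (b' := b) (by omega) (by omega) s4
  have k5 : (exec (copyBlock b (b + 1)) s4).ireg (b + 2) = s4.ireg (b + 2) := by
    simp [copyBlock, exec, Instr.apply]
  have q5 := runs_block (copyBlock b (b + 1)) s4
  set s5 := exec (copyBlock b (b + 1)) s4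
  obtain ⟨x6, e6, r6⟩ := copyBlock_spec (b := b + 2) (b' := b + 1) (by omega) (by omega) s5
  have q6 := runs_block (copyBlock (b + 1) (b + 2)) s5
  set s6 := exec (copyBlock (b + 1) (b + 2)) s5
  have x46 : Ext b s s6 := x24.trans (x5.trans (x6.mono (by omega)))
  have q7 := runs_block (consBlock b) s6
  obtain ⟨c, rfl⟩ := Nat.exists_eq_add_of_le' hb
  obtain ⟨x7, r7⟩ := consBlock_spec (c := c) (s := s6) (x := f a) (y := g a) (x46.pos h0)
    (by rw [x6.reg _ hb (by omega), e6, e5, r5]; exact r4')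
    (by rw [show c + 3 = c + 2 + 1 from rfl, r6, k5, e6, e5]; exact r4)
  refine ⟨_, _, .seq q1 (.seq q2 (.seq q3 (.seq q4 (.seq q5 (.seq q6 q7))))), ?_,
    x46.trans x7, r7⟩
  simp only [copyBlock, consBlock, List.length_cons, List.length_nil]
  nlinarith

/-- Only the branch that is taken has to meet its requirement. This admits branches that are
possible or cheap only under the test, such as splitting a nonempty list. -/
theorem Comp.ite {R R' R'' : α → ℕ → Prop} {c : α → Bool} {f g : α → β}
    (hc : Comp R c) (hf : Comp R' f) (hg : Comp R'' g) :
    Comp (fun a τ => R a τ ∧ (c a = true → R' a τ) ∧ (c a = false → R'' a τ))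
      (fun a => if c a then f a else g a) := by
  obtain ⟨C, hc⟩ := hc
  obtain ⟨C', hf⟩ := hf
  obtain ⟨C'', hg⟩ := hg
  refine ⟨C + C' + C'' + 10, fun b hb => ?_⟩
  obtain ⟨S, hc⟩ := hc (b + 1) (by omega)
  obtain ⟨P, hf⟩ := hf b hb
  obtain ⟨Q, hg⟩ := hg b hb
  refine ⟨.seq (block (copyBlock (b + 1) b)) (.seq S (.seq (block [.iconst (b + 2) 0])
    (.ite (.ilt (b + 2) (b + 1)) P Q))), fun s a τ ha h0 hr => ?_⟩
  obtain ⟨x1, e1, r1⟩ := copyBlock_spec (b := b) (b' := b + 1) (by omega) (by omega) s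
  have q1 := runs_block (copyBlock (b + 1) b) s
  set s1 := exec (copyBlock (b + 1) b) s
  obtain ⟨s2, t2, q2, l2, x2, r2⟩ := hc s1 a τ ha.1 (x1.pos h0) (by rw [e1, r1]; exact hr)
  have q3 := runs_block [.iconst (b + 2) 0] s2
  have h3 : heap (exec [.iconst (b + 2) 0] s2) = heap s2 := by
    simp [exec, Instr.apply, heap]
  have x3 : Ext (b + 1) s2 (exec [.iconst (b + 2) 0] s2) := by
    refine ⟨h3 ▸ .refl _, fun r _ _ => ?_⟩
    simp [exec, Instr.apply, Function.update_apply]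
    omega
  have v3 : (exec [.iconst (b + 2) 0] s2).ireg (b + 1) = s2.ireg (b + 1) ∧
    (exec [.iconst (b + 2) 0] s2).ireg (b + 2) = 0 := by
    simp [exec, Instr.apply]
  set s3 := exec [.iconst (b + 2) 0] s2
  have x13 : Ext (b + 1) s s3 := x1.trans (x2.trans x3)
  have hr3 : rep (heap s3) a (s3.ireg b) := x13.rep hr hb (by omega)
  rw [rep_bool] at r2
  cases hca : c a with
  | true =>
    obtain ⟨s4, t4, q4, l4, x4, r4⟩ := hf s3 a τ (ha.2.1 hca) (x13.pos h0) hr3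
    refine ⟨s4, _, .seq q1 (.seq q2 (.seq q3 (.ite_true ?_ q4))), ?_,
      (x13.mono (by omega)).trans x4, by simpa [hca] using r4⟩
    · simp [Test.Holds, v3, r2, hca]
    · simp only [copyBlock, List.length_cons, List.length_nil]
      nlinarith
  | false =>
    obtain ⟨s4, t4, q4, l4, x4, r4⟩ := hg s3 a τ (ha.2.2 hca) (x13.pos h0) hr3
    refine ⟨s4, _, .seq q1 (.seq q2 (.seq q3 (.ite_false ?_ q4))), ?_,
      (x13.mono (by omega)).trans x4, by simpa [hca] using r4⟩
    · simp [Test.Holds, v3, r2, hca]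
    · simp only [copyBlock, List.length_cons, List.length_nil]
      nlinarith

end RealRAM

/-! ### Primitive operations: constants, arithmetic, tests, list cells, while loops -/

namespace RealRAM

open HeapRep

variable {α β γ δ : Type} [HeapRep α] [HeapRep β] [HeapRep γ] [HeapRep δ]

/-- A block that only changes index registers from `b` on computes its result in register `b`. -/
theorem Comp.ofBlockHeap {f : α → β} (is : ℕ → List Instr) (C : ℕ) (hC : ∀ b, (is b).length ≤ C)
    (hh : ∀ c s, heap (exec (is (c + 2)) s) = heap s)
    (hr : ∀ c s r, 2 ≤ r → r < c + 2 → (exec (is (c + 2)) s).ireg r = s.ireg r)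
    (h : ∀ c s a, rep (heap s) a (s.ireg (c + 2)) →
        rep (heap s) (f a) ((exec (is (c + 2)) s).ireg (c + 2))) :
    Comp O1 f := by
  refine Comp.ofBlock is C hC fun c s a h0 ha => ⟨⟨?_, hr c s⟩, ?_⟩
  · rw [hh]; exact .refl _
  · rw [hh]; exact h c s a ha

theorem Comp.natConst (m : ℕ) : Comp O1 (fun _ : α => m) := by
  refine Comp.ofBlockHeap (fun b => [.iconst b m]) 1 (by simp) ?_ ?_ ?_
  · intro c s; simp [exec, Instr.apply, heap]
  · intro c s r h1 h2; simp [exec, Instr.apply, h2.ne]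
  · intro c s a ha; simp [exec, Instr.apply, rep_nat]

theorem Comp.boolConst (m : Bool) : Comp O1 (fun _ : α => m) := by
  refine Comp.ofBlockHeap (fun b => [.iconst b m.toNat]) 1 (by simp) ?_ ?_ ?_
  · intro c s; simp [exec, Instr.apply, heap]
  · intro c s r h1 h2; simp [exec, Instr.apply, h2.ne]
  · intro c s a ha; simp [exec, Instr.apply, rep_bool]

theorem Comp.nil : Comp O1 (fun _ : α => ([] : List β)) := by
  refine Comp.ofBlockHeap (fun b => [.iconst b 0]) 1 (by simp) ?_ ?_ ?_
  · intro c s; simp [exec, Instr.apply, heap]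
  · intro c s r h1 h2; simp [exec, Instr.apply, h2.ne]
  · intro c s a ha; simp [exec, Instr.apply, rep_nil]

theorem Comp.consPair : Comp O1 (fun a : α × List α => a.1 :: a.2) := by
  refine Comp.ofBlockHeap (fun _ => []) 0 (by simp) ?_ ?_ ?_
  · intro c s; simp [exec, Instr.apply, heap]
  · intro c s r h1 h2; simp [exec, Instr.apply]
  · intro c s a ha
    rw [rep_cons]
    simpa [exec, Instr.apply] using ha

/-- Loads both components of the pair in register `b` into registers `b` and `b + 1`. -/
def unpairBlock (b : ℕ) : List Instr :=
  [.iconst (b + 1) 1, .iadd (b + 1) b (b + 1), .iload (b + 1) (b + 1), .iload b b]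

theorem Comp.natAddPair : Comp O1 (fun a : ℕ × ℕ => a.1 + a.2) := by
  refine Comp.ofBlockHeap (fun b => unpairBlock b ++ [.iadd b b (b + 1)]) 5
    (by simp [unpairBlock]) ?_ ?_ ?_
  · intro c s; simp [unpairBlock, exec, Instr.apply, heap]
  · intro c s r h1 h2; simp [unpairBlock, exec, Instr.apply, h2.ne, (Nat.lt_succ_of_lt h2).ne]
  · intro c s a ha
    obtain ⟨-, -, h1, h2⟩ := ha
    rw [rep_nat] at *
    simp only [heap] at h1 h2
    simp [unpairBlock, exec, Instr.apply, h1, h2]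

theorem Comp.natSubPair : Comp O1 (fun a : ℕ × ℕ => a.1 - a.2) := by
  refine Comp.ofBlockHeap (fun b => unpairBlock b ++ [.isub b b (b + 1)]) 5
    (by simp [unpairBlock]) ?_ ?_ ?_
  · intro c s; simp [unpairBlock, exec, Instr.apply, heap]
  · intro c s r h1 h2; simp [unpairBlock, exec, Instr.apply, h2.ne, (Nat.lt_succ_of_lt h2).ne]
  · intro c s a ha
    obtain ⟨-, -, h1, h2⟩ := ha
    rw [rep_nat] at *
    simp only [heap] at h1 h2
    simp [unpairBlock, exec, Instr.apply, h1, h2]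

/-- Allocation of a cell with the content of real register `0`. -/
def boxBlock (b : ℕ) : List Instr :=
  [.rstore 1 0, .iconst b 0, .iadd b 1 b, .iconst (b + 1) 1, .iadd 1 1 (b + 1)]

theorem Comp.realConst (z : ℤ) : Comp O1 (fun _ : α => (z : ℝ)) := by
  refine Comp.ofBlock (fun b => .rconst 0 z :: boxBlock b) 6 (by simp [boxBlock]) fun c s a h0 ha => ?_
  have hle : (heap s).Le (heap (exec (.rconst 0 z :: boxBlock (c + 2)) s)) := by
    constructor <;> intros <;>
      simp [boxBlock, exec, Instr.apply, heap, Function.update_apply] at *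
    omega
  refine ⟨⟨hle, fun r hr hrb => ?_⟩, ?_, ?_⟩
  · simp [boxBlock, exec, Instr.apply, Function.update_apply]
    grind
  · simp [boxBlock, exec, Instr.apply, heap]
  · simp [boxBlock, exec, Instr.apply, heap]

theorem Comp.realBin (i : ℕ → ℕ → ℕ → Instr) (op : ℝ → ℝ → ℝ)
    (hi : ∀ a b c s, (i a b c).apply s =
      { s with rreg := Function.update s.rreg a (op (s.rreg b) (s.rreg c)) }) :
    Comp O1 (fun a : ℝ × ℝ => op a.1 a.2) := by
  refine Comp.ofBlock (fun b => unpairBlock b ++ [.rload 0 b, .rload 1 (b + 1), i 0 0 1] ++ boxBlock b)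
    12 (by simp [boxBlock, unpairBlock]) fun c s a h0 ha => ?_
  obtain ⟨-, -, ⟨h1, h2⟩, ⟨h3, h4⟩⟩ := ha
  have hle : (heap s).Le (heap (exec (unpairBlock (c + 2) ++ [.rload 0 (c + 2), .rload 1 (c + 2 + 1),
      i 0 0 1] ++ boxBlock (c + 2)) s)) := by
    constructor <;> intros <;>
      simp only [boxBlock, unpairBlock, hi, exec, List.cons_append, List.nil_append] <;>
      simp [Instr.apply, heap, Function.update_apply] at *
    omega
  refine ⟨⟨hle, fun r hr hrb => ?_⟩, ?_, ?_⟩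
  · simp only [boxBlock, unpairBlock, hi, exec, List.cons_append, List.nil_append]
    simp [Instr.apply, Function.update_apply]
    grind
  · simp only [boxBlock, unpairBlock, hi, exec, List.cons_append, List.nil_append]
    simp [Instr.apply, heap]
  · simp only [heap] at h2 h4
    simp only [boxBlock, unpairBlock, hi, exec, List.cons_append, List.nil_append]
    simp [Instr.apply, heap, h2, h4]

/-- Result of a test as a flag in register `b`. -/
theorem Comp.ofTest {f : α → Bool} (is : ℕ → List Instr) (T : ℕ → Test) (C : ℕ)
    (hC : ∀ b, (is b).length ≤ C)
    (hh : ∀ c s, heap (exec (is (c + 2)) s) = heap s)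
    (hr : ∀ c s r, 2 ≤ r → r < c + 2 → (exec (is (c + 2)) s).ireg r = s.ireg r)
    (h : ∀ c s a, rep (heap s) a (s.ireg (c + 2)) →
        ((T (c + 2)).Holds (exec (is (c + 2)) s) ↔ f a = true)) :
    Comp O1 f := by
  refine ⟨C + 10, fun b hb => ⟨.seq (block (is b)) (.ite (T b) (block [.iconst b 1])
    (block [.iconst b 0])), fun s a τ _ h0 ha => ?_⟩⟩
  obtain ⟨c, rfl⟩ := Nat.exists_eq_add_of_le' hb
  have hC := hC (c + 2)
  have q := runs_block (is (c + 2)) s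
  have hh := hh c s
  have hr := hr c s
  have h := h c s a ha
  set s' := exec (is (c + 2)) s
  have x : Ext (c + 2) s s' := ⟨hh ▸ .refl _, hr⟩
  have key : ∀ m, Ext (c + 2) s' (exec [.iconst (c + 2) m] s') ∧
      (exec [.iconst (c + 2) m] s').ireg (c + 2) = m := fun m => by
    have : heap (exec [.iconst (c + 2) m] s') = heap s' := by simp [exec, Instr.apply, heap]
    refine ⟨⟨this ▸ .refl _, fun r _ h2 => ?_⟩, ?_⟩
    · simp [exec, Instr.apply, h2.ne]
    · simp [exec, Instr.apply]
  cases hf : f a with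
  | true =>
    refine ⟨_, _, .seq q (.ite_true (h.2 hf) (runs_block _ _)), ?_, x.trans (key 1).1, ?_⟩
    · simp only [List.length_cons, List.length_nil]
      nlinarith
    · rw [rep_bool, (key 1).2]; rfl
  | false =>
    refine ⟨_, _, .seq q (.ite_false (by rw [h, hf]; simp) (runs_block _ _)), ?_,
      x.trans (key 0).1, ?_⟩
    · simp only [List.length_cons, List.length_nil]
      nlinarith
    · rw [rep_bool, (key 0).2]; rfl

theorem Comp.natLtPair : Comp O1 (fun a : ℕ × ℕ => decide (a.1 < a.2)) := by
  refine Comp.ofTest unpairBlock (fun b => .ilt b (b + 1)) 4 (by simp [unpairBlock]) ?_ ?_ ?_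
  · intro c s; simp [unpairBlock, exec, Instr.apply, heap]
  · intro c s r h1 h2; simp [unpairBlock, exec, Instr.apply, h2.ne, (Nat.lt_succ_of_lt h2).ne]
  · intro c s a ha
    obtain ⟨-, -, h1, h2⟩ := ha
    rw [rep_nat] at *
    simp only [heap] at h1 h2
    simp [unpairBlock, exec, Instr.apply, h1, h2, Test.Holds]

theorem Comp.realLtPair : Comp O1 (fun a : ℝ × ℝ => decide (a.1 < a.2)) := by
  refine Comp.ofTest (fun b => unpairBlock b ++ [.rload 1 b, .rload 2 (b + 1)])
    (fun _ => .rlt 1 2) 6 (by simp [unpairBlock]) ?_ ?_ ?_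
  · intro c s; simp [unpairBlock, exec, Instr.apply, heap]
  · intro c s r h1 h2; simp [unpairBlock, exec, Instr.apply, h2.ne, (Nat.lt_succ_of_lt h2).ne]
  · intro c s a ha
    obtain ⟨-, -, ⟨-, h1⟩, ⟨-, h2⟩⟩ := ha
    simp only [heap] at h1 h2
    simp [unpairBlock, exec, Instr.apply, h1, h2, Test.Holds]

/-- Whether a list is nonempty. -/
theorem Comp.nonempty : Comp O1 (fun l : List α => !l.isEmpty) := by
  refine Comp.ofTest (fun b => [.iconst (b + 1) 0]) (fun b => .ilt (b + 1) b) 1 (by simp) ?_ ?_ ?_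
  · intro c s; simp [exec, Instr.apply, heap]
  · intro c s r h1 h2; simp [exec, Instr.apply, (Nat.lt_succ_of_lt h2).ne]
  · intro c s a ha
    cases a with
    | nil => rw [rep_nil] at ha; simp [exec, Instr.apply, Test.Holds, ha]
    | cons x l =>
      rw [rep_cons] at ha
      have := ha.1
      simp [exec, Instr.apply, Test.Holds]
      omega

/-- The default-free head and tail of a nonempty list. -/
theorem Comp.uncons [Inhabited α] : Comp (fun (l : List α) _ => l ≠ []) (fun l => (l.headI, l.tail)) := by
  refine ⟨1, fun b hb => ⟨block [], fun s a τ h h0 ha => ?_⟩⟩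
  cases a with
  | nil => exact absurd rfl h
  | cons x l =>
    rw [rep_cons] at ha
    exact ⟨_, _, runs_block _ _, by simp, ⟨.refl _, fun _ _ _ => rfl⟩, ha⟩

open Classical in
/-- The functional form of a while loop; it returns its argument if the loop does not terminate. -/
noncomputable def whileFn {α : Type} (c : α → Bool) (f : α → α) (a : α) : α :=
  if h : ∃ n, c (f^[n] a) = false then f^[Nat.find h] a else a

-- The time is charged as number of rounds times time per round. The index `N` need not be the first
-- at which the condition fails, and nothing is required of states after the first failure, which
-- the loop never reaches.
open Classical in
theorem Comp.while {Rc Rf : α → ℕ → Prop} {c : α → Bool} {f : α → α} (hc : Comp Rc c)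
    (hf : Comp Rf f) :
    Comp (fun a τ => ∃ K B N, (K + 1) * (B + 1) ≤ τ ∧ N ≤ K ∧ c (f^[N] a) = false ∧
      ∀ i ≤ N, (∀ j < i, c (f^[j] a) = true) →
        Rc (f^[i] a) B ∧ (c (f^[i] a) = true → Rf (f^[i] a) B)) (whileFn c f) := by
  obtain ⟨C, hc⟩ := hc
  obtain ⟨C', hf⟩ := hf
  refine ⟨C + C' + 20, fun b hb => ?_⟩
  obtain ⟨Q, hc⟩ := hc (b + 1) (by omega)
  obtain ⟨P, hf⟩ := hf b hb
  -- A loop can only test registers. Hence the condition is evaluated into a flag once before the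
  -- loop and again at the end of each round.
  set E : Program := .seq (block (copyBlock (b + 1) b)) (.seq Q (block [.iconst (b + 2) 0])) with hE
  have hEr : ∀ s a B, Rc a B → 0 < s.ireg 0 → rep (heap s) a (s.ireg b) →
      ∃ s' t, Runs E s s' t ∧ t ≤ C * (B + 1) + 5 ∧ Ext b s s' ∧ rep (heap s') a (s'.ireg b) ∧
        s'.ireg (b + 1) = (c a).toNat ∧ s'.ireg (b + 2) = 0 := by
    intro s a B ha h0 hr
    obtain ⟨x1, e1, r1⟩ := copyBlock_spec (b := b) (b' := b + 1) (by omega) (by omega) s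
    have q1 := runs_block (copyBlock (b + 1) b) s
    set s1 := exec (copyBlock (b + 1) b) s
    obtain ⟨s2, t2, q2, l2, x2, r2⟩ := hc s1 a B ha (x1.pos h0) (by rw [e1, r1]; exact hr)
    have q3 := runs_block [.iconst (b + 2) 0] s2
    have h3 : heap (exec [.iconst (b + 2) 0] s2) = heap s2 := by
      simp [exec, Instr.apply, heap]
    have x3 : Ext (b + 1) s2 (exec [.iconst (b + 2) 0] s2) := by
      refine ⟨h3 ▸ .refl _, fun r _ _ => ?_⟩
      simp [exec, Instr.apply, Function.update_apply]
      omega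
    have v3 : (exec [.iconst (b + 2) 0] s2).ireg (b + 1) = s2.ireg (b + 1) ∧
      (exec [.iconst (b + 2) 0] s2).ireg (b + 2) = 0 := by
      simp [exec, Instr.apply]
    set s3 := exec [.iconst (b + 2) 0] s2
    have x13 : Ext (b + 1) s s3 := x1.trans (x2.trans x3)
    refine ⟨s3, _, .seq q1 (.seq q2 q3), ?_, x13.mono (by omega), x13.rep hr hb (by omega), ?_, v3.2⟩
    · simp only [copyBlock, List.length_cons, List.length_nil]
      omega
    · rw [v3.1]; exact r2
  refine ⟨.seq E (.loop (.ilt (b + 2) (b + 1)) (.seq P E)), fun s a τ ha h0 hr => ?_⟩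
  obtain ⟨K, B, N, hτ, hNK, hN, hR⟩ := ha
  have hex : ∃ n, c (f^[n] a) = false := ⟨N, hN⟩
  have hfind : Nat.find hex ≤ N := Nat.find_le hN
  have hbef : ∀ j < Nat.find hex, c (f^[j] a) = true := fun j hj => by
    have := Nat.find_min hex hj
    simpa using this
  have hloop : ∀ n i s, i + n = Nat.find hex → 0 < s.ireg 0 → rep (heap s) (f^[i] a) (s.ireg b) →
      s.ireg (b + 1) = (c (f^[i] a)).toNat → s.ireg (b + 2) = 0 →
      ∃ s' t, Runs (.loop (.ilt (b + 2) (b + 1)) (.seq P E)) s s' t ∧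
        t ≤ n * ((C + C' + 6) * (B + 1)) + 1 ∧ Ext b s s' ∧
        rep (heap s') (f^[Nat.find hex] a) (s'.ireg b) := by
    intro n
    induction n with
    | zero =>
      intro i s hi h0 hr h1 h2
      have hi' : i = Nat.find hex := by omega
      subst hi'
      refine ⟨s, _, .loop_false ?_, by omega, .refl _ _, hr⟩
      simp [Test.Holds, h1, h2, Nat.find_spec hex]
    | succ n ih =>
      intro i s hi h0 hr h1 h2
      have hci := hbef i (by omega)
      obtain ⟨-, hRf⟩ := hR i (by omega) fun j hj => hbef j (by omega)
      obtain ⟨s1, t1, q1, l1, x1, r1⟩ := hf s _ B (hRf hci) h0 hr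
      obtain ⟨hRc, -⟩ := hR (i + 1) (by omega) fun j hj => hbef j (by omega)
      rw [← Function.iterate_succ_apply' f i a] at r1
      obtain ⟨s2, t2, q2, l2, x2, r2, v1, v2⟩ := hEr s1 _ B hRc (x1.pos h0) r1
      obtain ⟨s3, t3, q3, l3, x3, r3⟩ := ih (i + 1) s2 (by omega) (x2.pos (x1.pos h0)) r2 v1 v2
      refine ⟨s3, _, .loop_true ?_ (.seq q1 q2) q3, ?_, x1.trans (x2.trans x3), r3⟩
      · simp [Test.Holds, h1, h2, hci]
      · nlinarith
  obtain ⟨hRc, -⟩ := hR 0 (by omega) (by simp)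
  obtain ⟨s1, t1, q1, l1, x1, r1, v1, v2⟩ := hEr s a B hRc h0 hr
  obtain ⟨s2, t2, q2, l2, x2, r2⟩ := hloop (Nat.find hex) 0 s1 (by omega) (x1.pos h0) r1 v1 v2
  refine ⟨s2, _, .seq q1 q2, ?_, x1.trans x2, ?_⟩
  · have h1 : Nat.find hex * ((C + C' + 6) * (B + 1)) ≤ K * ((C + C' + 6) * (B + 1)) := by
      gcongr; omega
    have h2 : (C + C' + 6) * ((K + 1) * (B + 1)) ≤ (C + C' + 6) * τ := by gcongr
    nlinarith
  · rw [whileFn, dif_pos hex]; exact r2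

end RealRAM

/-! ### Derived operations on lists and numbers -/

namespace RealRAM

open HeapRep

theorem whileFn_eq {α : Type} {c : α → Bool} {f : α → α} {a : α} {N : ℕ} (hN : c (f^[N] a) = false)
    (h : ∀ j < N, c (f^[j] a) = true) : whileFn c f a = f^[N] a := by
  classical
  have hex : ∃ n, c (f^[n] a) = false := ⟨N, hN⟩
  have : Nat.find hex = N := by
    rw [Nat.find_eq_iff]
    exact ⟨hN, fun j hj => by simp [h j hj]⟩
  rw [whileFn, dif_pos hex, this]

/-- This turns a fold into a loop: the state consists of the fixed parameter, the accumulator and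
the unread suffix of the list. -/
theorem foldl_step_iterate {α β γ : Type} (f : α → β → γ → β) (d : γ) (a : α) (i : β) (l : List γ) (n : ℕ)
    (hn : n ≤ l.length) :
    (fun q : α × (β × List γ) => (q.1, (f q.1 q.2.1 (q.2.2.headD d), q.2.2.tail)))^[n] (a, (i, l)) =
      (a, ((l.take n).foldl (f a) i, l.drop n)) := by
  induction n generalizing i l with
  | zero => simp
  | succ n ih =>
    cases l with
    | nil => simp at hn
    | cons x l =>
      rw [Function.iterate_succ_apply]
      simp only [List.headD_cons, List.tail_cons]
      rw [ih _ _ (by simpa using hn)]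
      simp

section
variable {α β γ δ : Type} [HeapRep α] [HeapRep β] [HeapRep γ] [HeapRep δ]
variable {R : α → ℕ → Prop}

theorem Comp.app {R' : β → ℕ → Prop} {g : β → γ} {f : α → β} (hg : Comp R' g) (hf : Comp R f)
    (c : ℕ) (h : ∀ a τ, R a τ → R' (f a) (c * (τ + 1))) : Comp R (fun a => g (f a)) :=
  ((hg.scale (R' := fun b τ => R' b (c * (τ + 1))) c fun _ _ => _root_.id).comp hf).mono
    fun a τ ha => ⟨ha, h a τ ha⟩

theorem Comp.appSame {R' : β → ℕ → Prop} {g : β → γ} {f : α → β} (hg : Comp R' g) (hf : Comp R f)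
    (h : ∀ a τ, R a τ → R' (f a) τ) : Comp R (fun a => g (f a)) :=
  (hg.comp hf).mono fun a τ ha => ⟨ha, h a τ ha⟩

theorem Comp.app1 {g : β → γ} {f : α → β} (hg : Comp O1 g) (hf : Comp R f) :
    Comp R (fun a => g (f a)) := hg.app hf 0 fun _ _ _ => trivial

theorem Comp.id' : Comp R (fun a : α => a) := Comp.id.mono fun _ _ _ => trivial

theorem Comp.fst' {f : α → β × γ} (h : Comp R f) : Comp R (fun a => (f a).1) := Comp.fst.app1 h

theorem Comp.snd' {f : α → β × γ} (h : Comp R f) : Comp R (fun a => (f a).2) := Comp.snd.app1 h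

theorem Comp.pair' {f : α → β} {g : α → γ} (hf : Comp R f) (hg : Comp R g) :
    Comp R (fun a => (f a, g a)) := (hf.pair hg).mono fun _ _ h => ⟨h, h⟩

theorem Comp.app2 {R' : β × γ → ℕ → Prop} {g : β → γ → δ} {f : α → β} {f' : α → γ}
    (hg : Comp R' (fun q => g q.1 q.2)) (hf : Comp R f) (hf' : Comp R f') (c : ℕ)
    (h : ∀ a τ, R a τ → R' (f a, f' a) (c * (τ + 1))) : Comp R (fun a => g (f a) (f' a)) :=
  hg.app (hf.pair' hf') c h

theorem Comp.natConst' (m : ℕ) : Comp R (fun _ : α => m) := (Comp.natConst m).mono fun _ _ _ => trivial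

theorem Comp.boolConst' (m : Bool) : Comp R (fun _ : α => m) :=
  (Comp.boolConst m).mono fun _ _ _ => trivial

theorem Comp.nil' : Comp R (fun _ : α => ([] : List β)) := Comp.nil.mono fun _ _ _ => trivial

theorem Comp.realInt (z : ℤ) (r : ℝ) (h : (z : ℝ) = r) : Comp R (fun _ : α => r) :=
  h ▸ (Comp.realConst z).mono fun _ _ _ => trivial

theorem Comp.real0 : Comp R (fun _ : α => (0 : ℝ)) := Comp.realInt 0 0 (by simp)

theorem Comp.real1 : Comp R (fun _ : α => (1 : ℝ)) := Comp.realInt 1 1 (by simp)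

theorem Comp.realNat (m : ℕ) [m.AtLeastTwo] : Comp R (fun _ : α => (OfNat.ofNat m : ℝ)) :=
  Comp.realInt (OfNat.ofNat m) _ (by simp)

theorem Comp.cons {f : α → β} {g : α → List β} (hf : Comp R f) (hg : Comp R g) :
    Comp R (fun a => f a :: g a) := Comp.consPair.app1 (hf.pair' hg)

theorem Comp.nadd {f g : α → ℕ} (hf : Comp R f) (hg : Comp R g) : Comp R (fun a => f a + g a) :=
  Comp.natAddPair.app1 (hf.pair' hg)

theorem Comp.nsub {f g : α → ℕ} (hf : Comp R f) (hg : Comp R g) : Comp R (fun a => f a - g a) :=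
  Comp.natSubPair.app1 (hf.pair' hg)

theorem Comp.radd {f g : α → ℝ} (hf : Comp R f) (hg : Comp R g) : Comp R (fun a => f a + g a) :=
  (Comp.realBin .radd (· + ·) fun _ _ _ _ => rfl).app1 (hf.pair' hg)

theorem Comp.rsub {f g : α → ℝ} (hf : Comp R f) (hg : Comp R g) : Comp R (fun a => f a - g a) :=
  (Comp.realBin .rsub (· - ·) fun _ _ _ _ => rfl).app1 (hf.pair' hg)

theorem Comp.rmul {f g : α → ℝ} (hf : Comp R f) (hg : Comp R g) : Comp R (fun a => f a * g a) :=
  (Comp.realBin .rmul (· * ·) fun _ _ _ _ => rfl).app1 (hf.pair' hg)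

theorem Comp.rdiv {f g : α → ℝ} (hf : Comp R f) (hg : Comp R g) : Comp R (fun a => f a / g a) :=
  (Comp.realBin .rdiv (· / ·) fun _ _ _ _ => rfl).app1 (hf.pair' hg)

theorem Comp.nlt {f g : α → ℕ} (hf : Comp R f) (hg : Comp R g) :
    Comp R (fun a => decide (f a < g a)) := Comp.natLtPair.app1 (hf.pair' hg)

theorem Comp.rlt {f g : α → ℝ} (hf : Comp R f) (hg : Comp R g) :
    Comp R (fun a => decide (f a < g a)) := Comp.realLtPair.app1 (hf.pair' hg)

theorem Comp.cond {c : α → Bool} {f g : α → β} (hc : Comp R c)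
    (hf : Comp (fun a τ => R a τ ∧ c a = true) f) (hg : Comp (fun a τ => R a τ ∧ c a = false) g) :
    Comp R (fun a => if c a then f a else g a) :=
  (hc.ite hf hg).mono fun _ _ h => ⟨h, fun h' => ⟨h, h'⟩, fun h' => ⟨h, h'⟩⟩

theorem Comp.ite' {c : α → Bool} {f g : α → β} (hc : Comp R c) (hf : Comp R f) (hg : Comp R g) :
    Comp R (fun a => if c a then f a else g a) :=
  (hc.ite hf hg).mono fun _ _ h => ⟨h, fun _ => h, fun _ => h⟩

theorem Comp.not {c : α → Bool} (hc : Comp R c) : Comp R (fun a => !c a) :=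
  (hc.ite' (Comp.boolConst' false) (Comp.boolConst' true)).congr fun a => by cases c a <;> rfl

theorem Comp.and {c c' : α → Bool} (hc : Comp R c) (hc' : Comp R c') : Comp R (fun a => c a && c' a) :=
  (hc.ite' hc' (Comp.boolConst' false)).congr fun a => by cases c a <;> rfl

theorem Comp.or {c c' : α → Bool} (hc : Comp R c) (hc' : Comp R c') : Comp R (fun a => c a || c' a) :=
  (hc.ite' (Comp.boolConst' true) hc').congr fun a => by cases c a <;> rfl

theorem Comp.beq {c c' : α → Bool} (hc : Comp R c) (hc' : Comp R c') : Comp R (fun a => c a == c' a) :=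
  (hc.ite' hc' hc'.not).congr fun a => by cases c a <;> cases c' a <;> rfl

theorem Comp.isEmpty {f : α → List β} (hf : Comp R f) : Comp R (fun a => (f a).isEmpty) :=
  (Comp.nonempty.app1 hf).not.congr fun _ => by simp

theorem Comp.tail {f : α → List β} (hf : Comp R f) : Comp R (fun a => (f a).tail) := by
  refine Comp.app1 (g := fun l : List β => l.tail) ?_ hf
  rcases isEmpty_or_nonempty β with hβ | ⟨⟨b⟩⟩
  · exact (Comp.nil (α := List β)).congr fun l => by cases l with
      | nil => rfl
      | cons x l => exact hβ.elim x
  · let _ : Inhabited β := ⟨b⟩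
    refine (Comp.cond (c := fun l : List β => !l.isEmpty) Comp.nonempty
      (f := fun l => l.tail) (g := fun _ => []) ?_ Comp.nil').congr fun l => by cases l <;> rfl
    refine Comp.snd' (Comp.uncons.mono fun l τ h => ?_)
    rintro rfl; simp at h

theorem Comp.headD {f : α → List β} {d : α → β} (hf : Comp R f) (hd : Comp R d) :
    Comp R (fun a => (f a).headD (d a)) := by
  rcases isEmpty_or_nonempty β with hβ | ⟨⟨b⟩⟩
  · exact hd.congr fun a => (hβ.elim (d a))
  · let _ : Inhabited β := ⟨b⟩
    refine (Comp.cond (c := fun a => (f a).isEmpty) hf.isEmpty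
      (f := fun a => d a) (g := fun a => (f a).headI) (hd.mono fun _ _ h => h.1) ?_).congr
        fun a => by cases f a <;> rfl
    refine Comp.fst' (Comp.app (Comp.uncons (α := β)) (hf.mono fun _ _ h => h.1) 0 fun a τ h => ?_)
    rintro h'; simp [h'] at h

/-- The step has to be fast only for accumulators that occur, namely the folds over the prefixes of
the list. This matters where the size of the accumulator is controlled by an invariant. -/
theorem Comp.foldl {Rf : α × (β × γ) → ℕ → Prop} {l : α → List γ} {i : α → β} {f : α → β → γ → β}
    (hl : Comp R l) (hi : Comp R i) (hf : Comp Rf (fun q => f q.1 q.2.1 q.2.2)) (c : ℕ)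
    (h : ∀ a τ, R a τ → ∃ B, (l a).length * (B + 1) ≤ c * (τ + 1) ∧
      ∀ pre x suf, l a = pre ++ x :: suf → Rf (a, (pre.foldl (f a) (i a), x)) B) :
    Comp R (fun a => (l a).foldl (f a) (i a)) := by
  rcases isEmpty_or_nonempty γ with hγ | ⟨⟨d⟩⟩
  · exact hi.congr fun a => by
      cases l a with
      | nil => rfl
      | cons x l => exact hγ.elim x
  let _ : Inhabited γ := ⟨d⟩
  have hstep : Comp (fun q τ => q.2.2 ≠ [] ∧ Rf (q.1, (q.2.1, q.2.2.headD d)) τ)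
      (fun q : α × (β × List γ) => (q.1, (f q.1 q.2.1 (q.2.2.headD d), q.2.2.tail))) := by
    refine Comp.id'.fst'.pair' (Comp.pair' ?_ (Comp.tail Comp.id'.snd'.snd'))
    refine Comp.appSame hf (f := fun q : α × (β × List γ) => (q.1, (q.2.1, q.2.2.headD d))) ?_
      fun q τ hq => hq.2
    · refine Comp.id'.fst'.pair' (Comp.id'.snd'.fst'.pair' ?_)
      have : Comp (fun (q : α × (β × List γ)) (_ : ℕ) => q.2.2 ≠ [])
          (fun q : α × (β × List γ) => q.2.2.headI) :=
        Comp.fst' (Comp.app (Comp.uncons (α := γ)) (Comp.id'.snd'.snd') 0 fun a τ h => h)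
      refine (this.mono fun _ _ h => h.1).congr fun q => by cases q.2.2 <;> rfl
  have hc : Comp O1 (fun q : α × (β × List γ) => !q.2.2.isEmpty) :=
    Comp.not (Comp.isEmpty Comp.id'.snd'.snd')
  have hw := hc.while hstep
  have hwl : ∀ a, whileFn (fun q : α × (β × List γ) => !q.2.2.isEmpty)
      (fun q : α × (β × List γ) => (q.1, (f q.1 q.2.1 (q.2.2.headD d), q.2.2.tail)))
      (a, (i a, l a)) = (a, ((l a).foldl (f a) (i a), [])) := by
    intro a
    rw [whileFn_eq (N := (l a).length)]
    · rw [foldl_step_iterate _ _ _ _ _ _ le_rfl]; simp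
    · rw [foldl_step_iterate _ _ _ _ _ _ le_rfl]; simp
    · intro j hj
      rw [foldl_step_iterate _ _ _ _ _ _ hj.le]; simpa using hj
  refine (Comp.fst' (Comp.snd' (Comp.app hw (Comp.id'.pair' (hi.pair' hl)) (2 * c + 2)
    fun a τ ha => ?_))).congr fun a => by rw [hwl]
  obtain ⟨B, hB, hRf⟩ := h a τ ha
  -- For an empty list the product bound says nothing about `B`, so that case is charged with `B =
  -- 0`.
  rcases Nat.eq_zero_or_pos (l a).length with h0 | h0
  · refine ⟨0, 0, 0, by nlinarith, le_rfl, ?_, fun i hi _ => ⟨trivial, ?_⟩⟩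
    · simpa using h0
    · obtain rfl : i = 0 := by omega
      simp [List.length_eq_zero_iff.1 h0]
  · refine ⟨(l a).length, B, (l a).length, by nlinarith, le_rfl, ?_, fun j hj _ => ⟨trivial, ?_⟩⟩
    · rw [foldl_step_iterate _ _ _ _ _ _ le_rfl]; simp
    · rw [foldl_step_iterate _ _ _ _ _ _ hj]
      intro hne
      have hne' : (l a).drop j ≠ [] := by simpa using hne
      refine ⟨hne', ?_⟩
      obtain ⟨x, t, hxt⟩ := List.exists_cons_of_ne_nil hne'
      have := hRf ((l a).take j) x t (by rw [← hxt, List.take_append_drop])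
      simpa [hxt] using this

theorem Comp.foldl' {Rf : α × (β × γ) → ℕ → Prop} {l : α → List γ} {i : α → β} {f : α → β → γ → β}
    (hl : Comp R l) (hi : Comp R i) (hf : Comp Rf (fun q => f q.1 q.2.1 q.2.2)) (c : ℕ)
    (h : ∀ a τ, R a τ → ∃ B, (l a).length * (B + 1) ≤ c * (τ + 1) ∧
      ∀ acc, ∀ x ∈ l a, Rf (a, (acc, x)) B) :
    Comp R (fun a => (l a).foldl (f a) (i a)) := by
  refine hl.foldl hi hf c fun a τ ha => ?_
  obtain ⟨B, h1, h2⟩ := h a τ ha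
  exact ⟨B, h1, fun pre x suf e => h2 _ _ (by simp [e])⟩

theorem Comp.reverse {l : α → List β} (hl : Comp R l) (c : ℕ)
    (h : ∀ a τ, R a τ → (l a).length ≤ c * (τ + 1)) : Comp R (fun a => (l a).reverse) := by
  refine (hl.foldl' (i := fun _ => []) (f := fun _ acc x => x :: acc) (Rf := O1) Comp.nil'
    (Comp.cons Comp.id'.snd'.snd' Comp.id'.snd'.fst') c fun a τ ha => ⟨0, by simpa using h a τ ha,
      fun _ _ _ => trivial⟩).congr fun a => ?_
  simp

/-- The list is reversed first, since a fold that conses its results reverses them once more. The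
same holds for the filter and the concatenation below. -/
theorem Comp.map {Rf : α × β → ℕ → Prop} {l : α → List β} {f : α → β → γ}
    (hl : Comp R l) (hf : Comp Rf (fun q => f q.1 q.2)) (c : ℕ)
    (h : ∀ a τ, R a τ → ∃ B, (l a).length * (B + 1) ≤ c * (τ + 1) ∧ ∀ x ∈ l a, Rf (a, x) B) :
    Comp R (fun a => (l a).map (f a)) := by
  have hr : Comp R (fun a => (l a).reverse) := hl.reverse c fun a τ ha => by
    obtain ⟨B, h1, h2⟩ := h a τ ha
    nlinarith
  refine (hr.foldl' (i := fun _ => []) (f := fun a acc x => f a x :: acc)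
    (Rf := fun q τ => Rf (q.1, q.2.2) τ) Comp.nil'
    (Comp.cons (Comp.appSame hf (Comp.id'.fst'.pair' Comp.id'.snd'.snd') fun _ _ h => h)
      Comp.id'.snd'.fst') c fun a τ ha => ?_).congr fun a => ?_
  · obtain ⟨B, h1, h2⟩ := h a τ ha
    exact ⟨B, by simpa using h1, fun _ x hx => h2 x (by simpa using hx)⟩
  · rw [List.foldl_reverse]
    induction l a with
    | nil => rfl
    | cons x l ih => simp_all

theorem Comp.filter {Rf : α × β → ℕ → Prop} {l : α → List β} {f : α → β → Bool}
    (hl : Comp R l) (hf : Comp Rf (fun q => f q.1 q.2)) (c : ℕ)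
    (h : ∀ a τ, R a τ → ∃ B, (l a).length * (B + 1) ≤ c * (τ + 1) ∧ ∀ x ∈ l a, Rf (a, x) B) :
    Comp R (fun a => (l a).filter (f a)) := by
  have hr : Comp R (fun a => (l a).reverse) := hl.reverse c fun a τ ha => by
    obtain ⟨B, h1, h2⟩ := h a τ ha
    nlinarith
  refine (hr.foldl' (i := fun _ => []) (f := fun a acc x => if f a x then x :: acc else acc)
    (Rf := fun q τ => Rf (q.1, q.2.2) τ) Comp.nil'
    (Comp.ite' (Comp.appSame hf (Comp.id'.fst'.pair' Comp.id'.snd'.snd') fun _ _ h => h)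
      (Comp.cons Comp.id'.snd'.snd' Comp.id'.snd'.fst') Comp.id'.snd'.fst')
    c fun a τ ha => ?_).congr fun a => ?_
  · obtain ⟨B, h1, h2⟩ := h a τ ha
    exact ⟨B, by simpa using h1, fun _ x hx => h2 x (by simpa using hx)⟩
  · rw [List.foldl_reverse]
    induction l a with
    | nil => rfl
    | cons x l ih => simp_all [List.filter_cons]

theorem Comp.append {l l' : α → List β} (hl : Comp R l) (hl' : Comp R l') (c : ℕ)
    (h : ∀ a τ, R a τ → (l a).length ≤ c * (τ + 1)) : Comp R (fun a => l a ++ l' a) := by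
  refine ((hl.reverse c h).foldl' (i := l') (f := fun _ acc x => x :: acc) (Rf := O1) hl'
    (Comp.cons Comp.id'.snd'.snd' Comp.id'.snd'.fst') c fun a τ ha => ⟨0, by simpa using h a τ ha,
      fun _ _ _ => trivial⟩).congr fun a => ?_
  simp [List.foldl_reverse]

theorem Comp.flatMap {Rf : α × β → ℕ → Prop} {l : α → List β} {f : α → β → List γ}
    (hl : Comp R l) (hf : Comp Rf (fun q => f q.1 q.2)) (c : ℕ)
    (h : ∀ a τ, R a τ → ∃ B, (l a).length * (B + 1) ≤ c * (τ + 1) ∧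
      ∀ x ∈ l a, Rf (a, x) B ∧ (f a x).length ≤ B) :
    Comp R (fun a => (l a).flatMap (f a)) := by
  have hr : Comp R (fun a => (l a).reverse) := hl.reverse c fun a τ ha => by
    obtain ⟨B, h1, h2⟩ := h a τ ha
    nlinarith
  refine (hr.foldl' (i := fun _ => []) (f := fun a acc x => f a x ++ acc)
    (Rf := fun q τ => Rf (q.1, q.2.2) τ ∧ (f q.1 q.2.2).length ≤ τ) Comp.nil'
    (Comp.append (Comp.appSame hf (Comp.id'.fst'.pair' Comp.id'.snd'.snd') fun _ _ h => h.1)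
      Comp.id'.snd'.fst' 1 fun a τ ha => ?_) c fun a τ ha => ?_).congr fun a => ?_
  · have := ha.2
    omega
  · obtain ⟨B, h1, h2⟩ := h a τ ha
    exact ⟨B, by simpa using h1, fun _ x hx => h2 x (by simpa using hx)⟩
  · rw [List.foldl_reverse]
    induction l a with
    | nil => rfl
    | cons x l ih => simp_all

theorem Comp.foldr' {Rf : α × (β × γ) → ℕ → Prop} {l : α → List β} {i : α → γ} {f : α → β → γ → γ}
    (hl : Comp R l) (hi : Comp R i) (hf : Comp Rf (fun q => f q.1 q.2.1 q.2.2)) (c : ℕ)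
    (h : ∀ a τ, R a τ → ∃ B, (l a).length * (B + 1) ≤ c * (τ + 1) ∧
      ∀ pre x suf, l a = pre ++ x :: suf → Rf (a, (x, suf.foldr (f a) (i a))) B) :
    Comp R (fun a => (l a).foldr (f a) (i a)) := by
  have hr : Comp R (fun a => (l a).reverse) := hl.reverse c fun a τ ha => by
    obtain ⟨B, h1, h2⟩ := h a τ ha
    nlinarith
  refine (hr.foldl (i := i) (f := fun a acc x => f a x acc)
    (Rf := fun q τ => Rf (q.1, (q.2.2, q.2.1)) τ) hi
    (Comp.appSame hf (Comp.id'.fst'.pair' (Comp.id'.snd'.snd'.pair' Comp.id'.snd'.fst'))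
      fun _ _ h => h) c fun a τ ha => ?_).congr fun a => by rw [List.foldl_reverse]
  obtain ⟨B, h1, h2⟩ := h a τ ha
  refine ⟨B, by simpa using h1, fun pre x suf e => ?_⟩
  have := h2 suf.reverse x pre.reverse (by
    rw [← List.reverse_reverse (l a), e]; simp)
  simpa using this

theorem Comp.zip {l : α → List β} {l' : α → List γ} (hl : Comp R l) (hl' : Comp R l') (c : ℕ)
    (h : ∀ a τ, R a τ → (l a).length ≤ c * (τ + 1)) : Comp R (fun a => (l a).zip (l' a)) := by
  rcases isEmpty_or_nonempty γ with hγ | ⟨⟨d⟩⟩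
  · exact (Comp.nil' (R := R)).congr fun a => by
      cases l' a with
      | nil => simp
      | cons x l => exact hγ.elim x
  let _ : Inhabited γ := ⟨d⟩
  have hf : Comp O1 (fun q : α × ((List (β × γ) × List γ) × β) =>
      if q.2.1.2.isEmpty then q.2.1 else
        ((q.2.2, q.2.1.2.headI) :: q.2.1.1, q.2.1.2.tail)) := by
    refine Comp.cond (Comp.isEmpty Comp.id'.snd'.fst'.snd') Comp.id'.snd'.fst' ?_
    refine Comp.pair' (Comp.cons (Comp.id'.snd'.snd'.pair' ?_) Comp.id'.snd'.fst'.fst')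
      (Comp.tail Comp.id'.snd'.fst'.snd')
    refine Comp.fst' (Comp.app (Comp.uncons (α := γ)) Comp.id'.snd'.fst'.snd' 0 fun q τ hq => ?_)
    rintro h'
    simp [h'] at hq
  have key : ∀ (l : List β) (l' : List γ) (acc : List (β × γ)),
      (l.foldl (fun (s : List (β × γ) × List γ) x =>
        if s.2.isEmpty then s else ((x, s.2.headI) :: s.1, s.2.tail)) (acc, l')).1 =
        (l.zip l').reverse ++ acc := by
    intro l
    induction l with
    | nil => simp
    | cons x l ih =>
      intro l' acc
      cases l' with
      | nil => simpa using ih [] acc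
      | cons y l' =>
        rw [List.foldl_cons, if_neg (by simp)]
        exact (ih l' _).trans (by simp)
  refine (Comp.reverse (Comp.fst' (hl.foldl' (i := fun a => (([] : List (β × γ)), l' a))
    (f := fun _ s x => if s.2.isEmpty then s else ((x, s.2.headI) :: s.1, s.2.tail))
    (Comp.pair' Comp.nil' hl') hf c fun a τ ha => ⟨0, by simpa using h a τ ha,
      fun _ _ _ => trivial⟩)) c fun a τ ha => ?_).congr fun a => ?_
  · rw [key]
    have := h a τ ha
    simp only [List.append_nil, List.length_reverse, List.length_zip]
    omega
  · rw [key]; simp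

/-- The list `[0, …, n - 1]`. -/
theorem Comp.range {n : α → ℕ} (hn : Comp R n) (c : ℕ) (h : ∀ a τ, R a τ → n a ≤ c * (τ + 1)) :
    Comp R (fun a => List.range (n a)) := by
  have key : ∀ m j, j ≤ m → (fun q : ℕ × List ℕ => (q.1 - 1, (q.1 - 1) :: q.2))^[j] (m, []) =
      (m - j, (List.range' (m - j) j)) := by
    intro m j hj
    induction j with
    | zero => simp
    | succ j ih =>
      rw [Function.iterate_succ_apply', ih (by omega)]
      simp only [Prod.mk.injEq]
      refine ⟨by omega, ?_⟩
      rw [List.range'_succ, show m - j - 1 = m - (j + 1) by omega,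
        show m - (j + 1) + 1 = m - j by omega]
  have hw := Comp.while (c := fun q : ℕ × List ℕ => decide (0 < q.1)) (Rc := O1) (Rf := O1)
    (f := fun q : ℕ × List ℕ => (q.1 - 1, (q.1 - 1) :: q.2))
    (Comp.nlt (Comp.natConst' 0) Comp.id'.fst')
    (Comp.pair' (Comp.nsub Comp.id'.fst' (Comp.natConst' 1))
      (Comp.cons (Comp.nsub Comp.id'.fst' (Comp.natConst' 1)) Comp.id'.snd'))
  refine (Comp.snd' (Comp.app hw (hn.pair' Comp.nil') (c + 1) fun a τ ha => ?_)).congr fun a => ?_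
  · refine ⟨n a, 0, n a, ?_, le_rfl, ?_, fun _ _ _ => ⟨trivial, fun _ => trivial⟩⟩
    · have := h a τ ha; nlinarith
    · rw [key _ _ le_rfl]; simp
  · rw [whileFn_eq (N := n a)]
    · rw [key _ _ le_rfl]; simp [List.range_eq_range']
    · rw [key _ _ le_rfl]; simp
    · intro j hj
      rw [key _ _ hj.le]; simpa using hj

theorem Comp.iterate {Rf : α × β → ℕ → Prop} {n : α → ℕ} {i : α → β} {f : α → β → β}
    (hn : Comp R n) (hi : Comp R i) (hf : Comp Rf (fun q => f q.1 q.2)) (c : ℕ)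
    (h : ∀ a τ, R a τ → ∃ B, n a * (B + 1) ≤ c * (τ + 1) ∧
      ∀ j < n a, Rf (a, (f a)^[j] (i a)) B) :
    Comp R (fun a => (f a)^[n a] (i a)) := by
  have key : ∀ (f : β → β) i (l : List ℕ), l.foldl (fun acc _ => f acc) i = f^[l.length] i := by
    intro f i l
    induction l generalizing i with
    | nil => rfl
    | cons x l ih => simp [ih]
  refine ((hn.range c fun a τ ha => ?_).foldl (f := fun a acc _ => f a acc) hi
    (Rf := fun q τ => Rf (q.1, q.2.1) τ)
    (Comp.appSame hf (Comp.id'.fst'.pair' Comp.id'.snd'.fst') fun _ _ h => h) c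
    fun a τ ha => ?_).congr fun a => by rw [key]; simp
  · obtain ⟨B, h1, h2⟩ := h a τ ha
    nlinarith
  · obtain ⟨B, h1, h2⟩ := h a τ ha
    refine ⟨B, by simpa using h1, fun pre x suf e => ?_⟩
    rw [key]
    refine h2 _ ?_
    have := congrArg List.length e
    simp at this
    omega

/-- The machine has no conversion to real numbers. The value is reached by adding `1` repeatedly, so
the time is linear in it. -/
theorem Comp.cast {n : α → ℕ} (hn : Comp R n) (c : ℕ) (h : ∀ a τ, R a τ → n a ≤ c * (τ + 1)) :
    Comp R (fun a => (n a : ℝ)) := by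
  refine (hn.iterate (i := fun _ => (0 : ℝ)) (f := fun _ x => x + 1) (Rf := O1)
    Comp.real0 (Comp.radd Comp.id'.snd' Comp.real1) c
    fun a τ ha => ⟨0, by simpa using h a τ ha, fun _ _ => trivial⟩).congr fun a => ?_
  induction n a with
  | zero => simp
  | succ n ih => rw [Function.iterate_succ_apply', ih]; simp

/-- Natural numbers can only be added and subtracted; the product is a repeated addition, and its
second factor is the price. -/
theorem Comp.nmul {m n : α → ℕ} (hm : Comp R m) (hn : Comp R n) (c : ℕ)
    (h : ∀ a τ, R a τ → n a ≤ c * (τ + 1)) : Comp R (fun a => m a * n a) := by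
  refine (Comp.app2 (g := fun (m : ℕ) (n : ℕ) => m * n) (R' := fun q τ => q.2 ≤ τ) ?_ hm hn c h)
  refine (Comp.id'.snd'.iterate (i := fun _ => 0) (f := fun a y => y + a.1) (Rf := O1)
    (Comp.natConst' 0) (Comp.nadd Comp.id'.snd' Comp.id'.fst'.fst') 1
    fun a τ ha => ⟨0, by omega, fun _ _ => trivial⟩).congr fun a => ?_
  induction a.2 with
  | zero => simp
  | succ n ih => rw [Function.iterate_succ_apply', ih]; ring

theorem Comp.rpow {x : α → ℝ} {n : α → ℕ} (hx : Comp R x) (hn : Comp R n) (c : ℕ)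
    (h : ∀ a τ, R a τ → n a ≤ c * (τ + 1)) : Comp R (fun a => x a ^ n a) := by
  refine (Comp.app2 (g := fun (x : ℝ) (n : ℕ) => x ^ n) (R' := fun q τ => q.2 ≤ τ) ?_ hx hn c h)
  refine (Comp.id'.snd'.iterate (i := fun _ => 1) (f := fun a y => y * a.1) (Rf := O1)
    Comp.real1 (Comp.rmul Comp.id'.snd' Comp.id'.fst'.fst') 1
    fun a τ ha => ⟨0, by omega, fun _ _ => trivial⟩).congr fun a => ?_
  induction a.2 with
  | zero => simp
  | succ n ih => rw [Function.iterate_succ_apply', ih]; ring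

/-- Rounding is done by counting: a natural and a real counter run in parallel until the real one
reaches `x`. -/
theorem Comp.natCeil {x : α → ℝ} (hx : Comp R x) (c : ℕ)
    (h : ∀ a τ, R a τ → ⌈x a⌉₊ ≤ c * (τ + 1)) : Comp R (fun a => ⌈x a⌉₊) := by
  have key : ∀ (x : ℝ) j, (fun q : ℝ × (ℕ × ℝ) => (q.1, (q.2.1 + 1, q.2.2 + 1)))^[j] (x, (0, 0)) =
      (x, (j, (j : ℝ))) := by
    intro x j
    induction j with
    | zero => simp
    | succ j ih => rw [Function.iterate_succ_apply', ih]; simp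
  have hw := Comp.while (c := fun q : ℝ × (ℕ × ℝ) => decide (q.2.2 < q.1)) (Rc := O1) (Rf := O1)
    (f := fun q : ℝ × (ℕ × ℝ) => (q.1, (q.2.1 + 1, q.2.2 + 1)))
    (Comp.rlt Comp.id'.snd'.snd' Comp.id'.fst')
    (Comp.pair' Comp.id'.fst' (Comp.pair' (Comp.nadd Comp.id'.snd'.fst' (Comp.natConst' 1))
      (Comp.radd Comp.id'.snd'.snd' Comp.real1)))
  refine (Comp.fst' (Comp.snd' (Comp.app hw (hx.pair' (Comp.pair' (Comp.natConst' 0)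
    Comp.real0)) (c + 1) fun a τ ha => ?_))).congr fun a => ?_
  · refine ⟨⌈x a⌉₊, 0, ⌈x a⌉₊, ?_, le_rfl, ?_, fun _ _ _ => ⟨trivial, fun _ => trivial⟩⟩
    · have := h a τ ha; nlinarith
    · rw [key]; simpa using Nat.le_ceil _
  · rw [whileFn_eq (N := ⌈x a⌉₊)]
    · rw [key]
    · rw [key]; simpa using Nat.le_ceil _
    · intro j hj
      rw [key]; simpa using Nat.lt_ceil.1 hj

end
end RealRAM

/-! ### Reading the input from and writing the output to the raw memory -/

namespace RealRAM

open HeapRep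

/-- The invariant is indexed by the number of rounds still to come, which yields the exact running
time together with termination. -/
theorem runs_loop {T : Test} {is : List Instr} (I : ℕ → State → Prop)
    (h0 : ∀ s, I 0 s → ¬ T.Holds s)
    (h : ∀ n s, I (n + 1) s → T.Holds s ∧ I n (exec is s)) (n : ℕ) (s : State) (hs : I n s) :
    ∃ s' t, Runs (.loop T (block is)) s s' t ∧ t = n * (is.length + 2) + 1 ∧ I 0 s' := by
  induction n generalizing s with
  | zero => exact ⟨s, _, .loop_false (h0 s hs), by simp, hs⟩
  | succ n ih =>
    obtain ⟨h1, h2⟩ := h n s hs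
    obtain ⟨s', t, h3, h4, h5⟩ := ih _ h2
    exact ⟨s', _, .loop_true h1 (runs_block _ _) h3, by rw [h4]; ring, h5⟩

/-- Moves the arguments `n`, `d`, `k` away from the allocation registers. -/
def setupBlock : List Instr :=
  -- The parameter `ε` is moved first, because the instruction that ends a block overwrites real
  -- register `0`.
  [.rconst 1 0, .radd 1 0 1, .iconst 8 0, .iconst 9 1, .iconst 10 2, .iadd 5 0 8, .iadd 6 1 8, .iadd 7 2 8,
    .iconst 11 0, .iconst 12 0]

def mulBody : List Instr := [.iadd 11 11 6, .iadd 12 12 9]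

/-- Index cells are allocated from address `1` on, as address `0` represents the empty list. -/
def midBlock : List Instr := [.iconst 0 1, .iconst 13 0, .iconst 12 0]

def pushBody : List Instr :=
  [.istore 0 12, .iadd 14 0 9, .istore 14 13, .iadd 13 0 8, .iadd 0 0 10, .iadd 12 12 9]

def packBlock : List Instr :=
  [.rstore 11 1, .iadd 1 11 9, .iadd 17 5 8, .iadd 18 6 8, .iadd 19 7 8, .iadd 20 11 8,
    .iadd 21 13 8]

def writeSetup : List Instr := [.iconst 18 0, .iconst 19 1, .iadd 20 1 18]

def writeBody : List Instr :=
  [.iload 21 17, .rload 0 21, .rstore 1 0, .iadd 1 1 19, .iadd 22 17 19, .iload 17 22]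

/-- The program that builds the argument `(n, (d, (k, (ε, l))))` in register `17`; here `l` is the list
of the coordinates of the input in reverse order. -/
def readProgram : Program :=
  .seq (block setupBlock) (.seq (.loop (.ilt 12 5) (block mulBody)) (.seq (block midBlock)
    (.seq (.loop (.ilt 12 11) (block pushBody)) (.seq (block packBlock)
      (.seq (block (consBlock 20)) (.seq (block (consBlock 19)) (.seq (block (consBlock 18))
        (block (consBlock 17)))))))))

/-- The program that copies the list of real numbers in register `17` to consecutive cells. -/
def writeProgram : Program :=
  .seq (block writeSetup) (.seq (.loop (.ilt 18 17) (block writeBody)) (block [.iadd 0 20 18]))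

/-- The first loop computes `n * d` by repeated addition. The second one pushes the addresses `0, …,
n * d - 1` onto a list: the input cells themselves serve as boxes, so no real number is copied, and
pushing reverses the order. New real cells start at `n * d`, the first of them holding `ε`. -/
theorem readProgram_spec (s : State) :
    ∃ s' t, Runs readProgram s s' t ∧ t ≤ 100 * (s.ireg 0 * s.ireg 1 + s.ireg 0 + 1) ∧
      0 < s'.ireg 0 ∧
      rep (heap s') (s.ireg 0, (s.ireg 1, (s.ireg 2, (s.rreg 0,
        ((List.range (s.ireg 0 * s.ireg 1)).map s.rmem).reverse)))) (s'.ireg 17) := by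
  set n := s.ireg 0 with hn
  set d := s.ireg 1 with hd
  set k := s.ireg 2 with hk
  set ε := s.rreg 0 with hε
  let K : State → Prop := fun s' => s'.ireg 5 = n ∧ s'.ireg 6 = d ∧ s'.ireg 7 = k ∧ s'.ireg 8 = 0 ∧
    s'.ireg 9 = 1 ∧ s'.ireg 10 = 2 ∧ s'.rreg 1 = ε ∧ s'.rmem = s.rmem
  have q1 := runs_block setupBlock s
  have v1 : K (exec setupBlock s) ∧ (exec setupBlock s).ireg 11 = 0 ∧
      (exec setupBlock s).ireg 12 = 0 := by
    simp [K, setupBlock, exec, Instr.apply, hn, hd, hk, hε]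
  set s1 := exec setupBlock s
  obtain ⟨s2, t2, q2, rfl, -, k2, h11, h12⟩ := runs_loop (T := .ilt 12 5) (is := mulBody)
    (fun m s' => m ≤ n ∧ K s' ∧ s'.ireg 11 = (n - m) * d ∧ s'.ireg 12 = n - m) (by
      rintro s' ⟨-, ⟨h5, -⟩, -, h12⟩
      simp [Test.Holds, h5, h12]) (by
      rintro m s' ⟨hm, ⟨h5, h6, h7, h8, h9, h10, hr, hrm⟩, h11, h12⟩
      refine ⟨by simp [Test.Holds, h5, h12]; omega, by omega, ?_, ?_, ?_⟩
      · simp [K, mulBody, exec, Instr.apply, *]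
      · simp only [mulBody, exec, Instr.apply]
        simp [h11, h6]
        rw [show n - m = n - (m + 1) + 1 by omega]
        ring
      · simp [mulBody, exec, Instr.apply, h12, h9]
        omega) n s1 ⟨le_rfl, v1.1, by simp [v1.2.1], by simp [v1.2.2]⟩
  have q3 := runs_block midBlock s2
  have v3 : K (exec midBlock s2) ∧ (exec midBlock s2).ireg 11 = n * d ∧
      (exec midBlock s2).ireg 12 = 0 ∧ (exec midBlock s2).ireg 0 = 1 ∧
      (exec midBlock s2).ireg 13 = 0 := by
    obtain ⟨h5, h6, h7, h8, h9, h10, hr, hrm⟩ := k2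
    simp [K, midBlock, exec, Instr.apply, *]
  set s3 := exec midBlock s2
  obtain ⟨s4, t4, q4, rfl, -, k4, h11, h12, h0, hrep⟩ := runs_loop (T := .ilt 12 11) (is := pushBody)
    (fun m s' => m ≤ n * d ∧ K s' ∧ s'.ireg 11 = n * d ∧ s'.ireg 12 = n * d - m ∧ 0 < s'.ireg 0 ∧
      rep ⟨s'.imem, s.rmem, s'.ireg 0, n * d⟩ ((List.range (n * d - m)).map s.rmem).reverse
        (s'.ireg 13)) (by
      rintro s' ⟨-, -, h11, h12, -⟩
      simp [Test.Holds, h11, h12]) (by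
      rintro m s' ⟨hm, ⟨h5, h6, h7, h8, h9, h10, hr, hrm⟩, h11, h12, h0, hrep⟩
      refine ⟨by simp only [Test.Holds, h11, h12]; omega, by omega, ?_, ?_, ?_, ?_, ?_⟩
      · simp [K, pushBody, exec, Instr.apply, *]
      · simp [pushBody, exec, Instr.apply, *]
      · simp [pushBody, exec, Instr.apply, h12, h9]
        omega
      · simp [pushBody, exec, Instr.apply, h10]
      · have hle : (⟨s'.imem, s.rmem, s'.ireg 0, n * d⟩ : Heap).Le
          ⟨(exec pushBody s').imem, s.rmem, (exec pushBody s').ireg 0, n * d⟩ := by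
          refine ⟨?_, le_rfl, fun p hp => ?_, fun _ _ => rfl⟩
          · simp [pushBody, exec, Instr.apply]
          · simp only at hp
            simp [pushBody, exec, Instr.apply, h9, Function.update_apply]
            rw [if_neg (by omega), if_neg (by omega)]
        rw [show n * d - m = n * d - (m + 1) + 1 by omega, List.range_succ, List.map_append,
          List.reverse_append]
        change rep _ (_ :: _) _
        rw [rep_cons]
        have e13 : (exec pushBody s').ireg 13 = s'.ireg 0 := by
          simp [pushBody, exec, Instr.apply, h8]
        rw [e13, rep_prod]
        refine ⟨h0.ne', ?_, ?_, ?_⟩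
        · simp [pushBody, exec, Instr.apply, h10]
        · rw [rep_real]
          have : (exec pushBody s').imem (s'.ireg 0) = n * d - (m + 1) := by
            simp [pushBody, exec, Instr.apply, h9, h12]
          simp only [this]
          exact ⟨by omega, trivial⟩
        · have h2 := mono hle hrep
          have : (exec pushBody s').imem (s'.ireg 0 + 1) = s'.ireg 13 := by
            simp [pushBody, exec, Instr.apply, h9]
          simp only [this]
          simpa using h2) (n * d) s3
      ⟨le_rfl, v3.1, v3.2.1, by simp [v3.2.2.1], by simp [v3.2.2.2.1], by
        simp [v3.2.2.2.2, rep_nil]⟩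
  have q5 := runs_block packBlock s4
  obtain ⟨h5, h6, h7, h8, h9, h10, hr, hrm⟩ := k4
  have v5 : (exec packBlock s4).ireg 17 = n ∧ (exec packBlock s4).ireg 18 = d ∧
      (exec packBlock s4).ireg 19 = k ∧ (exec packBlock s4).ireg 0 = s4.ireg 0 := by
    simp [packBlock, exec, Instr.apply, *]
  have w5 : rep (heap (exec packBlock s4)) ε ((exec packBlock s4).ireg 20) := by
    rw [rep_real]
    simp [packBlock, exec, Instr.apply, heap, *]
  have w6 : rep (heap (exec packBlock s4)) ((List.range (n * d)).map s.rmem).reverse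
      ((exec packBlock s4).ireg 21) := by
    have e : (exec packBlock s4).ireg 21 = s4.ireg 13 := by simp [packBlock, exec, Instr.apply, h8]
    rw [e]
    refine mono ⟨?_, ?_, ?_, ?_⟩ hrep
    · simp [packBlock, exec, Instr.apply, heap]
    · simp [packBlock, exec, Instr.apply, heap, h11]
    · simp [packBlock, exec, Instr.apply, heap]
    · intro p hp
      simp only at hp
      simp [packBlock, exec, Instr.apply, heap, h11, hrm, Function.update_of_ne hp.ne]
  set s5 := exec packBlock s4
  obtain ⟨x6, r6⟩ := consBlock_spec (c := 18) (s := s5) (by rw [v5.2.2.2]; exact h0) w5 w6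
  have q6 := runs_block (consBlock 20) s5
  set s6 := exec (consBlock 20) s5
  have p6 : 0 < s6.ireg 0 := x6.pos (by rw [v5.2.2.2]; exact h0)
  have r6' : rep (heap s6) k (s6.ireg 19) :=
    (x6.reg 19 (by omega) (by omega)).trans v5.2.2.1
  obtain ⟨x7, r7⟩ := consBlock_spec (c := 17) (s := s6) p6 r6' r6
  have q7 := runs_block (consBlock 19) s6
  set s7 := exec (consBlock 19) s6
  have r7' : rep (heap s7) d (s7.ireg 18) :=
    (x7.reg 18 (by omega) (by omega)).trans ((x6.reg 18 (by omega) (by omega)).trans v5.2.1)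
  obtain ⟨x8, r8⟩ := consBlock_spec (c := 16) (s := s7) (x7.pos p6) r7' r7
  have q8 := runs_block (consBlock 18) s7
  set s8 := exec (consBlock 18) s7
  have r8' : rep (heap s8) n (s8.ireg 17) :=
    (x8.reg 17 (by omega) (by omega)).trans ((x7.reg 17 (by omega) (by omega)).trans
      ((x6.reg 17 (by omega) (by omega)).trans v5.1))
  obtain ⟨x9, r9⟩ := consBlock_spec (c := 15) (s := s8) (x8.pos (x7.pos p6)) r8' r8
  have q9 := runs_block (consBlock 17) s8
  refine ⟨_, _, .seq q1 (.seq q2 (.seq q3 (.seq q4 (.seq q5 (.seq q6 (.seq q7 (.seq q8 q9))))))), ?_,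
    x9.pos (x8.pos (x7.pos p6)), r9⟩
  simp only [setupBlock, mulBody, midBlock, pushBody, packBlock, consBlock, List.length_cons,
    List.length_nil]
  nlinarith

/-- The target cells are those from the allocation pointer on. Therefore the writes never touch the
list that is being read. -/
theorem writeProgram_spec (s : State) (l : List ℝ) (hl : rep (heap s) l (s.ireg 17)) :
    ∃ s' t, Runs writeProgram s s' t ∧ t ≤ 100 * (l.length + 1) ∧
      ∀ i (hi : i < l.length), s'.rmem (s'.ireg 0 + i) = l[i] := by
  have q1 := runs_block writeSetup s
  have e1 : heap (exec writeSetup s) = heap s := by simp [writeSetup, exec, Instr.apply, heap]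
  have v1 : (exec writeSetup s).ireg 18 = 0 ∧ (exec writeSetup s).ireg 19 = 1 ∧
      (exec writeSetup s).ireg 20 = s.ireg 1 ∧ (exec writeSetup s).ireg 17 = s.ireg 17 := by
    simp [writeSetup, exec, Instr.apply]
  set s1 := exec writeSetup s
  obtain ⟨s2, t2, q2, rfl, -, h18, h20, -, -, -, hout⟩ := runs_loop (T := .ilt 18 17) (is := writeBody)
    (fun m s' => m ≤ l.length ∧ s'.ireg 18 = 0 ∧ s'.ireg 20 = s.ireg 1 ∧ s'.ireg 19 = 1 ∧
      s'.ireg 1 = s.ireg 1 + (l.length - m) ∧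
      rep ⟨s'.imem, s'.rmem, s.ireg 0, s.ireg 1⟩ (l.drop (l.length - m)) (s'.ireg 17) ∧
      ∀ i (hi : i < l.length), i < l.length - m → s'.rmem (s.ireg 1 + i) = l[i]) (by
        rintro s' ⟨-, h18, -, -, -, hr, -⟩
        simp only [Nat.sub_zero, List.drop_length, rep_nil] at hr
        simp [Test.Holds, h18, hr])
    (by
        rintro m s' ⟨hm, h18, h20, h19, h1, hr, hout⟩
        rw [List.drop_eq_getElem_cons (by omega), rep_cons] at hr
        obtain ⟨hr0, hr1, ⟨hr2, hr3⟩, hr4⟩ := hr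
        simp only at hr1 hr2 hr3 hr4
        have hle : (⟨s'.imem, s'.rmem, s.ireg 0, s.ireg 1⟩ : Heap).Le
            ⟨s'.imem, Function.update s'.rmem (s'.ireg 1) l[l.length - (m + 1)], s.ireg 0, s.ireg 1⟩ := by
          refine ⟨le_rfl, le_rfl, fun _ _ => rfl, fun p hp => ?_⟩
          simp only at hp ⊢
          rw [Function.update_of_ne (by omega)]
        refine ⟨by simp [Test.Holds, h18]; omega, by omega, ?_, ?_, ?_, ?_, ?_, ?_⟩
        · simp [writeBody, exec, Instr.apply, h18]
        · simp [writeBody, exec, Instr.apply, h20]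
        · simp [writeBody, exec, Instr.apply, h19]
        · simp [writeBody, exec, Instr.apply, h19, h1]
          omega
        · have := mono hle hr4
          rw [show l.length - (m + 1) + 1 = l.length - m by omega] at this
          simpa [writeBody, exec, Instr.apply, h19, hr3] using this
        · intro i hi him
          simp only [writeBody, exec, Instr.apply]
          simp [Function.update_apply, hr3, h1]
          split_ifs with h
          · congr 1; omega
          · exact hout i hi (by omega))
    l.length s1 (by
        refine ⟨le_rfl, v1.1, v1.2.2.1, v1.2.1, ?_, ?_, by simp⟩
        · have := congrArg Heap.hr e1
          simpa [heap] using this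
        · simp only [Nat.sub_self, List.drop_zero, v1.2.2.2]
          have h2 : heap s1 = ⟨s1.imem, s1.rmem, s.ireg 0, s.ireg 1⟩ := by
            rw [e1]
            have h3 := congrArg Heap.im e1
            have h4 := congrArg Heap.rm e1
            simp only [heap] at h3 h4 ⊢
            rw [h3, h4]
          rw [← h2, e1]; exact hl)
  refine ⟨_, _, .seq q1 (.seq q2 (runs_block _ _)), ?_, fun i hi => ?_⟩
  · simp only [writeSetup, writeBody, List.length_cons, List.length_nil]
    omega
  · simp [exec, Instr.apply, h18, h20]
    exact hout i hi (by omega)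

end RealRAM

/-! ### Complete programs, and the calculus of polynomial time -/

namespace RealRAM

open HeapRep

/-- From a functional program on lists to a program on the raw memory. -/
theorem Comp.exists_program {R : ℕ × (ℕ × (ℕ × (ℝ × List ℝ))) → ℕ → Prop}
    {f : ℕ × (ℕ × (ℕ × (ℝ × List ℝ))) → List ℝ} (hf : Comp R f) :
    ∃ (P : Program) (C : ℕ), ∀ (s : State) (τ : ℕ) (a : ℕ × (ℕ × (ℕ × (ℝ × List ℝ)))),
      a = (s.ireg 0, (s.ireg 1, (s.ireg 2, (s.rreg 0,
        ((List.range (s.ireg 0 * s.ireg 1)).map s.rmem).reverse)))) → R a τ →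
      ∃ s' t, Runs P s s' t ∧
        t ≤ C * (s.ireg 0 * s.ireg 1 + s.ireg 0 + τ + (f a).length + 1) ∧
        ∀ i (hi : i < (f a).length), s'.rmem (s'.ireg 0 + i) = (f a)[i] := by
  obtain ⟨C, hf⟩ := hf
  -- The argument is left in register `17` by `readProgram` and the result is expected there by
  -- `writeProgram`.
  obtain ⟨P, hf⟩ := hf 17 (by omega)
  refine ⟨.seq readProgram (.seq P writeProgram), C + 200, fun s τ a ha hR => ?_⟩
  obtain ⟨s1, t1, q1, l1, h1, r1⟩ := readProgram_spec s
  rw [← ha] at r1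
  obtain ⟨s2, t2, q2, l2, x2, r2⟩ := hf s1 a τ hR h1 r1
  obtain ⟨s3, t3, q3, l3, h3⟩ := writeProgram_spec s2 _ r2
  refine ⟨s3, _, .seq q1 (.seq q2 q3), ?_, h3⟩
  nlinarith [Nat.zero_le (C * (s.ireg 0 * s.ireg 1 + s.ireg 0 + (f a).length)), Nat.zero_le τ]

section
variable {α β γ δ : Type} [HeapRep α] [HeapRep β] [HeapRep γ] [HeapRep δ]
variable {R : α → ℕ → Prop}

/-- The parameter is carried along in the state of an ordinary loop. If the loop does not terminate,
both sides return the initial value, so the two functions agree in every case. -/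
theorem Comp.whileEnv {Rc Rf : α × β → ℕ → Prop} {c : α → β → Bool} {f : α → β → β} {i : α → β}
    (hc : Comp Rc (fun q => c q.1 q.2)) (hf : Comp Rf (fun q => f q.1 q.2)) (hi : Comp R i) (C : ℕ)
    (h : ∀ a τ, R a τ → ∃ K B, (K + 1) * (B + 1) ≤ C * (τ + 1) ∧ ∃ N ≤ K,
      c a ((f a)^[N] (i a)) = false ∧ ∀ j ≤ N, (∀ l < j, c a ((f a)^[l] (i a)) = true) →
        Rc (a, (f a)^[j] (i a)) B ∧
          (c a ((f a)^[j] (i a)) = true → Rf (a, (f a)^[j] (i a)) B)) :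
    Comp R (fun a => whileFn (c a) (f a) (i a)) := by
  have hw := hc.while (Comp.pair' (Comp.id'.fst') hf)
  have key : ∀ a (x : β) j, (fun q : α × β => (q.1, f q.1 q.2))^[j] (a, x) = (a, (f a)^[j] x) := by
    intro a x j
    induction j with
    | zero => rfl
    | succ j ih => rw [Function.iterate_succ_apply', ih, Function.iterate_succ_apply']
  refine (Comp.snd' (Comp.app hw (Comp.id'.pair' hi) C fun a τ ha => ?_)).congr fun a => ?_
  · obtain ⟨K, B, h1, N, h2, h3, h4⟩ := h a τ ha
    refine ⟨K, B, N, h1, h2, by rw [key]; exact h3, fun j hj => ?_⟩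
    simp only [key]
    exact h4 j hj
  · by_cases hex : ∃ n, c a ((f a)^[n] (i a)) = false
    · classical
      have h2 : ∀ j < Nat.find hex, c a ((f a)^[j] (i a)) = true := fun j hj => by
        simpa using Nat.find_min hex hj
      rw [whileFn_eq (Nat.find_spec hex) h2, whileFn_eq (N := Nat.find hex)]
      · rw [key]
      · rw [key]; exact Nat.find_spec hex
      · intro j hj; rw [key]; exact h2 j hj
    · rw [whileFn, whileFn, dif_neg hex, dif_neg]
      simpa only [key] using hex

theorem Comp.length {l : α → List β} (hl : Comp R l) (c : ℕ)
    (h : ∀ a τ, R a τ → (l a).length ≤ c * (τ + 1)) : Comp R (fun a => (l a).length) := by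
  refine (hl.foldl' (i := fun _ => 0) (f := fun _ acc _ => acc + 1) (Rf := O1) (Comp.natConst' 0)
    (Comp.nadd Comp.id'.snd'.fst' (Comp.natConst' 1)) c fun a τ ha => ⟨0, by simpa using h a τ ha,
      fun _ _ _ => trivial⟩).congr fun a => ?_
  have : ∀ (l : List β) i, l.foldl (fun acc _ => acc + 1) i = i + l.length := by
    intro l
    induction l with
    | nil => simp
    | cons x l ih => intro i; simp [ih]; omega
  simp [this]

/-- `τ` is at least the power of exponent `e` of a bound for the size of the argument. -/
def Pow (e : ℕ) (P : α → ℕ → Prop) : α → ℕ → Prop := fun a τ => ∃ Z, P a Z ∧ (Z + 2) ^ e ≤ τ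

/-- `f` can be computed in polynomial time, where `P a Z` says that `Z` bounds the size of `a`. -/
def PComp (P : α → ℕ → Prop) (f : α → β) : Prop := ∃ e, Comp (Pow e P) f

omit [HeapRep α] in
theorem Pow.of_le {e e' : ℕ} {P : α → ℕ → Prop} (h : e ≤ e') {a : α} {τ : ℕ} (ha : Pow e' P a τ) :
    Pow e P a τ := by
  obtain ⟨Z, h1, h2⟩ := ha
  exact ⟨Z, h1, (Nat.pow_le_pow_right (by omega) h).trans h2⟩

variable {P : α → ℕ → Prop}

theorem Comp.toP {f : α → β} (hf : Comp R f) (m : ℕ) (h : ∀ a Z τ, P a Z → (Z + 2) ^ m ≤ τ → R a τ) :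
    PComp P f :=
  ⟨m, hf.mono fun a τ ⟨Z, h1, h2⟩ => h a Z τ h1 h2⟩

theorem Comp.toP1 {f : α → β} (hf : Comp O1 f) : PComp P f := hf.toP 0 fun _ _ _ _ _ => trivial

theorem PComp.mono {P' : α → ℕ → Prop} {f : α → β} (hf : PComp P f) (h : ∀ a Z, P' a Z → P a Z) :
    PComp P' f := by
  obtain ⟨e, hf⟩ := hf
  exact ⟨e, hf.mono fun a τ ⟨Z, h1, h2⟩ => ⟨Z, h a Z h1, h2⟩⟩

theorem PComp.congr {f g : α → β} (h : PComp P f) (hfg : ∀ a, f a = g a) : PComp P g := by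
  rwa [← funext hfg]

/-- As the base is at least `2`, additive constants are absorbed by the exponent. Polynomial bounds
thus compose without coefficients. -/
theorem pow_add_two_le (Z m : ℕ) : (Z + 2) ^ m + 2 ≤ (Z + 2) ^ (m + 2) := by
  have h1 : 1 ≤ (Z + 2) ^ m := Nat.one_le_pow _ _ (by omega)
  have h2 : 2 ^ 2 ≤ (Z + 2) ^ 2 := Nat.pow_le_pow_left (by omega) 2
  rw [pow_add]
  nlinarith

theorem PComp.app {P' : β → ℕ → Prop} {g : β → γ} {f : α → β} (hg : PComp P' g) (hf : PComp P f)
    (m : ℕ) (h : ∀ a Z, P a Z → P' (f a) ((Z + 2) ^ m)) : PComp P (fun a => g (f a)) := by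
  obtain ⟨e, hg⟩ := hg
  obtain ⟨e', hf⟩ := hf
  refine ⟨max e' ((m + 2) * e), hg.appSame (hf.mono fun a τ ha => ha.of_le (le_max_left _ _)) ?_⟩
  intro a τ ha
  obtain ⟨Z, h1, h2⟩ := ha.of_le (le_max_right _ _)
  refine ⟨_, h a Z h1, le_trans ?_ h2⟩
  rw [pow_mul]
  exact Nat.pow_le_pow_left (pow_add_two_le Z m) e

theorem PComp.pair {f : α → β} {g : α → γ} (hf : PComp P f) (hg : PComp P g) :
    PComp P (fun a => (f a, g a)) := by
  obtain ⟨e, hf⟩ := hf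
  obtain ⟨e', hg⟩ := hg
  exact ⟨max e e', (hf.mono fun a τ ha => ha.of_le (le_max_left _ _)).pair'
    (hg.mono fun a τ ha => ha.of_le (le_max_right _ _))⟩

theorem PComp.app1 {g : β → γ} {f : α → β} (hg : Comp O1 g) (hf : PComp P f) :
    PComp P (fun a => g (f a)) :=
  (hg.toP1 (P := fun _ _ => True)).app hf 0 fun _ _ _ => trivial

theorem PComp.id : PComp P (fun a : α => a) := Comp.id.toP1
theorem PComp.fst {f : α → β × γ} (h : PComp P f) : PComp P (fun a => (f a).1) := h.app1 Comp.fst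
theorem PComp.snd {f : α → β × γ} (h : PComp P f) : PComp P (fun a => (f a).2) := h.app1 Comp.snd
theorem PComp.natConst (m : ℕ) : PComp P (fun _ : α => m) := (Comp.natConst m).toP1
theorem PComp.nil : PComp P (fun _ : α => ([] : List β)) := Comp.nil.toP1
theorem PComp.real0 : PComp P (fun _ : α => (0 : ℝ)) := Comp.real0.toP1
theorem PComp.real1 : PComp P (fun _ : α => (1 : ℝ)) := Comp.real1.toP1
theorem PComp.realNat (m : ℕ) [m.AtLeastTwo] : PComp P (fun _ : α => (OfNat.ofNat m : ℝ)) :=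
  (Comp.realNat m).toP1
theorem PComp.cons {f : α → β} {g : α → List β} (hf : PComp P f) (hg : PComp P g) :
    PComp P (fun a => f a :: g a) := (hf.pair hg).app1 Comp.consPair
theorem PComp.nadd {f g : α → ℕ} (hf : PComp P f) (hg : PComp P g) : PComp P (fun a => f a + g a) :=
  (hf.pair hg).app1 Comp.natAddPair
theorem PComp.radd {f g : α → ℝ} (hf : PComp P f) (hg : PComp P g) : PComp P (fun a => f a + g a) :=
  (hf.pair hg).app1 (Comp.radd Comp.id'.fst' Comp.id'.snd')
theorem PComp.rsub {f g : α → ℝ} (hf : PComp P f) (hg : PComp P g) : PComp P (fun a => f a - g a) :=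
  (hf.pair hg).app1 (Comp.rsub Comp.id'.fst' Comp.id'.snd')
theorem PComp.rmul {f g : α → ℝ} (hf : PComp P f) (hg : PComp P g) : PComp P (fun a => f a * g a) :=
  (hf.pair hg).app1 (Comp.rmul Comp.id'.fst' Comp.id'.snd')
theorem PComp.rdiv {f g : α → ℝ} (hf : PComp P f) (hg : PComp P g) : PComp P (fun a => f a / g a) :=
  (hf.pair hg).app1 (Comp.rdiv Comp.id'.fst' Comp.id'.snd')
theorem PComp.nlt {f g : α → ℕ} (hf : PComp P f) (hg : PComp P g) :
    PComp P (fun a => decide (f a < g a)) :=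
  (hf.pair hg).app1 (g := fun q : ℕ × ℕ => decide (q.1 < q.2)) Comp.natLtPair
theorem PComp.rlt {f g : α → ℝ} (hf : PComp P f) (hg : PComp P g) :
    PComp P (fun a => decide (f a < g a)) :=
  (hf.pair hg).app1 (g := fun q : ℝ × ℝ => decide (q.1 < q.2)) Comp.realLtPair
theorem PComp.isEmpty {f : α → List β} (hf : PComp P f) : PComp P (fun a => (f a).isEmpty) :=
  hf.app1 (g := fun l : List β => l.isEmpty) Comp.id'.isEmpty
theorem PComp.tail {f : α → List β} (hf : PComp P f) : PComp P (fun a => (f a).tail) :=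
  hf.app1 (g := fun l : List β => l.tail) Comp.id'.tail
theorem PComp.headD {f : α → List β} {d : α → β} (hf : PComp P f) (hd : PComp P d) :
    PComp P (fun a => (f a).headD (d a)) :=
  (hf.pair hd).app1 (g := fun q : List β × β => q.1.headD q.2) (Comp.id'.fst'.headD Comp.id'.snd')

theorem PComp.cond {c : α → Bool} {f g : α → β} (hc : PComp P c)
    (hf : PComp (fun a Z => P a Z ∧ c a = true) f) (hg : PComp (fun a Z => P a Z ∧ c a = false) g) :
    PComp P (fun a => if c a then f a else g a) := by
  obtain ⟨e, hc⟩ := hc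
  obtain ⟨e', hf⟩ := hf
  obtain ⟨e'', hg⟩ := hg
  refine ⟨max e (max e' e''), Comp.cond (hc.mono fun a τ ha => ha.of_le (by simp))
    (hf.mono fun a τ ha => ?_) (hg.mono fun a τ ha => ?_)⟩
  · obtain ⟨Z, h1, h2⟩ := ha.1.of_le (e := e') (by simp)
    exact ⟨Z, ⟨h1, ha.2⟩, h2⟩
  · obtain ⟨Z, h1, h2⟩ := ha.1.of_le (e := e'') (by simp)
    exact ⟨Z, ⟨h1, ha.2⟩, h2⟩

theorem PComp.ite {c : α → Bool} {f g : α → β} (hc : PComp P c) (hf : PComp P f) (hg : PComp P g) :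
    PComp P (fun a => if c a then f a else g a) :=
  hc.cond (hf.mono fun _ _ h => h.1) (hg.mono fun _ _ h => h.1)

theorem PComp.not {c : α → Bool} (hc : PComp P c) : PComp P (fun a => !c a) :=
  hc.app1 (g := fun b : Bool => !b) Comp.id'.not
theorem PComp.and {c c' : α → Bool} (hc : PComp P c) (hc' : PComp P c') :
    PComp P (fun a => c a && c' a) :=
  (hc.pair hc').app1 (g := fun q : Bool × Bool => q.1 && q.2) (Comp.id'.fst'.and Comp.id'.snd')
theorem PComp.or {c c' : α → Bool} (hc : PComp P c) (hc' : PComp P c') :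
    PComp P (fun a => c a || c' a) :=
  (hc.pair hc').app1 (g := fun q : Bool × Bool => q.1 || q.2) (Comp.id'.fst'.or Comp.id'.snd')
theorem PComp.beq {c c' : α → Bool} (hc : PComp P c) (hc' : PComp P c') :
    PComp P (fun a => c a == c' a) :=
  (hc.pair hc').app1 (g := fun q : Bool × Bool => q.1 == q.2) (Comp.id'.fst'.beq Comp.id'.snd')

/-- The common accounting for loops: polynomially many rounds, each polynomial in a size that is
itself polynomial in `Z`. -/
theorem pow_budget (Z m e τ : ℕ) (h : (Z + 2) ^ (m + 2 + (m + 2) * e) ≤ τ) {K : ℕ}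
    (hK : K ≤ (Z + 2) ^ m) : (K + 1) * (((Z + 2) ^ m + 2) ^ e + 1) ≤ 2 * (τ + 1) := by
  have h1 := pow_add_two_le Z m
  have h2 : ((Z + 2) ^ m + 2) ^ e ≤ (Z + 2) ^ ((m + 2) * e) := by
    rw [pow_mul]; exact Nat.pow_le_pow_left h1 e
  have h3 : 1 ≤ (Z + 2) ^ ((m + 2) * e) := Nat.one_le_pow _ _ (by omega)
  rw [pow_add] at h
  calc (K + 1) * (((Z + 2) ^ m + 2) ^ e + 1)
      ≤ (Z + 2) ^ (m + 2) * ((Z + 2) ^ ((m + 2) * e) + (Z + 2) ^ ((m + 2) * e)) := by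
        gcongr; omega
    _ ≤ 2 * (τ + 1) := by linarith

theorem PComp.foldl {Pf : α × (β × γ) → ℕ → Prop} {l : α → List γ} {i : α → β} {f : α → β → γ → β}
    (hl : PComp P l) (hi : PComp P i) (hf : PComp Pf (fun q => f q.1 q.2.1 q.2.2)) (m : ℕ)
    (h : ∀ a Z, P a Z → (l a).length ≤ (Z + 2) ^ m ∧
      ∀ pre x suf, l a = pre ++ x :: suf → Pf (a, (pre.foldl (f a) (i a), x)) ((Z + 2) ^ m)) :
    PComp P (fun a => (l a).foldl (f a) (i a)) := by
  obtain ⟨e, hl⟩ := hl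
  obtain ⟨e', hi⟩ := hi
  obtain ⟨e'', hf⟩ := hf
  refine ⟨max (max e e') (m + 2 + (m + 2) * e''), Comp.foldl (hl.mono fun a τ ha => ha.of_le (by simp))
    (hi.mono fun a τ ha => ha.of_le (by simp)) hf 2 fun a τ ha => ?_⟩
  obtain ⟨Z, h1, h2⟩ := ha.of_le (le_max_right _ _)
  obtain ⟨h3, h4⟩ := h a Z h1
  refine ⟨((Z + 2) ^ m + 2) ^ e'', ?_, fun pre x suf he => ⟨_, h4 pre x suf he, le_rfl⟩⟩
  have := pow_budget Z m e'' τ h2 h3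
  nlinarith

theorem PComp.foldr {Pf : α × (β × γ) → ℕ → Prop} {l : α → List β} {i : α → γ} {f : α → β → γ → γ}
    (hl : PComp P l) (hi : PComp P i) (hf : PComp Pf (fun q => f q.1 q.2.1 q.2.2)) (m : ℕ)
    (h : ∀ a Z, P a Z → (l a).length ≤ (Z + 2) ^ m ∧
      ∀ pre x suf, l a = pre ++ x :: suf → Pf (a, (x, suf.foldr (f a) (i a))) ((Z + 2) ^ m)) :
    PComp P (fun a => (l a).foldr (f a) (i a)) := by
  obtain ⟨e, hl⟩ := hl
  obtain ⟨e', hi⟩ := hi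
  obtain ⟨e'', hf⟩ := hf
  refine ⟨max (max e e') (m + 2 + (m + 2) * e''), Comp.foldr' (hl.mono fun a τ ha => ha.of_le (by simp))
    (hi.mono fun a τ ha => ha.of_le (by simp)) hf 2 fun a τ ha => ?_⟩
  obtain ⟨Z, h1, h2⟩ := ha.of_le (le_max_right _ _)
  obtain ⟨h3, h4⟩ := h a Z h1
  refine ⟨((Z + 2) ^ m + 2) ^ e'', ?_, fun pre x suf he => ⟨_, h4 pre x suf he, le_rfl⟩⟩
  have := pow_budget Z m e'' τ h2 h3
  nlinarith

theorem PComp.whileFn {Pc Pf : α × β → ℕ → Prop} {c : α → β → Bool} {f : α → β → β} {i : α → β}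
    (hc : PComp Pc (fun q => c q.1 q.2)) (hf : PComp Pf (fun q => f q.1 q.2)) (hi : PComp P i) (m : ℕ)
    (h : ∀ a Z, P a Z → ∃ N ≤ (Z + 2) ^ m, c a ((f a)^[N] (i a)) = false ∧
      ∀ j ≤ N, (∀ l < j, c a ((f a)^[l] (i a)) = true) → Pc (a, (f a)^[j] (i a)) ((Z + 2) ^ m) ∧
        (c a ((f a)^[j] (i a)) = true → Pf (a, (f a)^[j] (i a)) ((Z + 2) ^ m))) :
    PComp P (fun a => whileFn (c a) (f a) (i a)) := by
  obtain ⟨e, hc⟩ := hc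
  obtain ⟨e', hi⟩ := hi
  obtain ⟨e'', hf⟩ := hf
  have hc' : Comp (Pow (max e e'') Pc) (fun q => c q.1 q.2) :=
    hc.mono fun a τ ha => ha.of_le (le_max_left e e'')
  have hf' : Comp (Pow (max e e'') Pf) (fun q => f q.1 q.2) :=
    hf.mono fun a τ ha => ha.of_le (le_max_right e e'')
  refine ⟨max e' (m + 2 + (m + 2) * (max e e'')), Comp.whileEnv hc' hf' (hi.mono fun a τ ha => ha.of_le (by simp)) 2 fun a τ ha => ?_⟩
  obtain ⟨Z, h1, h2⟩ := ha.of_le (le_max_right _ _)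
  obtain ⟨N, hN, h3, h4⟩ := h a Z h1
  refine ⟨_, ((Z + 2) ^ m + 2) ^ (max e e''), pow_budget Z m _ τ h2 le_rfl, N, hN, h3,
    fun j hj hl => ?_⟩
  obtain ⟨h5, h6⟩ := h4 j hj hl
  exact ⟨⟨_, h5, le_rfl⟩, fun hcj => ⟨_, h6 hcj, le_rfl⟩⟩

theorem PComp.map {Pf : α × β → ℕ → Prop} {l : α → List β} {f : α → β → γ}
    (hl : PComp P l) (hf : PComp Pf (fun q => f q.1 q.2)) (m : ℕ)
    (h : ∀ a Z, P a Z → (l a).length ≤ (Z + 2) ^ m ∧ ∀ x ∈ l a, Pf (a, x) ((Z + 2) ^ m)) :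
    PComp P (fun a => (l a).map (f a)) := by
  obtain ⟨e, hl⟩ := hl
  obtain ⟨e', hf⟩ := hf
  refine ⟨max e (m + 2 + (m + 2) * e'), Comp.map (hl.mono fun a τ ha => ha.of_le (by simp)) hf 2
    fun a τ ha => ?_⟩
  obtain ⟨Z, h1, h2⟩ := ha.of_le (le_max_right _ _)
  obtain ⟨h3, h4⟩ := h a Z h1
  refine ⟨((Z + 2) ^ m + 2) ^ e', ?_, fun x hx => ⟨_, h4 x hx, le_rfl⟩⟩
  have := pow_budget Z m e' τ h2 h3
  nlinarith

theorem PComp.filter {Pf : α × β → ℕ → Prop} {l : α → List β} {f : α → β → Bool}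
    (hl : PComp P l) (hf : PComp Pf (fun q => f q.1 q.2)) (m : ℕ)
    (h : ∀ a Z, P a Z → (l a).length ≤ (Z + 2) ^ m ∧ ∀ x ∈ l a, Pf (a, x) ((Z + 2) ^ m)) :
    PComp P (fun a => (l a).filter (f a)) := by
  obtain ⟨e, hl⟩ := hl
  obtain ⟨e', hf⟩ := hf
  refine ⟨max e (m + 2 + (m + 2) * e'), Comp.filter (hl.mono fun a τ ha => ha.of_le (by simp)) hf 2
    fun a τ ha => ?_⟩
  obtain ⟨Z, h1, h2⟩ := ha.of_le (le_max_right _ _)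
  obtain ⟨h3, h4⟩ := h a Z h1
  refine ⟨((Z + 2) ^ m + 2) ^ e', ?_, fun x hx => ⟨_, h4 x hx, le_rfl⟩⟩
  have := pow_budget Z m e' τ h2 h3
  nlinarith

theorem PComp.any {Pf : α × β → ℕ → Prop} {l : α → List β} {f : α → β → Bool}
    (hl : PComp P l) (hf : PComp Pf (fun q => f q.1 q.2)) (m : ℕ)
    (h : ∀ a Z, P a Z → (l a).length ≤ (Z + 2) ^ m ∧ ∀ x ∈ l a, Pf (a, x) ((Z + 2) ^ m)) :
    PComp P (fun a => (l a).any (f a)) :=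
  (PComp.isEmpty (hl.filter hf m h)).not.congr fun a => by
    induction l a with
    | nil => rfl
    | cons x l ih => cases hx : f a x <;> simp_all

theorem PComp.all {Pf : α × β → ℕ → Prop} {l : α → List β} {f : α → β → Bool}
    (hl : PComp P l) (hf : PComp Pf (fun q => f q.1 q.2)) (m : ℕ)
    (h : ∀ a Z, P a Z → (l a).length ≤ (Z + 2) ^ m ∧ ∀ x ∈ l a, Pf (a, x) ((Z + 2) ^ m)) :
    PComp P (fun a => (l a).all (f a)) :=
  (hl.any (f := fun a x => !f a x) hf.not m h).not.congr fun a => by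
    induction l a with
    | nil => rfl
    | cons x l ih => simp_all

theorem PComp.flatMap {Pf : α × β → ℕ → Prop} {l : α → List β} {f : α → β → List γ}
    (hl : PComp P l) (hf : PComp Pf (fun q => f q.1 q.2)) (m : ℕ)
    (h : ∀ a Z, P a Z → (l a).length ≤ (Z + 2) ^ m ∧
      ∀ x ∈ l a, Pf (a, x) ((Z + 2) ^ m) ∧ (f a x).length ≤ (Z + 2) ^ m) :
    PComp P (fun a => (l a).flatMap (f a)) := by
  obtain ⟨e, hl⟩ := hl
  obtain ⟨e', hf⟩ := hf
  refine ⟨max e (m + 2 + (m + 2) * (e' + 1)), Comp.flatMap (hl.mono fun a τ ha => ha.of_le (by simp))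
    hf 2 fun a τ ha => ?_⟩
  obtain ⟨Z, h1, h2⟩ := ha.of_le (le_max_right _ _)
  obtain ⟨h3, h4⟩ := h a Z h1
  refine ⟨((Z + 2) ^ m + 2) ^ (e' + 1), ?_, fun x hx => ⟨⟨_, (h4 x hx).1, ?_⟩, ?_⟩⟩
  · have := pow_budget Z m (e' + 1) τ h2 h3
    nlinarith
  · exact Nat.pow_le_pow_right (by omega) (by omega)
  · refine (h4 x hx).2.trans ?_
    rw [pow_succ]
    nlinarith [Nat.one_le_pow e' ((Z + 2) ^ m + 2) (by omega)]

/-- Transfers operations whose time is governed by a single number `s a`, such as a length or a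
counter. -/
theorem PComp.ofComp {l : α → β} {g : α → γ} (hl : PComp P l) (m : ℕ) (s : α → ℕ)
    (h : ∀ a Z, P a Z → s a ≤ (Z + 2) ^ m)
    (hg : ∀ R : α → ℕ → Prop, Comp R l → (∀ a τ, R a τ → s a ≤ 1 * (τ + 1)) → Comp R g) : PComp P g := by
  obtain ⟨e, hl⟩ := hl
  refine ⟨max e m, hg _ (hl.mono fun a τ ha => ha.of_le (by simp)) fun a τ ha => ?_⟩
  obtain ⟨Z, h1, h2⟩ := ha.of_le (le_max_right _ _)
  have := h a Z h1
  omega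

theorem PComp.append {l l' : α → List β} (hl : PComp P l) (hl' : PComp P l') (m : ℕ)
    (h : ∀ a Z, P a Z → (l a).length ≤ (Z + 2) ^ m) : PComp P (fun a => l a ++ l' a) :=
  (hl.pair hl').ofComp m _ h fun _ hc h => hc.fst'.append hc.snd' 1 h

theorem PComp.zip {l : α → List β} {l' : α → List γ} (hl : PComp P l) (hl' : PComp P l') (m : ℕ)
    (h : ∀ a Z, P a Z → (l a).length ≤ (Z + 2) ^ m) : PComp P (fun a => (l a).zip (l' a)) :=
  (hl.pair hl').ofComp m _ h fun _ hc h => hc.fst'.zip hc.snd' 1 h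

theorem PComp.length {l : α → List β} (hl : PComp P l) (m : ℕ)
    (h : ∀ a Z, P a Z → (l a).length ≤ (Z + 2) ^ m) : PComp P (fun a => (l a).length) :=
  hl.ofComp m _ h fun _ hc h => hc.length 1 h

theorem PComp.range {n : α → ℕ} (hn : PComp P n) (m : ℕ) (h : ∀ a Z, P a Z → n a ≤ (Z + 2) ^ m) :
    PComp P (fun a => List.range (n a)) :=
  hn.ofComp m _ h fun _ hc h => hc.range 1 h

theorem PComp.cast {n : α → ℕ} (hn : PComp P n) (m : ℕ) (h : ∀ a Z, P a Z → n a ≤ (Z + 2) ^ m) :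
    PComp P (fun a => (n a : ℝ)) :=
  hn.ofComp m _ h fun _ hc h => hc.cast 1 h

theorem PComp.nmul {n n' : α → ℕ} (hn : PComp P n) (hn' : PComp P n') (m : ℕ)
    (h : ∀ a Z, P a Z → n' a ≤ (Z + 2) ^ m) : PComp P (fun a => n a * n' a) :=
  (hn.pair hn').ofComp m _ h fun _ hc h => hc.fst'.nmul hc.snd' 1 h

theorem PComp.rpow {x : α → ℝ} {n : α → ℕ} (hx : PComp P x) (hn : PComp P n) (m : ℕ)
    (h : ∀ a Z, P a Z → n a ≤ (Z + 2) ^ m) : PComp P (fun a => x a ^ n a) :=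
  (hx.pair hn).ofComp m _ h fun _ hc h => hc.fst'.rpow hc.snd' 1 h

theorem PComp.natCeil {x : α → ℝ} (hx : PComp P x) (m : ℕ)
    (h : ∀ a Z, P a Z → ⌈x a⌉₊ ≤ (Z + 2) ^ m) : PComp P (fun a => ⌈x a⌉₊) :=
  hx.ofComp m _ h fun _ hc h => hc.natCeil 1 h

end
end RealRAM

/-! ### Gonzalez' algorithm and its running time -/

namespace KCenter

open RealRAM

/-- Points are lists of coordinates. -/
abbrev Pt := List ℝ

/-- The squared Euclidean distance. -/
noncomputable def dist2 (x y : Pt) : ℝ :=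
  (x.zip y).foldl (fun acc q => acc + (q.1 - q.2) * (q.1 - q.2)) 0

/-- A point with the largest first entry. -/
noncomputable def far (cl : List (ℝ × Pt)) : ℝ × Pt :=
  -- Ties go to the later entry. So the default is replaced as soon as there is an entry with a
  -- nonnegative key, even if all keys are zero.
  cl.foldl (fun b c => if decide (c.1 < b.1) then b else c) (0, [])

/-- Adds the center `q` in Gonzalez' algorithm; the state consists of the centers and of the clients,
each with its squared distance to the nearest center. -/
noncomputable def gAdd (q : Pt) (st : List Pt × List (ℝ × Pt)) : List Pt × List (ℝ × Pt) :=
  (q :: st.1, st.2.map fun c => (if decide (dist2 c.2 q < c.1) then dist2 c.2 q else c.1, c.2))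

noncomputable def gStep (st : List Pt × List (ℝ × Pt)) : List Pt × List (ℝ × Pt) :=
  gAdd (far st.2).2 st

noncomputable def gInit (cs : List Pt) : List Pt × List (ℝ × Pt) :=
  ([cs.headD []], cs.map fun q => (dist2 q (cs.headD []), q))

/-- Gonzalez' algorithm for `k` centers. -/
noncomputable def gCenters (k : ℕ) (cs : List Pt) : List Pt × List (ℝ × Pt) := gStep^[k - 1] (gInit cs)

/-- Gonzalez' algorithm, continued until `64` times the squared radius is at most `θ`. -/
noncomputable def gNet (θ : ℝ) (st : List Pt × List (ℝ × Pt)) : List Pt × List (ℝ × Pt) :=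
  whileFn (fun st => decide (θ < 64 * (far st.2).1)) gStep st

theorem comp_dist2 : Comp (fun q τ => q.1.length ≤ τ) (fun q : Pt × Pt => dist2 q.1 q.2) := by
  refine Comp.foldl' (Rf := O1) (f := fun _ (acc : ℝ) (q : ℝ × ℝ) => acc + (q.1 - q.2) * (q.1 - q.2))
    (Comp.zip Comp.id'.fst' Comp.id'.snd' 1 fun a τ h => by omega) Comp.real0 ?_ 1
    fun a τ h => ⟨0, ?_, fun _ _ _ => trivial⟩
  · exact Comp.radd Comp.id'.snd'.fst' (Comp.rmul
      (Comp.rsub Comp.id'.snd'.snd'.fst' Comp.id'.snd'.snd'.snd')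
      (Comp.rsub Comp.id'.snd'.snd'.fst' Comp.id'.snd'.snd'.snd'))
  · simp only [List.length_zip]
    omega

theorem comp_far : Comp (fun q τ => q.length ≤ τ) far := by
  refine Comp.foldl' (Rf := O1) (i := fun _ => ((0 : ℝ), ([] : Pt)))
    (f := fun _ (b c : ℝ × Pt) => if decide (c.1 < b.1) then b else c)
    Comp.id' (Comp.real0.pair' Comp.nil') ?_ 1 fun a τ h => ⟨0, by omega, fun _ _ _ => trivial⟩
  exact Comp.ite' (Comp.rlt Comp.id'.snd'.snd'.fst' Comp.id'.snd'.fst'.fst') Comp.id'.snd'.fst'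
    Comp.id'.snd'.snd'

/-- The requirement for one scan over the clients. -/
def ScanTime (cl : List Pt) (τ : ℕ) : Prop := ∃ d, (∀ c ∈ cl, c.length ≤ d) ∧ cl.length * (d + 2) ≤ τ

theorem comp_gAdd : Comp (fun q τ => ScanTime (q.2.2.map Prod.snd) τ)
    (fun q : Pt × (List Pt × List (ℝ × Pt)) => gAdd q.1 q.2) := by
  refine Comp.pair' (Comp.cons Comp.id'.fst' Comp.id'.snd'.fst') ?_
  have hd : Comp (fun q τ => q.2.2.length ≤ τ)
      (fun q : (Pt × (List Pt × List (ℝ × Pt))) × (ℝ × Pt) => dist2 q.2.2 q.1.1) :=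
    Comp.app2 comp_dist2 Comp.id'.snd'.snd' Comp.id'.fst'.fst' 1 fun a τ h => by dsimp only; omega
  refine Comp.map (f := fun (q : Pt × (List Pt × List (ℝ × Pt))) (c : ℝ × Pt) =>
    (if decide (dist2 c.2 q.1 < c.1) then dist2 c.2 q.1 else c.1, c.2)) Comp.id'.snd'.snd'
    (Rf := fun q τ => q.2.2.length ≤ τ)
    (Comp.pair' (Comp.ite' (Comp.rlt hd Comp.id'.snd'.fst') hd Comp.id'.snd'.fst') Comp.id'.snd'.snd')
    1 fun a τ h => ?_
  obtain ⟨d, h1, h2⟩ := h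
  simp only [List.mem_map, forall_exists_index, and_imp, forall_apply_eq_imp_iff₂,
    List.length_map] at h1 h2
  exact ⟨d, by nlinarith, h1⟩

theorem comp_gStep : Comp (fun q τ => ScanTime (q.2.map Prod.snd) τ) gStep := by
  refine Comp.app2 comp_gAdd (Comp.snd' (Comp.app comp_far Comp.id'.snd' 1 fun a τ h => ?_)) Comp.id' 1
    fun a τ h => ?_
  · obtain ⟨d, h1, h2⟩ := h
    rw [List.length_map] at h2
    nlinarith
  · obtain ⟨d, h1, h2⟩ := h
    exact ⟨d, h1, by dsimp only; omega⟩

theorem comp_gInit : Comp ScanTime gInit := by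
  refine Comp.pair' (Comp.cons (Comp.headD Comp.id' Comp.nil') Comp.nil') ?_
  have hd : Comp (fun q τ => q.2.length ≤ τ) (fun q : List Pt × Pt => dist2 q.2 (q.1.headD [])) :=
    Comp.app2 comp_dist2 Comp.id'.snd' (Comp.headD Comp.id'.fst' Comp.nil') 1
      fun a τ h => by dsimp only; omega
  refine Comp.map (f := fun (cs : List Pt) (q : Pt) => (dist2 q (cs.headD []), q)) Comp.id'
    (Rf := fun q τ => q.2.length ≤ τ) (hd.pair' Comp.id'.snd') 1 fun a τ h => ?_
  obtain ⟨d, h1, h2⟩ := h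
  exact ⟨d, by nlinarith, h1⟩

theorem gStep_clients (st : List Pt × List (ℝ × Pt)) : (gStep st).2.map Prod.snd = st.2.map Prod.snd := by
  simp [gStep, gAdd, Function.comp_def]

theorem gStep_iterate_clients (n : ℕ) (st : List Pt × List (ℝ × Pt)) :
    (gStep^[n] st).2.map Prod.snd = st.2.map Prod.snd := by
  induction n with
  | zero => rfl
  | succ n ih => rw [Function.iterate_succ_apply', gStep_clients, ih]

theorem gInit_clients (cs : List Pt) : (gInit cs).2.map Prod.snd = cs := by
  simp [gInit, Function.comp_def]

theorem comp_gCenters : Comp (fun q τ => ∃ B, ScanTime q.2 B ∧ (q.1 + 1) * (B + 1) ≤ τ)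
    (fun q : ℕ × List Pt => gCenters q.1 q.2) := by
  refine Comp.iterate (f := fun _ st => gStep st) (Comp.nsub Comp.id'.fst' (Comp.natConst' 1))
    (Comp.app comp_gInit Comp.id'.snd' 1 fun a τ h => ?_)
    (Rf := fun q τ => ScanTime (q.2.2.map Prod.snd) τ)
    (Comp.appSame comp_gStep Comp.id'.snd' fun a τ h => h) 1 fun a τ h => ?_
  · obtain ⟨B, ⟨d, h1, h2⟩, h3⟩ := h
    exact ⟨d, h1, by nlinarith⟩
  · obtain ⟨B, h1, h3⟩ := h
    refine ⟨B, ?_, fun j _ => by rw [gStep_iterate_clients, gInit_clients]; exact h1⟩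
    have : (a.1 - 1) * (B + 1) ≤ (a.1 + 1) * (B + 1) := by gcongr; omega
    omega

theorem comp_gNet : Comp (fun q τ => ∃ B N, ScanTime (q.2.2.map Prod.snd) B ∧ (N + 1) * (B + 1) ≤ τ ∧
      ¬ q.1 < 64 * (far (gStep^[N] q.2).2).1)
    (fun q : ℝ × (List Pt × List (ℝ × Pt)) => gNet q.1 q.2) := by
  refine Comp.whileEnv (β := List Pt × List (ℝ × Pt))
    (c := fun (q : ℝ × (List Pt × List (ℝ × Pt))) st => decide (q.1 < 64 * (far st.2).1))
    (f := fun _ st => gStep st) (i := fun q => q.2)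
    (Rc := fun q τ => ScanTime (q.2.2.map Prod.snd) τ)
    (Rf := fun q τ => ScanTime (q.2.2.map Prod.snd) τ)
    (Comp.rlt Comp.id'.fst'.fst' (Comp.rmul (Comp.realNat 64)
      (Comp.fst' (Comp.app comp_far Comp.id'.snd'.snd' 1 fun a τ h => ?_))))
    (Comp.appSame comp_gStep Comp.id'.snd' fun a τ h => h) Comp.id'.snd' 1 fun a τ h => ?_
  · obtain ⟨d, h1, h2⟩ := h
    rw [List.length_map] at h2
    nlinarith
  · obtain ⟨B, N, h1, h2, h3⟩ := h
    refine ⟨N, B, by omega, N, le_rfl, by simpa using h3, fun j _ _ => ?_⟩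
    simp only [gStep_iterate_clients]
    exact ⟨h1, fun _ => h1⟩

end KCenter

/-! ### The dynamic program for covering the net -/

namespace KCenter

open RealRAM

/-- Whether the squared distance of `s` and `x` is at most `ρ`. -/
noncomputable def near (ρ : ℝ) (s x : Pt) : Bool := !decide (ρ < dist2 s x)

/-- Whether the centers `c` cover `s`. -/
noncomputable def cov (ρ : ℝ) (c : List Pt) (s : Pt) : Bool := c.any fun x => near ρ s x

/-- Whether two lists of centers have the same length and cover the same points of `S`. -/
noncomputable def same (ρ : ℝ) (S : List Pt) (c c' : List Pt) : Bool :=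
  (!decide (c.length < c'.length) && !decide (c'.length < c.length)) &&
    S.all fun s => cov ρ c s == cov ρ c' s

/-- Whether `c` has at most `k` centers and each point of `S` is covered or near some of `rest`. -/
noncomputable def valid (k : ℕ) (ρ : ℝ) (S rest c : List Pt) : Bool :=
  !decide (k < c.length) && S.all fun s => cov ρ c s || rest.any fun x => near ρ s x

/-- Removes duplicates with respect to `same`. -/
noncomputable def prune (ρ : ℝ) (S : List Pt) (L : List (List Pt)) : List (List Pt) :=
  L.foldl (fun acc c => if acc.any fun c' => same ρ S c c' then acc else c :: acc) []

/-- One step of the dynamic program: `x` is chosen or not. -/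
noncomputable def dpStep (k : ℕ) (ρ : ℝ) (S : List Pt) (x : Pt) (rest : List Pt)
    (L : List (List Pt)) : List (List Pt) :=
  prune ρ S ((L.flatMap fun c => [c, x :: c]).filter fun c => valid k ρ S rest c)

/-- The dynamic program over the prefix `Y` of the candidate list `X`. -/
noncomputable def dpRun (k : ℕ) (ρ : ℝ) (S X Y : List Pt) : List Pt × List (List Pt) :=
  Y.foldl (fun st x => (st.1.tail, dpStep k ρ S x st.1.tail st.2)) (X, [[]])

noncomputable def dp (k : ℕ) (ρ : ℝ) (S X : List Pt) : List (List Pt) := (dpRun k ρ S X X).2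

/-- The smallest radius in the geometric progression with ratio `t` for which the dynamic program
succeeds. -/
noncomputable def radius (k : ℕ) (S X : List Pt) (t ρ : ℝ) : ℝ :=
  whileFn (fun ρ => (dp k ρ S X).isEmpty) (fun ρ => ρ * t) ρ

theorem pcomp_dist2 : PComp (fun q Z => q.1.length ≤ Z) (fun q : Pt × Pt => dist2 q.1 q.2) :=
  comp_dist2.toP 1 fun a Z τ h h' => by rw [pow_one] at h'; omega

theorem pcomp_near :
    PComp (fun q Z => q.2.1.length ≤ Z) (fun q : ℝ × (Pt × Pt) => near q.1 q.2.1 q.2.2) :=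
  (PComp.id.fst.rlt (pcomp_dist2.app PComp.id.snd 1 fun a Z h => by rw [pow_one]; omega)).not

theorem pcomp_cov : PComp (fun q Z => q.2.1.length ≤ Z ∧ q.2.2.length ≤ Z)
    (fun q : ℝ × (List Pt × Pt) => cov q.1 q.2.1 q.2.2) := by
  refine PComp.any (f := fun (q : ℝ × (List Pt × Pt)) (x : Pt) => near q.1 q.2.2 x)
    (Pf := fun q Z => q.1.2.2.length ≤ Z) PComp.id.snd.fst ?_ 1
    fun a Z h => ⟨by rw [pow_one]; omega, fun _ _ => by dsimp only; rw [pow_one]; omega⟩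
  exact pcomp_near.app (PComp.id.fst.fst.pair (PComp.id.fst.snd.snd.pair PComp.id.snd)) 1
    fun a Z h => by dsimp only; rw [pow_one]; omega

theorem pcomp_same : PComp (fun q Z => q.2.1.length ≤ Z ∧ (∀ s ∈ q.2.1, s.length ≤ Z) ∧
      q.2.2.1.length ≤ Z ∧ q.2.2.2.length ≤ Z)
    (fun q : ℝ × (List Pt × (List Pt × List Pt)) => same q.1 q.2.1 q.2.2.1 q.2.2.2) := by
  have l1 : PComp (fun q Z => q.2.1.length ≤ Z ∧ (∀ s ∈ q.2.1, s.length ≤ Z) ∧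
      q.2.2.1.length ≤ Z ∧ q.2.2.2.length ≤ Z)
      (fun q : ℝ × (List Pt × (List Pt × List Pt)) => q.2.2.1.length) :=
    PComp.length PComp.id.snd.snd.fst 1 fun a Z h => by rw [pow_one]; omega
  have l2 : PComp (fun q Z => q.2.1.length ≤ Z ∧ (∀ s ∈ q.2.1, s.length ≤ Z) ∧
      q.2.2.1.length ≤ Z ∧ q.2.2.2.length ≤ Z)
      (fun q : ℝ × (List Pt × (List Pt × List Pt)) => q.2.2.2.length) :=
    PComp.length PComp.id.snd.snd.snd 1 fun a Z h => by rw [pow_one]; omega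
  refine ((l1.nlt l2).not.and (l2.nlt l1).not).and (PComp.all
    (f := fun (q : ℝ × (List Pt × (List Pt × List Pt))) s => cov q.1 q.2.2.1 s == cov q.1 q.2.2.2 s)
    (Pf := fun q Z => q.1.2.2.1.length ≤ Z ∧ q.1.2.2.2.length ≤ Z ∧ q.2.length ≤ Z)
    PComp.id.snd.fst (PComp.beq ?_ ?_) 1 fun a Z h => ⟨by rw [pow_one]; omega, fun s hs => ?_⟩)
  · exact pcomp_cov.app (PComp.id.fst.fst.pair (PComp.id.fst.snd.snd.fst.pair PComp.id.snd)) 1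
      fun a Z h => by dsimp only; rw [pow_one]; omega
  · exact pcomp_cov.app (PComp.id.fst.fst.pair (PComp.id.fst.snd.snd.snd.pair PComp.id.snd)) 1
      fun a Z h => by dsimp only; rw [pow_one]; omega
  · have := h.2.1 s hs
    dsimp only; rw [pow_one]; omega

theorem pcomp_valid : PComp (fun q Z => q.2.2.1.length ≤ Z ∧ (∀ s ∈ q.2.2.1, s.length ≤ Z) ∧
      q.2.2.2.1.length ≤ Z ∧ q.2.2.2.2.length ≤ Z)
    (fun q : ℕ × (ℝ × (List Pt × (List Pt × List Pt))) =>
      valid q.1 q.2.1 q.2.2.1 q.2.2.2.1 q.2.2.2.2) := by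
  refine (PComp.nlt PComp.id.fst (PComp.length PComp.id.snd.snd.snd.snd 1
    fun a Z h => by rw [pow_one]; omega)).not.and (PComp.all
    (f := fun (q : ℕ × (ℝ × (List Pt × (List Pt × List Pt)))) s =>
      cov q.2.1 q.2.2.2.2 s || q.2.2.2.1.any fun x => near q.2.1 s x)
    (Pf := fun q Z => q.1.2.2.2.1.length ≤ Z ∧ q.1.2.2.2.2.length ≤ Z ∧ q.2.length ≤ Z)
    PComp.id.snd.snd.fst (PComp.or ?_ ?_) 1 fun a Z h => ⟨by rw [pow_one]; omega, fun s hs => ?_⟩)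
  · exact pcomp_cov.app (PComp.id.fst.snd.fst.pair (PComp.id.fst.snd.snd.snd.snd.pair PComp.id.snd)) 1
      fun a Z h => by dsimp only; rw [pow_one]; omega
  · refine PComp.any (f := fun (q : (ℕ × (ℝ × (List Pt × (List Pt × List Pt)))) × Pt) (x : Pt) =>
      near q.1.2.1 q.2 x) (Pf := fun q Z => q.1.2.length ≤ Z) PComp.id.fst.snd.snd.snd.fst ?_ 1
      fun a Z h => ⟨by rw [pow_one]; omega, fun _ _ => by dsimp only; rw [pow_one]; omega⟩
    exact pcomp_near.app (PComp.id.fst.fst.snd.fst.pair (PComp.id.fst.snd.pair PComp.id.snd)) 1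
      fun a Z h => by dsimp only; rw [pow_one]; omega
  · have := h.2.1 s hs
    dsimp only; rw [pow_one]; omega

theorem prune_foldl_subset (p : List Pt → List Pt → Bool) (L acc : List (List Pt)) :
    (∀ c ∈ L.foldl (fun acc c => if acc.any fun c' => p c c' then acc else c :: acc) acc,
      c ∈ acc ∨ c ∈ L) ∧
    (L.foldl (fun acc c => if acc.any fun c' => p c c' then acc else c :: acc) acc).length ≤
      acc.length + L.length := by
  induction L generalizing acc with
  | nil => simp
  | cons x L ih =>
    rw [List.foldl_cons]
    split_ifs with h
    · obtain ⟨h1, h2⟩ := ih acc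
      refine ⟨fun c hc => (h1 c hc).imp_right (List.mem_cons_of_mem _), ?_⟩
      simp only [List.length_cons]; omega
    · obtain ⟨h1, h2⟩ := ih (x :: acc)
      refine ⟨fun c hc => ?_, ?_⟩
      · have := h1 c hc
        simp only [List.mem_cons] at *
        tauto
      · simp only [List.length_cons] at *; omega

theorem pcomp_prune : PComp (fun q Z => q.2.1.length ≤ Z ∧ (∀ s ∈ q.2.1, s.length ≤ Z) ∧
      q.2.2.length ≤ Z ∧ ∀ c ∈ q.2.2, c.length ≤ Z)
    (fun q : ℝ × (List Pt × List (List Pt)) => prune q.1 q.2.1 q.2.2) := by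
  refine PComp.foldl (f := fun (q : ℝ × (List Pt × List (List Pt))) acc c =>
      if acc.any fun c' => same q.1 q.2.1 c c' then acc else c :: acc)
    (Pf := fun q Z => (q.1.2.1.length ≤ Z ∧ ∀ s ∈ q.1.2.1, s.length ≤ Z) ∧
      q.2.1.length ≤ Z ∧ (∀ c ∈ q.2.1, c.length ≤ Z) ∧ q.2.2.length ≤ Z)
    PComp.id.snd.snd PComp.nil (PComp.ite (PComp.any (f := fun (q : (ℝ × (List Pt × List (List Pt))) ×
      (List (List Pt) × List Pt)) c' => same q.1.1 q.1.2.1 q.2.2 c') PComp.id.snd.fst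
      (Pf := fun q Z => (q.1.1.2.1.length ≤ Z ∧ ∀ s ∈ q.1.1.2.1, s.length ≤ Z) ∧
        q.1.2.2.length ≤ Z ∧ q.2.length ≤ Z)
      (pcomp_same.app (PComp.id.fst.fst.fst.pair (PComp.id.fst.fst.snd.fst.pair
        (PComp.id.fst.snd.snd.pair PComp.id.snd))) 1 fun a Z h => ?_) 1 fun a Z h => ?_)
      PComp.id.snd.fst (PComp.cons PComp.id.snd.snd PComp.id.snd.fst)) 1 fun a Z h => ⟨?_, ?_⟩
  · obtain ⟨⟨h1, h2⟩, h3, h4⟩ := h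
    exact ⟨by dsimp only; rw [pow_one]; omega, fun s hs => (h2 s hs).trans (by rw [pow_one]; omega), by dsimp only; rw [pow_one]; omega,
      by dsimp only; rw [pow_one]; omega⟩
  · obtain ⟨⟨h1, h2⟩, h3, h4, h5⟩ := h
    exact ⟨by rw [pow_one]; omega, fun c hc => ⟨⟨by dsimp only; rw [pow_one]; omega, fun s hs => (h2 s hs).trans (by rw [pow_one]; omega)⟩,
      by dsimp only; rw [pow_one]; omega, (h4 c hc).trans (by rw [pow_one]; omega)⟩⟩
  · rw [pow_one]; omega
  · obtain ⟨h1, h2, h3, h4⟩ := h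
    intro pre x suf he
    obtain ⟨h5, h6⟩ := prune_foldl_subset (same a.1 a.2.1) pre []
    have h7 : pre.length ≤ a.2.2.length := by rw [he]; simp
    refine ⟨⟨by dsimp only; rw [pow_one]; omega, fun s hs => (h2 s hs).trans (by rw [pow_one]; omega)⟩, ?_, fun c hc => ?_, ?_⟩
    · simp only [List.length_nil] at h6
      dsimp only; rw [pow_one]; omega
    · have := h5 c hc
      refine (h4 c ?_).trans (by rw [pow_one]; omega)
      rw [he]; simp at this ⊢; tauto
    · refine (h4 x (by rw [he]; simp)).trans (by rw [pow_one]; omega)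

theorem length_flatMap_pair (x : Pt) (L : List (List Pt)) :
    (L.flatMap fun c => [c, x :: c]).length = 2 * L.length := by
  induction L with
  | nil => rfl
  | cons c L ih => simp only [List.flatMap_cons, List.length_append, ih, List.length_cons]; simp; ring

theorem pcomp_extend : PComp (fun q Z => q.2.length ≤ Z)
    (fun q : Pt × List (List Pt) => q.2.flatMap fun c => [c, q.1 :: c]) :=
  PComp.flatMap (f := fun (q : Pt × List (List Pt)) c => [c, q.1 :: c]) (Pf := fun _ _ => True)
    PComp.id.snd (PComp.cons PComp.id.snd (PComp.cons (PComp.cons PComp.id.fst.fst PComp.id.snd)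
      PComp.nil)) 1 fun a Z h => ⟨by rw [pow_one]; omega, fun _ _ => ⟨trivial, by simp⟩⟩

theorem pcomp_dpStep : PComp (fun q Z => (q.2.2.1.length ≤ Z ∧ ∀ s ∈ q.2.2.1, s.length ≤ Z) ∧
      q.2.2.2.2.1.length ≤ Z ∧ q.2.2.2.2.2.length ≤ Z ∧ ∀ c ∈ q.2.2.2.2.2, c.length ≤ Z)
    (fun q : ℕ × (ℝ × (List Pt × (Pt × (List Pt × List (List Pt))))) =>
      dpStep q.1 q.2.1 q.2.2.1 q.2.2.2.1 q.2.2.2.2.1 q.2.2.2.2.2) := by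
  have hl : PComp (fun q Z => (q.2.2.1.length ≤ Z ∧ ∀ s ∈ q.2.2.1, s.length ≤ Z) ∧
      q.2.2.2.2.1.length ≤ Z ∧ q.2.2.2.2.2.length ≤ Z ∧ ∀ c ∈ q.2.2.2.2.2, c.length ≤ Z)
      (fun q : ℕ × (ℝ × (List Pt × (Pt × (List Pt × List (List Pt))))) =>
        q.2.2.2.2.2.flatMap fun c => [c, q.2.2.2.1 :: c]) :=
    pcomp_extend.app (PComp.id.snd.snd.snd.fst.pair PComp.id.snd.snd.snd.snd.snd) 1
      fun a Z h => h.2.2.1.trans (by rw [pow_one]; omega)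
  refine pcomp_prune.app (PComp.id.snd.fst.pair (PComp.id.snd.snd.fst.pair (PComp.filter
    (f := fun (q : ℕ × (ℝ × (List Pt × (Pt × (List Pt × List (List Pt)))))) c =>
      valid q.1 q.2.1 q.2.2.1 q.2.2.2.2.1 c)
    (l := fun q => q.2.2.2.2.2.flatMap fun c => [c, q.2.2.2.1 :: c])
    (Pf := fun q Z => (q.1.2.2.1.length ≤ Z ∧ ∀ s ∈ q.1.2.2.1, s.length ≤ Z) ∧
      q.1.2.2.2.2.1.length ≤ Z ∧ q.2.length ≤ Z)
    hl
    (pcomp_valid.app (PComp.id.fst.fst.pair (PComp.id.fst.snd.fst.pair (PComp.id.fst.snd.snd.fst.pair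
      (PComp.id.fst.snd.snd.snd.snd.fst.pair PComp.id.snd)))) 1 fun a Z h => ?_) 2 fun a Z h => ?_))) 2
    fun a Z h => ?_
  · obtain ⟨⟨h1, h2⟩, h3, h4⟩ := h
    exact ⟨by dsimp only; rw [pow_one]; omega, fun s hs => (h2 s hs).trans (by rw [pow_one]; omega), by dsimp only; rw [pow_one]; omega,
      by dsimp only; rw [pow_one]; omega⟩
  · obtain ⟨⟨h1, h2⟩, h3, h4, h5⟩ := h
    refine ⟨by rw [length_flatMap_pair]; nlinarith, fun c hc => ⟨⟨by dsimp only; nlinarith, fun s hs =>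
      (h2 s hs).trans (by nlinarith)⟩, by dsimp only; nlinarith, ?_⟩⟩
    simp only [List.mem_flatMap, List.mem_cons, List.not_mem_nil, or_false] at hc
    obtain ⟨c', hc', rfl | rfl⟩ := hc
    · have := h5 _ hc'
      nlinarith
    · have := h5 _ hc'
      simp only [List.length_cons]
      nlinarith
  · obtain ⟨⟨h1, h2⟩, h3, h4, h5⟩ := h
    refine ⟨by dsimp only; nlinarith, fun s hs => (h2 s hs).trans (by nlinarith), ?_, fun c hc => ?_⟩
    · refine (List.length_filter_le _ _).trans ?_
      rw [length_flatMap_pair]; nlinarith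
    · have hc := List.mem_of_mem_filter hc
      simp only [List.mem_flatMap, List.mem_cons, List.not_mem_nil, or_false] at hc
      obtain ⟨c', hc', rfl | rfl⟩ := hc
      · have := h5 _ hc'
        nlinarith
      · have := h5 _ hc'
        simp only [List.length_cons]
        nlinarith

theorem dpRun_fst (k : ℕ) (ρ : ℝ) (S X Y Y' : List Pt) (h : X = Y ++ Y') :
    (dpRun k ρ S X Y).1 = Y' := by
  induction Y using List.reverseRecOn generalizing Y' with
  | nil => exact h
  | append_singleton Y x ih =>
    rw [dpRun, List.foldl_append]
    have := ih (x :: Y') (by rw [h]; simp)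
    rw [dpRun] at this
    simp [this]

/-- The size of the instance of the dynamic program and of all its intermediate lists. -/
def DpSize (k : ℕ) (ρ : ℝ) (S X : List Pt) (Z : ℕ) : Prop :=
  (S.length ≤ Z ∧ ∀ s ∈ S, s.length ≤ Z) ∧ X.length ≤ Z ∧
    ∀ Y Y', X = Y ++ Y' → (dpRun k ρ S X Y).2.length ≤ Z ∧ ∀ c ∈ (dpRun k ρ S X Y).2, c.length ≤ Z

theorem pcomp_dp : PComp (fun q Z => DpSize q.1 q.2.1 q.2.2.1 q.2.2.2 Z)
    (fun q : ℕ × (ℝ × (List Pt × List Pt)) => dp q.1 q.2.1 q.2.2.1 q.2.2.2) := by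
  refine PComp.snd (PComp.foldl (f := fun (q : ℕ × (ℝ × (List Pt × List Pt)))
      (st : List Pt × List (List Pt)) x => (st.1.tail, dpStep q.1 q.2.1 q.2.2.1 x st.1.tail st.2))
    (Pf := fun q Z => (q.1.2.2.1.length ≤ Z ∧ ∀ s ∈ q.1.2.2.1, s.length ≤ Z) ∧
      q.2.1.1.length ≤ Z ∧ q.2.1.2.length ≤ Z ∧ ∀ c ∈ q.2.1.2, c.length ≤ Z)
    PComp.id.snd.snd.snd (PComp.id.snd.snd.snd.pair (PComp.cons PComp.nil PComp.nil))
    (PComp.id.snd.fst.fst.tail.pair (pcomp_dpStep.app (PComp.id.fst.fst.pair (PComp.id.fst.snd.fst.pair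
      (PComp.id.fst.snd.snd.fst.pair (PComp.id.snd.snd.pair (PComp.id.snd.fst.fst.tail.pair
        PComp.id.snd.fst.snd))))) 1 fun a Z h => ?_)) 1 fun a Z h => ⟨?_, ?_⟩)
  · obtain ⟨⟨h1, h2⟩, h3, h4, h5⟩ := h
    exact ⟨⟨by dsimp only; rw [pow_one]; omega, fun s hs => (h2 s hs).trans (by rw [pow_one]; omega)⟩,
      by simp only [List.length_tail]; rw [pow_one]; omega, by dsimp only; rw [pow_one]; omega,
      fun s hs => (h5 s hs).trans (by rw [pow_one]; omega)⟩
  · exact h.2.1.trans (by rw [pow_one]; omega)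
  · intro pre x suf he
    obtain ⟨⟨h1, h2⟩, h3, h4⟩ := h
    obtain ⟨h5, h6⟩ := h4 pre (x :: suf) he
    have h7 := dpRun_fst a.1 a.2.1 a.2.2.1 a.2.2.2 pre (x :: suf) he
    rw [dpRun] at h5 h6 h7
    refine ⟨⟨by dsimp only; rw [pow_one]; omega, fun s hs => (h2 s hs).trans (by rw [pow_one]; omega)⟩, ?_,
      h5.trans (by rw [pow_one]; omega), fun s hs => (h6 s hs).trans (by rw [pow_one]; omega)⟩
    dsimp only
    rw [h7]
    have : (x :: suf).length ≤ a.2.2.2.length := by rw [he]; simp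
    rw [pow_one]; omega

/-- The lists have to be small only for the radii up to the first success. Their size is controlled
only for radii up to twice Gonzalez' radius. -/
theorem pcomp_radius : PComp
    (fun (q : ℕ × (List Pt × (List Pt × (ℝ × ℝ)))) Z => ∃ N ≤ Z,
      dp q.1 (q.2.2.2.2 * q.2.2.2.1 ^ N) q.2.1 q.2.2.1 ≠ [] ∧
      ∀ j ≤ N, (∀ l < j, dp q.1 (q.2.2.2.2 * q.2.2.2.1 ^ l) q.2.1 q.2.2.1 = []) →
        DpSize q.1 (q.2.2.2.2 * q.2.2.2.1 ^ j) q.2.1 q.2.2.1 Z)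
    (fun q => radius q.1 q.2.1 q.2.2.1 q.2.2.2.1 q.2.2.2.2) := by
  have key : ∀ (ρ t : ℝ) j, (fun ρ => ρ * t)^[j] ρ = ρ * t ^ j := by
    intro ρ t j
    induction j with
    | zero => simp
    | succ j ih => rw [Function.iterate_succ_apply', ih]; ring
  refine PComp.whileFn (c := fun (q : ℕ × (List Pt × (List Pt × (ℝ × ℝ)))) ρ =>
      (dp q.1 ρ q.2.1 q.2.2.1).isEmpty) (f := fun q ρ => ρ * q.2.2.2.1) (i := fun q => q.2.2.2.2)
    (Pc := fun q Z => ∃ Z' ≤ Z, DpSize q.1.1 q.2 q.1.2.1 q.1.2.2.1 Z') (Pf := fun _ _ => True)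
    (PComp.isEmpty (pcomp_dp.app (PComp.id.fst.fst.pair (PComp.id.snd.pair
      (PComp.id.fst.snd.fst.pair PComp.id.fst.snd.snd.fst))) 1 fun a Z h => ?_))
    (PComp.id.snd.rmul PComp.id.fst.snd.snd.snd.fst) PComp.id.snd.snd.snd.snd 1 fun a Z h => ?_
  · obtain ⟨Z', h1, ⟨h2, h3⟩, h4, h5⟩ := h
    refine ⟨⟨by dsimp only; rw [pow_one]; omega, fun s hs => (h3 s hs).trans (by rw [pow_one]; omega)⟩, by dsimp only; rw [pow_one]; omega,
      fun Y Y' hY => ?_⟩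
    obtain ⟨h6, h7⟩ := h5 Y Y' hY
    exact ⟨h6.trans (by rw [pow_one]; omega), fun c hc => (h7 c hc).trans (by rw [pow_one]; omega)⟩
  · obtain ⟨N, h1, h2, h3⟩ := h
    refine ⟨N, by rw [pow_one]; omega, by simpa [key] using h2, fun j hj hl => ⟨⟨Z, by rw [pow_one]; omega, ?_⟩, fun _ => trivial⟩⟩
    simp only [key]
    exact h3 j hj fun l hlj => by simpa [key] using hl l hlj

end KCenter

/-! ### Scale, candidate grid and side length of the cells -/

namespace KCenter

open RealRAM

/-- A list of at most `Z` lists of length at most `Z`. -/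
def Small (S : List Pt) (Z : ℕ) : Prop := S.length ≤ Z ∧ ∀ s ∈ S, s.length ≤ Z

theorem Small.mono {S : List Pt} {Z Z' : ℕ} (h : Small S Z) (hZ : Z ≤ Z') : Small S Z' :=
  ⟨h.1.trans hZ, fun s hs => (h.2 s hs).trans hZ⟩

theorem Small.pow {S : List Pt} {Z : ℕ} (h : Small S Z) : Small S ((Z + 2) ^ 1) :=
  h.mono (by rw [pow_one]; omega)

/-- All differences of coordinates of `q` and of the points of `S`. -/
noncomputable def diffs (q : Pt) (S : List Pt) : List ℝ :=
  S.flatMap fun g => (q.zip g).map fun t => t.1 - t.2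

/-- An entry `v` of `vs` with `v ^ 2 ≤ rsq ≤ dr * v ^ 2`, or zero. -/
noncomputable def pickScale (dr rsq : ℝ) (vs : List ℝ) : ℝ :=
  vs.foldl (fun u v => if decide (rsq < v * v) || decide (dr * (v * v) < rsq) then u else v) 0

/-- A lower bound for `√rsq` that is sharp up to the factor `√d`. -/
noncomputable def scale (d : ℕ) (rsq : ℝ) (q : Pt) (S : List Pt) : ℝ :=
  if decide (pickScale d rsq (diffs q S) < 0) then 0 - pickScale d rsq (diffs q S)
  else pickScale d rsq (diffs q S)

theorem pcomp_scale : PComp (fun q Z => q.1 ≤ Z ∧ q.2.2.1.length ≤ Z ∧ Small q.2.2.2 Z)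
    (fun q : ℕ × (ℝ × (Pt × List Pt)) => scale q.1 q.2.1 q.2.2.1 q.2.2.2) := by
  have h1 : PComp (fun q Z => q.1.length ≤ Z ∧ Small q.2 Z)
      (fun q : Pt × List Pt => diffs q.1 q.2) := by
    refine PComp.flatMap (f := fun (q : Pt × List Pt) g => (q.1.zip g).map fun t => t.1 - t.2)
      (Pf := fun q Z => q.1.1.length ≤ Z) PComp.id.snd
      (PComp.map (f := fun _ (t : ℝ × ℝ) => t.1 - t.2) (Pf := fun _ _ => True)
        (PComp.zip PComp.id.fst.fst PComp.id.snd 1 fun a Z h => by rw [pow_one]; omega)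
        (PComp.id.snd.fst.rsub PComp.id.snd.snd) 1 fun a Z h => ⟨?_, fun _ _ => trivial⟩) 1
      fun a Z h => ⟨?_, fun x hx => ⟨?_, ?_⟩⟩
    · rw [List.length_zip, pow_one]; omega
    · exact h.2.pow.1
    · rw [pow_one]; dsimp only; omega
    · rw [List.length_map, List.length_zip, pow_one]; omega
  have h2 : PComp (fun q Z => q.2.2.length ≤ Z)
      (fun q : ℝ × (ℝ × List ℝ) => pickScale q.1 q.2.1 q.2.2) :=
    PComp.foldl (f := fun (q : ℝ × (ℝ × List ℝ)) u v =>
      if decide (q.2.1 < v * v) || decide (q.1 * (v * v) < q.2.1) then u else v)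
      (Pf := fun _ _ => True) PComp.id.snd.snd PComp.real0
      (PComp.ite ((PComp.id.fst.snd.fst.rlt (PComp.id.snd.snd.rmul PComp.id.snd.snd)).or
        ((PComp.id.fst.fst.rmul (PComp.id.snd.snd.rmul PComp.id.snd.snd)).rlt PComp.id.fst.snd.fst))
        PComp.id.snd.fst PComp.id.snd.snd) 1
      fun a Z h => ⟨by rw [pow_one]; omega, fun _ _ _ _ => trivial⟩
  have h3 : PComp (fun q Z => q.1 ≤ Z ∧ q.2.2.1.length ≤ Z ∧ Small q.2.2.2 Z)
      (fun q : ℕ × (ℝ × (Pt × List Pt)) => pickScale q.1 q.2.1 (diffs q.2.2.1 q.2.2.2)) := by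
    refine h2.app ((PComp.cast PComp.id.fst 1 fun a Z h => ?_).pair (PComp.id.snd.fst.pair
      (h1.app PComp.id.snd.snd 1 fun a Z h => ?_))) 2 fun a Z h => ?_
    · rw [pow_one]; omega
    · exact ⟨h.2.1.trans (by rw [pow_one]; omega), h.2.2.pow⟩
    · obtain ⟨h1, h2, h3, h4⟩ := h
      have : ∀ S : List Pt, (diffs a.2.2.1 S).length ≤ Z * S.length := by
        intro S
        induction S with
        | nil => simp [diffs]
        | cons s S ih =>
          simp only [diffs, List.flatMap_cons, List.length_append, List.length_map,
            List.length_zip, List.length_cons] at ih ⊢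
          nlinarith [min_le_left a.2.2.1.length s.length]
      exact (this _).trans (by nlinarith)
  exact PComp.ite (h3.rlt PComp.real0) (PComp.real0.rsub h3) h3

/-- The points `x` for which each coordinate of `x - s` is in `vals`. -/
noncomputable def around (vals : List ℝ) (s : Pt) : List Pt :=
  s.foldr (fun c acc => acc.flatMap fun z => vals.map fun v => (c + v) :: z) [[]]

theorem length_around (vals : List ℝ) (s : Pt) : (around vals s).length = vals.length ^ s.length := by
  induction s with
  | nil => rfl
  | cons c s ih =>
    have : ∀ L : List Pt, (L.flatMap fun z => vals.map fun v => (c + v) :: z).length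
        = L.length * vals.length := by
      intro L
      induction L with
      | nil => simp
      | cons z L ih =>
        rw [List.flatMap_cons, List.length_append, ih, List.length_map, List.length_cons]; ring
    rw [around, List.foldr_cons, this]
    rw [around] at ih
    rw [ih, List.length_cons, pow_succ]

theorem mem_around (vals : List ℝ) (s x : Pt) :
    x ∈ around vals s ↔ List.Forall₂ (fun a c => ∃ v ∈ vals, c + v = a) x s := by
  induction s generalizing x with
  | nil => simp [around]
  | cons c s ih =>
    rw [around, List.foldr_cons, ← around, List.mem_flatMap]
    constructor
    · rintro ⟨z, hz, hx⟩
      obtain ⟨v, hv, rfl⟩ := List.mem_map.1 hx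
      exact .cons ⟨v, hv, rfl⟩ ((ih z).1 hz)
    · rintro (_ | ⟨⟨v, hv, rfl⟩, h⟩)
      exact ⟨_, (ih _).2 h, List.mem_map.2 ⟨v, hv, rfl⟩⟩

theorem length_of_mem_around {vals : List ℝ} {s x : Pt} (h : x ∈ around vals s) :
    x.length = s.length := ((mem_around vals s x).1 h).length_eq

/-- The values `(t - N) * h` for `t ≤ 2 * N`. -/
noncomputable def steps (N : ℕ) (h : ℝ) : List ℝ :=
  (List.range (N + N + 1)).map fun t : ℕ => ((t : ℝ) - (N : ℝ)) * h

/-- The candidate centers. -/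
noncomputable def grid (d : ℕ) (e u : ℝ) (S : List Pt) : List Pt :=
  S.flatMap (around (steps ⌈128 * ((d : ℝ) * (d : ℝ)) / e⌉₊ (e * u / (64 * (d : ℝ)))))

theorem pcomp_around : PComp (fun q Z => q.1.length ≤ Z ∧ q.2.length ≤ Z ∧ q.1.length ^ q.2.length ≤ Z)
    (fun q : List ℝ × Pt => around q.1 q.2) := by
  refine PComp.foldr (f := fun (q : List ℝ × Pt) (c : ℝ) (acc : List Pt) =>
      acc.flatMap fun z => q.1.map fun v => (c + v) :: z)
    (Pf := fun q Z => q.1.1.length ≤ Z ∧ q.2.2.length ≤ Z)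
    PComp.id.snd (PComp.cons PComp.nil PComp.nil) (PComp.flatMap
      (f := fun (q : (List ℝ × Pt) × (ℝ × List Pt)) (z : Pt) => q.1.1.map fun v => (q.2.1 + v) :: z)
      (Pf := fun q Z => q.1.1.1.length ≤ Z)
      PComp.id.snd.snd (PComp.map (f := fun (q : ((List ℝ × Pt) × (ℝ × List Pt)) × Pt) (v : ℝ) =>
          (q.1.2.1 + v) :: q.2) (Pf := fun _ _ => True)
        PComp.id.fst.fst.fst (PComp.cons (PComp.id.fst.fst.snd.fst.radd PComp.id.snd) PComp.id.fst.snd) 1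
        fun a Z h => ⟨by rw [pow_one]; omega, fun _ _ => trivial⟩) 1
      fun a Z h => ⟨by rw [pow_one]; omega, fun x hx => ⟨by dsimp only; rw [pow_one]; omega, by
        rw [List.length_map, pow_one]; omega⟩⟩) 1
    fun a Z h => ⟨by rw [pow_one]; omega, fun pre x suf he => ?_⟩
  obtain ⟨h1, h2, h3⟩ := h
  refine ⟨by dsimp only; rw [pow_one]; omega, ?_⟩
  have := length_around a.1 suf
  rw [around] at this
  dsimp only
  rw [this, pow_one]
  rcases Nat.eq_zero_or_pos a.1.length with h0 | h0
  · rw [h0]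
    exact (pow_le_one₀ (by omega) (by omega)).trans (by omega)
  · refine (Nat.pow_le_pow_right h0 ?_).trans (h3.trans (by omega))
    rw [he]; simp; omega

theorem length_steps (N : ℕ) (h : ℝ) : (steps N h).length = 2 * N + 1 := by
  rw [steps, List.length_map, List.length_range]; ring

theorem pcomp_steps : PComp (fun q Z => q.1 ≤ Z) (fun q : ℕ × ℝ => steps q.1 q.2) := by
  have hr : PComp (fun q Z => q.1 ≤ Z) (fun q : ℕ × ℝ => List.range (q.1 + q.1 + 1)) :=
    PComp.range ((PComp.id.fst.nadd PComp.id.fst).nadd (PComp.natConst 1)) 2 fun a Z h => by nlinarith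
  refine PComp.map (f := fun (q : ℕ × ℝ) (t : ℕ) => ((t : ℝ) - (q.1 : ℝ)) * q.2)
    (Pf := fun q Z => q.1.1 ≤ Z ∧ q.2 ≤ Z)
    hr
    (((PComp.cast PComp.id.snd 1 fun a Z h => by rw [pow_one]; omega).rsub
      (PComp.cast PComp.id.fst.fst 1 fun a Z h => by rw [pow_one]; omega)).rmul PComp.id.fst.snd) 2
    fun a Z h => ⟨by rw [List.length_range]; nlinarith, fun x hx => ⟨by dsimp only; nlinarith, ?_⟩⟩
  have := List.mem_range.1 hx
  dsimp only
  nlinarith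

theorem pcomp_grid : PComp (fun q Z => q.1 ≤ Z ∧ ⌈128 * ((q.1 : ℝ) * (q.1 : ℝ)) / q.2.1⌉₊ ≤ Z ∧
      Small q.2.2.2 Z ∧ (∀ s ∈ q.2.2.2,
        (2 * ⌈128 * ((q.1 : ℝ) * (q.1 : ℝ)) / q.2.1⌉₊ + 1) ^ s.length ≤ Z))
    (fun q : ℕ × (ℝ × (ℝ × List Pt)) => grid q.1 q.2.1 q.2.2.1 q.2.2.2) := by
  refine PComp.flatMap (f := fun (q : ℕ × (ℝ × (ℝ × List Pt))) s =>
      around (steps ⌈128 * ((q.1 : ℝ) * (q.1 : ℝ)) / q.2.1⌉₊ (q.2.1 * q.2.2.1 / (64 * (q.1 : ℝ)))) s)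
    (Pf := fun q Z => q.1.1 ≤ Z ∧ ⌈128 * ((q.1.1 : ℝ) * (q.1.1 : ℝ)) / q.1.2.1⌉₊ ≤ Z ∧ q.2.length ≤ Z ∧
      (2 * ⌈128 * ((q.1.1 : ℝ) * (q.1.1 : ℝ)) / q.1.2.1⌉₊ + 1) ^ q.2.length ≤ Z)
    PComp.id.snd.snd.snd (pcomp_around.app (PComp.pair (pcomp_steps.app (PComp.pair
      (PComp.natCeil (((PComp.realNat 128).rmul ((PComp.cast PComp.id.fst.fst 1 fun a Z h => ?_).rmul
        (PComp.cast PComp.id.fst.fst 1 fun a Z h => ?_))).rdiv PComp.id.fst.snd.fst) 1 fun a Z h => ?_)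
      ((PComp.id.fst.snd.fst.rmul PComp.id.fst.snd.snd.fst).rdiv ((PComp.realNat 64).rmul
        (PComp.cast PComp.id.fst.fst 1 fun a Z h => ?_)))) 1 fun a Z h => ?_) PComp.id.snd) 2
      fun a Z h => ?_) 1 fun a Z h => ?_
  · rw [pow_one]; exact h.1.trans (by omega)
  · rw [pow_one]; exact h.1.trans (by omega)
  · rw [pow_one]; exact h.2.1.trans (by omega)
  · rw [pow_one]; exact h.1.trans (by omega)
  · rw [pow_one]; exact h.2.1.trans (by omega)
  · obtain ⟨h1, h2, h3, h4⟩ := h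
    dsimp only
    rw [length_steps]
    exact ⟨by nlinarith, by nlinarith, h4.trans (by nlinarith)⟩
  · obtain ⟨h1, h2, h3, h4⟩ := h
    refine ⟨h3.pow.1, fun x hx => ⟨⟨?_, ?_, h3.pow.2 x hx, (h4 x hx).trans (by rw [pow_one]; omega)⟩, ?_⟩⟩
    · rw [pow_one]; dsimp only; omega
    · rw [pow_one]; dsimp only; omega
    · rw [length_around, length_steps]
      exact (h4 x hx).trans (by rw [pow_one]; omega)

/-- The smallest `T ≥ 1` with `k ≤ (T * d ^ 2) ^ d`. -/
noncomputable def sideT (d k : ℕ) : ℕ :=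
  whileFn (fun T : ℕ => decide (((T : ℝ) * ((d : ℝ) * (d : ℝ))) ^ d < (k : ℝ))) (fun T => T + 1) 1

theorem iterate_succ_one (j : ℕ) : (fun T : ℕ => T + 1)^[j] 1 = j + 1 := by
  induction j with
  | zero => rfl
  | succ j ih => rw [Function.iterate_succ_apply', ih]

/-- Guarantees that the search for the side length ends: `T = k + 1` is always large enough. -/
theorem le_side_pow {d : ℕ} (hd : 1 ≤ d) (k : ℕ) :
    (k : ℝ) ≤ (((k + 1 : ℕ) : ℝ) * ((d : ℝ) * (d : ℝ))) ^ d := by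
  have h1 : (1 : ℝ) ≤ d := by exact_mod_cast hd
  have h2 : (k : ℝ) + 1 ≤ ((k + 1 : ℕ) : ℝ) * ((d : ℝ) * (d : ℝ)) := by
    push_cast
    nlinarith [mul_nonneg (Nat.cast_nonneg (α := ℝ) k) (by nlinarith : (0:ℝ) ≤ d * d - 1)]
  calc (k : ℝ) ≤ k + 1 := by linarith
    _ ≤ _ := h2
    _ ≤ _ := le_self_pow₀ (by linarith [Nat.cast_nonneg (α := ℝ) k]) (by omega)

theorem pcomp_sideT : PComp (fun q Z => 1 ≤ q.1 ∧ q.1 ≤ Z ∧ q.2 ≤ Z)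
    (fun q : ℕ × ℕ => sideT q.1 q.2) := by
  refine PComp.whileFn (c := fun (q : ℕ × ℕ) (T : ℕ) =>
      decide (((T : ℝ) * ((q.1 : ℝ) * (q.1 : ℝ))) ^ q.1 < (q.2 : ℝ))) (f := fun _ T => T + 1)
    (i := fun _ => 1) (Pc := fun q Z => q.1.1 ≤ Z ∧ q.1.2 ≤ Z ∧ q.2 ≤ Z) (Pf := fun _ _ => True)
    (PComp.rlt (PComp.rpow ((PComp.cast PComp.id.snd 1 fun a Z h => ?_).rmul
      ((PComp.cast PComp.id.fst.fst 1 fun a Z h => ?_).rmul (PComp.cast PComp.id.fst.fst 1 fun a Z h => ?_)))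
      PComp.id.fst.fst 1 fun a Z h => ?_) (PComp.cast PComp.id.fst.snd 1 fun a Z h => ?_))
    (PComp.id.snd.nadd (PComp.natConst 1)) (PComp.natConst 1) 1 fun a Z h => ⟨a.2, ?_, ?_, ?_⟩
  iterate 5
    rw [pow_one]
    try dsimp only
    omega
  · rw [pow_one]; omega
  · simp only [iterate_succ_one, decide_eq_false_iff_not, not_lt]
    exact le_side_pow h.1 _
  · intro j hj _
    simp only [iterate_succ_one]
    exact ⟨⟨by rw [pow_one]; omega, by rw [pow_one]; omega, by rw [pow_one]; omega⟩, fun _ => trivial⟩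

attribute [irreducible] sideT

end KCenter

/-! ### Greedy choice of the cuts in one coordinate -/

namespace KCenter

open RealRAM

/-- The smallest entry of a nonempty list. -/
noncomputable def minL (V : List ℝ) : ℝ :=
  V.foldl (fun a v => if decide (v < a) then v else a) (V.headD 0)

/-- The number of entries at distance at most `z` from `H`. -/
noncomputable def cnt (z : ℝ) (V : List ℝ) (H : ℝ) : ℕ :=
  (V.filter fun v => !decide (z < v - H) && !decide (z < H - v)).length

/-- The candidates for the first cut. -/
noncomputable def cands (T : ℕ) (W : ℝ) (V : List ℝ) : List ℝ :=
  (List.range T).map fun t : ℕ => minL V + (T : ℝ) * W + (t : ℝ) * W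

/-- A first cut that is close to as few entries of `V` as possible. -/
noncomputable def bestCut (T : ℕ) (W z : ℝ) (V : List ℝ) : ℝ :=
  (cands T W V).foldl (fun b c => if decide (cnt z V c < cnt z V b) then c else b)
    (minL V + (T : ℝ) * W)

noncomputable def cutStep (T : ℕ) (W z : ℝ) (st : List ℝ × List ℝ) : List ℝ × List ℝ :=
  (bestCut T W z st.2 :: st.1, st.2.filter fun v => decide (bestCut T W z st.2 < v))

/-- Cuts such that consecutive cuts have distance at least `T * W`. -/
noncomputable def cuts (T : ℕ) (W z : ℝ) (V : List ℝ) : List ℝ :=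
  (whileFn (fun st : List ℝ × List ℝ => !st.2.isEmpty) (cutStep T W z) ([], V)).1

theorem pcomp_minL : PComp (fun V Z => V.length ≤ Z) minL :=
  PComp.foldl (f := fun _ (a v : ℝ) => if decide (v < a) then v else a) (i := fun V => V.headD 0)
    (Pf := fun _ _ => True) PComp.id (PComp.headD PComp.id PComp.real0)
    (PComp.ite (PComp.id.snd.snd.rlt PComp.id.snd.fst) PComp.id.snd.snd PComp.id.snd.fst) 1
    fun a Z h => ⟨by rw [pow_one]; omega, fun _ _ _ _ => trivial⟩

theorem pcomp_cnt : PComp (fun q Z => q.2.1.length ≤ Z)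
    (fun q : ℝ × (List ℝ × ℝ) => cnt q.1 q.2.1 q.2.2) := by
  have h : PComp (fun q Z => q.2.1.length ≤ Z) (fun q : ℝ × (List ℝ × ℝ) =>
      q.2.1.filter fun v => !decide (q.1 < v - q.2.2) && !decide (q.1 < q.2.2 - v)) :=
    PComp.filter (f := fun (q : ℝ × (List ℝ × ℝ)) v =>
      !decide (q.1 < v - q.2.2) && !decide (q.1 < q.2.2 - v)) (Pf := fun _ _ => True) PComp.id.snd.fst
      ((PComp.id.fst.fst.rlt (PComp.id.snd.rsub PComp.id.fst.snd.snd)).not.and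
        (PComp.id.fst.fst.rlt (PComp.id.fst.snd.snd.rsub PComp.id.snd)).not) 1
      fun a Z h => ⟨by rw [pow_one]; omega, fun _ _ => trivial⟩
  exact h.length 1 fun a Z h => (List.length_filter_le _ _).trans (by rw [pow_one]; omega)

theorem pcomp_bestCut : PComp (fun q Z => q.1 ≤ Z ∧ q.2.2.2.length ≤ Z)
    (fun q : ℕ × (ℝ × (ℝ × List ℝ)) => bestCut q.1 q.2.1 q.2.2.1 q.2.2.2) := by
  have h0 : PComp (fun q Z => q.1 ≤ Z ∧ q.2.2.2.length ≤ Z)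
      (fun q : ℕ × (ℝ × (ℝ × List ℝ)) => minL q.2.2.2 + (q.1 : ℝ) * q.2.1) :=
    (pcomp_minL.app PComp.id.snd.snd.snd 1 fun a Z h => by rw [pow_one]; omega).radd
      ((PComp.cast PComp.id.fst 1 fun a Z h => by rw [pow_one]; omega).rmul PComp.id.snd.fst)
  have h1 : PComp (fun q Z => q.1 ≤ Z ∧ q.2.2.2.length ≤ Z)
      (fun q : ℕ × (ℝ × (ℝ × List ℝ)) => cands q.1 q.2.1 q.2.2.2) := by
    refine PComp.map (f := fun (q : ℕ × (ℝ × (ℝ × List ℝ))) (t : ℕ) =>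
        minL q.2.2.2 + (q.1 : ℝ) * q.2.1 + (t : ℝ) * q.2.1)
      (Pf := fun q Z => (q.1.1 ≤ Z ∧ q.1.2.2.2.length ≤ Z) ∧ q.2 ≤ Z)
      (PComp.range PComp.id.fst 1 fun a Z h => by rw [pow_one]; omega)
      ((h0.app PComp.id.fst 1 fun a Z h => ⟨by rw [pow_one]; omega, by rw [pow_one]; omega⟩).radd
      ((PComp.cast PComp.id.snd 1 fun a Z h => by rw [pow_one]; omega).rmul PComp.id.fst.snd.fst)) 1
      fun a Z h => ⟨by rw [List.length_range, pow_one]; omega, fun x hx => ?_⟩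
    have := List.mem_range.1 hx
    rw [pow_one]; dsimp only; omega
  refine PComp.foldl (f := fun (q : ℕ × (ℝ × (ℝ × List ℝ))) b c =>
      if decide (cnt q.2.2.1 q.2.2.2 c < cnt q.2.2.1 q.2.2.2 b) then c else b)
    (Pf := fun q Z => q.1.2.2.2.length ≤ Z) h1 h0
    (PComp.ite (PComp.nlt (pcomp_cnt.app (PComp.id.fst.snd.snd.fst.pair
      (PComp.id.fst.snd.snd.snd.pair PComp.id.snd.snd)) 1 fun a Z h => ?_)
      (pcomp_cnt.app (PComp.id.fst.snd.snd.fst.pair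
      (PComp.id.fst.snd.snd.snd.pair PComp.id.snd.fst)) 1 fun a Z h => ?_)) PComp.id.snd.snd
      PComp.id.snd.fst) 1 fun a Z h => ⟨?_, fun _ _ _ _ => ?_⟩
  · rw [pow_one]; exact h.trans (by omega)
  · rw [pow_one]; exact h.trans (by omega)
  · rw [cands, List.length_map, List.length_range, pow_one]; omega
  · rw [pow_one]; exact h.2.trans (by omega)

theorem minL_le_foldl (V : List ℝ) (a : ℝ) :
    V.foldl (fun a v => if decide (v < a) then v else a) a ≤ a ∧
    (∀ v ∈ V, V.foldl (fun a v => if decide (v < a) then v else a) a ≤ v) ∧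
    (V.foldl (fun a v => if decide (v < a) then v else a) a = a ∨
      V.foldl (fun a v => if decide (v < a) then v else a) a ∈ V) := by
  induction V generalizing a with
  | nil => simp
  | cons x V ih =>
    rw [List.foldl_cons]
    obtain ⟨h1, h2, h3⟩ := ih (if decide (x < a) then x else a)
    refine ⟨?_, ?_, ?_⟩
    · refine h1.trans ?_
      split_ifs with h
      · exact (of_decide_eq_true h).le
      · exact le_rfl
    · intro v hv
      rcases List.mem_cons.1 hv with rfl | hv
      · refine h1.trans ?_
        split_ifs with h
        · exact le_rfl
        · exact not_lt.1 (of_decide_eq_false (by simpa using h))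
      · exact h2 v hv
    · rcases h3 with h3 | h3
      · rw [h3]
        split_ifs with h
        · exact Or.inr (by simp)
        · exact Or.inl rfl
      · exact Or.inr (List.mem_cons_of_mem _ h3)

theorem minL_le {V : List ℝ} {v : ℝ} (hv : v ∈ V) : minL V ≤ v := (minL_le_foldl V _).2.1 v hv

theorem minL_mem {V : List ℝ} (hV : V ≠ []) : minL V ∈ V := by
  rcases (minL_le_foldl V (V.headD 0)).2.2 with h | h
  · rw [minL, h]
    cases V with
    | nil => exact absurd rfl hV
    | cons x V => simp
  · exact h

theorem bestCut_foldl {g : ℝ → ℕ} (L : List ℝ) (b : ℝ) :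
    (L.foldl (fun b c => if decide (g c < g b) then c else b) b = b ∨
      L.foldl (fun b c => if decide (g c < g b) then c else b) b ∈ L) ∧
    g (L.foldl (fun b c => if decide (g c < g b) then c else b) b) ≤ g b ∧
    ∀ c ∈ L, g (L.foldl (fun b c => if decide (g c < g b) then c else b) b) ≤ g c := by
  induction L generalizing b with
  | nil => simp
  | cons x L ih =>
    rw [List.foldl_cons]
    obtain ⟨h1, h2, h3⟩ := ih (if decide (g x < g b) then x else b)
    have h4 : g (if decide (g x < g b) then x else b) ≤ g b ∧
        g (if decide (g x < g b) then x else b) ≤ g x := by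
      split_ifs with h
      · exact ⟨(of_decide_eq_true h).le, le_rfl⟩
      · exact ⟨le_rfl, not_lt.1 (of_decide_eq_false (by simpa using h))⟩
    refine ⟨?_, h2.trans h4.1, fun c hc => ?_⟩
    · rcases h1 with h1 | h1
      · rw [h1]
        split_ifs
        · exact Or.inr (by simp)
        · exact Or.inl rfl
      · exact Or.inr (List.mem_cons_of_mem _ h1)
    · rcases List.mem_cons.1 hc with rfl | hc
      · exact h2.trans h4.2
      · exact h3 c hc

theorem bestCut_eq (T : ℕ) (hT : 1 ≤ T) (W z : ℝ) (V : List ℝ) :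
    (∃ t < T, bestCut T W z V = minL V + (T : ℝ) * W + (t : ℝ) * W) ∧
    ∀ t < T, cnt z V (bestCut T W z V) ≤ cnt z V (minL V + (T : ℝ) * W + (t : ℝ) * W) := by
  obtain ⟨h1, h2, h3⟩ := bestCut_foldl (g := cnt z V) (cands T W V) (minL V + (T : ℝ) * W)
  refine ⟨?_, fun t ht => h3 _ (List.mem_map.2 ⟨t, List.mem_range.2 ht, rfl⟩)⟩
  rcases h1 with h1 | h1
  · exact ⟨0, hT, by rw [bestCut, h1]; simp⟩
  · obtain ⟨t, ht, h⟩ := List.mem_map.1 h1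
    exact ⟨t, List.mem_range.1 ht, h.symm⟩

/-- The smallest entry is not above the cut and is therefore removed, so the number of rounds is at
most the number of entries. -/
theorem cutStep_length {T : ℕ} (hT : 1 ≤ T) {W : ℝ} (hW : 0 ≤ W) (z : ℝ) (st : List ℝ × List ℝ) :
    (cutStep T W z st).2.length ≤ st.2.length - 1 := by
  rcases eq_or_ne st.2 [] with h | h
  · simp [cutStep, h]
  · have h1 := minL_mem h
    refine Nat.le_sub_one_of_lt (lt_of_le_of_ne (List.length_filter_le _ _) fun h2 => ?_)
    have h3 := List.length_filter_eq_length_iff.1 h2 _ h1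
    obtain ⟨⟨t, -, ht⟩, -⟩ := bestCut_eq T hT W z st.2
    rw [ht, decide_eq_true_eq] at h3
    have : (0 : ℝ) ≤ T * W := by positivity
    have : (0 : ℝ) ≤ t * W := by positivity
    linarith

theorem cutStep_iterate {T : ℕ} (hT : 1 ≤ T) {W : ℝ} (hW : 0 ≤ W) (z : ℝ) (st : List ℝ × List ℝ) (j : ℕ) :
    ((cutStep T W z)^[j] st).2.length ≤ st.2.length - j ∧
      ((cutStep T W z)^[j] st).1.length = st.1.length + j := by
  induction j with
  | zero => simp
  | succ j ih =>
    rw [Function.iterate_succ_apply']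
    refine ⟨?_, by rw [cutStep, List.length_cons, ih.2]; rfl⟩
    have := cutStep_length hT hW z ((cutStep T W z)^[j] st)
    omega

theorem cuts_eq {T : ℕ} (hT : 1 ≤ T) {W : ℝ} (hW : 0 ≤ W) (z : ℝ) (V : List ℝ) :
    ∃ N ≤ V.length, ((cutStep T W z)^[N] ([], V)).2 = [] ∧ cuts T W z V = ((cutStep T W z)^[N] ([], V)).1 := by
  classical
  have hex : ∃ N, ((cutStep T W z)^[N] ([], V)).2 = [] := ⟨V.length, by
    have := (cutStep_iterate hT hW z ([], V) V.length).1
    exact List.length_eq_zero_iff.1 (by simpa using this)⟩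
  refine ⟨Nat.find hex, Nat.find_min' hex ?_, Nat.find_spec hex, ?_⟩
  · have := (cutStep_iterate hT hW z ([], V) V.length).1
    exact List.length_eq_zero_iff.1 (by simpa using this)
  · rw [cuts, whileFn_eq (N := Nat.find hex) (by simp [Nat.find_spec hex])]
    intro j hj
    have := Nat.find_min hex hj
    simpa using this

theorem length_cuts {T : ℕ} (hT : 1 ≤ T) {W : ℝ} (hW : 0 ≤ W) (z : ℝ) (V : List ℝ) :
    (cuts T W z V).length ≤ V.length := by
  obtain ⟨N, h1, -, h3⟩ := cuts_eq hT hW z V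
  rw [h3, (cutStep_iterate hT hW z ([], V) N).2]
  simpa using h1

theorem pcomp_cuts : PComp (fun q Z => 1 ≤ q.1 ∧ 0 ≤ q.2.1 ∧ q.1 ≤ Z ∧ q.2.2.2.length ≤ Z)
    (fun q : ℕ × (ℝ × (ℝ × List ℝ)) => cuts q.1 q.2.1 q.2.2.1 q.2.2.2) := by
  have hb : PComp (fun q Z => q.1.1 ≤ Z ∧ q.2.2.length ≤ Z)
      (fun q : (ℕ × (ℝ × (ℝ × List ℝ))) × (List ℝ × List ℝ) =>
        bestCut q.1.1 q.1.2.1 q.1.2.2.1 q.2.2) :=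
    pcomp_bestCut.app (PComp.id.fst.fst.pair (PComp.id.fst.snd.fst.pair (PComp.id.fst.snd.snd.fst.pair
      PComp.id.snd.snd))) 1 fun a Z h => ⟨by rw [pow_one]; dsimp only; omega, by rw [pow_one]; dsimp only; omega⟩
  refine PComp.fst (PComp.whileFn (c := fun _ (st : List ℝ × List ℝ) => !st.2.isEmpty)
    (f := fun (q : ℕ × (ℝ × (ℝ × List ℝ))) st => cutStep q.1 q.2.1 q.2.2.1 st)
    (i := fun q => (([] : List ℝ), q.2.2.2)) (Pc := fun _ _ => True)
    (Pf := fun q Z => q.1.1 ≤ Z ∧ q.2.2.length ≤ Z)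
    PComp.id.snd.snd.isEmpty.not (PComp.pair (PComp.cons hb PComp.id.snd.fst)
      (PComp.filter (f := fun (q : (ℕ × (ℝ × (ℝ × List ℝ))) × (List ℝ × List ℝ)) v =>
        decide (bestCut q.1.1 q.1.2.1 q.1.2.2.1 q.2.2 < v))
      (Pf := fun q Z => q.1.1.1 ≤ Z ∧ q.1.2.2.length ≤ Z)
      PComp.id.snd.snd (PComp.rlt (hb.app PComp.id.fst 1 fun a Z h => ?_) PComp.id.snd) 1
      fun a Z h => ?_)) (PComp.nil.pair PComp.id.snd.snd.snd) 1 fun a Z h => ⟨a.2.2.2.length, ?_, ?_, ?_⟩)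
  · rw [pow_one]; omega
  · exact ⟨by rw [pow_one]; omega, fun _ _ => by rw [pow_one]; dsimp only; omega⟩
  · rw [pow_one]; omega
  · have := (cutStep_iterate h.1 h.2.1 a.2.2.1 ([], a.2.2.2) a.2.2.2.length).1
    have := List.length_eq_zero_iff.1 (by simpa using this)
    simp [this]
  · intro j hj _
    have := (cutStep_iterate h.1 h.2.1 a.2.2.1 ([], a.2.2.2) j).1
    refine ⟨trivial, fun _ => ⟨by rw [pow_one]; dsimp only; omega, this.trans ?_⟩⟩
    rw [pow_one]; dsimp only; omega

attribute [irreducible] cuts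

end KCenter

/-! ### Cells of the subdivision and the order of the candidates -/

namespace KCenter

open RealRAM

/-- The `l`-th coordinate. -/
noncomputable def coord (l : ℕ) (s : Pt) : ℝ :=
  ((List.range l).foldl (fun (acc : Pt) _ => acc.tail) s).headD 0

theorem coord_eq (l : ℕ) (s : Pt) : coord l s = s.getD l 0 := by
  have : ∀ l, (List.range l).foldl (fun (acc : Pt) _ => acc.tail) s = s.drop l := by
    intro l
    induction l with
    | zero => rfl
    | succ l ih => rw [List.range_succ, List.foldl_append, ih]; simp
  rw [coord, this]
  simp [List.headD_eq_head?_getD, List.head?_drop]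

/-- The coordinates of the points of `S`. -/
noncomputable def columns (d : ℕ) (S : List Pt) : List (List ℝ) :=
  (List.range d).map fun l => S.map fun s => coord l s

/-- The number of cuts below `v`. -/
noncomputable def below (cs : List ℝ) (v : ℝ) : ℕ := (cs.filter fun H => decide (H < v)).length

/-- The cell of `x` in the subdivision by the cuts `C`, as a number in base `B`. -/
noncomputable def code (B : ℕ) (C : List (List ℝ)) (x : Pt) : ℕ :=
  (C.zip x).foldr (fun p acc => below p.1 p.2 + acc * B) 0

theorem pcomp_coord : PComp (fun q Z => q.1 ≤ Z) (fun q : ℕ × Pt => coord q.1 q.2) :=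
  PComp.headD (PComp.foldl (f := fun _ (acc : Pt) (_ : ℕ) => acc.tail) (Pf := fun _ _ => True)
    (PComp.range PComp.id.fst 1 fun a Z h => by rw [pow_one]; omega) PComp.id.snd PComp.id.snd.fst.tail 1
    fun a Z h => ⟨by rw [List.length_range, pow_one]; omega, fun _ _ _ _ => trivial⟩) PComp.real0

theorem pcomp_columns : PComp (fun q Z => q.1 ≤ Z ∧ q.2.length ≤ Z)
    (fun q : ℕ × List Pt => columns q.1 q.2) := by
  refine PComp.map (f := fun (q : ℕ × List Pt) l => q.2.map fun s => coord l s)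
    (Pf := fun q Z => q.1.2.length ≤ Z ∧ q.2 ≤ Z)
    (PComp.range PComp.id.fst 1 fun a Z h => by rw [pow_one]; omega)
    (PComp.map (f := fun (q : (ℕ × List Pt) × ℕ) s => coord q.2 s) (Pf := fun q Z => q.1.2 ≤ Z)
      PComp.id.fst.snd (pcomp_coord.app (PComp.id.fst.snd.pair PComp.id.snd) 1
        fun a Z h => by rw [pow_one]; dsimp only; omega) 1 fun a Z h => ?_) 1 fun a Z h => ?_
  · exact ⟨by rw [pow_one]; omega, fun _ _ => by rw [pow_one]; dsimp only; omega⟩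
  · refine ⟨by rw [List.length_range, pow_one]; omega, fun x hx => ?_⟩
    have := List.mem_range.1 hx
    rw [pow_one]; dsimp only; omega

theorem pcomp_below : PComp (fun q Z => q.1.length ≤ Z) (fun q : List ℝ × ℝ => below q.1 q.2) :=
  PComp.length (PComp.filter (f := fun (q : List ℝ × ℝ) H => decide (H < q.2)) (Pf := fun _ _ => True)
    PComp.id.fst (PComp.id.snd.rlt PComp.id.fst.snd) 1
      fun a Z h => ⟨by rw [pow_one]; omega, fun _ _ => trivial⟩) 1
    fun a Z h => (List.length_filter_le _ _).trans (by rw [pow_one]; omega)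

theorem pcomp_code : PComp (fun q Z => q.1 ≤ Z ∧ q.2.1.length ≤ Z ∧ ∀ c ∈ q.2.1, c.length ≤ Z)
    (fun q : ℕ × (List (List ℝ) × Pt) => code q.1 q.2.1 q.2.2) := by
  refine PComp.foldr (f := fun (q : ℕ × (List (List ℝ) × Pt)) (p : List ℝ × ℝ) (acc : ℕ) =>
      below p.1 p.2 + acc * q.1) (Pf := fun q Z => q.1.1 ≤ Z ∧ q.2.1.1.length ≤ Z)
    (PComp.zip PComp.id.snd.fst PComp.id.snd.snd 1 fun a Z h => ?_) (PComp.natConst 0)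
    (PComp.nadd (pcomp_below.app PComp.id.snd.fst 1 fun a Z h => ?_)
      (PComp.nmul PComp.id.snd.snd PComp.id.fst.fst 1 fun a Z h => ?_)) 1
    fun a Z h => ⟨?_, fun pre x suf he => ?_⟩
  · rw [pow_one]; omega
  · rw [pow_one]; omega
  · rw [pow_one]; omega
  · rw [List.length_zip, pow_one]; omega
  · have h1 : x.1 ∈ a.2.1 := by
      have : x ∈ a.2.1.zip a.2.2 := by rw [he]; simp
      exact (List.of_mem_zip (a := x.1) (b := x.2) this).1
    have := h.2.2 _ h1
    rw [pow_one]; dsimp only; omega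

/-- Lexicographic comparison of keys. -/
noncomputable def keyLt (a b : ℕ × ℝ) : Bool :=
  decide (a.1 < b.1) || (!decide (b.1 < a.1) && decide (a.2 < b.2))

/-- Insertion into a list that is sorted by the keys. -/
noncomputable def insertKey (x : (ℕ × ℝ) × Pt) (l : List ((ℕ × ℝ) × Pt)) : List ((ℕ × ℝ) × Pt) :=
  (l.filter fun y => keyLt y.1 x.1) ++ x :: l.filter fun y => !keyLt y.1 x.1

noncomputable def sortKey (l : List ((ℕ × ℝ) × Pt)) : List ((ℕ × ℝ) × Pt) :=
  l.foldr (fun x acc => insertKey x acc) []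

/-- The points of `X`, cell by cell, and within each cell by their first coordinate. -/
noncomputable def ordered (B : ℕ) (C : List (List ℝ)) (X : List Pt) : List Pt :=
  (sortKey (X.map fun x => ((code B C x, x.headD 0), x))).map fun y => y.2

theorem pcomp_keyLt {α : Type} [HeapRep α] {P : α → ℕ → Prop} {f g : α → ℕ × ℝ} (hf : PComp P f) (hg : PComp P g) :
    PComp P (fun a => keyLt (f a) (g a)) :=
  (hf.fst.nlt hg.fst).or ((hg.fst.nlt hf.fst).not.and (hf.snd.rlt hg.snd))

theorem mem_insertKey (x y : (ℕ × ℝ) × Pt) (l : List ((ℕ × ℝ) × Pt)) :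
    y ∈ insertKey x l ↔ y = x ∨ y ∈ l := by
  simp only [insertKey, List.mem_append, List.mem_filter, List.mem_cons]
  cases keyLt y.1 x.1 <;> simp; tauto

theorem length_insertKey (x : (ℕ × ℝ) × Pt) (l : List ((ℕ × ℝ) × Pt)) :
    (insertKey x l).length = l.length + 1 := by
  have h := List.length_eq_length_filter_add (l := l) (fun y => keyLt y.1 x.1)
  simp only [insertKey, List.length_append, List.length_cons]
  omega

theorem mem_sortKey (y : (ℕ × ℝ) × Pt) (l : List ((ℕ × ℝ) × Pt)) : y ∈ sortKey l ↔ y ∈ l := by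
  induction l with
  | nil => simp [sortKey]
  | cons x l ih => rw [sortKey, List.foldr_cons, mem_insertKey, List.mem_cons, ← sortKey, ih]

theorem length_sortKey (l : List ((ℕ × ℝ) × Pt)) : (sortKey l).length = l.length := by
  induction l with
  | nil => rfl
  | cons x l ih => rw [sortKey, List.foldr_cons, length_insertKey, ← sortKey, ih, List.length_cons]

/-- Connects the computable test with the linear order on `ℕ ×ₗ ℝ`, whose transitivity gives
sortedness. -/
theorem keyLt_iff (a b : ℕ × ℝ) : keyLt a b = true ↔ toLex a < toLex b := by
  rw [Prod.Lex.toLex_lt_toLex]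
  simp only [keyLt, Bool.or_eq_true, Bool.and_eq_true, decide_eq_true_eq, Bool.not_eq_true',
    decide_eq_false_iff_not, not_lt]
  constructor
  · rintro (h | ⟨h, h'⟩)
    · exact Or.inl h
    · rcases h.lt_or_eq with h | h
      · exact Or.inl h
      · exact Or.inr ⟨h, h'⟩
  · rintro (h | ⟨h, h'⟩)
    · exact Or.inl h
    · exact Or.inr ⟨h.le, h'⟩

theorem pairwise_sortKey (l : List ((ℕ × ℝ) × Pt)) :
    (sortKey l).Pairwise fun a b => toLex a.1 ≤ toLex b.1 := by
  induction l with
  | nil => exact List.Pairwise.nil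
  | cons x l ih =>
    rw [sortKey, List.foldr_cons, ← sortKey, insertKey, List.pairwise_append, List.pairwise_cons]
    simp only [List.mem_filter, List.mem_cons, keyLt_iff, Bool.not_eq_true', ← Bool.not_eq_true, not_lt]
    refine ⟨ih.filter _, ⟨fun a ha => ha.2, ih.filter _⟩, fun a ha b hb => ?_⟩
    rcases hb with rfl | hb
    · exact ha.2.le
    · exact ha.2.le.trans hb.2

theorem mem_ordered {B : ℕ} {C : List (List ℝ)} {X : List Pt} {x : Pt} : x ∈ ordered B C X ↔ x ∈ X := by
  simp only [ordered, List.mem_map, mem_sortKey]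
  constructor
  · rintro ⟨_, ⟨y, hy, rfl⟩, rfl⟩; exact hy
  · intro h; exact ⟨_, ⟨x, h, rfl⟩, rfl⟩

theorem length_ordered (B : ℕ) (C : List (List ℝ)) (X : List Pt) : (ordered B C X).length = X.length := by
  rw [ordered, List.length_map, length_sortKey, List.length_map]

theorem pairwise_ordered (B : ℕ) (C : List (List ℝ)) (X : List Pt) :
    (ordered B C X).Pairwise fun a b =>
      toLex (code B C a, a.headD 0) ≤ toLex (code B C b, b.headD 0) := by
  rw [ordered, List.pairwise_map]
  refine (pairwise_sortKey _).imp_of_mem fun {a b} ha hb h => ?_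
  obtain ⟨x, -, rfl⟩ := List.mem_map.1 ((mem_sortKey _ _).1 ha)
  obtain ⟨y, -, rfl⟩ := List.mem_map.1 ((mem_sortKey _ _).1 hb)
  exact h

theorem pcomp_ordered : PComp (fun q Z => q.1 ≤ Z ∧ (q.2.1.length ≤ Z ∧ ∀ c ∈ q.2.1, c.length ≤ Z) ∧
      q.2.2.length ≤ Z)
    (fun q : ℕ × (List (List ℝ) × List Pt) => ordered q.1 q.2.1 q.2.2) := by
  have h1 : PComp (fun q Z => q.1 ≤ Z ∧ (q.2.1.length ≤ Z ∧ ∀ c ∈ q.2.1, c.length ≤ Z) ∧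
      q.2.2.length ≤ Z) (fun q : ℕ × (List (List ℝ) × List Pt) =>
        q.2.2.map fun x => ((code q.1 q.2.1 x, x.headD 0), x)) := by
    refine PComp.map (f := fun (q : ℕ × (List (List ℝ) × List Pt)) x => ((code q.1 q.2.1 x, x.headD 0), x))
      (Pf := fun q Z => q.1.1 ≤ Z ∧ (q.1.2.1.length ≤ Z ∧ ∀ c ∈ q.1.2.1, c.length ≤ Z))
      PComp.id.snd.snd (((pcomp_code.app (PComp.id.fst.fst.pair (PComp.id.fst.snd.fst.pair PComp.id.snd)) 1
        fun a Z h => ?_).pair (PComp.id.snd.headD PComp.real0)).pair PComp.id.snd) 1 fun a Z h => ?_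
    · exact ⟨by rw [pow_one]; dsimp only; omega, by rw [pow_one]; dsimp only; omega,
        fun c hc => (h.2.2 c hc).trans (by rw [pow_one]; omega)⟩
    · exact ⟨by rw [pow_one]; omega, fun _ _ => ⟨by rw [pow_one]; dsimp only; omega,
        by rw [pow_one]; dsimp only; omega,
        fun c hc => (h.2.1.2 c hc).trans (by rw [pow_one]; omega)⟩⟩
  have h2 : PComp (fun q Z => q.2.length ≤ Z) (fun q : ((ℕ × ℝ) × Pt) × List ((ℕ × ℝ) × Pt) =>
      insertKey q.1 q.2) := by
    have h3 : PComp (fun q Z => q.2.length ≤ Z) (fun q : ((ℕ × ℝ) × Pt) × List ((ℕ × ℝ) × Pt) =>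
        q.2.filter fun y => keyLt y.1 q.1.1) :=
      PComp.filter (f := fun (q : ((ℕ × ℝ) × Pt) × List ((ℕ × ℝ) × Pt)) y => keyLt y.1 q.1.1)
        (Pf := fun _ _ => True) PComp.id.snd (pcomp_keyLt PComp.id.snd.fst PComp.id.fst.fst.fst) 1
        fun a Z h => ⟨by rw [pow_one]; omega, fun _ _ => trivial⟩
    refine PComp.append h3 (PComp.cons PComp.id.fst
      (PComp.filter (f := fun (q : ((ℕ × ℝ) × Pt) × List ((ℕ × ℝ) × Pt)) y => !keyLt y.1 q.1.1)
        (Pf := fun _ _ => True) PComp.id.snd (pcomp_keyLt PComp.id.snd.fst PComp.id.fst.fst.fst).not 1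
        fun a Z h => ⟨by rw [pow_one]; omega, fun _ _ => trivial⟩)) 1
      fun a Z h => (List.length_filter_le _ _).trans (by rw [pow_one]; omega)
  have h4 : PComp (fun q Z => q.length ≤ Z) sortKey :=
    PComp.foldr (f := fun _ (x : (ℕ × ℝ) × Pt) acc => insertKey x acc) (Pf := fun q Z => q.2.2.length ≤ Z)
      PComp.id PComp.nil (h2.app PComp.id.snd 1 fun a Z h => by rw [pow_one]; omega) 1
      fun a Z h => ⟨by rw [pow_one]; omega, fun pre x suf he => by
        have h5 := length_sortKey suf
        rw [sortKey] at h5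
        dsimp only
        rw [h5, pow_one]
        rw [he] at h
        simp at h
        omega⟩
  exact PComp.map (f := fun _ (y : (ℕ × ℝ) × Pt) => y.2) (Pf := fun _ _ => True)
    (h4.app h1 1 fun a Z h => by rw [List.length_map, pow_one]; omega) PComp.id.snd.snd 1
    fun a Z h => ⟨by rw [length_sortKey, List.length_map, pow_one]; omega, fun _ _ => trivial⟩

end KCenter

/-! ### The second phase: candidates, search for the radius, centers -/

namespace KCenter

open RealRAM

/-- The cuts for every coordinate. -/
noncomputable def allCuts (d k : ℕ) (u : ℝ) (S : List Pt) : List (List ℝ) :=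
  -- As `r ≤ d * u`, the margin `2 * (d * u)` is at least every radius up to `2 * r`. The spacing `5
  -- * (d * u)` exceeds twice the margin, so neighbourhoods of different cut positions are disjoint.
  (columns d S).map (cuts (sideT d k) (5 * ((d : ℝ) * u)) (2 * ((d : ℝ) * u)))

/-- The ordered candidate centers. -/
noncomputable def candidates (d k : ℕ) (e u : ℝ) (S : List Pt) : List Pt :=
  -- Each coordinate has at most `S.length` cuts, so the number of cuts below a value is a valid
  -- digit in base `S.length + 1`.
  ordered (S.length + 1) (allCuts d k u S) (grid d e u S)

/-- The size of the input of `candidates`. -/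
def CandSize (d k : ℕ) (e u : ℝ) (S : List Pt) (Z : ℕ) : Prop :=
  1 ≤ d ∧ d ≤ Z ∧ k ≤ Z ∧ 0 ≤ u ∧ ⌈128 * ((d : ℝ) * (d : ℝ)) / e⌉₊ ≤ Z ∧ Small S Z ∧
    ∀ s ∈ S, (2 * ⌈128 * ((d : ℝ) * (d : ℝ)) / e⌉₊ + 1) ^ s.length ≤ Z

/-- Both directions are needed later: `T` is large enough for few points to be close to cuts, and by
minimality small enough for cells to contain few points. -/
theorem sideT_exists {d : ℕ} (hd : 1 ≤ d) (k : ℕ) : ∃ N ≤ k, sideT d k = N + 1 ∧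
    (k : ℝ) ≤ ((sideT d k : ℝ) * ((d : ℝ) * (d : ℝ))) ^ d ∧
    ∀ j < N, (((j + 1 : ℕ) : ℝ) * ((d : ℝ) * (d : ℝ))) ^ d < k := by
  classical
  have hex : ∃ N : ℕ, (k : ℝ) ≤ (((N + 1 : ℕ) : ℝ) * ((d : ℝ) * (d : ℝ))) ^ d := ⟨k, le_side_pow hd k⟩
  have h : sideT d k = Nat.find hex + 1 := by
    rw [sideT, whileFn_eq (N := Nat.find hex), iterate_succ_one]
    · rw [iterate_succ_one, decide_eq_false_iff_not, not_lt]
      exact Nat.find_spec hex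
    · intro j hj
      rw [iterate_succ_one, decide_eq_true_eq]
      exact not_le.1 (Nat.find_min hex hj)
  exact ⟨_, Nat.find_min' hex (le_side_pow hd k), h, by rw [h]; exact Nat.find_spec hex,
    fun j hj => not_le.1 (Nat.find_min hex hj)⟩

theorem pcomp_allCuts : PComp (fun q Z => 1 ≤ q.1 ∧ q.1 ≤ Z ∧ q.2.1 ≤ Z ∧ 0 ≤ q.2.2.1 ∧ q.2.2.2.length ≤ Z)
    (fun q : ℕ × (ℕ × (ℝ × List Pt)) => allCuts q.1 q.2.1 q.2.2.1 q.2.2.2) := by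
  have hs : PComp (fun q Z => 1 ≤ q.1.1 ∧ q.1.1 ≤ Z ∧ q.1.2.1 ≤ Z ∧ 0 ≤ q.1.2.2.1 ∧ q.2.length ≤ Z)
      (fun q : (ℕ × (ℕ × (ℝ × List Pt))) × List ℝ => sideT q.1.1 q.1.2.1) :=
    pcomp_sideT.app (PComp.id.fst.fst.pair PComp.id.fst.snd.fst) 1
      fun a Z h => by rw [pow_one]; dsimp only; omega
  have hu : PComp (fun q Z => 1 ≤ q.1.1 ∧ q.1.1 ≤ Z ∧ q.1.2.1 ≤ Z ∧ 0 ≤ q.1.2.2.1 ∧ q.2.length ≤ Z)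
      (fun q : (ℕ × (ℕ × (ℝ × List Pt))) × List ℝ => (q.1.1 : ℝ) * q.1.2.2.1) :=
    (PComp.cast PComp.id.fst.fst 1 fun a Z h => by rw [pow_one]; omega).rmul PComp.id.fst.snd.snd.fst
  have hc : PComp (fun q Z => 1 ≤ q.1.1 ∧ q.1.1 ≤ Z ∧ q.1.2.1 ≤ Z ∧ 0 ≤ q.1.2.2.1 ∧ q.2.length ≤ Z)
      (fun q : (ℕ × (ℕ × (ℝ × List Pt))) × List ℝ => cuts (sideT q.1.1 q.1.2.1)
        (5 * ((q.1.1 : ℝ) * q.1.2.2.1)) (2 * ((q.1.1 : ℝ) * q.1.2.2.1)) q.2) := by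
    refine pcomp_cuts.app (hs.pair (((PComp.realNat 5).rmul hu).pair (((PComp.realNat 2).rmul hu).pair
      PComp.id.snd))) 1 fun a Z h => ?_
    obtain ⟨h1, h2, h3, h4, h5⟩ := h
    obtain ⟨N, h6, h7, -⟩ := sideT_exists h1 a.1.2.1
    refine ⟨by dsimp only; omega, ?_, by rw [pow_one]; dsimp only; omega, by rw [pow_one]; dsimp only; omega⟩
    exact mul_nonneg (by norm_num) (mul_nonneg (Nat.cast_nonneg _) h4)
  refine PComp.map (f := fun (q : ℕ × (ℕ × (ℝ × List Pt))) (V : List ℝ) =>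
      cuts (sideT q.1 q.2.1) (5 * ((q.1 : ℝ) * q.2.2.1)) (2 * ((q.1 : ℝ) * q.2.2.1)) V)
    (pcomp_columns.app (PComp.id.fst.pair PComp.id.snd.snd.snd) 1 fun a Z h => ?_) hc 1 fun a Z h => ?_
  · rw [pow_one]; dsimp only; omega
  · obtain ⟨h1, h2, h3, h4, h5⟩ := h
    refine ⟨by rw [columns, List.length_map, List.length_range, pow_one]; omega, fun x hx => ?_⟩
    obtain ⟨l, -, rfl⟩ := List.mem_map.1 hx
    refine ⟨h1, ?_, ?_, h4, ?_⟩
    · rw [pow_one]; dsimp only; omega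
    · rw [pow_one]; dsimp only; omega
    · rw [List.length_map, pow_one]; omega

theorem length_allCuts (d k : ℕ) (u : ℝ) (S : List Pt) : (allCuts d k u S).length = d := by
  rw [allCuts, columns, List.length_map, List.length_map, List.length_range]

theorem length_of_mem_allCuts {d k : ℕ} (hd : 1 ≤ d) {u : ℝ} (hu : 0 ≤ u) {S : List Pt} {c : List ℝ}
    (hc : c ∈ allCuts d k u S) : c.length ≤ S.length := by
  obtain ⟨V, hV, rfl⟩ := List.mem_map.1 hc
  obtain ⟨l, -, rfl⟩ := List.mem_map.1 hV
  obtain ⟨N, -, h, -⟩ := sideT_exists hd k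
  refine (length_cuts (by omega) (by positivity) _ _).trans (by rw [List.length_map])

theorem length_grid_le (d : ℕ) (e u : ℝ) (S : List Pt) {K : ℕ}
    (h : ∀ s ∈ S, (2 * ⌈128 * ((d : ℝ) * (d : ℝ)) / e⌉₊ + 1) ^ s.length ≤ K) :
    (grid d e u S).length ≤ S.length * K := by
  rw [grid, List.length_flatMap]
  refine (List.sum_le_card_nsmul _ K fun x hx => ?_).trans (by simp)
  obtain ⟨s, hs, rfl⟩ := List.mem_map.1 hx
  rw [length_around, length_steps]
  exact h s hs

theorem pcomp_candidates : PComp (fun q Z => CandSize q.1 q.2.1 q.2.2.1 q.2.2.2.1 q.2.2.2.2 Z)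
    (fun q : ℕ × (ℕ × (ℝ × (ℝ × List Pt))) =>
      candidates q.1 q.2.1 q.2.2.1 q.2.2.2.1 q.2.2.2.2) := by
  refine pcomp_ordered.app (((PComp.length PComp.id.snd.snd.snd.snd 1 fun a Z h => ?_).nadd
    (PComp.natConst 1)).pair ((pcomp_allCuts.app (PComp.id.fst.pair (PComp.id.snd.fst.pair
      PComp.id.snd.snd.snd)) 1 fun a Z h => ?_).pair (pcomp_grid.app
      (PComp.id.fst.pair PComp.id.snd.snd) 1 fun a Z h => ?_))) 2 fun a Z h => ?_
  all_goals obtain ⟨h1, h2, h3, h4, h5, h6, h7⟩ := h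
  · exact h6.pow.1
  · exact ⟨h1, by rw [pow_one]; dsimp only; omega, by rw [pow_one]; dsimp only; omega, h4, h6.pow.1⟩
  · exact ⟨by rw [pow_one]; dsimp only; omega, h5.trans (by rw [pow_one]; omega), h6.pow,
      fun s hs => (h7 s hs).trans (by rw [pow_one]; omega)⟩
  · have h8 := h6.1
    refine ⟨?_, ⟨?_, fun c hc => ?_⟩, ?_⟩
    · dsimp only; nlinarith
    · dsimp only; rw [length_allCuts]; nlinarith
    · exact (length_of_mem_allCuts h1 h4 hc).trans (by nlinarith)
    · exact (length_grid_le _ _ _ _ h7).trans (by nlinarith)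

/-- The centers that the dynamic program finds. -/
noncomputable def dpCenters (k : ℕ) (e rsq : ℝ) (S X : List Pt) : List Pt :=
  -- All radii are squared: the search runs over the squares of `r / 2 * (1 + e / 16) ^ j`.
  (dp k (radius k S X ((1 + e / 16) * (1 + e / 16)) (rsq / 4)) S X).headD []

/-- The size of all runs of the dynamic program. -/
def RunSize (k : ℕ) (e rsq : ℝ) (S X : List Pt) (Z : ℕ) : Prop :=
  ∃ N ≤ Z, dp k (rsq / 4 * ((1 + e / 16) * (1 + e / 16)) ^ N) S X ≠ [] ∧
    ∀ j ≤ N, (∀ l < j, dp k (rsq / 4 * ((1 + e / 16) * (1 + e / 16)) ^ l) S X = []) →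
      DpSize k (rsq / 4 * ((1 + e / 16) * (1 + e / 16)) ^ j) S X Z

theorem iterate_mul_right (ρ t : ℝ) (j : ℕ) : (fun ρ => ρ * t)^[j] ρ = ρ * t ^ j := by
  induction j with
  | zero => simp
  | succ j ih => rw [Function.iterate_succ_apply', ih]; ring

theorem radius_eq {k : ℕ} {S X : List Pt} {t ρ : ℝ} {N : ℕ} (hN : dp k (ρ * t ^ N) S X ≠ []) :
    ∃ j ≤ N, radius k S X t ρ = ρ * t ^ j ∧ dp k (ρ * t ^ j) S X ≠ [] ∧
      ∀ l < j, dp k (ρ * t ^ l) S X = [] := by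
  classical
  have hex : ∃ N, dp k (ρ * t ^ N) S X ≠ [] := ⟨N, hN⟩
  refine ⟨Nat.find hex, Nat.find_min' hex hN, ?_, Nat.find_spec hex, fun l hl =>
    not_not.1 (Nat.find_min hex hl)⟩
  rw [radius, whileFn_eq (N := Nat.find hex), iterate_mul_right]
  · simpa [iterate_mul_right] using Nat.find_spec hex
  · intro j hj
    simpa [iterate_mul_right] using Nat.find_min hex hj

theorem DpSize.mono {k : ℕ} {ρ : ℝ} {S X : List Pt} {Z Z' : ℕ} (h : DpSize k ρ S X Z) (hZ : Z ≤ Z') :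
    DpSize k ρ S X Z' := by
  obtain ⟨⟨h1, h2⟩, h3, h4⟩ := h
  exact ⟨⟨h1.trans hZ, fun s hs => (h2 s hs).trans hZ⟩, h3.trans hZ, fun Y Y' hY =>
    ⟨(h4 Y Y' hY).1.trans hZ, fun c hc => ((h4 Y Y' hY).2 c hc).trans hZ⟩⟩

theorem pcomp_dpCenters : PComp (fun q Z => RunSize q.1 q.2.1 q.2.2.1 q.2.2.2.1 q.2.2.2.2 Z)
    (fun q : ℕ × (ℝ × (ℝ × (List Pt × List Pt))) =>
      dpCenters q.1 q.2.1 q.2.2.1 q.2.2.2.1 q.2.2.2.2) := by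
  have ht : PComp (fun q Z => RunSize q.1 q.2.1 q.2.2.1 q.2.2.2.1 q.2.2.2.2 Z)
    (fun q : ℕ × (ℝ × (ℝ × (List Pt × List Pt))) => 1 + q.2.1 / 16) :=
    PComp.real1.radd (PComp.id.snd.fst.rdiv (PComp.realNat 16))
  refine PComp.headD (pcomp_dp.app (PComp.id.fst.pair ((pcomp_radius.app (PComp.id.fst.pair
    (PComp.id.snd.snd.snd.fst.pair (PComp.id.snd.snd.snd.snd.pair ((ht.rmul ht).pair
      (PComp.id.snd.snd.fst.rdiv (PComp.realNat 4)))))) 1 fun a Z h => ?_).pair PComp.id.snd.snd.snd)) 1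
    fun a Z h => ?_) PComp.nil
  · obtain ⟨N, h1, h2, h3⟩ := h
    exact ⟨N, h1.trans (by rw [pow_one]; omega), h2, fun j hj hl => (h3 j hj hl).mono (by rw [pow_one]; omega)⟩
  · obtain ⟨N, h1, h2, h3⟩ := h
    obtain ⟨j, h4, h5, h6, h7⟩ := radius_eq h2
    exact (h5 ▸ h3 j h4 h7 : DpSize _ (radius _ _ _ _ _) _ _ _).mono (by rw [pow_one]; omega)

attribute [irreducible] candidates dpCenters

/-- The coordinates of at least `k` centers, starting with those of `F`. -/
noncomputable def padded (k : ℕ) (F S : List Pt) : List ℝ :=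
  (F ++ (List.range k).map fun _ => S.headD []).flatMap fun x => x

/-- The second phase of the algorithm, for the net `S`. -/
noncomputable def improve (d k : ℕ) (e u rsq : ℝ) (S : List Pt) : List ℝ :=
  padded k (dpCenters k e rsq S (candidates d k e u S)) S

theorem CandSize.mono {d k : ℕ} {e u : ℝ} {S : List Pt} {Z Z' : ℕ} (h : CandSize d k e u S Z)
    (hZ : Z ≤ Z') : CandSize d k e u S Z' := by
  obtain ⟨h1, h2, h3, h4, h5, h6, h7⟩ := h
  exact ⟨h1, h2.trans hZ, h3.trans hZ, h4, h5.trans hZ, h6.mono hZ, fun s hs => (h7 s hs).trans hZ⟩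

theorem RunSize.mono {k : ℕ} {e rsq : ℝ} {S X : List Pt} {Z Z' : ℕ} (h : RunSize k e rsq S X Z)
    (hZ : Z ≤ Z') : RunSize k e rsq S X Z' := by
  obtain ⟨N, h1, h2, h3⟩ := h
  exact ⟨N, h1.trans hZ, h2, fun j hj hl => (h3 j hj hl).mono hZ⟩

/-- The size of all intermediate results of `improve`. -/
def RefSize (d k : ℕ) (e u rsq : ℝ) (S : List Pt) (Z : ℕ) : Prop :=
  CandSize d k e u S Z ∧ RunSize k e rsq S (candidates d k e u S) Z ∧
    (dpCenters k e rsq S (candidates d k e u S)).length ≤ Z ∧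
    (∀ x ∈ dpCenters k e rsq S (candidates d k e u S), x.length ≤ Z)

theorem headD_mem_or {α : Type} (S : List α) (a : α) : S.headD a = a ∨ S.headD a ∈ S := by
  cases S <;> simp

theorem pcomp_improve : PComp (fun q Z => RefSize q.1 q.2.1 q.2.2.1 q.2.2.2.1 q.2.2.2.2.1 q.2.2.2.2.2 Z)
    (fun q : ℕ × (ℕ × (ℝ × (ℝ × (ℝ × List Pt)))) =>
      improve q.1 q.2.1 q.2.2.1 q.2.2.2.1 q.2.2.2.2.1 q.2.2.2.2.2) := by
  have hX : PComp (fun q Z => RefSize q.1 q.2.1 q.2.2.1 q.2.2.2.1 q.2.2.2.2.1 q.2.2.2.2.2 Z)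
      (fun q : ℕ × (ℕ × (ℝ × (ℝ × (ℝ × List Pt)))) =>
        candidates q.1 q.2.1 q.2.2.1 q.2.2.2.1 q.2.2.2.2.2) :=
    pcomp_candidates.app (PComp.id.fst.pair (PComp.id.snd.fst.pair
      (PComp.id.snd.snd.fst.pair (PComp.id.snd.snd.snd.fst.pair PComp.id.snd.snd.snd.snd.snd)))) 1
      fun a Z h => h.1.mono (by rw [pow_one]; omega)
  have hF : PComp (fun q Z => RefSize q.1 q.2.1 q.2.2.1 q.2.2.2.1 q.2.2.2.2.1 q.2.2.2.2.2 Z)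
      (fun q : ℕ × (ℕ × (ℝ × (ℝ × (ℝ × List Pt)))) =>
        dpCenters q.2.1 q.2.2.1 q.2.2.2.2.1 q.2.2.2.2.2
          (candidates q.1 q.2.1 q.2.2.1 q.2.2.2.1 q.2.2.2.2.2)) :=
    pcomp_dpCenters.app (PComp.id.snd.fst.pair (PComp.id.snd.snd.fst.pair
      (PComp.id.snd.snd.snd.snd.fst.pair (PComp.id.snd.snd.snd.snd.snd.pair hX)))) 1
      fun a Z h => h.2.1.mono (by rw [pow_one]; omega)
  have hR : PComp (fun q Z => q.1 ≤ Z) (fun q : ℕ × List Pt => (List.range q.1).map fun _ => q.2.headD []) :=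
    PComp.map (f := fun (q : ℕ × List Pt) (_ : ℕ) => q.2.headD []) (Pf := fun _ _ => True)
      (PComp.range PComp.id.fst 1 fun a Z h => by rw [pow_one]; omega) (PComp.id.fst.snd.headD PComp.nil) 1
      fun a Z h => ⟨by rw [List.length_range, pow_one]; omega, fun _ _ => trivial⟩
  have hA := hF.append (hR.app (PComp.id.snd.fst.pair PComp.id.snd.snd.snd.snd.snd) 1 fun a Z h => ?_) 1
    fun a Z h => h.2.2.1.trans (by rw [pow_one]; omega)
  · refine PComp.flatMap (f := fun _ (x : Pt) => x) (Pf := fun _ _ => True) hA PComp.id.snd 2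
      fun a Z h => ⟨?_, fun x hx => ⟨trivial, ?_⟩⟩
    · rw [List.length_append, List.length_map, List.length_range]
      have h1 := h.2.2.1
      have h2 := h.1.2.2.1
      nlinarith
    · refine le_trans (b := Z) ?_ (by nlinarith)
      rcases List.mem_append.1 hx with hx | hx
      · exact h.2.2.2 x hx
      · obtain ⟨_, -, rfl⟩ := List.mem_map.1 hx
        rcases headD_mem_or a.2.2.2.2.2 [] with h1 | h1
        · rw [h1]; simp
        · exact h.1.2.2.2.2.2.1.2 _ h1
  · have := h.1.2.2.1
    rw [pow_one]; dsimp only; omega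

attribute [irreducible] improve

end KCenter

/-! ### Parsing the input, and the complete algorithm -/

namespace KCenter

open RealRAM

/-- Reads `d` coordinates, the last one first. -/
noncomputable def takeRow (d : ℕ) (flat : List ℝ) : List ℝ × List ℝ :=
  (fun st : List ℝ × List ℝ => (st.1.tail, st.1.headD 0 :: st.2))^[d] (flat, [])

noncomputable def rowStep (d : ℕ) (st : List ℝ × List Pt) : List ℝ × List Pt :=
  ((takeRow d st.1).1, (takeRow d st.1).2 :: st.2)

/-- The `n` points of dimension `d` whose coordinates, in reverse order, are the list `flat`. -/
noncomputable def rows (n d : ℕ) (flat : List ℝ) : List Pt := ((rowStep d)^[n] (flat, [])).2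

/-- Since the flat list is reversed, taking coordinates from its head and consing them restores
their order; for the rows it is the same. -/
theorem takeRow_reverse (g : ℕ → ℝ) (m d : ℕ) :
    takeRow d ((List.range (m + d)).map g).reverse =
      (((List.range m).map g).reverse, (List.range d).map fun l => g (m + l)) := by
  have key : ∀ j ≤ d, (fun st : List ℝ × List ℝ => (st.1.tail, st.1.headD 0 :: st.2))^[j]
      (((List.range (m + d)).map g).reverse, []) =
      (((List.range (m + d - j)).map g).reverse, (List.range j).map fun l => g (m + d - j + l)) := by
    intro j hj
    induction j with
    | zero => simp
    | succ j ih =>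
      rw [Function.iterate_succ_apply', ih (by omega), show m + d - j = m + d - (j + 1) + 1 by omega,
        List.range_succ, List.range_succ_eq_map]
      simp [Function.comp_def, add_assoc, add_comm 1]
  rw [takeRow, key d le_rfl]
  simp

theorem rows_reverse (g : ℕ → ℝ) (n d : ℕ) : rows n d ((List.range (n * d)).map g).reverse =
    (List.range n).map fun i => (List.range d).map fun l => g (i * d + l) := by
  have key : ∀ j ≤ n, (rowStep d)^[j] (((List.range (n * d)).map g).reverse, []) =
      (((List.range ((n - j) * d)).map g).reverse,
        (List.range j).map fun i => (List.range d).map fun l => g ((n - j + i) * d + l)) := by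
    intro j hj
    induction j with
    | zero => simp
    | succ j ih =>
      obtain ⟨r, rfl⟩ := Nat.exists_eq_add_of_le hj
      rw [Function.iterate_succ_apply', ih (by omega), rowStep,
        show (j + 1 + r - j) * d = r * d + d by rw [show j + 1 + r - j = r + 1 by omega]; ring,
        takeRow_reverse, show j + 1 + r - (j + 1) = r by omega, show j + 1 + r - j = r + 1 by omega,
        List.range_succ_eq_map (n := j)]
      simp [Function.comp_def, add_assoc, add_comm 1]
  rw [rows, key n le_rfl]
  simp

theorem comp_takeRow : Comp (fun q τ => q.1 ≤ τ) (fun q : ℕ × List ℝ => takeRow q.1 q.2) :=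
  Comp.iterate (f := fun _ (st : List ℝ × List ℝ) => (st.1.tail, st.1.headD 0 :: st.2)) (Rf := O1)
    Comp.id'.fst' (Comp.id'.snd'.pair' Comp.nil') (Comp.id'.snd'.fst'.tail.pair'
      (Comp.cons (Comp.headD Comp.id'.snd'.fst' Comp.real0) Comp.id'.snd'.snd')) 1
    fun a τ h => ⟨0, by omega, fun _ _ => trivial⟩

theorem comp_rows : Comp (fun q τ => q.1 * (q.2.1 + 1) ≤ τ)
    (fun q : ℕ × (ℕ × List ℝ) => rows q.1 q.2.1 q.2.2) := by
  have h : Comp (fun q τ => q.1.2.1 ≤ τ) (fun q : (ℕ × (ℕ × List ℝ)) × (List ℝ × List Pt) =>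
      takeRow q.1.2.1 q.2.1) :=
    Comp.app comp_takeRow (Comp.id'.fst'.snd'.fst'.pair' Comp.id'.snd'.fst') 1
      fun a τ h => by dsimp only; omega
  exact Comp.snd' (Comp.iterate (f := fun (q : ℕ × (ℕ × List ℝ)) st => rowStep q.2.1 st)
    (i := fun q => (q.2.2, ([] : List Pt))) Comp.id'.fst' (Comp.id'.snd'.snd'.pair' Comp.nil')
    (h.fst'.pair' (Comp.cons h.snd' Comp.id'.snd'.snd')) 1
    fun a τ h => ⟨a.2.1, by omega, fun _ _ => le_rfl⟩)

/-- The error parameter that is used, and the result of Gonzalez' algorithm. -/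
noncomputable def prep (q : ℕ × (ℕ × (ℕ × (ℝ × List ℝ)))) :
    ℕ × (ℕ × (ℝ × (List Pt × List (ℝ × Pt)))) :=
  (q.2.1, (q.2.2.1, (if decide (q.2.2.2.1 < 1 / 2) then q.2.2.2.1 else 1 / 2,
    gCenters q.2.2.1 (rows q.1 q.2.1 q.2.2.2.2))))

theorem comp_prep : Comp (fun q τ => q.1 * (q.2.1 + 1) ≤ τ ∧
    ∃ B, ScanTime (rows q.1 q.2.1 q.2.2.2.2) B ∧ (q.2.2.1 + 1) * (B + 1) ≤ τ) prep := by
  have hh : Comp (fun (q : ℕ × (ℕ × (ℕ × (ℝ × List ℝ)))) τ => q.1 * (q.2.1 + 1) ≤ τ ∧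
      ∃ B, ScanTime (rows q.1 q.2.1 q.2.2.2.2) B ∧ (q.2.2.1 + 1) * (B + 1) ≤ τ)
      (fun _ => (1 : ℝ) / 2) := Comp.rdiv Comp.real1 (Comp.realNat 2)
  refine Comp.id'.snd'.fst'.pair' (Comp.id'.snd'.snd'.fst'.pair' (Comp.pair' (Comp.ite' (Comp.rlt
    Comp.id'.snd'.snd'.snd'.fst' hh) Comp.id'.snd'.snd'.snd'.fst' hh) (Comp.appSame comp_gCenters
    (Comp.id'.snd'.snd'.fst'.pair' (Comp.app comp_rows
      (Comp.id'.fst'.pair' (Comp.id'.snd'.fst'.pair' Comp.id'.snd'.snd'.snd'.snd')) 1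
      fun a τ h => ?_)) fun a τ h => h.2)))
  dsimp only; omega

/-- The second phase, for the result `A` of Gonzalez' algorithm. -/
noncomputable def finish (q : ℕ × (ℕ × (ℝ × (List Pt × List (ℝ × Pt))))) : List ℝ :=
  if decide (0 < (far q.2.2.2.2).1) then
    improve q.1 q.2.1 q.2.2.1 (scale q.1 (far q.2.2.2.2).1 (far q.2.2.2.2).2 q.2.2.2.1)
      (far q.2.2.2.2).1 (gNet (q.2.2.1 * q.2.2.1 * (far q.2.2.2.2).1) q.2.2.2).1
  -- Radius zero means that every client coincides with one of Gonzalez' centers, and these are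
  -- already optimal.
  else q.2.2.2.1.flatMap fun x => x

/-- The time for `finish` if the radius is positive. -/
def NetTime (E : ℕ) (q : ℕ × (ℕ × (ℝ × (List Pt × List (ℝ × Pt))))) (τ : ℕ) : Prop :=
  (∃ B N, ScanTime (q.2.2.2.2.map Prod.snd) B ∧ (N + 1) * (B + 1) ≤ τ ∧
    ¬ q.2.2.1 * q.2.2.1 * (far q.2.2.2.2).1 < 64 * (far (gStep^[N] q.2.2.2).2).1) ∧
  ∃ Z, (far q.2.2.2.2).2.length ≤ Z ∧ Small q.2.2.2.1 Z ∧
    RefSize q.1 q.2.1 q.2.2.1 (scale q.1 (far q.2.2.2.2).1 (far q.2.2.2.2).2 q.2.2.2.1)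
      (far q.2.2.2.2).1 (gNet (q.2.2.1 * q.2.2.1 * (far q.2.2.2.2).1) q.2.2.2).1 Z ∧ (Z + 2) ^ E ≤ τ

/-- The second phase is charged only for a positive radius. For radius zero the scale and the
separation of the net degenerate, and no bound on its size would hold. -/
theorem comp_finish : ∃ E, Comp (fun q τ => q.2.2.2.2.length ≤ τ ∧
    (∃ B, q.2.2.2.1.length * (B + 1) ≤ τ ∧ ∀ x ∈ q.2.2.2.1, x.length ≤ B) ∧
    (0 < (far q.2.2.2.2).1 → NetTime E q τ)) finish := by
  obtain ⟨E, hE⟩ := pcomp_scale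
  obtain ⟨E', hE'⟩ := pcomp_improve
  refine ⟨max E E', ?_⟩
  have hf : Comp (fun q τ => q.2.2.2.2.length ≤ τ)
      (fun q : ℕ × (ℕ × (ℝ × (List Pt × List (ℝ × Pt)))) => far q.2.2.2.2) :=
    Comp.appSame comp_far Comp.id'.snd'.snd'.snd'.snd' fun a τ h => h
  have hf' : Comp (fun q τ => q.2.2.2.2.length ≤ τ ∧ NetTime (max E E') q τ)
      (fun q : ℕ × (ℕ × (ℝ × (List Pt × List (ℝ × Pt)))) => far q.2.2.2.2) :=
    hf.mono fun a τ h => h.1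
  have hs : Comp (fun q τ => q.2.2.2.2.length ≤ τ ∧ NetTime (max E E') q τ)
      (fun q : ℕ × (ℕ × (ℝ × (List Pt × List (ℝ × Pt)))) =>
        scale q.1 (far q.2.2.2.2).1 (far q.2.2.2.2).2 q.2.2.2.1) :=
    Comp.appSame hE (Comp.id'.fst'.pair' (hf'.fst'.pair' (hf'.snd'.pair' Comp.id'.snd'.snd'.snd'.fst')))
      fun a τ ⟨h1, _, Z, h2, h3, h4, h5⟩ => ⟨Z, ⟨h4.1.2.1, h2, h3⟩,
        (Nat.pow_le_pow_right (by omega) (le_max_left _ _)).trans h5⟩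
  have hn : Comp (fun q τ => q.2.2.2.2.length ≤ τ ∧ NetTime (max E E') q τ)
      (fun q : ℕ × (ℕ × (ℝ × (List Pt × List (ℝ × Pt)))) =>
        gNet (q.2.2.1 * q.2.2.1 * (far q.2.2.2.2).1) q.2.2.2) :=
    Comp.appSame comp_gNet (Comp.pair' ((Comp.id'.snd'.snd'.fst'.rmul Comp.id'.snd'.snd'.fst').rmul hf'.fst')
      Comp.id'.snd'.snd'.snd') fun a τ h => h.2.1
  have hr : Comp (fun q τ => q.2.2.2.2.length ≤ τ ∧ NetTime (max E E') q τ)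
      (fun q : ℕ × (ℕ × (ℝ × (List Pt × List (ℝ × Pt)))) =>
        improve q.1 q.2.1 q.2.2.1 (scale q.1 (far q.2.2.2.2).1 (far q.2.2.2.2).2 q.2.2.2.1)
      (far q.2.2.2.2).1 (gNet (q.2.2.1 * q.2.2.1 * (far q.2.2.2.2).1) q.2.2.2).1) :=
    Comp.appSame hE' (Comp.id'.fst'.pair' (Comp.id'.snd'.fst'.pair' (Comp.id'.snd'.snd'.fst'.pair'
      (hs.pair' (hf'.fst'.pair' hn.fst')))))
      fun a τ ⟨h1, _, Z, h2, h3, h4, h5⟩ => ⟨Z, h4,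
        (Nat.pow_le_pow_right (by omega) (le_max_right _ _)).trans h5⟩
  have hg : Comp (fun q τ => ∃ B, q.2.2.2.1.length * (B + 1) ≤ τ ∧ ∀ x ∈ q.2.2.2.1, x.length ≤ B)
      (fun q : ℕ × (ℕ × (ℝ × (List Pt × List (ℝ × Pt)))) => q.2.2.2.1.flatMap fun x => x) :=
    Comp.flatMap (f := fun _ (x : Pt) => x) (Rf := O1) Comp.id'.snd'.snd'.snd'.fst' Comp.id'.snd' 1
      fun a τ ⟨B, h1, h2⟩ => ⟨B, by omega, fun x hx => ⟨trivial, h2 x hx⟩⟩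
  exact (Comp.ite (Comp.rlt Comp.real0 hf.fst') hr hg).mono fun a τ ⟨h1, h2, h3⟩ =>
    ⟨h1, fun h => ⟨h1, h3 (of_decide_eq_true h)⟩, fun _ => h2⟩
/-- The algorithm: the coordinates of the centers. -/
noncomputable def solve (q : ℕ × (ℕ × (ℕ × (ℝ × List ℝ)))) : List ℝ := finish (prep q)

/-- The time for `solve`. -/
def SolveTime (E : ℕ) (q : ℕ × (ℕ × (ℕ × (ℝ × List ℝ)))) (τ : ℕ) : Prop :=
  (q.1 * (q.2.1 + 1) ≤ τ ∧
    ∃ B, ScanTime (rows q.1 q.2.1 q.2.2.2.2) B ∧ (q.2.2.1 + 1) * (B + 1) ≤ τ) ∧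
  (prep q).2.2.2.2.length ≤ τ ∧
  (∃ B, (prep q).2.2.2.1.length * (B + 1) ≤ τ ∧ ∀ x ∈ (prep q).2.2.2.1, x.length ≤ B) ∧
  (0 < (far (prep q).2.2.2.2).1 → NetTime E (prep q) τ)

theorem comp_solve : ∃ E, Comp (SolveTime E) solve := by
  obtain ⟨E, hE⟩ := comp_finish
  have h : Comp (SolveTime E) prep := comp_prep.mono fun _ _ h => h.1
  exact ⟨E, Comp.appSame (g := finish) (f := prep) hE h fun _ _ h => h.2⟩

end KCenter

/-! ### Correctness of the dynamic program and the number of its selections -/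

namespace KCenter

theorem same_iff {ρ : ℝ} {S c c' : List Pt} :
    same ρ S c c' = true ↔ c.length = c'.length ∧ ∀ s ∈ S, cov ρ c s = cov ρ c' s := by
  simp only [same, Bool.and_eq_true, Bool.not_eq_true', decide_eq_false_iff_not, List.all_eq_true,
    beq_iff_eq, and_congr_left_iff]
  intro _
  omega

theorem same_symm {ρ : ℝ} {S c c' : List Pt} (h : same ρ S c c' = true) : same ρ S c' c = true := by
  rw [same_iff] at *
  exact ⟨h.1.symm, fun s hs => (h.2 s hs).symm⟩

theorem valid_iff {k : ℕ} {ρ : ℝ} {S rest c : List Pt} : valid k ρ S rest c = true ↔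
    c.length ≤ k ∧ ∀ s ∈ S, cov ρ c s = true ∨ ∃ x ∈ rest, near ρ s x = true := by
  simp [valid]

theorem cov_iff {ρ : ℝ} {c : List Pt} {s : Pt} : cov ρ c s = true ↔ ∃ x ∈ c, near ρ s x = true := by
  simp [cov]

theorem prune_foldl_spec {ρ : ℝ} {S : List Pt} (L acc : List (List Pt)) :
    (acc.Pairwise (fun c c' => ¬ same ρ S c c' = true) →
      (L.foldl (fun acc c => if acc.any fun c' => same ρ S c c' then acc else c :: acc) acc).Pairwise
        fun c c' => ¬ same ρ S c c' = true) ∧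
    (∀ c ∈ acc, c ∈ L.foldl (fun acc c => if acc.any fun c' => same ρ S c c' then acc else c :: acc) acc) ∧
    ∀ c ∈ L, ∃ c' ∈ L.foldl (fun acc c => if acc.any fun c' => same ρ S c c' then acc else c :: acc) acc,
      same ρ S c c' = true := by
  induction L generalizing acc with
  | nil => simp
  | cons x L ih =>
    simp only [List.foldl_cons]
    split_ifs with h
    · obtain ⟨h1, h2, h3⟩ := ih acc
      refine ⟨h1, h2, fun c hc => ?_⟩
      rcases List.mem_cons.1 hc with rfl | hc
      · obtain ⟨c', hc', h⟩ := List.any_eq_true.1 h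
        exact ⟨c', h2 _ hc', h⟩
      · exact h3 c hc
    · obtain ⟨h1, h2, h3⟩ := ih (x :: acc)
      refine ⟨fun ha => h1 (List.pairwise_cons.2 ⟨fun c hc hs => h ?_, ha⟩),
        fun c hc => h2 c (List.mem_cons_of_mem _ hc), fun c hc => ?_⟩
      · exact List.any_eq_true.2 ⟨c, hc, hs⟩
      · rcases List.mem_cons.1 hc with rfl | hc
        · exact ⟨c, h2 _ (by simp), by rw [same_iff]; simp⟩
        · exact h3 c hc

theorem pairwise_prune (ρ : ℝ) (S : List Pt) (L : List (List Pt)) :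
    (prune ρ S L).Pairwise fun c c' => ¬ same ρ S c c' = true :=
  (prune_foldl_spec L []).1 List.Pairwise.nil

theorem exists_mem_prune {ρ : ℝ} {S : List Pt} {L : List (List Pt)} {c : List Pt} (hc : c ∈ L) :
    ∃ c' ∈ prune ρ S L, same ρ S c c' = true := (prune_foldl_spec L []).2.2 c hc

theorem mem_of_mem_prune {ρ : ℝ} {S : List Pt} {L : List (List Pt)} {c : List Pt}
    (hc : c ∈ prune ρ S L) : c ∈ L := by
  simpa using (prune_foldl_subset (same ρ S) L []).1 c hc

theorem mem_of_mem_dpStep {k : ℕ} {ρ : ℝ} {S rest : List Pt} {x : Pt} {L : List (List Pt)} {c : List Pt}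
    (hc : c ∈ dpStep k ρ S x rest L) :
    valid k ρ S rest c = true ∧ ∃ c' ∈ L, c = c' ∨ c = x :: c' := by
  have := List.mem_filter.1 (mem_of_mem_prune hc)
  refine ⟨this.2, ?_⟩
  simpa using this.1

theorem exists_mem_dpStep {k : ℕ} {ρ : ℝ} {S rest : List Pt} {x : Pt} {L : List (List Pt)} {c c' : List Pt}
    (hc : c' ∈ L) (h : c = c' ∨ c = x :: c') (hv : valid k ρ S rest c = true) :
    ∃ c'' ∈ dpStep k ρ S x rest L, same ρ S c c'' = true :=
  exists_mem_prune (List.mem_filter.2 ⟨by simpa using ⟨c', hc, h⟩, hv⟩)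

theorem dpRun_append {k : ℕ} {ρ : ℝ} {S X Y Y' : List Pt} {x : Pt} (h : X = Y ++ x :: Y') :
    (dpRun k ρ S X (Y ++ [x])).2 = dpStep k ρ S x Y' (dpRun k ρ S X Y).2 := by
  have := dpRun_fst k ρ S X Y (x :: Y') h
  rw [dpRun] at this
  rw [dpRun, List.foldl_append, List.foldl_cons, List.foldl_nil, this]
  rfl

/-- Every set of at most `k` candidates that covers `S` is detected. -/
theorem dp_ne_nil {k : ℕ} {ρ : ℝ} {S X F : List Pt} (hF : F.Sublist X) (hk : F.length ≤ k)
    (hc : ∀ s ∈ S, cov ρ F s = true) : dp k ρ S X ≠ [] := by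
  -- Induction over the unscanned part `Y'`: some stored selection, completed by the members of `F`
  -- still to come, covers `S` with at most `k` centers. Pruning may replace the selection by an
  -- equivalent one, which has the same length and coverage and so serves equally well.
  have key : ∀ (Y' Y F : List Pt), X = Y ++ Y' → F.Sublist Y' →
      (∃ c ∈ (dpRun k ρ S X Y).2, c.length + F.length ≤ k ∧
        ∀ s ∈ S, cov ρ c s = true ∨ cov ρ F s = true) → dp k ρ S X ≠ [] := by
    intro Y'
    induction Y' with
    | nil =>
      rintro Y F hX - ⟨c, hc, -⟩
      rw [List.append_nil] at hX
      rw [dp, ← hX] at *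
      exact List.ne_nil_of_mem hc
    | cons x Y' ih =>
      rintro Y F hX hF ⟨c, hc, hk, hcov⟩
      have hX' : X = Y ++ [x] ++ Y' := by rw [hX]; simp
      have h3 := dpRun_append (k := k) (ρ := ρ) (S := S) hX
      rcases List.sublist_cons_iff.1 hF with hF | ⟨F', rfl, hF'⟩
      · have hv : valid k ρ S Y' c = true := valid_iff.2 ⟨by omega, fun s hs =>
          (hcov s hs).imp_right fun h => by
            obtain ⟨y, hy, h⟩ := cov_iff.1 h
            exact ⟨y, hF.subset hy, h⟩⟩
        obtain ⟨c', h1, h2⟩ := exists_mem_dpStep (x := x) hc (Or.inl rfl) hv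
        rw [same_iff] at h2
        exact ih (Y ++ [x]) F hX' hF
          ⟨c', h3 ▸ h1, by omega, fun s hs => h2.2 s hs ▸ hcov s hs⟩
      · simp only [List.length_cons] at hk
        have h4 : ∀ s ∈ S, cov ρ (x :: c) s = true ∨ cov ρ F' s = true := by
          intro s hs
          have := hcov s hs
          simp only [cov, List.any_cons, Bool.or_eq_true] at this ⊢
          tauto
        have hv : valid k ρ S Y' (x :: c) = true := valid_iff.2 ⟨by simp only [List.length_cons]; omega,
          fun s hs => (h4 s hs).imp_right fun h => by
            obtain ⟨y, hy, h⟩ := cov_iff.1 h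
            exact ⟨y, hF'.subset hy, h⟩⟩
        obtain ⟨c', h1, h2⟩ := exists_mem_dpStep (x := x) hc (Or.inr rfl) hv
        rw [same_iff] at h2
        simp only [List.length_cons] at h2
        exact ih (Y ++ [x]) F' hX' hF'
          ⟨c', h3 ▸ h1, by omega, fun s hs => h2.2 s hs ▸ h4 s hs⟩
  exact key X [] F rfl hF ⟨[], by simp [dpRun], by simpa using hk, fun s hs => Or.inr (hc s hs)⟩

/-- Validity holds only after the first candidate, because the initial selection `[]` is never
tested. -/
theorem mem_dpRun {k : ℕ} {ρ : ℝ} {S X Y Y' : List Pt} (hX : X = Y ++ Y') {c : List Pt}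
    (hc : c ∈ (dpRun k ρ S X Y).2) :
    (∀ x ∈ c, x ∈ Y) ∧ c.length ≤ k ∧ (Y ≠ [] → valid k ρ S Y' c = true) := by
  induction Y using List.reverseRecOn generalizing Y' c with
  | nil =>
    simp only [dpRun, List.foldl_nil, List.mem_singleton] at hc
    simp [hc]
  | append_singleton Y x ih =>
    have hX' : X = Y ++ x :: Y' := by rw [hX]; simp
    rw [dpRun_append hX'] at hc
    obtain ⟨h1, c', h2, h3⟩ := mem_of_mem_dpStep hc
    refine ⟨fun y hy => ?_, (valid_iff.1 h1).1, fun _ => h1⟩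
    have h4 := (ih hX' h2).1
    rcases h3 with rfl | rfl
    · exact List.mem_append_left _ (h4 y hy)
    · rcases List.mem_cons.1 hy with rfl | hy
      · simp
      · exact List.mem_append_left _ (h4 y hy)

theorem pairwise_dpRun {k : ℕ} {ρ : ℝ} {S X Y Y' : List Pt} (hX : X = Y ++ Y') :
    (dpRun k ρ S X Y).2.Pairwise fun c c' => ¬ same ρ S c c' = true := by
  induction Y using List.reverseRecOn with
  | nil => simp [dpRun]
  | append_singleton Y x ih =>
    rw [dpRun_append (show X = Y ++ x :: Y' by rw [hX]; simp)]
    exact pairwise_prune _ _ _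

/-- When no candidate remains, validity is the same as covering all of `S`. -/
theorem mem_dp {k : ℕ} {ρ : ℝ} {S X : List Pt} (hX : X ≠ []) {c : List Pt} (hc : c ∈ dp k ρ S X) :
    (∀ x ∈ c, x ∈ X) ∧ c.length ≤ k ∧ ∀ s ∈ S, ∃ x ∈ c, near ρ s x = true := by
  obtain ⟨h1, h2, h3⟩ := mem_dpRun (Y' := []) (by simp) hc
  refine ⟨h1, h2, fun s hs => ?_⟩
  rcases (valid_iff.1 (h3 hX)).2 s hs with h | ⟨x, hx, -⟩
  · exact cov_iff.1 h
  · simp at hx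

/-- The points of `S` whose coverage is not determined by validity. -/
noncomputable def frontier (ρ : ℝ) (S Y Y' : List Pt) : List Pt :=
  S.filter fun s => cov ρ Y s && cov ρ Y' s

/-- Off the frontier the coverage is forced: a point that no unscanned candidate can reach must be
covered by validity, and a point that no scanned candidate reaches is not covered. Stored selections
are pairwise inequivalent, so each is determined by its cardinality and its coverage of the
frontier. -/
theorem length_dpRun_le {k : ℕ} {ρ : ℝ} {S X Y Y' : List Pt} (hX : X = Y ++ Y') {w : ℕ}
    (hw : (frontier ρ S Y Y').length ≤ w) : (dpRun k ρ S X Y).2.length ≤ (k + 1) * 2 ^ w := by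
  rcases eq_or_ne Y [] with rfl | hY
  · simp only [dpRun, List.foldl_nil, List.length_singleton]
    exact Nat.mul_pos (by omega) (by positivity)
  have hdet : ∀ c ∈ (dpRun k ρ S X Y).2, ∀ c' ∈ (dpRun k ρ S X Y).2, c.length = c'.length →
      (∀ s ∈ frontier ρ S Y Y', cov ρ c s = cov ρ c' s) → same ρ S c c' = true := by
    intro c hc c' hc' hl hs
    refine same_iff.2 ⟨hl, fun s hsS => ?_⟩
    obtain ⟨h1, -, h2⟩ := mem_dpRun hX hc
    obtain ⟨h1', -, h2'⟩ := mem_dpRun hX hc'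
    have h3 := (valid_iff.1 (h2 hY)).2 s hsS
    have h3' := (valid_iff.1 (h2' hY)).2 s hsS
    by_cases hf : s ∈ frontier ρ S Y Y'
    · exact hs s hf
    · rw [frontier, List.mem_filter, Bool.and_eq_true] at hf
      by_cases h5 : cov ρ Y' s = true
      · have h6 : ¬ cov ρ Y s = true := fun h => hf ⟨hsS, h, h5⟩
        have h7 : ∀ c, (∀ x ∈ c, x ∈ Y) → cov ρ c s = false := fun c hcY => by
          rw [← Bool.not_eq_true]
          intro h
          obtain ⟨x, hx, h⟩ := cov_iff.1 h
          exact h6 (cov_iff.2 ⟨x, hcY x hx, h⟩)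
        rw [h7 c h1, h7 c' h1']
      · have h6 : ¬ ∃ x ∈ Y', near ρ s x = true := fun h => h5 (cov_iff.2 h)
        rw [h3.resolve_right h6, h3'.resolve_right h6]
  classical
  have hnd : (dpRun k ρ S X Y).2.Nodup := (pairwise_dpRun hX).imp fun {a b} h h' => h (by
    rw [h', same_iff]; simp)
  rw [← List.toFinset_card_of_nodup hnd]
  let f : List Pt → Fin (k + 1) × (Fin (frontier ρ S Y Y').length → Bool) := fun c =>
    (⟨min c.length k, by omega⟩, fun i => cov ρ c ((frontier ρ S Y Y').get i))
  refine (Finset.card_le_card_of_injOn f (fun _ _ => Finset.mem_univ _) ?_).trans ?_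
  · intro c hc c' hc' h
    rw [Finset.mem_coe, List.mem_toFinset] at hc hc'
    simp only [f, Prod.mk.injEq, Fin.mk.injEq] at h
    by_contra hne
    have h1 := (mem_dpRun hX hc).2.1
    have h2 := (mem_dpRun hX hc').2.1
    have h3 := hdet c hc c' hc' (by omega) fun s hs => by
      obtain ⟨i, rfl⟩ := List.get_of_mem hs
      exact congrFun h.2 i
    obtain ⟨i, hi, rfl⟩ := List.getElem_of_mem hc
    obtain ⟨j, hj, rfl⟩ := List.getElem_of_mem hc'
    have h4 := List.pairwise_iff_getElem.1 (pairwise_dpRun (k := k) (ρ := ρ) (S := S) hX)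
    rcases lt_trichotomy i j with hij | rfl | hij
    · exact h4 i j hi hj hij h3
    · exact hne rfl
    · exact h4 j i hj hi hij (same_symm h3)
  · rw [Finset.card_univ, Fintype.card_prod, Fintype.card_fin, Fintype.card_fun, Fintype.card_bool,
      Fintype.card_fin]
    gcongr
    omega

/-- For `k = 1` the claimed running time has no exponential term in the width, since `log k = 0`.
Here selections are empty or single candidates, and counting those replaces the frontier bound. -/
theorem length_dpRun_one_le {ρ : ℝ} {S X Y Y' : List Pt} (hX : X = Y ++ Y') :
    (dpRun 1 ρ S X Y).2.length ≤ X.length + 1 := by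
  classical
  have hnd : (dpRun 1 ρ S X Y).2.Nodup := (pairwise_dpRun hX).imp fun {a b} h h' => h (by
    rw [h', same_iff]; simp)
  rw [← List.toFinset_card_of_nodup hnd]
  have : (dpRun 1 ρ S X Y).2.toFinset ⊆ insert [] (X.toFinset.image fun x => [x]) := by
    intro c hc
    rw [List.mem_toFinset] at hc
    obtain ⟨h1, h2, -⟩ := mem_dpRun hX hc
    match c with
    | [] => simp
    | [x] =>
      have := h1 x (by simp)
      simp [hX, this]
    | _ :: _ :: _ => simp at h2
  refine (Finset.card_le_card this).trans ((Finset.card_insert_le _ _).trans ?_)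
  have := X.toFinset_card_le
  have := Finset.card_image_le (s := X.toFinset) (f := fun x => [x])
  omega

end KCenter

/-! ### Distances, and the analysis of Gonzalez' algorithm -/

namespace KCenter

/-- The point with the given coordinates. -/
noncomputable def vec (d : ℕ) (s : Pt) : EuclideanSpace ℝ (Fin d) := WithLp.toLp 2 fun l => s.getD l 0

theorem dist2_foldl (d : ℕ) (x y : Pt) (hx : x.length = d) (hy : y.length = d) (a : ℝ) :
    (x.zip y).foldl (fun acc q => acc + (q.1 - q.2) * (q.1 - q.2)) a =
      a + ∑ l ∈ Finset.range d, (x.getD l 0 - y.getD l 0) ^ 2 := by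
  induction d generalizing x y a with
  | zero =>
    rw [List.length_eq_zero_iff] at hx
    simp [hx]
  | succ d ih =>
    match x, y with
    | u :: x, v :: y =>
      simp only [List.length_cons, Nat.succ.injEq] at hx hy
      rw [List.zip_cons_cons, List.foldl_cons, ih x y hx hy, Finset.sum_range_succ']
      simp only [List.getD_cons_succ, List.getD_cons_zero]
      ring

theorem dist2_eq {d : ℕ} {x y : Pt} (hx : x.length = d) (hy : y.length = d) :
    dist2 x y = dist (vec d x) (vec d y) ^ 2 := by
  rw [dist2, dist2_foldl d x y hx hy, zero_add, EuclideanSpace.dist_eq, Real.sq_sqrt (by positivity),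
    ← Fin.sum_univ_eq_sum_range (fun l => (x.getD l 0 - y.getD l 0) ^ 2)]
  refine Finset.sum_congr rfl fun l _ => ?_
  rw [Real.dist_eq, sq_abs]
  rfl

theorem dist2_nonneg {x y : Pt} : 0 ≤ dist2 x y := by
  have : ∀ (l : List (ℝ × ℝ)) (a : ℝ), 0 ≤ a →
      0 ≤ l.foldl (fun acc q => acc + (q.1 - q.2) * (q.1 - q.2)) a := by
    intro l
    induction l with
    | nil => intro a h; exact h
    | cons p l ih => intro a h; exact ih _ (add_nonneg h (mul_self_nonneg _))
  exact this _ 0 le_rfl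

theorem dist2_comm {d : ℕ} {x y : Pt} (hx : x.length = d) (hy : y.length = d) :
    dist2 x y = dist2 y x := by
  rw [dist2_eq hx hy, dist2_eq hy hx, dist_comm]

theorem sq_coord_sub_le {d : ℕ} {x y : Pt} (hx : x.length = d) (hy : y.length = d) (l : ℕ) :
    (x.getD l 0 - y.getD l 0) ^ 2 ≤ dist2 x y := by
  rw [dist2, dist2_foldl d x y hx hy, zero_add]
  rcases lt_or_ge l d with h | h
  · exact Finset.single_le_sum (f := fun l => (x.getD l 0 - y.getD l 0) ^ 2)
      (fun _ _ => sq_nonneg _) (Finset.mem_range.2 h)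
  · rw [List.getD_eq_default _ _ (by omega), List.getD_eq_default _ _ (by omega)]
    simpa using Finset.sum_nonneg fun _ _ => sq_nonneg _

theorem far_foldl (cl : List (ℝ × Pt)) (b : ℝ × Pt) :
    (cl.foldl (fun b c => if decide (c.1 < b.1) then b else c) b = b ∨
      cl.foldl (fun b c => if decide (c.1 < b.1) then b else c) b ∈ cl) ∧
    b.1 ≤ (cl.foldl (fun b c => if decide (c.1 < b.1) then b else c) b).1 ∧
    ∀ c ∈ cl, c.1 ≤ (cl.foldl (fun b c => if decide (c.1 < b.1) then b else c) b).1 := by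
  induction cl generalizing b with
  | nil => simp
  | cons x cl ih =>
    rw [List.foldl_cons]
    by_cases h : x.1 < b.1
    · simp only [h, decide_true, if_true]
      obtain ⟨h1, h2, h3⟩ := ih b
      refine ⟨h1.imp_right (List.mem_cons_of_mem _), h2, fun c hc => ?_⟩
      rcases List.mem_cons.1 hc with rfl | hc
      · exact h.le.trans h2
      · exact h3 c hc
    · simp only [h, decide_false, Bool.false_eq_true, if_false]
      obtain ⟨h1, h2, h3⟩ := ih x
      refine ⟨Or.inr ?_, (not_lt.1 h).trans h2, fun c hc => ?_⟩
      · rcases h1 with h1 | h1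
        · rw [h1]; simp
        · exact List.mem_cons_of_mem _ h1
      · rcases List.mem_cons.1 hc with rfl | hc
        · exact h2
        · exact h3 c hc

theorem le_far {cl : List (ℝ × Pt)} {c : ℝ × Pt} (hc : c ∈ cl) : c.1 ≤ (far cl).1 :=
  (far_foldl cl _).2.2 c hc

theorem far_mem {cl : List (ℝ × Pt)} (hcl : cl ≠ []) (h : ∀ c ∈ cl, 0 ≤ c.1) : far cl ∈ cl := by
  match cl with
  | [] => exact absurd rfl hcl
  | x :: cl =>
    have hx : ¬ x.1 < 0 := not_lt.2 (h x (by simp))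
    rw [far, List.foldl_cons]
    simp only [hx, decide_false, Bool.false_eq_true, if_false]
    rcases (far_foldl cl x).1 with h1 | h1
    · rw [h1]; simp
    · exact List.mem_cons_of_mem _ h1

theorem le_dist2_of_pairwise {d : ℕ} {t : ℝ} {S : List Pt} (hS : ∀ s ∈ S, s.length = d)
    (h : S.Pairwise fun a b => t ≤ dist2 a b) {x y : Pt} (hx : x ∈ S) (hy : y ∈ S) (hxy : x ≠ y) :
    t ≤ dist2 x y := by
  obtain ⟨i, hi, rfl⟩ := List.getElem_of_mem hx
  obtain ⟨j, hj, rfl⟩ := List.getElem_of_mem hy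
  have h4 := List.pairwise_iff_getElem.1 h
  rcases lt_trichotomy i j with hij | rfl | hij
  · exact h4 i j hi hj hij
  · exact absurd rfl hxy
  · rw [dist2_comm (hS _ hx) (hS _ hy)]
    exact h4 j i hj hi hij

/-- The invariant of Gonzalez' algorithm for the clients `cs`. -/
structure GInv (cs : List Pt) (st : List Pt × List (ℝ × Pt)) : Prop where
  clients : st.2.map Prod.snd = cs
  ne_nil : cs ≠ []
  mem : ∀ g ∈ st.1, g ∈ cs
  attained : ∀ c ∈ st.2, ∃ g ∈ st.1, c.1 = dist2 c.2 g
  le : ∀ c ∈ st.2, ∀ g ∈ st.1, c.1 ≤ dist2 c.2 g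

theorem GInv.far_mem {cs : List Pt} {st : List Pt × List (ℝ × Pt)} (h : GInv cs st) :
    far st.2 ∈ st.2 := by
  refine KCenter.far_mem (fun h0 => h.ne_nil ?_) fun c hc => ?_
  · rw [← h.clients, h0]; rfl
  · obtain ⟨g, -, hg⟩ := h.attained c hc
    rw [hg]; exact dist2_nonneg

theorem GInv.far_mem_clients {cs : List Pt} {st : List Pt × List (ℝ × Pt)} (h : GInv cs st) :
    (far st.2).2 ∈ cs := by
  rw [← h.clients]; exact List.mem_map_of_mem h.far_mem

theorem GInv.far_nonneg {cs : List Pt} {st : List Pt × List (ℝ × Pt)} (h : GInv cs st) :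
    0 ≤ (far st.2).1 := by
  obtain ⟨g, -, hg⟩ := h.attained _ h.far_mem
  rw [hg]; exact dist2_nonneg

theorem GInv.init {cs : List Pt} (hcs : cs ≠ []) : GInv cs (gInit cs) where
  clients := gInit_clients cs
  ne_nil := hcs
  mem := by
    cases cs with
    | nil => exact absurd rfl hcs
    | cons x cs => simp [gInit]
  attained := by simp [gInit]
  le := by simp [gInit]

theorem GInv.step {cs : List Pt} {st : List Pt × List (ℝ × Pt)} (h : GInv cs st) : GInv cs (gStep st) where
  clients := by rw [gStep_clients, h.clients]
  ne_nil := h.ne_nil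
  mem := by
    intro g hg
    rcases List.mem_cons.1 hg with rfl | hg
    · exact h.far_mem_clients
    · exact h.mem g hg
  attained := by
    intro c hc
    obtain ⟨b, hb, rfl⟩ := List.mem_map.1 hc
    dsimp only
    split_ifs with h1
    · exact ⟨_, List.mem_cons_self, rfl⟩
    · obtain ⟨g, hg, h2⟩ := h.attained b hb
      exact ⟨g, List.mem_cons_of_mem _ hg, h2⟩
  le := by
    intro c hc g hg
    obtain ⟨b, hb, rfl⟩ := List.mem_map.1 hc
    dsimp only
    rcases List.mem_cons.1 hg with rfl | hg
    · split_ifs with h1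
      · exact le_rfl
      · exact not_lt.1 (by simpa using h1)
    · split_ifs with h1
      · exact (of_decide_eq_true h1).le.trans (h.le b hb g hg)
      · exact h.le b hb g hg

/-- A new center can only decrease the distances to the nearest center. -/
theorem GInv.far_step_le {cs : List Pt} {st : List Pt × List (ℝ × Pt)} (h : GInv cs st) :
    (far (gStep st).2).1 ≤ (far st.2).1 := by
  obtain ⟨c, hc, hc'⟩ := List.mem_map.1 h.step.far_mem
  rw [← hc']
  refine le_trans ?_ (le_far hc)
  dsimp only
  split_ifs with h1
  · exact (of_decide_eq_true h1).le
  · exact le_rfl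

theorem GInv.iterate {cs : List Pt} {st : List Pt × List (ℝ × Pt)} (h : GInv cs st) (n : ℕ) :
    GInv cs (gStep^[n] st) := by
  induction n with
  | zero => exact h
  | succ n ih => rw [Function.iterate_succ_apply']; exact ih.step

theorem GInv.far_iterate_le {cs : List Pt} {st : List Pt × List (ℝ × Pt)} (h : GInv cs st) (n : ℕ) :
    (far (gStep^[n] st).2).1 ≤ (far st.2).1 := by
  induction n with
  | zero => exact le_rfl
  | succ n ih => rw [Function.iterate_succ_apply']; exact (h.iterate n).far_step_le.trans ih

/-- The new center is the farthest client, so its distance to every earlier center is at least the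
current radius. -/
theorem GInv.pairwise_step {cs : List Pt} {st : List Pt × List (ℝ × Pt)} (h : GInv cs st) {t : ℝ}
    (ht : t ≤ (far st.2).1) (hp : st.1.Pairwise fun a b => t ≤ dist2 a b) :
    (gStep st).1.Pairwise fun a b => t ≤ dist2 a b :=
  List.pairwise_cons.2 ⟨fun g hg => ht.trans (h.le _ h.far_mem g hg), hp⟩

theorem GInv.pairwise_iterate {cs : List Pt} {st : List Pt × List (ℝ × Pt)} (h : GInv cs st) {t : ℝ}
    {n : ℕ} (ht : ∀ j < n, t ≤ (far (gStep^[j] st).2).1) (hp : st.1.Pairwise fun a b => t ≤ dist2 a b) :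
    (gStep^[n] st).1.Pairwise fun a b => t ≤ dist2 a b := by
  induction n with
  | zero => exact hp
  | succ n ih =>
    rw [Function.iterate_succ_apply']
    exact (h.iterate n).pairwise_step (ht n (by omega)) (ih fun j hj => ht j (by omega))

theorem length_gStep_iterate (st : List Pt × List (ℝ × Pt)) (n : ℕ) :
    (gStep^[n] st).1.length = st.1.length + n := by
  induction n with
  | zero => rfl
  | succ n ih =>
    rw [Function.iterate_succ_apply', gStep, gAdd, List.length_cons, ih]; rfl

/-- Every center was added at a radius no smaller than the final one, because the radii decrease.
The farthest client extends the centers to `k + 1` separated points, the source of the lower bound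
for the optimum. -/
theorem gCenters_spec {k : ℕ} (hk : 1 ≤ k) {cs : List Pt} (hcs : cs ≠ []) :
    GInv cs (gCenters k cs) ∧ (gCenters k cs).1.length = k ∧
      ((far (gCenters k cs).2).2 :: (gCenters k cs).1).Pairwise
        fun a b => (far (gCenters k cs).2).1 ≤ dist2 a b := by
  have h := GInv.init hcs
  have h1 : GInv cs (gCenters k cs) := h.iterate _
  refine ⟨h1, ?_, h1.pairwise_step le_rfl (h.pairwise_iterate (fun j hj => ?_) ?_)⟩
  · rw [gCenters, length_gStep_iterate, gInit, List.length_singleton]; omega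
  · have := (h.iterate j).far_iterate_le (k - 1 - j)
    rwa [← Function.iterate_add_apply, show k - 1 - j + j = k - 1 by omega] at this
  · simp [gInit]

/-- The net that `gNet` computes. -/
theorem gNet_spec {cs : List Pt} {st : List Pt × List (ℝ × Pt)} (h : GInv cs st) {θ : ℝ}
    {M : ℕ} (hp : st.1.Pairwise fun a b => θ / 64 ≤ dist2 a b)
    (hM : ∀ st', GInv cs st' → (st'.1.Pairwise fun a b => θ / 64 ≤ dist2 a b) → st'.1.length ≤ M) :
    ∃ N ≤ M, (∀ j < N, θ < 64 * (far (gStep^[j] st).2).1) ∧ ¬ θ < 64 * (far (gStep^[N] st).2).1 ∧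
      gNet θ st = gStep^[N] st ∧ GInv cs (gNet θ st) ∧
      (gNet θ st).1.Pairwise fun a b => θ / 64 ≤ dist2 a b := by
  classical
  have hpw : ∀ N, (∀ j < N, θ < 64 * (far (gStep^[j] st).2).1) →
      (gStep^[N] st).1.Pairwise fun a b => θ / 64 ≤ dist2 a b := fun N hN =>
    h.pairwise_iterate (fun j hj => by linarith [hN j hj]) hp
  -- Every further step adds a center and preserves the separation, so the bound `M` on separated
  -- sets forces the loop to stop.
  have hex : ∃ N, ¬ θ < 64 * (far (gStep^[N] st).2).1 := by
    by_contra hne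
    push Not at hne
    have := hM _ (h.iterate (M + 1)) (hpw (M + 1) fun j _ => hne j)
    rw [length_gStep_iterate] at this
    omega
  have hlt : ∀ j < Nat.find hex, θ < 64 * (far (gStep^[j] st).2).1 := fun j hj =>
    not_not.1 (Nat.find_min hex hj)
  have heq : gNet θ st = gStep^[Nat.find hex] st := by
    rw [gNet, RealRAM.whileFn_eq (N := Nat.find hex)]
    · simpa using Nat.find_spec hex
    · simpa using hlt
  refine ⟨Nat.find hex, ?_, hlt, Nat.find_spec hex, heq, heq ▸ h.iterate _, heq ▸ hpw _ hlt⟩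
  have := hM _ (h.iterate _) (hpw _ hlt)
  rw [length_gStep_iterate] at this
  omega

end KCenter

/-! ### Packing bound, nets and the candidate grid -/

open MeasureTheory in
/-- A volume bound for separated sets. -/
theorem EuclideanSpace.card_mul_le_of_separated {d : ℕ} (S A : Finset (EuclideanSpace ℝ (Fin d)))
    {δ r : ℝ} (hδ : 0 < δ) (hr : 0 ≤ r) (hS : ∀ x ∈ S, ∀ y ∈ S, x ≠ y → δ ≤ dist x y)
    (hA : ∀ x ∈ S, ∃ a ∈ A, dist x a ≤ r) :
    (S.card : ℝ) * (δ / 2) ^ d ≤ A.card * (r + δ / 2) ^ d := by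
  let μ : Measure (EuclideanSpace ℝ (Fin d)) := volume
  have hb : ∀ (x : EuclideanSpace ℝ (Fin d)) (t : ℝ), 0 < t →
      μ (Metric.ball x t) = ENNReal.ofReal (t ^ d) * μ (Metric.ball 0 1) := fun x t ht => by
    rw [Measure.addHaar_ball_of_pos μ x ht, finrank_euclideanSpace_fin]
  -- The balls of radius `δ / 2` around `S` are disjoint, and they lie in the union of the balls of
  -- radius `r + δ / 2` around `A`.
  have h1 : μ (⋃ x ∈ S, Metric.ball x (δ / 2)) = ∑ x ∈ S, μ (Metric.ball x (δ / 2)) := by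
    refine measure_biUnion_finset (fun x hx y hy hxy => ?_) fun x _ => measurableSet_ball
    exact Metric.ball_disjoint_ball (by linarith [hS x hx y hy hxy])
  have h2 : (⋃ x ∈ S, Metric.ball x (δ / 2)) ⊆ ⋃ a ∈ A, Metric.ball a (r + δ / 2) := by
    intro y hy
    simp only [Set.mem_iUnion, Metric.mem_ball, exists_prop] at hy ⊢
    obtain ⟨x, hx, hxy⟩ := hy
    obtain ⟨a, ha, hxa⟩ := hA x hx
    exact ⟨a, ha, by linarith [dist_triangle y x a]⟩
  have h3 : ∑ x ∈ S, μ (Metric.ball x (δ / 2)) ≤ ∑ a ∈ A, μ (Metric.ball a (r + δ / 2)) :=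
    h1 ▸ (measure_mono h2).trans (measure_biUnion_finset_le _ _)
  simp only [hb _ _ (by positivity : 0 < δ / 2), hb _ _ (by positivity : 0 < r + δ / 2),
    Finset.sum_const, nsmul_eq_mul, ← mul_assoc] at h3
  have h4 : μ (Metric.ball 0 1) ≠ 0 := (Metric.measure_ball_pos μ 0 one_pos).ne'
  have h5 : μ (Metric.ball 0 1) ≠ ⊤ := measure_ball_lt_top.ne
  rw [ENNReal.mul_le_mul_iff_left h4 h5, ← ENNReal.ofReal_natCast, ← ENNReal.ofReal_natCast,
    ← ENNReal.ofReal_mul (by positivity), ← ENNReal.ofReal_mul (by positivity)] at h3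
  exact (ENNReal.ofReal_le_ofReal_iff (by positivity)).1 h3

namespace KCenter

theorem vec_ofFn {d : ℕ} (f : Fin d → ℝ) : vec d (List.ofFn f) = WithLp.toLp 2 f := by
  rw [vec]
  congr 1
  ext l
  rw [List.getD_eq_getElem _ _ (by simp)]
  simp

/-- A net of the clients together with the parameters of the second phase. -/
structure Net (d : ℕ) (e r u : ℝ) (S : List Pt) : Prop where
  dim : 1 ≤ d
  length : ∀ s ∈ S, s.length = d
  ne_nil : S ≠ []
  e_pos : 0 < e
  e_le : e ≤ 1 / 2
  u_pos : 0 < u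
  u_le : u ≤ r
  le_u : r ^ 2 ≤ d * u ^ 2
  sep : S.Pairwise fun a b => (e * r / 8) ^ 2 ≤ dist2 a b

namespace Net

variable {d : ℕ} {e r u : ℝ} {S : List Pt}

theorem r_pos (h : Net d e r u S) : 0 < r := h.u_pos.trans_le h.u_le

theorem one_le_d (h : Net d e r u S) : (1 : ℝ) ≤ d := by exact_mod_cast h.dim

theorem r_le (h : Net d e r u S) : r ≤ d * u := by
  have h1 := h.one_le_d
  have h2 := h.le_u
  refine abs_le_of_sq_le_sq' ?_ (by have := h.u_pos; positivity) |>.2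
  nlinarith [mul_nonneg (by linarith : (0:ℝ) ≤ d) (sq_nonneg u), mul_nonneg (mul_nonneg (by linarith : (0:ℝ) ≤ d) (sub_nonneg.2 h1)) (sq_nonneg u)]

/-- Each coordinate of `y - s` is rounded down to a multiple of the mesh `η = e * u / (64 * d)`. The
range suffices since `2 * r ≤ 2 * (d * u) ≤ N * η`. The rounding error is at most `η` per
coordinate, in total at most `√d * η ≤ d * η = e * u / 64 ≤ e * r / 64`. -/
theorem exists_mem_grid (h : Net d e r u S) {s : Pt} (hs : s ∈ S) (y : EuclideanSpace ℝ (Fin d))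
    (hy : dist (vec d s) y ≤ 2 * r) : ∃ x ∈ grid d e u S, dist (vec d x) y ≤ e * r / 64 := by
  have h1 := h.one_le_d
  have hu := h.u_pos
  have he := h.e_pos
  have hd : (0 : ℝ) < d := by linarith
  set N := ⌈128 * ((d : ℝ) * (d : ℝ)) / e⌉₊ with hN
  set η := e * u / (64 * (d : ℝ)) with hη
  have hη0 : 0 < η := by positivity
  have hNle : 2 * (d * u) ≤ N * η := by
    have := Nat.le_ceil (128 * ((d : ℝ) * (d : ℝ)) / e)
    calc 2 * (d * u) = 128 * ((d : ℝ) * (d : ℝ)) / e * η := by rw [hη]; field_simp; norm_num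
      _ ≤ _ := by gcongr
  have hcoord : ∀ l : Fin d, |y l - s.getD l 0| ≤ N * η := by
    intro l
    have h2 : |y l - s.getD l 0| ≤ dist (vec d s) y := by
      rw [dist_comm, dist_eq_norm]
      exact PiLp.norm_apply_le (p := 2) (y - vec d s) l
    have := h.r_le
    linarith
  let t : Fin d → ℤ := fun l => ⌊(y l - s.getD l 0) / η⌋
  have ht1 : ∀ l, (t l : ℝ) * η ≤ y l - s.getD l 0 := fun l =>
    (le_div_iff₀ hη0).1 (Int.floor_le ((y l - s.getD l 0) / η))
  have ht2 : ∀ l, y l - s.getD l 0 < ((t l : ℝ) + 1) * η := fun l =>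
    (div_lt_iff₀ hη0).1 (Int.lt_floor_add_one ((y l - s.getD l 0) / η))
  have ht3 : ∀ l, -(N : ℤ) ≤ t l ∧ t l ≤ N := by
    intro l
    have := abs_le.1 (hcoord l)
    constructor
    · refine Int.le_floor.2 ((le_div_iff₀ hη0).2 ?_)
      push_cast; linarith
    · refine Int.cast_le.1 ((Int.floor_le _).trans ((div_le_iff₀ hη0).2 ?_) : ((t l : ℤ) : ℝ) ≤ ((N : ℤ) : ℝ))
      push_cast; linarith
  refine ⟨List.ofFn fun l : Fin d => s.getD l 0 + (t l : ℝ) * η, ?_, ?_⟩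
  · rw [grid, List.mem_flatMap]
    refine ⟨s, hs, (mem_around _ _ _).2 ?_⟩
    rw [List.forall₂_iff_get]
    refine ⟨by simp [h.length s hs], fun i hi hi' => ?_⟩
    rw [h.length s hs] at hi'
    refine ⟨(t ⟨i, hi'⟩ : ℝ) * η, List.mem_map.2 ⟨(t ⟨i, hi'⟩ + N).toNat, ?_, ?_⟩, ?_⟩
    · have := ht3 ⟨i, hi'⟩
      rw [List.mem_range]; omega
    · have := ht3 ⟨i, hi'⟩
      have h3 : (((t ⟨i, hi'⟩ + N).toNat : ℤ) : ℝ) = ((t ⟨i, hi'⟩ + N : ℤ) : ℝ) := by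
        rw [Int.toNat_of_nonneg (by omega)]
      push_cast at h3
      rw [h3]; ring
    · have hi2 : i < s.length := by rw [h.length s hs]; exact hi'
      simp [List.getElem?_eq_getElem hi2]
  · rw [vec_ofFn, EuclideanSpace.dist_eq]
    refine Real.sqrt_le_iff.2 ⟨by have := h.r_pos; positivity, ?_⟩
    calc ∑ l : Fin d, dist (s.getD l 0 + (t l : ℝ) * η) (y l) ^ 2 ≤ ∑ l : Fin d, η ^ 2 := by
          refine Finset.sum_le_sum fun l _ => ?_
          rw [Real.dist_eq]
          refine pow_le_pow_left₀ (abs_nonneg _) (abs_le.2 ⟨?_, ?_⟩) 2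
          · linarith [ht2 l]
          · linarith [ht1 l]
      _ = d * η ^ 2 := by simp
      _ ≤ (d * η) ^ 2 := by nlinarith [sq_nonneg η, mul_nonneg (mul_nonneg hd.le (sub_nonneg.2 h1)) (sq_nonneg η)]
      _ = (e * u / 64) ^ 2 := by rw [hη]; field_simp
      _ ≤ (e * r / 64) ^ 2 := by have := h.u_le; gcongr

theorem length_of_mem_grid (h : Net d e r u S) {x : Pt} (hx : x ∈ grid d e u S) : x.length = d := by
  obtain ⟨s, hs, hx⟩ := List.mem_flatMap.1 hx
  rw [length_of_mem_around hx, h.length s hs]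

theorem grid_ne_nil (h : Net d e r u S) : grid d e u S ≠ [] := by
  obtain ⟨s, hs⟩ := List.exists_mem_of_ne_nil S h.ne_nil
  obtain ⟨x, hx, -⟩ := h.exists_mem_grid hs (vec d s) (by rw [dist_self]; have := h.r_pos; positivity)
  exact List.ne_nil_of_mem hx

end Net

theorem near_iff {d : ℕ} {ρ R : ℝ} (hR : 0 ≤ R) (hρ : ρ = R ^ 2) {s x : Pt} (hs : s.length = d)
    (hx : x.length = d) : near ρ s x = true ↔ dist (vec d s) (vec d x) ≤ R := by
  rw [near, Bool.not_eq_true', decide_eq_false_iff_not, not_lt, dist2_eq hs hx, hρ,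
    pow_le_pow_iff_left₀ dist_nonneg hR (by norm_num)]

/-- The dynamic program succeeds if the radius is slightly larger than the cost of some centers. -/
theorem Net.dp_ne_nil {d : ℕ} {e r u : ℝ} {S X : List Pt} (h : Net d e r u S)
    (hX : ∀ x, x ∈ X ↔ x ∈ grid d e u S) {k : ℕ} (F : Fin k → EuclideanSpace ℝ (Fin d)) {R R' : ℝ}
    (hR0 : 0 ≤ R) (hR : R ≤ 2 * r) (hF : ∀ s ∈ S, ∃ j, dist (vec d s) (F j) ≤ R)
    (hR' : R + e * r / 64 ≤ R') : dp k (R' ^ 2) S X ≠ [] := by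
  classical
  have hr := h.r_pos
  have he := h.e_pos
  have hR'0 : 0 ≤ R' := le_trans (by positivity) hR'
  -- A center that serves some net point is moved to a nearby candidate. A center that serves none
  -- is replaced by an arbitrary candidate.
  have hg : ∀ j, ∃ x ∈ X, (∃ s ∈ S, dist (vec d s) (F j) ≤ R) → dist (vec d x) (F j) ≤ e * r / 64 := by
    intro j
    by_cases hj : ∃ s ∈ S, dist (vec d s) (F j) ≤ R
    · obtain ⟨s, hs, hs'⟩ := hj
      obtain ⟨x, hx, hx'⟩ := h.exists_mem_grid hs (F j) (hs'.trans hR)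
      exact ⟨x, (hX x).2 hx, fun _ => hx'⟩
    · obtain ⟨x, hx⟩ := List.exists_mem_of_ne_nil _ h.grid_ne_nil
      exact ⟨x, (hX x).2 hx, fun hj' => absurd hj' hj⟩
  choose G hG1 hG2 using hg
  -- The chosen candidates have to be listed without repetition and in the order of `X`, in which
  -- the dynamic program meets them.
  refine KCenter.dp_ne_nil (F := X.dedup.filter fun x => decide (x ∈ Finset.univ.image G))
    ((List.filter_sublist).trans (List.dedup_sublist X)) ?_ fun s hs => ?_
  · have hnd : (X.dedup.filter fun x => decide (x ∈ Finset.univ.image G)).Nodup :=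
      (List.nodup_dedup X).filter _
    rw [← List.toFinset_card_of_nodup hnd]
    refine (Finset.card_le_card (t := Finset.univ.image G) fun x hx => ?_).trans
      (Finset.card_image_le.trans (by simp))
    rw [List.mem_toFinset, List.mem_filter] at hx
    simpa using hx.2
  · obtain ⟨j, hj⟩ := hF s hs
    refine cov_iff.2 ⟨G j, List.mem_filter.2 ⟨List.mem_dedup.2 (hG1 j), by simp⟩, ?_⟩
    rw [near_iff hR'0 rfl (h.length s hs) (h.length_of_mem_grid ((hX _).1 (hG1 j)))]
    have h1 := hG2 j ⟨s, hs, hj⟩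
    linarith [dist_triangle_right (vec d s) (vec d (G j)) (F j)]

end KCenter

/-! ### Analysis of the cuts: narrow cells, few points close to cuts -/

namespace KCenter

theorem cutStep_iterate_append (T : ℕ) (W z : ℝ) (acc V : List ℝ) (j : ℕ) :
    (cutStep T W z)^[j] (acc, V) =
      (((cutStep T W z)^[j] ([], V)).1 ++ acc, ((cutStep T W z)^[j] ([], V)).2) := by
  induction j with
  | zero => simp
  | succ j ih =>
    rw [Function.iterate_succ_apply', ih, Function.iterate_succ_apply']
    simp [cutStep]

theorem cuts_nil (T : ℕ) (W z : ℝ) : cuts T W z [] = [] := by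
  rw [cuts, RealRAM.whileFn_eq (N := 0)] <;> simp

/-- Exhibits the loop as a recursion on the entries above the first cut, the form in which all
properties of the cuts are proved by induction on the number of entries. Later cuts come first in
the list. -/
theorem cuts_cons {T : ℕ} (hT : 1 ≤ T) {W : ℝ} (hW : 0 ≤ W) (z : ℝ) {V : List ℝ} (hV : V ≠ []) :
    cuts T W z V = cuts T W z (V.filter fun v => decide (bestCut T W z V < v)) ++ [bestCut T W z V] := by
  classical
  set V' := V.filter fun v => decide (bestCut T W z V < v) with hV'
  have hex : ∃ N, ((cutStep T W z)^[N] ([], V')).2 = [] := by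
    obtain ⟨N, -, h, -⟩ := cuts_eq hT hW z V'
    exact ⟨N, h⟩
  have h1 : cuts T W z V' = ((cutStep T W z)^[Nat.find hex] ([], V')).1 := by
    rw [cuts, RealRAM.whileFn_eq (N := Nat.find hex)]
    · simpa using Nat.find_spec hex
    · intro j hj
      simpa using Nat.find_min hex hj
  have h2 : ∀ j, (cutStep T W z)^[j + 1] ([], V) =
      (((cutStep T W z)^[j] ([], V')).1 ++ [bestCut T W z V], ((cutStep T W z)^[j] ([], V')).2) := by
    intro j
    rw [Function.iterate_succ_apply, ← cutStep_iterate_append]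
    rfl
  rw [h1, cuts, RealRAM.whileFn_eq (N := Nat.find hex + 1), h2]
  · rw [h2]
    simpa using Nat.find_spec hex
  · intro j hj
    cases j with
    | zero => simpa using hV
    | succ j =>
      rw [h2]
      simpa using Nat.find_min hex (by omega : j < Nat.find hex)

theorem length_filter_bestCut_lt {T : ℕ} (hT : 1 ≤ T) {W : ℝ} (hW : 0 ≤ W) (z : ℝ) {V : List ℝ}
    (hV : V ≠ []) : (V.filter fun v => decide (bestCut T W z V < v)).length < V.length := by
  have h1 : (V.filter fun v => decide (bestCut T W z V < v)).length ≤ V.length - 1 :=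
    cutStep_length hT hW z ([], V)
  have := List.length_pos_iff.2 hV
  omega

theorem le_bestCut {T : ℕ} (hT : 1 ≤ T) {W : ℝ} (hW : 0 ≤ W) (z : ℝ) (V : List ℝ) :
    minL V + T * W ≤ bestCut T W z V ∧ bestCut T W z V ≤ minL V + 2 * (T * W) := by
  obtain ⟨⟨t, ht, h⟩, -⟩ := bestCut_eq T hT W z V
  have h1 : (t : ℝ) * W ≤ T * W := by gcongr
  have h2 : 0 ≤ (t : ℝ) * W := by positivity
  constructor <;> rw [h] <;> linarith

theorem le_of_mem_cuts {T : ℕ} (hT : 1 ≤ T) {W : ℝ} (hW : 0 ≤ W) (z : ℝ) {V : List ℝ} {H : ℝ}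
    (hH : H ∈ cuts T W z V) : minL V + T * W ≤ H := by
  induction hn : V.length using Nat.strong_induction_on generalizing V with
  | _ n ih =>
    rcases eq_or_ne V [] with rfl | hV
    · simp [cuts_nil] at hH
    rw [cuts_cons hT hW z hV, List.mem_append, List.mem_singleton] at hH
    rcases hH with hH | rfl
    · have hne : (V.filter fun v => decide (bestCut T W z V < v)) ≠ [] := by
        rintro h0
        rw [h0, cuts_nil] at hH
        simp at hH
      have h1 := ih _ (hn ▸ length_filter_bestCut_lt hT hW z hV) hH rfl
      have h2 := minL_le (List.mem_of_mem_filter (minL_mem hne))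
      linarith
    · exact (le_bestCut hT hW z V).1

theorem below_append (cs cs' : List ℝ) (v : ℝ) : below (cs ++ cs') v = below cs v + below cs' v := by
  simp [below]

theorem below_mono (cs : List ℝ) {v v' : ℝ} (h : v ≤ v') : below cs v ≤ below cs v' := by
  rw [below, below, ← List.countP_eq_length_filter, ← List.countP_eq_length_filter]
  exact List.countP_mono_left fun x _ hx => by
    rw [decide_eq_true_eq] at *
    exact hx.trans_le h

/-- Numbers that are not separated by a cut are close. -/
theorem sub_le_of_below_eq {T : ℕ} (hT : 1 ≤ T) {W : ℝ} (hW : 0 ≤ W) (z : ℝ) {V : List ℝ} {v v' : ℝ}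
    (hv : v ∈ V) (hv' : v' ∈ V) (hle : v ≤ v')
    (h : below (cuts T W z V) v = below (cuts T W z V) v') : v' - v ≤ 2 * (T * W) := by
  induction hn : V.length using Nat.strong_induction_on generalizing V with
  | _ n ih =>
    have hV := List.ne_nil_of_mem hv
    rw [cuts_cons hT hW z hV, below_append, below_append] at h
    have h1 := below_mono (cuts T W z (V.filter fun v => decide (bestCut T W z V < v))) hle
    have h2 : ∀ w, below [bestCut T W z V] w = if bestCut T W z V < w then 1 else 0 := by
      intro w
      by_cases hw : bestCut T W z V < w <;> simp [below, hw]
    rw [h2, h2] at h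
    by_cases hb' : bestCut T W z V < v'
    · by_cases hb : bestCut T W z V < v
      · rw [if_pos hb, if_pos hb'] at h
        exact ih _ (hn ▸ length_filter_bestCut_lt hT hW z hV) (List.mem_filter.2 ⟨hv, by simpa using hb⟩)
          (List.mem_filter.2 ⟨hv', by simpa using hb'⟩) (by omega) rfl
      · rw [if_neg hb, if_pos hb'] at h
        omega
    -- Neither number exceeds the first cut, which is at most `minL V + 2 * (T * W)`, while both are
    -- at least `minL V`.
    · have h3 := minL_le hv
      have h4 := (le_bestCut hT hW z V).2
      linarith

/-- Double counting: each element satisfies at most one of the predicates `p i`, and only if it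
satisfies `q`. -/
theorem sum_countP_le {α ι : Type*} (I : Finset ι) (p : ι → α → Bool) (q : α → Bool) (V : List α)
    (h1 : ∀ v ∈ V, ∀ i ∈ I, p i v = true → q v = true)
    (h2 : ∀ v ∈ V, ∀ i ∈ I, ∀ j ∈ I, p i v = true → p j v = true → i = j) :
    ∑ i ∈ I, V.countP (p i) ≤ V.countP q := by
  classical
  induction V with
  | nil => simp
  | cons v V ih =>
    simp only [List.countP_cons, Finset.sum_add_distrib]
    refine add_le_add (ih (fun w hw => h1 w (List.mem_cons_of_mem _ hw))
      fun w hw => h2 w (List.mem_cons_of_mem _ hw)) ?_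
    rw [← Finset.sum_filter, Finset.sum_const, smul_eq_mul, mul_one]
    by_cases hq : q v = true
    · rw [if_pos hq]
      refine Finset.card_le_one.2 fun i hi j hj => ?_
      rw [Finset.mem_filter] at hi hj
      exact h2 v (by simp) i hi.1 j hj.1 hi.2 hj.2
    · rw [if_neg hq, Nat.le_zero, Finset.card_eq_zero, Finset.filter_eq_empty_iff]
      exact fun i hi hp => hq (h1 v (by simp) i hi hp)

theorem cnt_eq_countP (z : ℝ) (V : List ℝ) (H : ℝ) :
    cnt z V H = V.countP fun v => decide (|v - H| ≤ z) := by
  rw [cnt, ← List.countP_eq_length_filter]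
  refine List.countP_congr fun v _ => ?_
  simp only [Bool.and_eq_true, Bool.not_eq_true', decide_eq_false_iff_not, not_lt, decide_eq_true_eq,
    abs_le]
  constructor
  · rintro ⟨h1, h2⟩; exact ⟨by linarith, h1⟩
  · rintro ⟨h1, h2⟩; exact ⟨h2, by linarith⟩

/-- The `z`-neighbourhoods of the `T` possible positions of a cut are disjoint because `2 * z < W`,
so the best position gets at most a `1 / T` share of the entries between `minL V + T * W - z` and
`minL V + 2 * (T * W) - W + z`. Counting only entries from `minL V + T * W - z` on makes the
induction work: the entries charged to later cuts lie beyond those charged to the first. -/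
theorem cuts_count_aux {T : ℕ} (hT : 1 ≤ T) {W z : ℝ} (hz : 0 ≤ z) (hW : 2 * z < W) (V : List ℝ) :
    T * ((cuts T W z V).map (cnt z V)).sum ≤ V.countP fun v => decide (minL V + T * W - z ≤ v) := by
  have hW0 : 0 ≤ W := by linarith
  induction hn : V.length using Nat.strong_induction_on generalizing V with
  | _ n ih =>
    rcases eq_or_ne V [] with rfl | hV
    · simp [cuts_nil]
    set b := bestCut T W z V with hb
    set V' := V.filter fun v => decide (b < v) with hV'
    obtain ⟨hb1, hb2⟩ := le_bestCut hT hW0 z V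
    have hT1 : (1 : ℝ) ≤ T := by exact_mod_cast hT
    have hTW : W ≤ T * W := le_mul_of_one_le_left hW0 hT1
    rw [cuts_cons hT hW0 z hV, List.map_append, List.sum_append, List.map_singleton, List.sum_singleton,
      mul_add]
    -- Later cuts are at distance more than `T * W > z` from the first one, so the entries removed
    -- by the first cut are not close to them.
    have h1 : (cuts T W z V').map (cnt z V) = (cuts T W z V').map (cnt z V') := by
      refine List.map_congr_left fun H hH => ?_
      have hne : V' ≠ [] := by
        rintro h0
        rw [h0, cuts_nil] at hH
        simp at hH
      have h2 := le_of_mem_cuts hT hW0 z hH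
      have h3 : b < minL V' := by simpa using (List.mem_filter.1 (minL_mem hne)).2
      rw [cnt_eq_countP, cnt_eq_countP, hV', List.countP_filter]
      refine List.countP_congr fun v _ => ?_
      simp only [Bool.and_eq_true, decide_eq_true_eq, abs_le]
      exact ⟨fun h => ⟨h, by linarith [h.1]⟩, fun h => h.1⟩
    have h2 : T * cnt z V b ≤ V.countP fun v => decide (minL V + T * W - z ≤ v) &&
        decide (v ≤ minL V + 2 * (T * W) - W + z) := by
      obtain ⟨-, h3⟩ := bestCut_eq T hT W z V
      calc T * cnt z V b = ∑ t ∈ Finset.range T, cnt z V b := by simp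
        _ ≤ ∑ t ∈ Finset.range T, V.countP fun v => decide (|v - (minL V + T * W + t * W)| ≤ z) :=
            Finset.sum_le_sum fun t ht => by
              rw [← cnt_eq_countP]
              exact h3 t (Finset.mem_range.1 ht)
        _ ≤ _ := by
            refine sum_countP_le _ _ _ _ (fun v _ t ht h => ?_) fun v _ t ht t' ht' h h' => ?_
            · rw [decide_eq_true_eq, abs_le] at h
              have h4 : (t : ℝ) + 1 ≤ T := by exact_mod_cast Finset.mem_range.1 ht
              have h5 : ((t : ℝ) + 1) * W ≤ T * W := by gcongr
              have h6 : 0 ≤ (t : ℝ) * W := by positivity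
              simp only [Bool.and_eq_true, decide_eq_true_eq]
              constructor <;> linarith [h.1, h.2]
            · rw [decide_eq_true_eq, abs_le] at h h'
              by_contra hne
              rcases lt_or_gt_of_ne hne with hlt | hlt
              · have h4 : (t : ℝ) + 1 ≤ t' := by exact_mod_cast hlt
                have h5 : ((t : ℝ) + 1) * W ≤ t' * W := by gcongr
                linarith [h.1, h.2, h'.1, h'.2]
              · have h4 : (t' : ℝ) + 1 ≤ t := by exact_mod_cast hlt
                have h5 : ((t' : ℝ) + 1) * W ≤ t * W := by gcongr
                linarith [h.1, h.2, h'.1, h'.2]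
    have h3 := ih _ (hn ▸ length_filter_bestCut_lt hT hW0 z hV) V' rfl
    rw [h1]
    rcases eq_or_ne V' [] with h0 | hne
    · rw [h0, cuts_nil]
      simp only [List.map_nil, List.sum_nil, mul_zero, zero_add]
      refine h2.trans (List.countP_mono_left fun v _ h => ?_)
      exact (Bool.and_eq_true _ _ ▸ h).1
    · have h4 : b < minL V' := by simpa using (List.mem_filter.1 (minL_mem hne)).2
      have h5 : (V'.countP fun v => decide (minL V' + T * W - z ≤ v)) ≤
          V.countP fun v => decide (minL V + 2 * (T * W) - W + z < v) := by
        rw [hV', List.countP_filter]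
        refine List.countP_mono_left fun v _ h => ?_
        simp only [Bool.and_eq_true, decide_eq_true_eq] at h ⊢
        rw [← hV'] at h
        linarith [h.1]
      refine (add_le_add (h3.trans h5) h2).trans ?_
      have h6 := sum_countP_le (Finset.univ : Finset Bool) (fun i v => bif i then
        decide (minL V + 2 * (T * W) - W + z < v) else (decide (minL V + T * W - z ≤ v) &&
        decide (v ≤ minL V + 2 * (T * W) - W + z))) (fun v => decide (minL V + T * W - z ≤ v)) V
        (fun v _ i _ h => ?_) (fun v _ i _ j _ h h' => ?_)
      · simpa using h6
      · cases i
        · simp only [cond_false, Bool.and_eq_true] at h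
          exact h.1
        · simp only [cond_true, decide_eq_true_eq] at h ⊢
          linarith
      · cases i <;> cases j <;> simp at h h' ⊢
        · linarith
        · linarith

/-- Few numbers are close to a cut. -/
theorem cuts_count {T : ℕ} (hT : 1 ≤ T) {W z : ℝ} (hz : 0 ≤ z) (hW : 2 * z < W) (V : List ℝ) :
    T * ((cuts T W z V).map (cnt z V)).sum ≤ V.length :=
  (cuts_count_aux hT hz hW V).trans List.countP_le_length

end KCenter

/-! ### The frontier: points close to cuts and points in a slice of a cell -/

namespace KCenter

/-- Uniqueness of the digits in base `B`: the number of cuts below a coordinate is at most the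
number of all cuts, hence less than `B`. -/
theorem code_eq_iff {B : ℕ} {C : List (List ℝ)} (hC : ∀ c ∈ C, c.length < B) {x y : Pt}
    (hx : x.length = C.length) (hy : y.length = C.length) : code B C x = code B C y ↔
      ∀ l < C.length, below (C.getD l []) (x.getD l 0) = below (C.getD l []) (y.getD l 0) := by
  induction C generalizing x y with
  | nil => simp [code]
  | cons c C ih =>
    match x, y with
    | a :: x, b :: y =>
      simp only [List.length_cons, Nat.succ.injEq] at hx hy
      have hb : ∀ v, below c v < B := fun v => (List.length_filter_le _ _).trans_lt (hC c (by simp))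
      have h1 := ih (fun c hc => hC c (List.mem_cons_of_mem _ hc)) hx hy
      have h2 : ∀ (v : ℝ) (w : Pt), code B (c :: C) (v :: w) = below c v + code B C w * B := fun v w => rfl
      rw [h2, h2]
      constructor
      · intro h
        have h3 : below c a = below c b := by
          have := congrArg (· % B) h
          simpa [Nat.mod_eq_of_lt (hb _)] using this
        have h4 : code B C x = code B C y := by
          rw [h3, Nat.add_left_cancel_iff] at h
          exact Nat.eq_of_mul_eq_mul_right ((Nat.zero_le _).trans_lt (hb 0)) h
        intro l hl
        cases l with
        | zero => simpa using h3
        | succ l => simpa using h1.1 h4 l (by simpa using hl)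
      · intro h
        have h3 : below c a = below c b := by simpa using h 0 (by simp)
        rw [h3, h1.2 fun l hl => by simpa using h (l + 1) (by simpa using hl)]

theorem allCuts_getD {d k : ℕ} {u : ℝ} {S : List Pt} {l : ℕ} (hl : l < d) :
    (allCuts d k u S).getD l [] =
      cuts (sideT d k) (5 * ((d : ℝ) * u)) (2 * ((d : ℝ) * u)) (S.map fun s => s.getD l 0) := by
  rw [List.getD_eq_getElem _ _ (by rw [length_allCuts]; exact hl)]
  simp [allCuts, columns, coord_eq]

/-- Whether `s` is at distance at most `z` from a cut. -/
noncomputable def nearCut (d : ℕ) (C : List (List ℝ)) (z : ℝ) (s : Pt) : Bool :=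
  (List.range d).any fun l => (C.getD l []).any fun H => decide (|s.getD l 0 - H| ≤ z)

/-- No cut can separate `a` from `b`: it would be at distance at most `z` from `a`. -/
theorem below_eq_of_abs_lt {cs : List ℝ} {a b z : ℝ} (h : ∀ H ∈ cs, ¬ |a - H| ≤ z) (hab : |a - b| ≤ z) :
    below cs a = below cs b := by
  rw [below, below]
  congr 1
  refine List.filter_congr fun H hH => ?_
  have h1 := h H hH
  rw [abs_le] at h1 hab
  rw [decide_eq_decide]
  constructor
  · intro h2
    by_contra h3
    exact h1 ⟨by linarith [hab.1], by linarith [hab.2]⟩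
  · intro h2
    by_contra h3
    exact h1 ⟨by linarith [hab.1], by linarith [hab.2]⟩

theorem code_eq_of_not_nearCut {B d : ℕ} {C : List (List ℝ)} (hC : ∀ c ∈ C, c.length < B)
    (hCd : C.length = d) {z : ℝ} {s x : Pt} (hs : s.length = d) (hx : x.length = d)
    (hn : ¬ nearCut d C z s = true) (h : ∀ l, |s.getD l 0 - x.getD l 0| ≤ z) :
    code B C s = code B C x := by
  rw [code_eq_iff hC (by omega) (by omega)]
  intro l hl
  refine below_eq_of_abs_lt (fun H hH h1 => hn ?_) (h l)
  exact List.any_eq_true.2 ⟨l, List.mem_range.2 (hCd ▸ hl), List.any_eq_true.2 ⟨H, hH, by simpa using h1⟩⟩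

theorem countP_or_le {α : Type*} (p q : α → Bool) (V : List α) :
    (V.countP fun v => p v || q v) ≤ V.countP p + V.countP q := by
  induction V with
  | nil => simp
  | cons v V ih =>
    simp only [List.countP_cons]
    cases p v <;> cases q v <;> simp <;> omega

theorem countP_any_le {α β : Type*} (p : α → β → Bool) (V : List α) (L : List β) :
    (V.countP fun v => L.any fun a => p v a) ≤ (L.map fun a => V.countP fun v => p v a).sum := by
  induction L with
  | nil => simp
  | cons a L ih =>
    simp only [List.any_cons, List.map_cons, List.sum_cons]
    exact (countP_or_le _ _ V).trans (by omega)

/-- Each of the `d` coordinates contributes at most `S.length / T` points, by `cuts_count`. -/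
theorem Net.countP_nearCut_le {d : ℕ} {e r u : ℝ} {S : List Pt} (h : Net d e r u S) (k : ℕ) :
    sideT d k * S.countP (nearCut d (allCuts d k u S) (2 * ((d : ℝ) * u))) ≤ d * S.length := by
  obtain ⟨N, -, hN, -⟩ := sideT_exists h.dim k
  have h1 := h.one_le_d
  have hu := h.u_pos
  have hdu : 0 < (d : ℝ) * u := by positivity
  refine (Nat.mul_le_mul_left _ (countP_any_le _ S (List.range d))).trans ?_
  rw [← List.sum_map_mul_left]
  refine (List.sum_le_card_nsmul _ S.length fun y hy => ?_).trans (by simp)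
  obtain ⟨l, hl, rfl⟩ := List.mem_map.1 hy
  refine (Nat.mul_le_mul_left _ (countP_any_le _ S _)).trans ?_
  rw [allCuts_getD (List.mem_range.1 hl)]
  refine le_trans (le_of_eq ?_) ((cuts_count (T := sideT d k) (W := 5 * ((d : ℝ) * u))
    (z := 2 * ((d : ℝ) * u)) (by omega) (by positivity) (by linarith) (S.map fun s => s.getD l 0)).trans
    (by rw [List.length_map]))
  congr 2
  refine List.map_congr_left fun H _ => ?_
  rw [cnt_eq_countP, List.countP_map]
  rfl

/-- The points of `S` in a given cell whose first coordinate is close to `a`. -/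
noncomputable def slice (B : ℕ) (C : List (List ℝ)) (z : ℝ) (S : List Pt) (c : ℕ) (a : ℝ) : List Pt :=
  S.filter fun s => decide (code B C s = c) && decide (|s.getD 0 0 - a| ≤ z)

theorem headD_eq_getD (x : Pt) : x.headD 0 = x.getD 0 0 := by cases x <;> rfl

/-- Let `x` be the last scanned candidate. A frontier point `s` not close to a cut is in the same
cell as the scanned `y` and the unscanned `y'` that are near to it. As `y ≤ x ≤ y'` in the order,
`x` is in this cell as well, and its first coordinate is between those of `y` and `y'`, hence at
distance at most `2 * (d * u)` from that of `s`. So `s` is in the slice of the cell of `x` around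
`x`. -/
theorem Net.frontier_le {d : ℕ} {e r u : ℝ} {S : List Pt} (h : Net d e r u S) (k : ℕ) {R : ℝ} (hR0 : 0 ≤ R)
    (hR : R ≤ 2 * r) {Y Y' : List Pt} (hX : candidates d k e u S = Y ++ Y') {K : ℕ}
    (hK : ∀ c a, (slice (S.length + 1) (allCuts d k u S) (2 * ((d : ℝ) * u)) S c a).length ≤ K) :
    sideT d k * (frontier (R ^ 2) S Y Y').length ≤ d * S.length + sideT d k * K := by
  have hX' : ordered (S.length + 1) (allCuts d k u S) (grid d e u S) = Y ++ Y' := by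
    rw [← hX, candidates]
  set C := allCuts d k u S with hCdef
  set z := 2 * ((d : ℝ) * u) with hz
  set B := S.length + 1 with hB
  have hC : ∀ c ∈ C, c.length < B := fun c hc =>
    Nat.lt_succ_of_le (length_of_mem_allCuts h.dim h.u_pos.le hc)
  have hCd : C.length = d := length_allCuts _ _ _ _
  rcases eq_or_ne Y [] with rfl | hY
  · simp [frontier, cov]
  have hlen : ∀ x ∈ Y ++ Y', x.length = d := fun x hx => by
    rw [← hX', mem_ordered] at hx
    exact h.length_of_mem_grid hx
  have hnear : ∀ s ∈ S, ∀ x ∈ Y ++ Y', near (R ^ 2) s x = true → ∀ l, |s.getD l 0 - x.getD l 0| ≤ z := by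
    intro s hs x hx hn l
    rw [near, Bool.not_eq_true', decide_eq_false_iff_not, not_lt] at hn
    have h1 := sq_coord_sub_le (h.length s hs) (hlen x hx) l
    have h2 := abs_le_of_sq_le_sq (h1.trans hn) hR0
    have := h.r_le
    rw [hz]
    linarith
  have hsorted := pairwise_ordered B C (grid d e u S)
  rw [hX', List.pairwise_append] at hsorted
  set x := Y.getLast hY with hx
  have hYx : Y = Y.dropLast ++ [x] := (List.dropLast_append_getLast hY).symm
  have hxm : x ∈ Y := List.getLast_mem hY
  have hbefore : ∀ y ∈ Y, toLex (code B C y, y.headD 0) ≤ toLex (code B C x, x.headD 0) := by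
    intro y hy
    rw [hYx] at hy
    rcases List.mem_append.1 hy with hy | hy
    · have h1 := hsorted.1
      rw [hYx, List.pairwise_append] at h1
      exact h1.2.2 y hy x (by simp)
    · rw [List.mem_singleton.1 hy]
  have hsub : (frontier (R ^ 2) S Y Y').length ≤ S.countP (nearCut d C z) + K := by
    refine le_trans ?_ (Nat.add_le_add_left (hK (code B C x) (x.headD 0)) _)
    rw [frontier, slice, ← List.countP_eq_length_filter, ← List.countP_eq_length_filter]
    refine le_trans (List.countP_mono_left fun s hs hfs => ?_) (countP_or_le _ _ S)
    rw [Bool.or_eq_true, or_iff_not_imp_left]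
    intro hn
    rw [Bool.and_eq_true, cov_iff, cov_iff] at hfs
    obtain ⟨⟨y, hy, hys⟩, y', hy', hys'⟩ := hfs
    have hyl := List.mem_append_left Y' hy
    have hyl' := List.mem_append_right Y hy'
    have h1 := hnear s hs y hyl hys
    have h2 := hnear s hs y' hyl' hys'
    have h3 := code_eq_of_not_nearCut hC hCd (h.length s hs) (hlen y hyl) hn h1
    have h4 := code_eq_of_not_nearCut hC hCd (h.length s hs) (hlen y' hyl') hn h2
    have h5 := hbefore y hy
    have h6 := hsorted.2.2 x hxm y' hy'
    rw [Prod.Lex.toLex_le_toLex] at h5 h6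
    simp only [← h3, ← h4] at h5 h6
    have h7 : code B C s = code B C x := by
      rcases h5 with h5 | h5
      · rcases h6 with h6 | h6
        · omega
        · exact h6.1.symm
      · exact h5.1
    rw [h7] at h5 h6
    have h8 := h5.resolve_left (lt_irrefl _)
    have h9 := h6.resolve_left (lt_irrefl _)
    have h10 := abs_le.1 (h1 0)
    have h11 := abs_le.1 (h2 0)
    simp only [headD_eq_getD] at h8 h9 ⊢
    simp only [h7, decide_true, Bool.true_and, decide_eq_true_eq, abs_le]
    constructor <;> linarith [h8.2, h9.2]
  have := h.countP_nearCut_le k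
  calc sideT d k * (frontier (R ^ 2) S Y Y').length
      ≤ sideT d k * (S.countP (nearCut d C z) + K) := Nat.mul_le_mul_left _ hsub
    _ ≤ _ := by rw [mul_add]; exact Nat.add_le_add_right this _

/-- The number of points in a slice of a cell. -/
theorem Net.length_slice_le {d : ℕ} {e r u : ℝ} {S : List Pt} (h : Net d e r u S) (k c : ℕ) (a : ℝ) :
    (slice (S.length + 1) (allCuts d k u S) (2 * ((d : ℝ) * u)) S c a).length ≤
      (2 * (⌈32 * ((d : ℝ) * d / e)⌉₊ + 1) + 1) *
        (2 * (⌈80 * (sideT d k * ((d : ℝ) * d) / e)⌉₊ + 1) + 1) ^ (d - 1) := by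
  classical
  obtain ⟨N, -, hT, -⟩ := sideT_exists h.dim k
  have h1 := h.one_le_d
  have hu := h.u_pos
  have hr := h.r_pos
  have he := h.e_pos
  have hd : (0 : ℝ) < d := by linarith
  set L := slice (S.length + 1) (allCuts d k u S) (2 * ((d : ℝ) * u)) S c a with hL
  set M₀ := ⌈32 * ((d : ℝ) * d / e)⌉₊ + 1 with hM₀
  set M₁ := ⌈80 * (sideT d k * ((d : ℝ) * d) / e)⌉₊ + 1 with hM₁
  -- Two points in a common cube of side `σ` have distance less than `√d * σ ≤ e * r / 8`; thus each
  -- such cube contains at most one net point, and it suffices to count cubes.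
  set σ := e * r / (8 * d) with hσ
  have hσ0 : 0 < σ := by positivity
  have hLS : ∀ s ∈ L, s ∈ S := fun s hs => List.mem_of_mem_filter hs
  have hC : ∀ c ∈ allCuts d k u S, c.length < S.length + 1 := fun c hc =>
    Nat.lt_succ_of_le (length_of_mem_allCuts h.dim h.u_pos.le hc)
  have hnd : L.Nodup := by
    refine List.Nodup.filter _ (h.sep.imp_of_mem fun {a b} ha hb hab heq => ?_)
    rw [heq, dist2_eq (h.length b hb) (h.length b hb), dist_self] at hab
    have : 0 < (e * r / 8) ^ 2 := by positivity
    linarith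
  rcases L.eq_nil_or_concat with h0 | ⟨L', s₀, hL'⟩
  · rw [h0]; simp
  have hs₀ : s₀ ∈ L := by rw [hL']; simp
  rw [← List.toFinset_card_of_nodup hnd]
  let f : Pt → Fin d → ℤ := fun s l => ⌊s.getD l 0 / σ⌋
  -- In the first coordinate the slice has width `4 * (d * u)`; in the others only the cell limits
  -- the extent, to `2 * T * W = 10 * T * (d * u)`. Divided by `σ`, with `u ≤ r`, these give `M₀`
  -- and `M₁`.
  let M : Fin d → ℕ := fun l => if (l : ℕ) = 0 then M₀ else M₁
  have hM : ∀ s ∈ L, ∀ l : Fin d, |s.getD l 0 - s₀.getD l 0| ≤ (M l - 1) * σ := by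
    intro s hs l
    have h2 := (List.mem_filter.1 hs).2
    have h3 := (List.mem_filter.1 hs₀).2
    simp only [Bool.and_eq_true, decide_eq_true_eq] at h2 h3
    by_cases hl : (l : ℕ) = 0
    · simp only [M, hl, if_true]
      have h4 : |s.getD 0 0 - s₀.getD 0 0| ≤ 4 * (d * u) := by
        have h5 := abs_le.1 h2.2
        have h6 := abs_le.1 h3.2
        rw [abs_le]
        constructor <;> linarith [h5.1, h5.2, h6.1, h6.2]
      refine h4.trans ?_
      calc 4 * (d * u) ≤ 4 * (d * r) := by have := h.u_le; gcongr
        _ = 32 * ((d : ℝ) * d / e) * σ := by rw [hσ]; field_simp; norm_num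
        _ ≤ (M₀ - 1) * σ := by
            gcongr
            rw [hM₀]; push_cast
            linarith [Nat.le_ceil (32 * ((d : ℝ) * d / e))]
    · simp only [M, hl, if_false]
      have h4 := (code_eq_iff hC (by rw [length_allCuts, h.length s (hLS s hs)])
        (by rw [length_allCuts, h.length s₀ (hLS s₀ hs₀)])).1 (h2.1.trans h3.1.symm) l
        (by rw [length_allCuts]; exact l.2)
      rw [allCuts_getD l.2] at h4
      have h5 : s.getD l 0 ∈ S.map fun s => s.getD l 0 := List.mem_map.2 ⟨s, hLS s hs, rfl⟩
      have h6 : s₀.getD l 0 ∈ S.map fun s => s.getD l 0 := List.mem_map.2 ⟨s₀, hLS s₀ hs₀, rfl⟩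
      have h7 : |s.getD l 0 - s₀.getD l 0| ≤ 2 * (sideT d k * (5 * (d * u))) := by
        rcases le_total (s.getD l 0) (s₀.getD l 0) with hle | hle
        · rw [abs_sub_comm, abs_of_nonneg (sub_nonneg.2 hle)]
          exact sub_le_of_below_eq (by omega) (by positivity) _ h5 h6 hle h4
        · rw [abs_of_nonneg (sub_nonneg.2 hle)]
          exact sub_le_of_below_eq (by omega) (by positivity) _ h6 h5 hle h4.symm
      refine h7.trans ?_
      calc 2 * (sideT d k * (5 * (d * u))) ≤ 2 * (sideT d k * (5 * (d * r))) := by have := h.u_le; gcongr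
        _ = 80 * (sideT d k * ((d : ℝ) * d) / e) * σ := by rw [hσ]; field_simp; ring
        _ ≤ (M₁ - 1) * σ := by
            gcongr
            rw [hM₁]; push_cast
            linarith [Nat.le_ceil (80 * (sideT d k * ((d : ℝ) * d) / e))]
  have hcard := Finset.card_le_card_of_injOn f
    (s := L.toFinset) (t := Fintype.piFinset fun l => Finset.Icc (f s₀ l - M l) (f s₀ l + M l)) ?_ ?_
  · refine hcard.trans (le_of_eq ?_)
    rw [Fintype.card_piFinset]
    have h2 : ∀ l, (Finset.Icc (f s₀ l - M l) (f s₀ l + M l)).card = 2 * M l + 1 := by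
      intro l
      rw [Int.card_Icc]; omega
    simp only [h2]
    obtain ⟨d', hd'⟩ : ∃ d', d = d' + 1 := ⟨d - 1, by have := h.dim; omega⟩
    clear_value M₀ M₁
    subst hd'
    rw [Fin.prod_univ_succ]
    simp [M]
  · intro s hs
    rw [Finset.mem_coe, List.mem_toFinset] at hs
    rw [Finset.mem_coe, Fintype.mem_piFinset]
    intro l
    have h2 := abs_le.1 (hM s hs l)
    have h3 : (s.getD l 0 - s₀.getD l 0) / σ ≤ M l - 1 := (div_le_iff₀ hσ0).2 h2.2
    have h4 : -((M l : ℝ) - 1) ≤ (s.getD l 0 - s₀.getD l 0) / σ := (le_div_iff₀ hσ0).2 (by linarith [h2.1])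
    rw [sub_div] at h3 h4
    have h5 := Int.floor_le (s.getD l 0 / σ)
    have h6 := Int.lt_floor_add_one (s.getD l 0 / σ)
    have h7 := Int.floor_le (s₀.getD l 0 / σ)
    have h8 := Int.lt_floor_add_one (s₀.getD l 0 / σ)
    rw [Finset.mem_Icc]
    constructor
    · have : ((f s₀ l - M l : ℤ) : ℝ) < ((f s l + 1 : ℤ) : ℝ) := by
        push_cast; simp only [f]; linarith
      have := Int.cast_lt.1 this
      omega
    · have : ((f s l : ℤ) : ℝ) < ((f s₀ l + M l + 1 : ℤ) : ℝ) := by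
        push_cast; simp only [f]; linarith
      have := Int.cast_lt.1 this
      omega
  · intro s hs s' hs' hss
    rw [Finset.mem_coe, List.mem_toFinset] at hs hs'
    by_contra hne
    have h2 : dist2 s s' < (e * r / 8) ^ 2 := by
      rw [dist2_eq (h.length s (hLS s hs)) (h.length s' (hLS s' hs')), EuclideanSpace.dist_eq,
        Real.sq_sqrt (by positivity)]
      calc ∑ l : Fin d, dist (vec d s l) (vec d s' l) ^ 2 < ∑ l : Fin d, σ ^ 2 := by
            refine Finset.sum_lt_sum_of_nonempty ⟨⟨0, h.dim⟩, Finset.mem_univ _⟩ fun l _ => ?_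
            refine pow_lt_pow_left₀ ?_ dist_nonneg (by norm_num)
            rw [Real.dist_eq]
            have h3 := Int.abs_sub_lt_one_of_floor_eq_floor (congrFun hss l)
            rw [← sub_div, abs_div, abs_of_pos hσ0, div_lt_one hσ0] at h3
            exact h3
        _ = d * σ ^ 2 := by simp
        _ ≤ (d * σ) ^ 2 := by
            nlinarith [mul_nonneg (mul_nonneg hd.le (sub_nonneg.2 h1)) (sq_nonneg σ)]
        _ = _ := by rw [hσ]; field_simp
    exact absurd (le_dist2_of_pairwise h.length h.sep (hLS s hs) (hLS s' hs') hne) (not_le.2 h2)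

end KCenter

/-! ### Size of the net and width of the dynamic program in terms of `k`, `d`, `e` -/

namespace KCenter

/-- The number of points of a separated subset of the clients. -/
theorem length_le_of_sep {d : ℕ} {e r : ℝ} (he : 0 < e) (he1 : e ≤ 1) (hr : 0 < r) {A S : List Pt}
    (hA : ∀ s ∈ A, s.length = d) (hS : ∀ s ∈ S, s.length = d)
    (hcov : ∀ s ∈ S, ∃ g ∈ A, dist2 s g ≤ r ^ 2)
    (hsep : S.Pairwise fun a b => (e * r / 8) ^ 2 ≤ dist2 a b) :
    (S.length : ℝ) ≤ A.length * (17 * (1 / e)) ^ d := by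
  classical
  have hδ : 0 < e * r / 8 := by positivity
  have hne : S.Pairwise fun a b => vec d a ≠ vec d b := hsep.imp_of_mem fun {a b} ha hb hab heq => by
    rw [dist2_eq (hS a ha) (hS b hb), heq, dist_self] at hab
    have : 0 < (e * r / 8) ^ 2 := by positivity
    linarith
  have hcard : (S.map (vec d)).toFinset.card = S.length := by
    rw [List.toFinset_card_of_nodup (List.pairwise_map.2 hne), List.length_map]
  have h := EuclideanSpace.card_mul_le_of_separated (S.map (vec d)).toFinset (A.map (vec d)).toFinset hδ hr.le
    (fun x hx y hy hxy => ?_) (fun x hx => ?_)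
  · rw [hcard] at h
    have h1 : ((A.map (vec d)).toFinset.card : ℝ) ≤ A.length := by
      exact_mod_cast (List.toFinset_card_le _).trans (by rw [List.length_map])
    have h2 : (S.length : ℝ) * (e * r / 8 / 2) ^ d ≤
        (A.length * (17 * (1 / e)) ^ d) * (e * r / 8 / 2) ^ d := by
      refine h.trans ?_
      rw [mul_assoc, ← mul_pow]
      gcongr
      -- With `δ = e * r / 8`, the ratio of the radii is `(r + δ / 2) / (δ / 2) = 16 / e + 1 ≤ 17 /
      -- e`.
      have : 17 * (1 / e) * (e * r / 8 / 2) = 17 * r / 16 := by field_simp; norm_num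
      rw [this]
      nlinarith
    exact le_of_mul_le_mul_right h2 (by positivity)
  · obtain ⟨a, ha, rfl⟩ := List.mem_map.1 (List.mem_toFinset.1 hx)
    obtain ⟨b, hb, rfl⟩ := List.mem_map.1 (List.mem_toFinset.1 hy)
    have h1 := le_dist2_of_pairwise hS hsep ha hb fun hab => hxy (by rw [hab])
    rw [dist2_eq (hS a ha) (hS b hb)] at h1
    exact (pow_le_pow_iff_left₀ hδ.le dist_nonneg (by norm_num)).1 h1
  · obtain ⟨a, ha, rfl⟩ := List.mem_map.1 (List.mem_toFinset.1 hx)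
    obtain ⟨g, hg, h1⟩ := hcov a ha
    rw [dist2_eq (hS a ha) (hA g hg)] at h1
    exact ⟨vec d g, List.mem_toFinset.2 (List.mem_map.2 ⟨g, hg, rfl⟩),
      (pow_le_pow_iff_left₀ dist_nonneg hr.le (by norm_num)).1 h1⟩

theorem cast_le_two_pow (d : ℕ) : (d : ℝ) ≤ 2 ^ d := by exact_mod_cast Nat.lt_two_pow_self.le

/-- As `q = 1 / e` is at least `2`, constant factors are absorbed by its exponent. This is why `e`
is capped at `1 / 2`. -/
theorem const_mul_pow_le {q C : ℝ} {m d : ℕ} (hq : 2 ≤ q) (h0 : 0 ≤ C) (hC : C ≤ 2 ^ m) :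
    (C * q) ^ d ≤ q ^ ((m + 1) * d) := by
  have h1 : C * q ≤ q ^ (m + 1) := by
    rw [pow_succ]
    gcongr
    exact hC.trans (by gcongr)
  rw [pow_mul]
  gcongr

theorem ceil_odd_le {a x : ℝ} (ha : 0 ≤ a) (hx : 2 ≤ x) :
    ((2 * (⌈a * x⌉₊ + 1) + 1 : ℕ) : ℝ) ≤ (2 * a + 3) * x := by
  have := Nat.ceil_lt_add_one (mul_nonneg ha (by linarith : 0 ≤ x))
  push_cast
  nlinarith

/-- The width of the dynamic program. -/
theorem Net.frontier_le_pow {d : ℕ} {e r u : ℝ} {S : List Pt} (h : Net d e r u S) {k : ℕ} (hk : 1 ≤ k)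
    (hS : (S.length : ℝ) ≤ k * (17 * (1 / e)) ^ d) {R : ℝ} (hR0 : 0 ≤ R)
    (hR : R ≤ 2 * r) {Y Y' : List Pt} (hX : candidates d k e u S = Y ++ Y') :
    ((frontier (R ^ 2) S Y Y').length : ℝ) ≤ (1 / e) ^ (12 * d) * (k : ℝ) ^ (1 - 1 / (d : ℝ)) := by
  have h1 := h.one_le_d
  have he := h.e_pos
  have hd : (0 : ℝ) < d := by linarith
  have hk1 : (1 : ℝ) ≤ k := by exact_mod_cast hk
  set q := 1 / e with hq
  have hq2 : 2 ≤ q := by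
    rw [hq, le_div_iff₀ he]
    linarith [h.e_le]
  have hq0 : 0 < q := by linarith
  set κ := (k : ℝ) ^ (1 / (d : ℝ)) with hκ
  have hκ1 : 1 ≤ κ := Real.one_le_rpow hk1 (by positivity)
  have hκ0 : 0 < κ := by linarith
  have hκd : κ ^ d = k := by
    rw [hκ, ← Real.rpow_natCast, ← Real.rpow_mul (by linarith), one_div, inv_mul_cancel₀ hd.ne',
      Real.rpow_one]
  have hsplit : (k : ℝ) = κ ^ (d - 1) * κ := by
    rw [← pow_succ, Nat.sub_add_cancel h.dim, hκd]
  have hpow : (k : ℝ) ^ (1 - 1 / (d : ℝ)) = κ ^ (d - 1) := by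
    rw [Real.rpow_sub (by linarith), Real.rpow_one, ← hκ, div_eq_iff hκ0.ne']
    exact hsplit
  have hd2 : (d : ℝ) ^ 2 ≤ 4 ^ d := by
    calc (d : ℝ) ^ 2 ≤ (2 ^ d) ^ 2 := by gcongr; exact cast_le_two_pow d
      _ = 4 ^ d := by rw [← pow_mul, mul_comm, pow_mul]; norm_num
  have hd3 : (d : ℝ) ^ 3 ≤ 8 ^ d := by
    calc (d : ℝ) ^ 3 ≤ (2 ^ d) ^ 3 := by gcongr; exact cast_le_two_pow d
      _ = 8 ^ d := by rw [← pow_mul, mul_comm, pow_mul]; norm_num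
  obtain ⟨N, -, hT, hTk, hN⟩ := sideT_exists h.dim k
  rw [hpow]
  -- If `T = 1`, then `κ ≤ d ^ 2 ≤ 4 ^ d`, and already the size of the whole net is small enough
  -- because `k = κ ^ (d - 1) * κ`.
  rcases Nat.eq_zero_or_pos N with rfl | hNpos
  · have h2 : κ ≤ (d : ℝ) ^ 2 := by
      rw [hT, ← hκd] at hTk
      have := (pow_le_pow_iff_left₀ hκ0.le (by positivity) (by have := h.dim; omega)).1 hTk
      simpa [sq] using this
    have h3 : ((frontier (R ^ 2) S Y Y').length : ℝ) ≤ S.length := by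
      exact_mod_cast List.length_filter_le _ _
    calc ((frontier (R ^ 2) S Y Y').length : ℝ) ≤ k * (17 * q) ^ d := h3.trans hS
      _ = κ * (17 * q) ^ d * κ ^ (d - 1) := by rw [hsplit]; ring
      _ ≤ 4 ^ d * (17 * q) ^ d * κ ^ (d - 1) := by gcongr; exact h2.trans hd2
      _ = (68 * q) ^ d * κ ^ (d - 1) := by rw [← mul_pow]; ring_nf
      _ ≤ q ^ (12 * d) * κ ^ (d - 1) := by
          gcongr
          exact const_mul_pow_le (m := 11) hq2 (by norm_num) (by norm_num)
  · have hTd : κ ≤ sideT d k * (d : ℝ) ^ 2 := by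
      rw [← hκd] at hTk
      have := (pow_le_pow_iff_left₀ hκ0.le (by positivity) (by have := h.dim; omega)).1 hTk
      rwa [sq]
    have hNκ : (N : ℝ) * (d : ℝ) ^ 2 ≤ κ := by
      have h2 := hN (N - 1) (by omega)
      rw [Nat.sub_add_cancel hNpos, ← hκd] at h2
      rw [sq]
      exact (pow_le_pow_iff_left₀ (by positivity) hκ0.le (by have := h.dim; omega)).1 h2.le
    have hN1 : (1 : ℝ) ≤ N := by exact_mod_cast hNpos
    -- Here `T = N + 1 ≤ 2 * N`, and `N * d ^ 2 ≤ κ` by minimality of `T`.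
    have hTκ : (sideT d k : ℝ) * (d : ℝ) ^ 2 ≤ 2 * κ := by
      rw [hT]; push_cast
      nlinarith [sq_nonneg (d : ℝ)]
    set T := sideT d k with hTdef
    have hT0 : (0 : ℝ) < T := by rw [hT]; positivity
    have hT1 : (1 : ℝ) ≤ T := by rw [hT]; push_cast; linarith
    have h2 : (T : ℝ) * (frontier (R ^ 2) S Y Y').length ≤ d * S.length + T *
        ((2 * (⌈32 * ((d : ℝ) * d / e)⌉₊ + 1) + 1 : ℕ) *
        ((2 * (⌈80 * (T * ((d : ℝ) * d) / e)⌉₊ + 1) + 1 : ℕ) : ℝ) ^ (d - 1)) := by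
      exact_mod_cast h.frontier_le k hR0 hR hX (h.length_slice_le k)
    have hdd : 1 ≤ (d : ℝ) * d := by nlinarith
    have hx : (d : ℝ) * d / e = d ^ 2 * q := by rw [hq]; ring
    have hy : (T : ℝ) * ((d : ℝ) * d) / e = T * d ^ 2 * q := by rw [hq]; ring
    have h3 : ((2 * (⌈32 * ((d : ℝ) * d / e)⌉₊ + 1) + 1 : ℕ) : ℝ) ≤ 67 * (d ^ 2 * q) := by
      rw [hx]
      refine (ceil_odd_le (by norm_num) ?_).trans (by norm_num)
      have := mul_le_mul (one_le_pow₀ h1 : 1 ≤ (d : ℝ) ^ 2) hq2 (by norm_num) (by positivity)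
      linarith
    have h4 : ((2 * (⌈80 * (T * ((d : ℝ) * d) / e)⌉₊ + 1) + 1 : ℕ) : ℝ) ≤ 326 * q * κ := by
      rw [hy]
      refine (ceil_odd_le (by norm_num) ?_).trans ?_
      · have := mul_le_mul (one_le_mul_of_one_le_of_one_le hT1 (one_le_pow₀ h1 : 1 ≤ (d : ℝ) ^ 2)) hq2
          (by norm_num) (by positivity)
        linarith
      · have := mul_le_mul_of_nonneg_left hTκ (by positivity : 0 ≤ 163 * q)
        linarith
    -- One factor `κ` of `k` is bounded by `T * d ^ 2`; this provides the factor `T` that cancels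
    -- and leaves `κ ^ (d - 1)`.
    have h5 : (d : ℝ) * S.length ≤ T * ((136 * q) ^ d * κ ^ (d - 1)) := by
      calc (d : ℝ) * S.length ≤ d * (k * (17 * q) ^ d) := by gcongr
        _ = d * κ * ((17 * q) ^ d * κ ^ (d - 1)) := by rw [hsplit]; ring
        _ ≤ d * (T * d ^ 2) * ((17 * q) ^ d * κ ^ (d - 1)) := by gcongr
        _ = T * (d ^ 3 * (17 * q) ^ d * κ ^ (d - 1)) := by ring
        _ ≤ T * (8 ^ d * (17 * q) ^ d * κ ^ (d - 1)) := by gcongr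
        _ = _ := by rw [← mul_pow]; ring_nf
    have h6 : ((2 * (⌈32 * ((d : ℝ) * d / e)⌉₊ + 1) + 1 : ℕ) *
        ((2 * (⌈80 * (T * ((d : ℝ) * d) / e)⌉₊ + 1) + 1 : ℕ) : ℝ) ^ (d - 1)) ≤
        (1304 * q) ^ d * κ ^ (d - 1) := by
      calc _ ≤ (67 * (d ^ 2 * q)) * (326 * q * κ) ^ (d - 1) := by gcongr
        _ ≤ (326 * (4 ^ d * q)) * (326 * q * κ) ^ (d - 1) := by gcongr; norm_num
        _ = 4 ^ d * ((326 * q) ^ (d - 1) * (326 * q)) * κ ^ (d - 1) := by rw [mul_pow _ κ]; ring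
        _ = _ := by
            rw [← pow_succ, Nat.sub_add_cancel h.dim, ← mul_pow]; ring_nf
    have h7 : (T : ℝ) * (frontier (R ^ 2) S Y Y').length ≤ T * ((136 * q) ^ d * κ ^ (d - 1) +
        (1304 * q) ^ d * κ ^ (d - 1)) := by
      rw [mul_add]
      refine h2.trans (add_le_add h5 ?_)
      gcongr
    refine (le_of_mul_le_mul_left h7 hT0).trans ?_
    rw [← add_mul]
    gcongr
    refine (pow_add_pow_le (by positivity) (by positivity) (by have := h.dim; omega)).trans ?_
    rw [← add_mul]
    exact const_mul_pow_le (m := 11) hq2 (by norm_num) (by norm_num)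

end KCenter

/-! ### The search for the radius, and the size of the second phase -/

namespace KCenter

theorem mem_candidates {d k : ℕ} {e u : ℝ} {S : List Pt} {x : Pt} :
    x ∈ candidates d k e u S ↔ x ∈ grid d e u S := by
  rw [candidates, mem_ordered]

theorem length_candidates (d k : ℕ) (e u : ℝ) (S : List Pt) :
    (candidates d k e u S).length = (grid d e u S).length := by
  rw [candidates, length_ordered]

theorem radius_sq (r e : ℝ) (j : ℕ) :
    r ^ 2 / 4 * ((1 + e / 16) * (1 + e / 16)) ^ j = (r / 2 * (1 + e / 16) ^ j) ^ 2 := by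
  rw [mul_pow (1 + e / 16)]; ring

namespace Net

variable {d : ℕ} {e r u : ℝ} {S : List Pt}

/-- The radii that are tested are not too large. -/
theorem radius_le (h : Net d e r u S) {k : ℕ} (F : Fin k → EuclideanSpace ℝ (Fin d)) {R : ℝ}
    (hR0 : 0 ≤ R) (hR : R ≤ 65 / 64 * r) (hF : ∀ s ∈ S, ∃ j, dist (vec d s) (F j) ≤ R) {j : ℕ}
    (hj : ∀ l < j, dp k (r ^ 2 / 4 * ((1 + e / 16) * (1 + e / 16)) ^ l) S (candidates d k e u S) = []) :
    r / 2 * (1 + e / 16) ^ j ≤ max (r / 2) ((R + e * r / 64) * (1 + e / 16)) := by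
  have hr := h.r_pos
  have he := h.e_pos
  cases j with
  | zero => simp
  | succ j =>
    refine le_max_of_le_right ?_
    rw [pow_succ, ← mul_assoc]
    gcongr
    -- Otherwise the preceding radius would exceed `R + e * r / 64`, and the dynamic program would
    -- have succeeded there.
    by_contra hlt
    refine h.dp_ne_nil (X := candidates d k e u S) (fun x => mem_candidates) F hR0 (by linarith) hF
      (le_of_not_ge hlt) ?_
    rw [← radius_sq]
    exact hj j (by omega)

/-- Keeps all tested radii in the range where the cut margin, and with it the bound for the
frontier, applies. -/
theorem max_radius_le (h : Net d e r u S) {R : ℝ} (hR : R ≤ 65 / 64 * r) :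
    max (r / 2) ((R + e * r / 64) * (1 + e / 16)) ≤ 2 * r := by
  have hr := h.r_pos
  have he := h.e_pos
  have he' := h.e_le
  refine max_le (by linarith) ?_
  have h1 : R + e * r / 64 ≤ 33 / 32 * r := by nlinarith
  calc (R + e * r / 64) * (1 + e / 16) ≤ (33 / 32 * r) * (1 + (1 / 2) / 16) := by gcongr
    _ ≤ 2 * r := by nlinarith

theorem exists_dp_ne_nil (h : Net d e r u S) {k : ℕ} (F : Fin k → EuclideanSpace ℝ (Fin d)) {R : ℝ}
    (hR0 : 0 ≤ R) (hR : R ≤ 65 / 64 * r) (hF : ∀ s ∈ S, ∃ j, dist (vec d s) (F j) ≤ R) :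
    dp k (r ^ 2 / 4 * ((1 + e / 16) * (1 + e / 16)) ^ ⌈32 / e⌉₊) S (candidates d k e u S) ≠ [] := by
  have hr := h.r_pos
  have he := h.e_pos
  have he' := h.e_le
  rw [radius_sq]
  refine h.dp_ne_nil (X := candidates d k e u S) (fun x => mem_candidates) F hR0 (by linarith) hF ?_
  -- By Bernoulli's inequality the factor is at least `3` after `⌈32 / e⌉₊` rounds. The radius is
  -- then at least `3 / 2 * r`, more than `R + e * r / 64`.
  have h1 := one_add_mul_le_pow (a := e / 16) (by linarith) ⌈32 / e⌉₊
  have h2 : 2 ≤ (⌈32 / e⌉₊ : ℝ) * (e / 16) := by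
    calc (2 : ℝ) = 32 / e * (e / 16) := by field_simp; norm_num
      _ ≤ _ := by gcongr; exact Nat.le_ceil _
  have h3 : 3 ≤ (1 + e / 16) ^ ⌈32 / e⌉₊ := by linarith
  nlinarith

theorem runSize (h : Net d e r u S) {k : ℕ} (F : Fin k → EuclideanSpace ℝ (Fin d)) {R : ℝ}
    (hR0 : 0 ≤ R) (hR : R ≤ 65 / 64 * r) (hF : ∀ s ∈ S, ∃ j, dist (vec d s) (F j) ≤ R) {Z : ℕ}
    (hN : ⌈32 / e⌉₊ ≤ Z) (hS : Small S Z) (hX : (grid d e u S).length ≤ Z) (hk : k ≤ Z)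
    (hZ : ∀ R, 0 ≤ R → R ≤ 2 * r → ∀ Y Y', candidates d k e u S = Y ++ Y' →
      (dpRun k (R ^ 2) S (candidates d k e u S) Y).2.length ≤ Z) :
    RunSize k e (r ^ 2) S (candidates d k e u S) Z := by
  refine ⟨_, hN, h.exists_dp_ne_nil F hR0 hR hF, fun j _ hj => ⟨hS, by rwa [length_candidates],
    fun Y Y' hY => ⟨?_, fun c hc => (mem_dpRun hY hc).2.1.trans hk⟩⟩⟩
  have hr := h.r_pos
  have he := h.e_pos
  rw [radius_sq]
  exact hZ _ (by positivity) ((h.radius_le F hR0 hR hF hj).trans (h.max_radius_le hR)) Y Y' hY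

theorem dpCenters_spec (h : Net d e r u S) {k : ℕ} (F : Fin k → EuclideanSpace ℝ (Fin d)) {R : ℝ}
    (hR0 : 0 ≤ R) (hR : R ≤ 65 / 64 * r) (hF : ∀ s ∈ S, ∃ j, dist (vec d s) (F j) ≤ R) :
    (dpCenters k e (r ^ 2) S (candidates d k e u S)).length ≤ k ∧
    (∀ x ∈ dpCenters k e (r ^ 2) S (candidates d k e u S), x.length = d) ∧
    ∀ s ∈ S, ∃ x ∈ dpCenters k e (r ^ 2) S (candidates d k e u S),
      dist (vec d s) (vec d x) ≤ max (r / 2) ((R + e * r / 64) * (1 + e / 16)) := by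
  have hr := h.r_pos
  have he := h.e_pos
  obtain ⟨j, -, h1, h2, h3⟩ := radius_eq (h.exists_dp_ne_nil F hR0 hR hF)
  have hX : candidates d k e u S ≠ [] := by
    obtain ⟨x, hx⟩ := List.exists_mem_of_ne_nil _ h.grid_ne_nil
    exact List.ne_nil_of_mem (mem_candidates.2 hx)
  have hmem : dpCenters k e (r ^ 2) S (candidates d k e u S) ∈
      dp k (r ^ 2 / 4 * ((1 + e / 16) * (1 + e / 16)) ^ j) S (candidates d k e u S) := by
    rw [dpCenters, h1]
    obtain ⟨c, L, hc⟩ := List.exists_cons_of_ne_nil h2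
    rw [hc]; simp
  obtain ⟨h4, h5, h6⟩ := mem_dp hX hmem
  have hlen : ∀ x ∈ dpCenters k e (r ^ 2) S (candidates d k e u S), x.length = d := fun x hx =>
    h.length_of_mem_grid (mem_candidates.1 (h4 x hx))
  refine ⟨h5, hlen, fun s hs => ?_⟩
  obtain ⟨x, hx, hsx⟩ := h6 s hs
  rw [near_iff (R := r / 2 * (1 + e / 16) ^ j) (by positivity) (radius_sq _ _ _) (h.length s hs)
    (hlen x hx)] at hsx
  exact ⟨x, hx, hsx.trans (h.radius_le F hR0 hR hF h3)⟩

/-- A bound for the size of all intermediate results of the second phase. -/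
theorem exists_refSize (h : Net d e r u S) {k : ℕ} (hk : 1 ≤ k)
    (hS : (S.length : ℝ) ≤ k * (17 * (1 / e)) ^ d)
    (F : Fin k → EuclideanSpace ℝ (Fin d)) {R : ℝ}
    (hR0 : 0 ≤ R) (hR : R ≤ 65 / 64 * r) (hF : ∀ s ∈ S, ∃ j, dist (vec d s) (F j) ≤ R) :
    ∃ w : ℕ, (k = 1 → w = 0) ∧ (w : ℝ) ≤ (1 / e) ^ (12 * d) * (k : ℝ) ^ (1 - 1 / (d : ℝ)) ∧
      RefSize d k e u (r ^ 2) S ((k + 1) *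
        (S.length * (2 * ⌈128 * ((d : ℝ) * (d : ℝ)) / e⌉₊ + 1) ^ d + 1) * 2 ^ w) := by
  have hr := h.r_pos
  have he := h.e_pos
  have he' := h.e_le
  have h1 := h.one_le_d
  set N := ⌈128 * ((d : ℝ) * (d : ℝ)) / e⌉₊ with hN
  set w₀ := ⌊(1 / e) ^ (12 * d) * (k : ℝ) ^ (1 - 1 / (d : ℝ))⌋₊ with hw₀
  have hpos : 0 ≤ (1 / e) ^ (12 * d) * (k : ℝ) ^ (1 - 1 / (d : ℝ)) := by positivity
  -- For `k = 1` the width plays no role, and the value `0` is needed because the exponent of the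
  -- final bound contains the factor `log k`.
  refine ⟨if k = 1 then 0 else w₀, fun h0 => if_pos h0, ?_, ?_⟩
  · split_ifs
    · simpa using hpos
    · exact Nat.floor_le hpos
  set w := if k = 1 then 0 else w₀ with hw
  set Z := (k + 1) * (S.length * (2 * N + 1) ^ d + 1) * 2 ^ w with hZ
  have hm : 1 ≤ S.length := List.length_pos_iff.2 h.ne_nil
  have h2w : 1 ≤ 2 ^ w := Nat.one_le_two_pow
  have hA : (k + 1) * (S.length * (2 * N + 1) ^ d + 1) ≤ Z := Nat.le_mul_of_pos_right _ h2w
  have hB : S.length * (2 * N + 1) ^ d + 1 ≤ Z := (Nat.le_mul_of_pos_left _ (by omega)).trans hA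
  have hC : (2 * N + 1) ^ d ≤ Z := (Nat.le_mul_of_pos_left _ hm).trans ((Nat.le_succ _).trans hB)
  have hD : 2 * N + 1 ≤ Z := (Nat.le_self_pow (by have := h.dim; omega) _).trans hC
  have hE : S.length ≤ Z :=
    (Nat.le_mul_of_pos_right _ (Nat.one_le_pow _ _ (by omega))).trans ((Nat.le_succ _).trans hB)
  have hkZ : k ≤ Z := (Nat.le_succ k).trans ((Nat.le_mul_of_pos_right _ (Nat.succ_pos _)).trans hA)
  have hNr := Nat.le_ceil (128 * ((d : ℝ) * (d : ℝ)) / e)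
  have hx : (d : ℝ) ≤ 128 * ((d : ℝ) * (d : ℝ)) / e := by
    rw [le_div_iff₀ he]; nlinarith
  have hdN : d ≤ N := (Nat.cast_le (α := ℝ)).1 (hx.trans hNr)
  have hiter : ⌈32 / e⌉₊ ≤ N := by
    refine Nat.ceil_le_ceil ?_
    gcongr
    nlinarith
  have hsmall : Small S Z := ⟨hE, fun s hs => by rw [h.length s hs]; omega⟩
  have hgrid : (grid d e u S).length ≤ S.length * (2 * N + 1) ^ d :=
    length_grid_le _ _ _ _ fun s hs => by rw [h.length s hs]
  obtain ⟨h2, h3, -⟩ := h.dpCenters_spec F hR0 hR hF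
  refine ⟨⟨h.dim, by omega, hkZ, h.u_pos.le, by omega, hsmall, fun s hs => by rwa [h.length s hs]⟩,
    h.runSize F hR0 hR hF (by omega) hsmall (by omega) hkZ fun R hR0 hR Y Y' hY => ?_, h2.trans hkZ,
    fun x hx => by rw [h3 x hx]; omega⟩
  by_cases hk1 : k = 1
  · subst hk1
    refine (length_dpRun_one_le hY).trans ?_
    rw [length_candidates]
    omega
  · have hfr : (frontier (R ^ 2) S Y Y').length ≤ w := by
      rw [hw, if_neg hk1]
      exact Nat.le_floor (h.frontier_le_pow hk hS hR0 hR hY)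
    refine (length_dpRun_le hY hfr).trans ?_
    rw [hZ]
    gcongr
    exact Nat.le_mul_of_pos_right _ (Nat.succ_pos _)

end Net

end KCenter

/-! ### Correctness of the scale; cost, optimum and output -/

namespace KCenter

/-- An admissible value, once found, is only ever replaced by an admissible one. -/
theorem pickScale_spec {dr rsq : ℝ} (vs : List ℝ) (h : ∃ v ∈ vs, v ^ 2 ≤ rsq ∧ rsq ≤ dr * v ^ 2) :
    pickScale dr rsq vs ^ 2 ≤ rsq ∧ rsq ≤ dr * pickScale dr rsq vs ^ 2 := by
  have key : ∀ (vs : List ℝ) (u : ℝ), ((u ^ 2 ≤ rsq ∧ rsq ≤ dr * u ^ 2) ∨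
      ∃ v ∈ vs, v ^ 2 ≤ rsq ∧ rsq ≤ dr * v ^ 2) →
      (vs.foldl (fun u v => if decide (rsq < v * v) || decide (dr * (v * v) < rsq) then u else v) u) ^ 2
        ≤ rsq ∧ rsq ≤ dr * (vs.foldl (fun u v =>
          if decide (rsq < v * v) || decide (dr * (v * v) < rsq) then u else v) u) ^ 2 := by
    intro vs
    induction vs with
    | nil => intro u h; simpa using h
    | cons v vs ih =>
      intro u h
      rw [List.foldl_cons]
      apply ih
      by_cases hv : v ^ 2 ≤ rsq ∧ rsq ≤ dr * v ^ 2
      · left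
        have h1 : (decide (rsq < v * v) || decide (dr * (v * v) < rsq)) = false := by
          rw [← sq]
          simp [not_lt.2 hv.1, not_lt.2 hv.2]
        rw [h1]
        simpa using hv
      · have h1 : (decide (rsq < v * v) || decide (dr * (v * v) < rsq)) = true := by
          rw [← sq]
          rw [not_and_or, not_le, not_le] at hv
          simpa using hv
        rw [h1]
        rcases h with h | ⟨w, hw, h⟩
        · exact Or.inl (by simpa using h)
        · rcases List.mem_cons.1 hw with rfl | hw
          · exact absurd h hv
          · exact Or.inr ⟨w, hw, h⟩
  exact key vs 0 (Or.inr h)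

/-- The coordinate difference of `q` and `g` of largest modulus is admissible: its square is one of
the `d` summands of the squared distance, and the largest one. -/
theorem scale_spec {d : ℕ} (hd : 1 ≤ d) {q g : Pt} {A : List Pt} (hq : q.length = d) (hg : g.length = d)
    (hgA : g ∈ A) (hpos : 0 < dist2 q g) :
    0 < scale d (dist2 q g) q A ∧ scale d (dist2 q g) q A ^ 2 ≤ dist2 q g ∧
      dist2 q g ≤ d * scale d (dist2 q g) q A ^ 2 := by
  have hex : ∃ v ∈ diffs q A, v ^ 2 ≤ dist2 q g ∧ dist2 q g ≤ d * v ^ 2 := by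
    obtain ⟨l, hl, hmax⟩ := Finset.exists_max_image (Finset.range d)
      (fun l => (q.getD l 0 - g.getD l 0) ^ 2) ⟨0, Finset.mem_range.2 hd⟩
    refine ⟨q.getD l 0 - g.getD l 0, ?_, sq_coord_sub_le hq hg l, ?_⟩
    · have h1 : l < q.length := by rw [hq]; exact Finset.mem_range.1 hl
      have h2 : l < g.length := by rw [hg]; exact Finset.mem_range.1 hl
      refine List.mem_flatMap.2 ⟨g, hgA, List.mem_map.2 ⟨(q[l], g[l]), ?_, ?_⟩⟩
      · rw [← List.getElem_zip (h := by rw [List.length_zip]; omega)]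
        exact List.getElem_mem _
      · rw [List.getD_eq_getElem _ _ h1, List.getD_eq_getElem _ _ h2]
    · rw [dist2, dist2_foldl d q g hq hg, zero_add]
      exact (Finset.sum_le_card_nsmul _ _ _ hmax).trans (by simp)
  obtain ⟨h1, h2⟩ := pickScale_spec (diffs q A) hex
  have hne : pickScale d (dist2 q g) (diffs q A) ≠ 0 := fun h0 => by
    rw [h0] at h2
    simp at h2
    linarith
  have hsq : scale d (dist2 q g) q A ^ 2 = pickScale d (dist2 q g) (diffs q A) ^ 2 := by
    rw [scale]
    split_ifs <;> ring
  refine ⟨?_, hsq ▸ h1, hsq ▸ h2⟩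
  rw [scale]
  split_ifs with h
  · have := of_decide_eq_true h
    linarith
  · exact lt_of_le_of_ne (not_lt.1 (by simpa using h)) hne.symm

section Cost

variable {d n k : ℕ} (p : Fin n → EuclideanSpace ℝ (Fin d)) (F : Fin k → EuclideanSpace ℝ (Fin d))

theorem cost_le (hn : 1 ≤ n) {c : ℝ} (h : ∀ i, ∃ j, dist (p i) (F j) ≤ c) : cost p F ≤ c := by
  have : Nonempty (Fin n) := ⟨⟨0, hn⟩⟩
  refine ciSup_le fun i => ?_
  obtain ⟨j, hj⟩ := h i
  exact ciInf_le_of_le (Set.finite_range _).bddBelow j hj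

theorem exists_dist_le_cost (hk : 1 ≤ k) (i : Fin n) : ∃ j, dist (p i) (F j) ≤ cost p F := by
  have : Nonempty (Fin k) := ⟨⟨0, hk⟩⟩
  obtain ⟨j, hj⟩ := exists_eq_ciInf_of_finite (f := fun j => dist (p i) (F j))
  exact ⟨j, hj.le.trans (le_ciSup (f := fun i => ⨅ j, dist (p i) (F j)) (Set.finite_range _).bddAbove i)⟩

theorem cost_nonneg : 0 ≤ cost p F :=
  Real.iSup_nonneg fun _ => Real.iInf_nonneg fun _ => dist_nonneg

theorem opt_le : opt k p ≤ cost p F :=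
  ciInf_le ⟨0, by rintro _ ⟨F, rfl⟩; exact cost_nonneg p F⟩ F

theorem opt_nonneg : 0 ≤ opt k p := Real.iInf_nonneg fun _ => cost_nonneg p _

end Cost

/-- Among `k + 1` separated points, two have the same nearest center. -/
theorem le_two_mul_cost {d n k : ℕ} (hk : 1 ≤ k) (p : Fin n → EuclideanSpace ℝ (Fin d))
    (F : Fin k → EuclideanSpace ℝ (Fin d)) {r : ℝ} (hr : 0 ≤ r) {L : List Pt} (hL : k < L.length)
    (hLd : ∀ x ∈ L, x.length = d) (hLp : ∀ x ∈ L, ∃ i, vec d x = p i)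
    (hsep : L.Pairwise fun a b => r ^ 2 ≤ dist2 a b) : r ≤ 2 * cost p F := by
  have h1 : ∀ i : Fin L.length, ∃ j, dist (vec d (L.get i)) (F j) ≤ cost p F := fun i => by
    obtain ⟨i', hi'⟩ := hLp _ (L.get_mem i)
    rw [hi']
    exact exists_dist_le_cost p F hk i'
  choose f hf using h1
  obtain ⟨i, j, hij, hfij⟩ := Fintype.exists_ne_map_eq_of_card_lt f (by simpa using hL)
  wlog hlt : i < j generalizing i j
  · exact this j i hij.symm hfij.symm (lt_of_le_of_ne (not_lt.1 hlt) hij.symm)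
  have h2 := List.pairwise_iff_get.1 hsep i j hlt
  rw [dist2_eq (hLd _ (L.get_mem i)) (hLd _ (L.get_mem j)),
    pow_le_pow_iff_left₀ hr dist_nonneg (by norm_num)] at h2
  have h3 := hf i
  have h4 := hf j
  rw [← hfij] at h4
  linarith [dist_triangle_right (vec d (L.get i)) (vec d (L.get j)) (F (f i))]

theorem getD_flatMap {d : ℕ} (L : List Pt) (hL : ∀ x ∈ L, x.length = d) {j l : ℕ} (hj : j < L.length)
    (hl : l < d) : (L.flatMap fun x => x).getD (j * d + l) 0 = (L.getD j []).getD l 0 := by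
  induction L generalizing j with
  | nil => simp at hj
  | cons x L ih =>
    have hx := hL x (by simp)
    rw [List.flatMap_cons]
    cases j with
    | zero =>
      rw [List.getD_append _ _ _ _ (by omega)]
      simp
    | succ j =>
      rw [List.getD_append_right _ _ _ _ (by rw [hx]; nlinarith),
        show (j + 1) * d + l - x.length = j * d + l by rw [hx, Nat.sub_eq_iff_eq_add (by nlinarith)]; ring,
        ih (fun y hy => hL y (List.mem_cons_of_mem _ hy)) (by simpa using hj)]
      simp

theorem length_flatMap_points {d : ℕ} (L : List Pt) (hL : ∀ x ∈ L, x.length = d) :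
    (L.flatMap fun x => x).length = L.length * d := by
  rw [List.length_flatMap, List.map_congr_left hL]
  simp

theorem output_eq {d k : ℕ} {s : RealRAM.State} {L : List Pt} (hL : ∀ x ∈ L, x.length = d)
    (hs : ∀ i (hi : i < (L.flatMap fun x => x).length), s.rmem (s.ireg 0 + i) = (L.flatMap fun x => x)[i])
    (j : Fin k) (hj : (j : ℕ) < L.length) : output d k s j = vec d (L.getD j []) := by
  rw [output, vec]
  congr 1
  ext l
  have hlt : (j : ℕ) * d + l < (L.flatMap fun x => x).length := by
    rw [length_flatMap_points L hL]
    calc (j : ℕ) * d + l < j * d + d := by omega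
      _ = (j + 1) * d := by ring
      _ ≤ _ := Nat.mul_le_mul_right _ hj
  rw [hs _ hlt, ← getD_flatMap L hL hj l.2, List.getD_eq_getElem _ _ hlt]

/-- Additional centers only decrease the distances. So nothing has to be known about output points
beyond those in `L`. -/
theorem cost_output_le {d n k : ℕ} (hn : 1 ≤ n) (p : Fin n → EuclideanSpace ℝ (Fin d))
    {s : RealRAM.State} {L : List Pt} (hL : ∀ x ∈ L, x.length = d)
    (hs : ∀ i (hi : i < (L.flatMap fun x => x).length), s.rmem (s.ireg 0 + i) = (L.flatMap fun x => x)[i])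
    {c : ℝ} (h : ∀ i, ∃ j < k, ∃ _ : j < L.length, dist (p i) (vec d (L.getD j [])) ≤ c) :
    cost p (output d k s) ≤ c := by
  refine cost_le p _ hn fun i => ?_
  obtain ⟨j, hj, hjL, hij⟩ := h i
  exact ⟨⟨j, hj⟩, by rwa [output_eq hL hs ⟨j, hj⟩ hjL]⟩

end KCenter

/-! ### The approximation guarantee -/

namespace KCenter

/-- The list `cs` holds the clients `p`. -/
structure Clients {d n : ℕ} (p : Fin n → EuclideanSpace ℝ (Fin d)) (cs : List Pt) : Prop where
  card : cs.length = n
  length : ∀ c ∈ cs, c.length = d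
  vec_mem : ∀ c ∈ cs, ∃ i, vec d c = p i
  exists_vec : ∀ i, ∃ c ∈ cs, vec d c = p i

theorem GInv.exists_center {cs : List Pt} {st : List Pt × List (ℝ × Pt)} (h : GInv cs st) {x : Pt}
    (hx : x ∈ cs) : ∃ g ∈ st.1, dist2 x g ≤ (far st.2).1 := by
  rw [← h.clients] at hx
  obtain ⟨c, hc, rfl⟩ := List.mem_map.1 hx
  obtain ⟨g, hg, h1⟩ := h.attained c hc
  exact ⟨g, hg, h1 ▸ le_far hc⟩

section

variable {d n k : ℕ} {p : Fin n → EuclideanSpace ℝ (Fin d)} {cs : List Pt}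

theorem Clients.dist_le (h : Clients p cs) {A : List Pt} (hA : ∀ g ∈ A, g.length = d) {t : ℝ} (ht : 0 ≤ t)
    (hcov : ∀ c ∈ cs, ∃ g ∈ A, dist2 c g ≤ t ^ 2) (i : Fin n) : ∃ g ∈ A, dist (p i) (vec d g) ≤ t := by
  obtain ⟨c, hc, hci⟩ := h.exists_vec i
  obtain ⟨g, hg, hcg⟩ := hcov c hc
  rw [dist2_eq (h.length c hc) (hA g hg), pow_le_pow_iff_left₀ dist_nonneg ht (by norm_num)] at hcg
  exact ⟨g, hg, hci ▸ hcg⟩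

/-- The relation of the radius `√rsq` of Gonzalez' algorithm and the optimum. -/
theorem Clients.gonzalez (h : Clients p cs) (hn : 1 ≤ n) (hk : 1 ≤ k) :
    √(far (gCenters k cs).2).1 ≤ 2 * opt k p ∧ opt k p ≤ √(far (gCenters k cs).2).1 := by
  have hcs : cs ≠ [] := by
    rintro rfl
    have := h.card
    simp at this; omega
  obtain ⟨h1, h2, h3⟩ := gCenters_spec hk hcs
  set A := gCenters k cs with hA
  have hr2 := Real.sq_sqrt h1.far_nonneg
  have hAl : ∀ g ∈ A.1, g.length = d := fun g hg => h.length g (h1.mem g hg)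
  constructor
  · have : √(far A.2).1 / 2 ≤ opt k p := by
      refine le_ciInf fun F => ?_
      have := le_two_mul_cost hk p F (Real.sqrt_nonneg (far A.2).1) (L := (far A.2).2 :: A.1)
        (by rw [List.length_cons]; omega) (fun x hx => ?_) (fun x hx => ?_) (by rwa [hr2])
      · linarith
      · rcases List.mem_cons.1 hx with rfl | hx
        · exact h.length _ h1.far_mem_clients
        · exact hAl x hx
      · rcases List.mem_cons.1 hx with rfl | hx
        · exact h.vec_mem _ h1.far_mem_clients
        · exact h.vec_mem x (h1.mem x hx)
    linarith
  · refine (opt_le p fun j : Fin k => vec d (A.1.getD j [])).trans (cost_le p _ hn fun i => ?_)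
    obtain ⟨g, hg, hi⟩ := h.dist_le hAl (Real.sqrt_nonneg (far A.2).1)
      (fun c hc => by rw [hr2]; exact h1.exists_center hc) i
    obtain ⟨j, hj, rfl⟩ := List.getElem_of_mem hg
    exact ⟨⟨j, by omega⟩, by simpa [List.getElem?_eq_getElem hj] using hi⟩

/-- The net of the second phase. -/
theorem Clients.net (h : Clients p cs) (hd : 1 ≤ d) (hn : 1 ≤ n) (hk : 1 ≤ k) {e : ℝ} (he : 0 < e)
    (he' : e ≤ 1 / 2) (hpos : 0 < (far (gCenters k cs).2).1) :
    let A := gCenters k cs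
    let r := √(far A.2).1
    let S := (gNet (e * e * (far A.2).1) A).1
    Net d e r (scale d (far A.2).1 (far A.2).2 A.1) S ∧ (S.length : ℝ) ≤ k * (17 * (1 / e)) ^ d ∧
      (∀ s ∈ S, s ∈ cs) ∧ (∀ c ∈ cs, ∃ s ∈ S, dist2 c s ≤ (e * r / 8) ^ 2) ∧
      ∃ N : ℕ, (N : ℝ) ≤ k * (17 * (1 / e)) ^ d ∧
        ¬ e * e * (far A.2).1 < 64 * (far (gStep^[N] A).2).1 := by
  intro A r S
  have hcs : cs ≠ [] := by
    rintro rfl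
    have := h.card
    simp at this; omega
  obtain ⟨h1, h2, h3⟩ := gCenters_spec hk hcs
  have hr : 0 < r := Real.sqrt_pos.2 hpos
  have hr2 : r ^ 2 = (far A.2).1 := Real.sq_sqrt hpos.le
  have hAl : ∀ g ∈ A.1, g.length = d := fun g hg => h.length g (h1.mem g hg)
  have hθ : e * e * (far A.2).1 / 64 = (e * r / 8) ^ 2 := by rw [← hr2]; ring
  have hlen : ∀ st, GInv cs st → (st.1.Pairwise fun a b => e * e * (far A.2).1 / 64 ≤ dist2 a b) →
      (st.1.length : ℝ) ≤ k * (17 * (1 / e)) ^ d := by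
    intro st hst hsep
    rw [hθ] at hsep
    have := length_le_of_sep he (by linarith) hr hAl (fun s hs => h.length s (hst.mem s hs))
      (fun s hs => hr2 ▸ h1.exists_center (hst.mem s hs)) hsep
    rwa [h2] at this
  have hθle : e * e * (far A.2).1 / 64 ≤ (far A.2).1 := by
    have h9 : e * e ≤ 1 := by nlinarith
    rw [← hr2]
    nlinarith [mul_le_mul_of_nonneg_right h9 (sq_nonneg r), sq_nonneg r]
  obtain ⟨N, hN, h4, h5, h6, h7, h8⟩ := gNet_spec h1 (θ := e * e * (far A.2).1)
    (M := ⌊(k : ℝ) * (17 * (1 / e)) ^ d⌋₊)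
    ((List.pairwise_cons.1 h3).2.imp fun {a b} hab => hθle.trans hab)
    (fun st hst hsep => Nat.le_floor (hlen st hst hsep))
  have hSl : ∀ s ∈ S, s.length = d := fun s hs => h.length s (h7.mem s hs)
  have hSne : S ≠ [] := by
    obtain ⟨c, hc⟩ := List.exists_mem_of_ne_nil _ hcs
    obtain ⟨g, hg, -⟩ := h7.exists_center hc
    exact List.ne_nil_of_mem hg
  obtain ⟨g, hg, hgr⟩ := h1.attained _ h1.far_mem
  have hqd := h.length _ h1.far_mem_clients
  obtain ⟨hu0, hu1, hu2⟩ := scale_spec hd hqd (hAl g hg) hg (hgr ▸ hpos)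
  rw [← hgr] at hu0 hu1 hu2
  refine ⟨⟨hd, hSl, hSne, he, he', hu0, ?_, ?_, by rwa [hθ] at h8⟩, hlen _ h7 h8, h7.mem,
    fun c hc => ?_, N, ?_, h5⟩
  · exact Real.le_sqrt_of_sq_le hu1
  · rwa [hr2]
  · obtain ⟨g, hg, h9⟩ := h7.exists_center hc
    refine ⟨g, hg, h9.trans ?_⟩
    rw [← hθ, h6]
    linarith
  · exact (Nat.cast_le.2 hN).trans (Nat.floor_le (by positivity))

/-- Centers that are good for the net are good for the clients. -/
theorem final_ratio {e r o R : ℝ} (he : 0 < e) (he' : e ≤ 1 / 2) (hr : r ≤ 2 * o) (hr0 : 0 ≤ r)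
    (hR : R ≤ o + e * r / 64) :
    e * r / 8 + max (r / 2) ((R + e * r / 64) * (1 + e / 16)) ≤ (1 + e) * o := by
  have ho : 0 ≤ o := by linarith
  have h1 : e * r ≤ e * (2 * o) := by gcongr
  have h2 : 0 ≤ e * o := by positivity
  rcases max_choice (r / 2) ((R + e * r / 64) * (1 + e / 16)) with h | h <;> rw [h]
  · linarith
  -- The two errors `e * r / 64` add up to `e * r / 32 ≤ e * o / 16`. The remaining losses are the
  -- factor `1 + e / 16` of the search and the net radius `e * r / 8 ≤ e * o / 4`.
  · have h3 : R + e * r / 64 ≤ o * (1 + e / 16) := by linarith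
    have h4 : (R + e * r / 64) * (1 + e / 16) ≤ o * (1 + e / 16) * (1 + e / 16) := by gcongr
    have h5 : e * o * e ≤ e * o * (1 / 2) := by gcongr
    nlinarith

/-- Centers of cost slightly above the infimum are enough, so it need not be shown that the optimum
is attained. The excess `e * r / 64` is part of the error budget. -/
theorem Clients.exists_centers (h : Clients p cs) (hk : 1 ≤ k) {e r u : ℝ} {S : List Pt}
    (hS : Net d e r u S) (hr : opt k p ≤ r) (hSc : ∀ s ∈ S, s ∈ cs) :
    ∃ (F : Fin k → EuclideanSpace ℝ (Fin d)) (R : ℝ), 0 ≤ R ∧ R ≤ 65 / 64 * r ∧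
      R ≤ opt k p + e * r / 64 ∧ ∀ s ∈ S, ∃ j, dist (vec d s) (F j) ≤ R := by
  have hr0 := hS.r_pos
  have he := hS.e_pos
  have he' := hS.e_le
  obtain ⟨F, hF⟩ := exists_lt_of_ciInf_lt
    (show ⨅ F : Fin k → EuclideanSpace ℝ (Fin d), cost p F < opt k p + e * r / 64 from
      lt_add_of_pos_right _ (by positivity))
  refine ⟨F, cost p F, cost_nonneg p F, by nlinarith, hF.le, fun s hs => ?_⟩
  obtain ⟨i, hi⟩ := h.vec_mem s (hSc s hs)
  rw [hi]
  exact exists_dist_le_cost p F hk i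

theorem prep_eq {n d k : ℕ} {ε : ℝ} {flat : List ℝ} {cs : List Pt} (hcs : rows n d flat = cs) :
    prep (n, (d, (k, (ε, flat)))) = (d, (k, (min ε (1 / 2), gCenters k cs))) := by
  rw [prep]
  simp only [hcs]
  congr 3
  rcases lt_or_ge ε (1 / 2) with hlt | hlt
  · rw [if_pos (decide_eq_true hlt), min_eq_left hlt.le]
  · rw [if_neg (by rw [decide_eq_true_eq]; exact not_lt.2 hlt), min_eq_right hlt]

/-- The algorithm computes good centers. -/
theorem Clients.solve_spec (h : Clients p cs) (hd : 1 ≤ d) (hn : 1 ≤ n) (hk : 1 ≤ k) {ε : ℝ} (hε : 0 < ε)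
    {flat : List ℝ} (hcs : rows n d flat = cs) :
    ∃ L : List Pt, solve (n, (d, (k, (ε, flat)))) = (L.flatMap fun x => x) ∧ (∀ x ∈ L, x.length = d) ∧
      L.length ≤ 2 * k ∧
      ∀ i, ∃ j < k, ∃ _ : j < L.length, dist (p i) (vec d (L.getD j [])) ≤ (1 + ε) * opt k p := by
  have hne : cs ≠ [] := by
    rintro rfl
    have := h.card
    simp at this; omega
  obtain ⟨h1, h2, h3⟩ := gCenters_spec hk hne
  have hprep := prep_eq (k := k) (ε := ε) hcs
  obtain ⟨ho1, ho2⟩ := h.gonzalez hn hk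
  have ho := opt_nonneg (k := k) p
  rw [solve, hprep, finish]
  dsimp only
  set A := gCenters k cs with hA
  set e := min ε (1 / 2) with he
  have he0 : 0 < e := lt_min hε (by norm_num)
  have he1 : e ≤ 1 / 2 := min_le_right _ _
  have hAl : ∀ g ∈ A.1, g.length = d := fun g hg => h.length g (h1.mem g hg)
  by_cases hpos : 0 < (far A.2).1
  · rw [if_pos (by simpa using hpos), improve, padded]
    obtain ⟨hS, hSk, hSc, hcov, -⟩ := h.net hd hn hk he0 he1 hpos
    set S := (gNet (e * e * (far A.2).1) A).1 with hSdef
    set u := scale d (far A.2).1 (far A.2).2 A.1 with hu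
    set r := √(far A.2).1 with hr
    have hr2 : (far A.2).1 = r ^ 2 := (Real.sq_sqrt hpos.le).symm
    obtain ⟨F, R, hR0, hR1, hR2, hF⟩ := h.exists_centers hk hS ho2 hSc
    obtain ⟨h4, h5, h6⟩ := hS.dpCenters_spec F hR0 hR1 hF
    rw [hr2]
    set D := dpCenters k e (r ^ 2) S (candidates d k e u S) with hD
    refine ⟨_, rfl, fun x hx => ?_, ?_, fun i => ?_⟩
    · rcases List.mem_append.1 hx with hx | hx
      · exact h5 x hx
      · obtain ⟨_, -, rfl⟩ := List.mem_map.1 hx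
        obtain ⟨s, S', hS'⟩ := List.exists_cons_of_ne_nil hS.ne_nil
        rw [hS']
        exact hS.length s (by rw [hS']; simp)
    · rw [List.length_append, List.length_map, List.length_range]; omega
    · have her : 0 ≤ e * r / 8 := by have := hS.r_pos; positivity
      obtain ⟨s, hs, hi⟩ := h.dist_le hS.length her hcov i
      obtain ⟨x, hx, hsx⟩ := h6 s hs
      obtain ⟨j, hj, rfl⟩ := List.getElem_of_mem hx
      refine ⟨j, by omega, by rw [List.length_append]; omega, ?_⟩
      rw [List.getD_append _ _ _ _ hj, List.getD_eq_getElem _ _ hj]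
      calc dist (p i) (vec d D[j]) ≤ dist (p i) (vec d s) + dist (vec d s) (vec d D[j]) :=
            dist_triangle _ _ _
        _ ≤ e * r / 8 + max (r / 2) ((R + e * r / 64) * (1 + e / 16)) := add_le_add hi hsx
        _ ≤ (1 + e) * opt k p := final_ratio he0 he1 ho1 (Real.sqrt_nonneg _) hR2
        _ ≤ (1 + ε) * opt k p := by gcongr; exact min_le_left _ _
  · rw [if_neg (by simpa using hpos)]
    refine ⟨A.1, rfl, hAl, by omega, fun i => ?_⟩
    -- The radius of Gonzalez' centers is zero, so each client is at distance zero from some center.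
    obtain ⟨g, hg, hi⟩ := h.dist_le hAl le_rfl (fun c hc => by
      obtain ⟨g, hg, h4⟩ := h1.exists_center hc
      exact ⟨g, hg, h4.trans (by linarith)⟩) i
    obtain ⟨j, hj, rfl⟩ := List.getElem_of_mem hg
    refine ⟨j, by omega, hj, ?_⟩
    rw [List.getD_eq_getElem _ _ hj]
    exact hi.trans (by positivity)

end

end KCenter

/-! ### The running time -/

namespace KCenter

/-- The size of the second phase, in closed form. -/
theorem size_bound {d k m w : ℕ} {e : ℝ} (hd : 1 ≤ d) (hk : 1 ≤ k) (he : 0 < e) (he' : e ≤ 1 / 2)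
    (hm : (m : ℝ) ≤ k * (17 * (1 / e)) ^ d) :
    (((k + 1) * (m * (2 * ⌈128 * ((d : ℝ) * (d : ℝ)) / e⌉₊ + 1) ^ d + 1) * 2 ^ w : ℕ) : ℝ) + 2 ≤
      12 * (k : ℝ) ^ 2 * (1 / e) ^ (16 * d) * (d : ℝ) ^ (2 * d) * 2 ^ w := by
  have hq : 2 ≤ 1 / e := by rw [le_div_iff₀ he]; linarith
  set q := 1 / e with hq'
  have hd1 : (1 : ℝ) ≤ d := by exact_mod_cast hd
  have hk1 : (1 : ℝ) ≤ k := by exact_mod_cast hk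
  have h1 : (2 * (⌈128 * ((d : ℝ) * (d : ℝ)) / e⌉₊ : ℝ) + 1) ^ d ≤ (d : ℝ) ^ (2 * d) * q ^ (10 * d) := by
    have h2 := Nat.ceil_lt_add_one (a := 128 * ((d : ℝ) * (d : ℝ)) / e) (by positivity)
    have h3 : 128 * ((d : ℝ) * (d : ℝ)) / e = 128 * ((d : ℝ) * (d : ℝ)) * q := by rw [hq']; ring
    have h4 : 1 ≤ (d : ℝ) * (d : ℝ) * q := by nlinarith [mul_le_mul hd1 hd1 zero_le_one (by linarith)]
    have h5 : 2 * (⌈128 * ((d : ℝ) * (d : ℝ)) / e⌉₊ : ℝ) + 1 ≤ (d : ℝ) ^ 2 * (512 * q) := by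
      rw [h3] at h2 ⊢
      nlinarith
    calc _ ≤ ((d : ℝ) ^ 2 * (512 * q)) ^ d := by gcongr
      _ = (d : ℝ) ^ (2 * d) * (512 * q) ^ d := by rw [mul_pow, ← pow_mul]
      _ ≤ _ := by
        gcongr
        exact const_mul_pow_le (m := 9) hq (by norm_num) (by norm_num)
  have h2 : (m : ℝ) ≤ k * q ^ (6 * d) :=
    hm.trans (by gcongr; exact const_mul_pow_le (m := 5) hq (by norm_num) (by norm_num))
  set X : ℝ := k * q ^ (16 * d) * (d : ℝ) ^ (2 * d) with hX
  have h3 : (m : ℝ) * (2 * (⌈128 * ((d : ℝ) * (d : ℝ)) / e⌉₊ : ℝ) + 1) ^ d ≤ X := by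
    calc _ ≤ (k * q ^ (6 * d)) * ((d : ℝ) ^ (2 * d) * q ^ (10 * d)) := by gcongr
      _ = X := by rw [hX, show 16 * d = 6 * d + 10 * d by ring, pow_add]; ring
  have h4 : 1 ≤ X := by
    have : 1 ≤ q ^ (16 * d) := one_le_pow₀ (by linarith)
    have : 1 ≤ (d : ℝ) ^ (2 * d) := one_le_pow₀ hd1
    rw [hX]
    exact one_le_mul_of_one_le_of_one_le (one_le_mul_of_one_le_of_one_le hk1 (by assumption)) this
  have h5 : (1 : ℝ) ≤ 2 ^ w := one_le_pow₀ (by norm_num)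
  push_cast
  have h6 : 1 ≤ k * X * 2 ^ w :=
    one_le_mul_of_one_le_of_one_le (one_le_mul_of_one_le_of_one_le hk1 h4) h5
  calc _ ≤ ((k : ℝ) + k) * (X + X) * 2 ^ w + 2 * (k * X * 2 ^ w) := by gcongr; linarith
    _ = 6 * (k * X * 2 ^ w) := by ring
    _ ≤ 12 * (k * X * 2 ^ w) := by linarith
    _ = _ := by rw [hX]; ring

/-- The time of the algorithm. -/
theorem Clients.exists_solveTime {d n k : ℕ} {p : Fin n → EuclideanSpace ℝ (Fin d)} {cs : List Pt}
    (h : Clients p cs) (hd : 1 ≤ d) (hn : 1 ≤ n) (hk : 1 ≤ k) {ε : ℝ} (hε : 0 < ε)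
    {flat : List ℝ} (hcs : rows n d flat = cs) (E : ℕ) :
    ∃ N w Z : ℕ, (N : ℝ) ≤ k * (17 * (1 / min ε (1 / 2))) ^ d ∧ (k = 1 → w = 0) ∧
      (w : ℝ) ≤ (1 / min ε (1 / 2)) ^ (12 * d) * (k : ℝ) ^ (1 - 1 / (d : ℝ)) ∧
      (Z : ℝ) + 2 ≤ 12 * (k : ℝ) ^ 2 * (1 / min ε (1 / 2)) ^ (16 * d) * (d : ℝ) ^ (2 * d) * 2 ^ w ∧
      SolveTime E (n, (d, (k, (ε, flat))))
        ((k + N + 2) * (n * (d + 2) + 1) + n * (d + 1) + k * (d + 1) + (Z + 2) ^ E) := by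
  have hne : cs ≠ [] := by
    rintro rfl
    have := h.card
    simp at this; omega
  obtain ⟨h1, h2, h3⟩ := gCenters_spec hk hne
  have hprep := prep_eq (k := k) (ε := ε) hcs
  obtain ⟨ho1, ho2⟩ := h.gonzalez hn hk
  set A := gCenters k cs with hA
  set e := min ε (1 / 2) with he
  have he0 : 0 < e := lt_min hε (by norm_num)
  have he1 : e ≤ 1 / 2 := min_le_right _ _
  have hAl : ∀ g ∈ A.1, g.length = d := fun g hg => h.length g (h1.mem g hg)
  have hscan : ScanTime cs (n * (d + 2)) := ⟨d, fun c hc => (h.length c hc).le, by rw [h.card]⟩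
  have hA2 : A.2.length = n := by rw [← h.card, ← h1.clients, List.length_map]
  have hmain : ∃ N w Z : ℕ, (N : ℝ) ≤ k * (17 * (1 / e)) ^ d ∧ (k = 1 → w = 0) ∧
      (w : ℝ) ≤ (1 / e) ^ (12 * d) * (k : ℝ) ^ (1 - 1 / (d : ℝ)) ∧
      (Z : ℝ) + 2 ≤ 12 * (k : ℝ) ^ 2 * (1 / e) ^ (16 * d) * (d : ℝ) ^ (2 * d) * 2 ^ w ∧
      (0 < (far A.2).1 → ∀ τ, (N + 1) * (n * (d + 2) + 1) ≤ τ → (Z + 2) ^ E ≤ τ →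
        NetTime E (d, (k, (e, A))) τ) := by
    by_cases hpos : 0 < (far A.2).1
    · obtain ⟨hS, hSk, hSc, -, N, hN, hN'⟩ := h.net hd hn hk he0 he1 hpos
      obtain ⟨F, R, hR0, hR1, -, hF⟩ := h.exists_centers hk hS ho2 hSc
      obtain ⟨w, hw0, hw, hZ⟩ := hS.exists_refSize hk hSk F hR0 hR1 hF
      rw [Real.sq_sqrt hpos.le] at hZ
      refine ⟨N, w, _, hN, hw0, hw, size_bound hd hk he0 he1 hSk, fun _ τ h4 h5 =>
        ⟨⟨_, N, h1.clients ▸ hscan, h4, hN'⟩, _, ?_, ?_, hZ, h5⟩⟩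
      · rw [h.length _ h1.far_mem_clients]
        exact hZ.1.2.1
      · exact ⟨h2 ▸ hZ.1.2.2.1, fun s hs => (hAl s hs) ▸ hZ.1.2.1⟩
    · refine ⟨0, 0, _, by rw [Nat.cast_zero]; positivity, fun _ => rfl,
        by rw [Nat.cast_zero]; positivity,
        size_bound (m := 0) hd hk he0 he1 (by rw [Nat.cast_zero]; positivity), fun h0 => absurd h0 hpos⟩
  obtain ⟨N, w, Z, hN, hw0, hw, hZ, hnet⟩ := hmain
  refine ⟨N, w, Z, hN, hw0, hw, hZ, ⟨?_, n * (d + 2), ?_, ?_⟩, ?_, ⟨d, ?_, ?_⟩, ?_⟩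
  · dsimp only; omega
  · dsimp only; rw [hcs]; exact hscan
  · dsimp only
    have : (k + 1) * (n * (d + 2) + 1) ≤ (k + N + 2) * (n * (d + 2) + 1) :=
      Nat.mul_le_mul_right _ (by omega)
    omega
  · rw [hprep]
    dsimp only
    rw [hA2]
    have : n * 1 ≤ n * (d + 1) := Nat.mul_le_mul_left _ (by omega)
    omega
  · rw [hprep]
    dsimp only
    rw [h2]
    omega
  · rw [hprep]
    exact fun x hx => (hAl x hx).le
  · rw [hprep]
    intro h0
    refine hnet h0 _ ?_ (by omega)
    have : (N + 1) * (n * (d + 2) + 1) ≤ (k + N + 2) * (n * (d + 2) + 1) :=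
      Nat.mul_le_mul_right _ (by omega)
    omega

/-- Natural logarithms in the exponent of `2` cost a factor `1 / log 2 < 2`. -/
theorem natCast_pow_le_two_rpow {k : ℕ} (hk : 1 ≤ k) (j : ℕ) :
    (k : ℝ) ^ j ≤ (2 : ℝ) ^ (2 * j * Real.log k) := by
  have hk0 : (0 : ℝ) < k := by exact_mod_cast hk
  have hl : 0 ≤ Real.log k := Real.log_natCast_nonneg k
  rw [Real.rpow_def_of_pos (by norm_num), ← Real.rpow_natCast, Real.rpow_def_of_pos hk0]
  refine Real.exp_le_exp.2 ?_
  have h2 := Real.log_two_gt_d9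
  have : 0 ≤ (j : ℝ) * Real.log k := by positivity
  nlinarith

/-- The exponential part of the running time. -/
theorem exp_part_le {d k w : ℕ} {q : ℝ} (hd : 1 ≤ d) (hk : 1 ≤ k) (hq : 1 ≤ q) (hw0 : k = 1 → w = 0)
    (hw : (w : ℝ) ≤ q ^ (12 * d) * (k : ℝ) ^ (1 - 1 / (d : ℝ))) (E : ℕ) :
    (((k : ℝ) ^ 2 * (d : ℝ) ^ (2 * d) * 2 ^ w) ^ E) ^ 2 ≤
      2 ^ (((12 * E : ℕ) : ℝ) * (q ^ (12 * d) * (k : ℝ) ^ (1 - 1 / (d : ℝ)) * Real.log k +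
        d * Real.log d)) := by
  have hd1 : (1 : ℝ) ≤ d := by exact_mod_cast hd
  have hk1 : (1 : ℝ) ≤ k := by exact_mod_cast hk
  have hlk : 0 ≤ Real.log k := Real.log_natCast_nonneg k
  have hld : 0 ≤ Real.log d := Real.log_natCast_nonneg d
  set W := q ^ (12 * d) * (k : ℝ) ^ (1 - 1 / (d : ℝ)) with hW
  have hW1 : 1 ≤ W := by
    refine one_le_mul_of_one_le_of_one_le (one_le_pow₀ hq) (Real.one_le_rpow hk1 ?_)
    rw [sub_nonneg, div_le_one (by linarith)]
    exact hd1
  have hw2 : (w : ℝ) ≤ 2 * (W * Real.log k) := by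
    -- For `k ≥ 2` the factor `log k` is at least `log 2 > 1 / 2`. For `k = 1` it vanishes, and so
    -- does `w`.
    rcases Nat.lt_or_ge k 2 with h | h
    · rw [hw0 (by omega), Nat.cast_zero]; positivity
    · have h2 := Real.log_two_gt_d9
      have h3 : Real.log 2 ≤ Real.log k := Real.log_le_log (by norm_num) (by exact_mod_cast h)
      have h4 : W * (1 / 2) ≤ W * Real.log k := by gcongr; linarith
      linarith
  have hlW : Real.log k ≤ W * Real.log k := le_mul_of_one_le_left hlk hW1
  have h1 := natCast_pow_le_two_rpow hk (4 * E)
  have h2 := natCast_pow_le_two_rpow hd (4 * d * E)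
  calc (((k : ℝ) ^ 2 * (d : ℝ) ^ (2 * d) * 2 ^ w) ^ E) ^ 2
      = (k : ℝ) ^ (4 * E) * (d : ℝ) ^ (4 * d * E) * 2 ^ (2 * w * E) := by
        simp only [mul_pow, ← pow_mul]
        congr 2
        · congr 1; ring
        · congr 1; ring
        · ring
    _ ≤ 2 ^ (2 * ((4 * E : ℕ) : ℝ) * Real.log k) * 2 ^ (2 * ((4 * d * E : ℕ) : ℝ) * Real.log d) *
        2 ^ ((2 * w * E : ℕ) : ℝ) := by
        rw [Real.rpow_natCast]
        gcongr
    _ = 2 ^ (2 * ((4 * E : ℕ) : ℝ) * Real.log k + 2 * ((4 * d * E : ℕ) : ℝ) * Real.log d +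
        ((2 * w * E : ℕ) : ℝ)) := by
        rw [Real.rpow_add (by norm_num), Real.rpow_add (by norm_num)]
    _ ≤ _ := by
        refine Real.rpow_le_rpow_of_exponent_le (by norm_num) ?_
        push_cast
        have h3 : (E : ℝ) * w ≤ E * (2 * (W * Real.log k)) := by gcongr
        have h4 : (E : ℝ) * Real.log k ≤ E * (W * Real.log k) := by gcongr
        have h5 : 0 ≤ (E : ℝ) * (d * Real.log d) := by positivity
        linarith

/-- The polynomial part of the running time. -/
theorem poly_part_le {n d k N : ℕ} {q : ℝ} (hn : 1 ≤ n) (hd : 1 ≤ d) (hk : 1 ≤ k) (hq : 2 ≤ q)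
    (hN : (N : ℝ) ≤ k * (17 * q) ^ d) :
    (((n * d + n + ((k + N + 2) * (n * (d + 2) + 1) + n * (d + 1) + k * (d + 1)) + 2 * k * d + 1 : ℕ) : ℝ)) ≤
      25 * (n * k * q ^ (7 * d)) := by
  have hd1 : (1 : ℝ) ≤ d := by exact_mod_cast hd
  have hk1 : (1 : ℝ) ≤ k := by exact_mod_cast hk
  have hn1 : (1 : ℝ) ≤ n := by exact_mod_cast hn
  set Q := q ^ (6 * d) with hQ
  have hQ1 : 1 ≤ Q := one_le_pow₀ (by linarith)
  have h1 : (N : ℝ) ≤ k * Q :=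
    hN.trans (by gcongr; exact const_mul_pow_le (m := 5) hq (by norm_num) (by norm_num))
  have hdq : (d : ℝ) * Q ≤ q ^ (7 * d) := by
    rw [show 7 * d = d + 6 * d by ring, pow_add]
    gcongr
    exact (cast_le_two_pow d).trans (by gcongr)
  have hkQ : (k : ℝ) ≤ k * Q := le_mul_of_one_le_right (by linarith) hQ1
  have h2 : (k : ℝ) + N + 2 ≤ 4 * (k * Q) := by linarith
  have hnd : (n : ℝ) ≤ n * d := le_mul_of_one_le_right (by linarith) hd1
  have hkd : (k : ℝ) ≤ k * d := le_mul_of_one_le_right (by linarith) hd1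
  have h3 : (n : ℝ) * (d + 2) + 1 ≤ 4 * (n * d) := by linarith
  have h4 : (n : ℝ) * d ≤ n * d * (k * Q) := le_mul_of_one_le_right (by positivity) (by linarith)
  have h5 : (k : ℝ) * d ≤ k * d * (n * Q) :=
    le_mul_of_one_le_right (by positivity) (one_le_mul_of_one_le_of_one_le hn1 hQ1)
  have h6 : ((k : ℝ) + N + 2) * (n * (d + 2) + 1) ≤ 4 * (k * Q) * (4 * (n * d)) := by gcongr
  have h7 : (n : ℝ) * k * (d * Q) ≤ n * k * q ^ (7 * d) := by gcongr
  push_cast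
  linarith

/-- The running time in the form of the theorem. -/
theorem time_bound {n d k N w Z E C l : ℕ} {q : ℝ} (hn : 1 ≤ n) (hd : 1 ≤ d) (hk : 1 ≤ k) (hq : 2 ≤ q)
    (hN : (N : ℝ) ≤ k * (17 * q) ^ d) (hw0 : k = 1 → w = 0)
    (hw : (w : ℝ) ≤ q ^ (12 * d) * (k : ℝ) ^ (1 - 1 / (d : ℝ)))
    (hZ : (Z : ℝ) + 2 ≤ 12 * (k : ℝ) ^ 2 * q ^ (16 * d) * (d : ℝ) ^ (2 * d) * 2 ^ w)
    (hl : l ≤ 2 * k * d) :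
    ((C * (n * d + n + ((k + N + 2) * (n * (d + 2) + 1) + n * (d + 1) + k * (d + 1) + (Z + 2) ^ E) +
      l + 1) : ℕ) : ℝ) ≤
      ((26 * C + 40 * E + 12 : ℕ) : ℝ) * ((n : ℝ) * k * q ^ ((26 * C + 40 * E + 12) * d) +
        2 ^ (((26 * C + 40 * E + 12 : ℕ) : ℝ) *
          (q ^ ((26 * C + 40 * E + 12) * d) * (k : ℝ) ^ (1 - 1 / (d : ℝ)) * Real.log k +
            d * Real.log d))) := by
  -- The part `26 * C` serves as the leading factor, `40 * E` dominates the exponent of `a ^ 2` and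
  -- the factor in the exponent of `b ^ 2`, and `12` is the exponent in the width.
  set c := 26 * C + 40 * E + 12 with hc
  have hd1 : (1 : ℝ) ≤ d := by exact_mod_cast hd
  have hk1 : (1 : ℝ) ≤ k := by exact_mod_cast hk
  have hn1 : (1 : ℝ) ≤ n := by exact_mod_cast hn
  have hlk : 0 ≤ Real.log k := Real.log_natCast_nonneg k
  have hld : 0 ≤ Real.log d := Real.log_natCast_nonneg d
  have hq1 : 1 ≤ q := by linarith
  set a := q ^ (20 * E * d) with ha
  set b := ((k : ℝ) ^ 2 * (d : ℝ) ^ (2 * d) * 2 ^ w) ^ E with hb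
  have hZE : ((Z : ℝ) + 2) ^ E ≤ a * b := by
    calc ((Z : ℝ) + 2) ^ E
        ≤ (q ^ (4 * d) * (q ^ (16 * d) * ((k : ℝ) ^ 2 * (d : ℝ) ^ (2 * d) * 2 ^ w))) ^ E := by
          gcongr
          refine hZ.trans ?_
          have h12 : (12 : ℝ) ≤ q ^ (4 * d) := by
            calc (12 : ℝ) ≤ 2 ^ 4 := by norm_num
              _ ≤ q ^ 4 := by gcongr
              _ ≤ q ^ (4 * d) := pow_le_pow_right₀ hq1 (by omega)
          calc _ = 12 * (q ^ (16 * d) * ((k : ℝ) ^ 2 * (d : ℝ) ^ (2 * d) * 2 ^ w)) := by ring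
            _ ≤ _ := by gcongr
      _ = a * b := by
          rw [ha, hb, ← mul_assoc, ← pow_add, mul_pow, ← pow_mul]
          congr 2; ring
  -- The product of a power of `1 / e` and an exponential in `k` and `d` is split, so that each
  -- factor goes into one summand of the bound.
  have hab : a * b ≤ a ^ 2 + b ^ 2 := by nlinarith [sq_nonneg (a - b), sq_nonneg a, sq_nonneg b]
  have ha2 : a ^ 2 ≤ n * k * q ^ (c * d) := by
    rw [ha, ← pow_mul]
    calc q ^ (20 * E * d * 2) ≤ q ^ (c * d) :=
          pow_le_pow_right₀ hq1 (by
            rw [show 20 * E * d * 2 = 40 * E * d by ring]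
            exact Nat.mul_le_mul_right _ (by omega))
      _ ≤ _ := le_mul_of_one_le_left (by positivity) (one_le_mul_of_one_le_of_one_le hn1 hk1)
  have hb2 : b ^ 2 ≤ 2 ^ ((c : ℝ) * (q ^ (c * d) * (k : ℝ) ^ (1 - 1 / (d : ℝ)) * Real.log k +
      d * Real.log d)) := by
    refine (exp_part_le hd hk hq1 hw0 hw E).trans (Real.rpow_le_rpow_of_exponent_le (by norm_num) ?_)
    have : 12 * E ≤ c := by omega
    gcongr ?_ * (?_ * _ * _ + _)
    · exact_mod_cast this
    · exact pow_le_pow_right₀ hq1 (Nat.mul_le_mul_right _ (by omega))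
  set B : ℝ := 2 ^ ((c : ℝ) * (q ^ (c * d) * (k : ℝ) ^ (1 - 1 / (d : ℝ)) * Real.log k + d * Real.log d))
    with hB
  have hB0 : 0 < B := Real.rpow_pos_of_pos (by norm_num) _
  have hp := poly_part_le hn hd hk hq hN
  have hp' : (n : ℝ) * k * q ^ (7 * d) ≤ n * k * q ^ (c * d) := by
    have : 7 ≤ c := by omega
    gcongr
  have hl' : (l : ℝ) ≤ 2 * k * d := by exact_mod_cast hl
  have hP0 : 0 ≤ (n : ℝ) * k * q ^ (c * d) := by positivity
  have hsum : (n : ℝ) * d + n + ((k + N + 2) * (n * (d + 2) + 1) + n * (d + 1) + k * (d + 1) +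
      ((Z : ℝ) + 2) ^ E) + l + 1 ≤ 26 * (n * k * q ^ (c * d) + B) := by
    push_cast at hp
    linarith
  have hCc : (26 * C : ℝ) ≤ c := by rw [hc]; push_cast; linarith [(Nat.cast_nonneg E : (0 : ℝ) ≤ E)]
  push_cast
  calc _ ≤ (C : ℝ) * (26 * (n * k * q ^ (c * d) + B)) := by gcongr
    _ = (26 * C : ℝ) * (n * k * q ^ (c * d) + B) := by ring
    _ ≤ _ := by gcongr

end KCenter

/-! ### The main theorem -/

namespace KCenter

/-- The points in the memory of the machine are the clients. -/
theorem clients_input {d n k : ℕ} {ε : ℝ} (p : Fin n → EuclideanSpace ℝ (Fin d)) :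
    Clients p ((List.range n).map fun i =>
      (List.range d).map fun l => (input k ε p).rmem (i * d + l)) := by
  have hrow : ∀ i : Fin n,
      vec d ((List.range d).map fun l => (input k ε p).rmem ((i : ℕ) * d + l)) = p i := by
    intro i
    ext l
    have hlt : (i : ℕ) * d + l < n * d := by
      calc (i : ℕ) * d + l < i * d + d := by omega
        _ = (i + 1) * d := by ring
        _ ≤ _ := Nat.mul_le_mul_right _ i.2
    have hd : 0 < d := l.pos
    have h1 : Fin.divNat ⟨(i : ℕ) * d + l, hlt⟩ = i := by
      ext
      simp [Fin.coe_divNat, mul_comm (i : ℕ) d, Nat.mul_add_div hd,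
        Nat.div_eq_of_lt l.2]
    have h2 : Fin.modNat ⟨(i : ℕ) * d + l, hlt⟩ = l := by
      ext
      simp [Fin.coe_modNat, mul_comm (i : ℕ) d, Nat.mod_eq_of_lt l.2]
    simp only [vec, List.getD_eq_getElem?_getD, List.getElem?_map, List.getElem?_range l.2,
      Option.map_some, Option.getD_some, input, dif_pos hlt, h1, h2]
  refine ⟨by simp, ?_, ?_, fun i => ?_⟩
  · simp only [List.mem_map, List.mem_range]
    rintro _ ⟨i, -, rfl⟩
    simp
  · simp only [List.mem_map, List.mem_range]
    rintro _ ⟨i, hi, rfl⟩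
    exact ⟨⟨i, hi⟩, hrow ⟨i, hi⟩⟩
  · exact ⟨_, List.mem_map.2 ⟨i, List.mem_range.2 i.2, rfl⟩, hrow i⟩

end KCenter

/-- One real RAM program is a `(1+ε)`-approximation for continuous Euclidean `k`-center in every
dimension `d` and for every `ε > 0`.  The constant `c` is absolute. -/
theorem theorem2p2 :
    ∃ (P : RealRAM.Program) (c : ℕ),
      ∀ (d : ℕ) (ε : ℝ) (k n : ℕ) (p : Fin n → EuclideanSpace ℝ (Fin d)),
        1 ≤ d → 0 < ε → 1 ≤ k → 1 ≤ n →
        ∃ (s : RealRAM.State) (t : ℕ),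
          RealRAM.Runs P (KCenter.input k ε p) s t ∧
          KCenter.cost p (KCenter.output d k s) ≤ (1 + ε) * KCenter.opt k p ∧
          (t : ℝ) ≤ c * ((n : ℝ) * (k : ℝ) * (1 / min ε (1 / 2)) ^ (c * d) +
            (2 : ℝ) ^ ((c : ℝ) *
              ((1 / min ε (1 / 2)) ^ (c * d) * (k : ℝ) ^ (1 - 1 / (d : ℝ)) * Real.log k +
                (d : ℝ) * Real.log d))) := by
  obtain ⟨E, hE⟩ := KCenter.comp_solve
  -- The program and the constants `C` and `E` are fixed before the input is introduced, hence they
  -- depend on nothing.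
  obtain ⟨P, C, hP⟩ := hE.exists_program
  refine ⟨P, 26 * C + 40 * E + 12, fun d ε k n p hd hε hk hn => ?_⟩
  have hcl := KCenter.clients_input (k := k) (ε := ε) p
  have hrows := KCenter.rows_reverse (KCenter.input k ε p).rmem n d
  obtain ⟨L, hL, hLd, hLk, hgood⟩ := hcl.solve_spec hd hn hk hε hrows
  obtain ⟨N, w, Z, hN, hw0, hw, hZ, hτ⟩ := hcl.exists_solveTime hd hn hk hε hrows E
  obtain ⟨s, t, hrun, ht, hout⟩ := hP (KCenter.input k ε p) _ _ rfl hτ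
  have he : 0 < min ε (1 / 2) := lt_min hε (by norm_num)
  have hq : 2 ≤ 1 / min ε (1 / 2) := by
    rw [le_div_iff₀ he]
    linarith [min_le_right ε (1 / 2)]
  have hlen : (KCenter.solve (n, (d, (k, (ε,
      ((List.range (n * d)).map (KCenter.input k ε p).rmem).reverse))))).length ≤ 2 * k * d := by
    rw [hL, KCenter.length_flatMap_points L hLd]
    exact Nat.mul_le_mul_right _ hLk
  refine ⟨s, t, hrun, KCenter.cost_output_le hn p hLd (fun i hi => ?_) hgood,
    (Nat.cast_le.2 ht).trans (KCenter.time_bound hn hd hk hq hN hw0 hw hZ hlen)⟩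
  rw [hout i (by rw [← hL] at hi; exact hi)]
  exact List.getElem_of_eq hL _
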